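/- Notation. $\boldsymbol G=\mathrm{PGL}_2$; for a number field $F$, $[\boldsymbol G]=\boldsymbol G(F)\backslash \boldsymbol G(\mathbb A_F)$ and $[\boldsymbol G]_{\boldsymbol K}=\boldsymbol G(F)\backslash\boldsymbol G(\mathbb A_F)/\boldsymbol K$. For an $F$-algebra embedding $\psi\colon K\to M_2(F)$ of a quadratic extension $K/F$, $\boldsymbol T_\psi\subset\boldsymbol G$ is the image of the torus $\mathrm{Res}_{K/F}\mathbb G_m/\mathbb G_m$, and $[\boldsymbol T_\psi g]$ is the image of $\boldsymbol T_\psi(\mathbb A_F)g$ in $[\boldsymbol G]$. $A$ is the diagonal subgroup of $\mathrm{PGL}_2$; the superscript $+$ means positive determinant. $\mathrm{PGL}_2^+(\mathbb R)$ acts on the unit tangent bundle $T^1\mathcal H$ by $g(z,\zeta)=(gz,Dg(z)\zeta)$ and is identified with it by $g\mapsto g\cdot(i,i)$. $Pic^+$ denotes the narrow class group (invertible fractional ideals modulo principal ideals with a totally positive generator). (A) ATR cycles. Let $F$ be a totally real number field of narrow class number $1$ with real embeddings $\sigma_0,\dots,\sigma_r$, and let $\boldsymbol K=\mathrm{PGL}_2(\widehat{\mathbb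 Z}_F)\times\mathrm{PSO}_2(\mathbb R)\times 1$, with $\mathrm{PSO}_2(\mathbb R)$ at $\sigma_0$ and the trivial group at $\sigma_1,\dots,\sigma_r$. There is a bijection $$\Phi\colon[\boldsymbol G]_{\boldsymbol K}\to \mathrm{PSL}_2(\mathbb Z_F)\backslash\Big(\mathcal H_0\times\prod_{j=1}^rT^1\mathcal H_j\Big)$$ sending the class of $x$ to the orbit of $(\gamma x)_\infty\cdot(i,(i,i),\dots,(i,i))$ for every $\gamma\in\boldsymbol G(F)$ with $\gamma x\in\mathrm{PGL}_2(\widehat{\mathbb Z}_F)\times\mathrm{PGL}_2^+(\mathbb R)^{r+1}$. Let $K/F$ be a quadratic extension with $K\otimes_{F,\sigma_0}\mathbb R\cong\mathbb C$ and $K\otimes_{F,\sigma_j}\mathbb R\cong\mathbb R\times\mathbb R$ for $1\le j\le r$; fix extensions $K\to\mathbb C$ of $\sigma_0$ and $K\to\mathbb R$ of $\sigma_j$ $(j\ge1)$, again denoted $\sigma_0,\sigma_j$. Let $\mathcal O$ be a $\mathbb Z_F$-order in $K$, and let $opt(\mathcal O)$ be the set of $F$-algebra embeddings $\psi\colon K\to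 M_2(F)$ with $\psi(K)\cap M_2(\mathbb Z_F)=\psi(\mathcal O)$. For $\psi\in opt(\mathcal O)$ let $\tau_0\in K$ be the fixed point of $\psi(K^\times)$ with $\mathrm{Im}\,\sigma_0(\tau_0)>0$, let $\mathcal Y_j\subset\mathcal H_j$ be the geodesic joining $\sigma_j(\tau_0)$ and $\sigma_j(\tau_0')$, where $\tau_0'$ is the other fixed point, and let $\Delta_\psi$ be the image of $\{\sigma_0(\tau_0)\}\times\prod_{j\ge1}\mathcal Y_j$ in $\mathrm{PSL}_2(\mathbb Z_F)\backslash\mathcal H^{r+1}$ (the ATR cycle of $\psi$, of conductor $\mathcal O$). Call $g\in\boldsymbol G(F_\infty)$ normalized for $\psi$ if $g_{\sigma_0}\in\mathrm{PGL}_2^+(\mathbb R)$, $g_{\sigma_0}\mathrm{PSO}_2(\mathbb R)g_{\sigma_0}^{-1}=\boldsymbol T_\psi(F_{\sigma_0})$ and, for $j\ge1$, $g_{\sigma_j}A(\mathbb R)g_{\sigma_j}^{-1}=\boldsymbol T_\psi(F_{\sigma_j})$ and $g_{\sigma_j}\infty=\sigma_j(\tau_0)$. The lift of $\Delta_\psi$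 is the image of $g_{\sigma_0}\mathrm{PSO}_2(\mathbb R)\times\prod_{j\ge1} g_{\sigma_j}A^+(\mathbb R)$ in $\mathrm{PSL}_2(\mathbb Z_F)\backslash(\mathcal H_0\times\prod_{j\ge1} T^1\mathcal H_j)$, where $g$ is normalized for $\psi$ with all components in $\mathrm{PGL}_2^+(\mathbb R)$. Then for every $\psi_0\in opt(\mathcal O)$ and every $g\in\boldsymbol G(\mathbb A_F)$ trivial at the finite places and normalized for $\psi_0$ at infinity, $\Phi$ maps the projection of $[\boldsymbol T_{\psi_0}g]$ to $[\boldsymbol G]_{\boldsymbol K}$ onto the union of the lifts of the ATR cycles $\Delta_\psi$, $\psi\in opt(\mathcal O)$. There are exactly $h^+(\mathcal O)=|Pic^+(\mathcal O)|$ distinct lifts and $h^+(\mathcal O)$ distinct ATR cycles of conductor $\mathcal O$, and the lift of $\Delta_\psi$ projects onto $\Delta_\psi$. (B) Stark–Heegner cycles. Let $p$ be a prime, $u\in\mathbb Z_p^\times$ a non-square with a square root $\alpha\in\mathbb Q_{p^2}$, the unramified quadratic extension of $\mathbb Q_p$; let $\mathcal H^{unr}_{p^2}=\mathbb P^1(\mathbb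 Q_{p^2})\smallsetminus\mathbb P^1(\mathbb Q_p)$, let $\boldsymbol K_p$ be the stabilizer of $\alpha$ in $\mathrm{PGL}_2(\mathbb Q_p)$, and let $\boldsymbol K=\prod_{q\ne p}\mathrm{PGL}_2(\mathbb Z_q)\times\boldsymbol K_p$ (trivial at infinity). There is a bijection $$\Phi\colon[\boldsymbol G]_{\boldsymbol K}\to\mathrm{PGL}_2^+(\mathbb Z[1/p])\backslash(T^1\mathcal H\times\mathcal H^{unr}_{p^2})\qquad(F=\mathbb Q)$$ sending the class of $x$ to the orbit of $((\gamma x)_\infty\cdot(i,i),(\gamma x)_p\cdot\alpha)$ for every $\gamma\in\boldsymbol G(\mathbb Q)$ with $(\gamma x)_q\in\mathrm{PGL}_2(\mathbb Z_q)$ for all $q\neq p$ and $(\gamma x)_\infty\in\mathrm{PGL}_2^+(\mathbb R)$. Let $K$ be a real quadratic field in which $p$ is inert, with fixed embeddings in $\mathbb R$ and in $\mathbb Q_{p^2}$; let $\mathcal O$ be an order in $K$ and $opt(\mathcal O[1/p])$ the set of embeddings $\psi\colon K\to M_2(\mathbb Q)$ with $\psi(K)\cap M_2(\mathbb Z[1/p])=\psi(\mathcal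 O[1/p])$. For such $\psi$ let $\tau_\psi\in K$ be the element such that $\psi(x)(\tau_\psi,1)^t=x(\tau_\psi,1)^t$ for all $x\in K$, let $\mathcal Y_\psi$ be the geodesic in $\mathcal H$ joining $\tau_\psi$ and its conjugate, and let $\Delta_\psi$ be the image of $\mathcal Y_\psi\times\{\tau_\psi\}$ in $\mathrm{PGL}_2^+(\mathbb Z[1/p])\backslash(\mathcal H\times\mathcal H^{unr}_{p^2})$ (the Stark–Heegner cycle of $\psi$, of conductor $\mathcal O[1/p]$). Call $(g_\infty,g_p)\in\mathrm{PGL}_2^+(\mathbb R)\times\mathrm{PGL}_2(\mathbb Q_p)$ normalized for $\psi$ if $g_\infty A(\mathbb R)g_\infty^{-1}=\boldsymbol T_\psi(\mathbb R)$, $g_p\boldsymbol K_pg_p^{-1}=\boldsymbol T_\psi(\mathbb Q_p)$, $g_\infty\infty=\tau_\psi$ and $g_p\alpha=\tau_\psi$; the lift of $\Delta_\psi$ is the image of $g_\infty A^+(\mathbb R)\times g_p\boldsymbol K_p$ in $\mathrm{PGL}_2^+(\mathbb Z[1/p])\backslash(T^1\mathcal H\times\mathcal H^{unr}_{p^2})$.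 Then for every $\psi_0\in opt(\mathcal O[1/p])$ and every $g\in\boldsymbol G(\mathbb A_{\mathbb Q})$ trivial at the primes $q\ne p$ with $(g_\infty,g_p)$ normalized for $\psi_0$, $\Phi$ maps the projection of $[\boldsymbol T_{\psi_0}g]$ to $[\boldsymbol G]_{\boldsymbol K}$ onto the union of the lifts of the Stark–Heegner cycles $\Delta_\psi$, $\psi\in opt(\mathcal O[1/p])$. There are exactly $h^+(\mathcal O[1/p])=|Pic^+(\mathcal O[1/p])|$ distinct lifts and $h^+(\mathcal O[1/p])$ distinct Stark–Heegner cycles of conductor $\mathcal O[1/p]$, and the lift of $\Delta_\psi$ projects onto $\Delta_\psi$. -/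

import Mathlib

open scoped MatrixGroups TensorProduct NumberField
open Matrix IsDedekindDomain NumberField UpperHalfPlane

noncomputable section

namespace ToralCycles

/-! ### `PGL₂` and its actions -/

/-- `PGL₂⁺`: the classes of matrices of positive determinant. -/
def PGLpos (R : Type*) [CommRing R] [LinearOrder R] [IsStrictOrderedRing R] :
    Subgroup PGL(2, R) where
  carrier := {x | ∃ g : GL (Fin 2) R, 0 < g.det.val ∧ ProjGenLinGroup.mk g = x}
  one_mem' := ⟨1, by simp, rfl⟩
  mul_mem' := by
    rintro _ _ ⟨g, hg, rfl⟩ ⟨h, hh, rfl⟩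
    exact ⟨g * h, by simpa using mul_pos hg hh, map_mul _ _ _⟩
  inv_mem' := by
    rintro _ ⟨g, hg, rfl⟩
    refine ⟨g⁻¹, ?_, map_inv _ _⟩
    have h : 0 < g.det.val * (g⁻¹).det.val := by
      rw [← Units.val_mul, ← map_mul, mul_inv_cancel]; simp
    exact pos_of_mul_pos_right h hg.le

/-- The unit tangent bundle `T¹ℍ` of the upper half-plane: a point `z` together with a tangent
vector `ζ ∈ T_z ℍ = ℂ` of hyperbolic length `|ζ| / Im z = 1`. -/
@[ext]
structure UnitTangent where
  pt : ℍ
  vec : ℂ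
  norm_vec : ‖vec‖ = pt.im

/-- `g (z, ζ) = (g z, Dg(z) ζ)`, where `Dg(z) = det g / (c z + d)²` if `det g > 0` (so it is
`(c z + d)⁻²` on `SL₂`). As in Mathlib's action on `ℍ`, matrices of negative determinant act through
the composition with complex conjugation. -/
instance : MulAction (GL (Fin 2) ℝ) UnitTangent where
  smul g x := ⟨g • x.pt, UpperHalfPlane.σ g ((g.det.val : ℂ) * x.vec / denom g x.pt ^ 2), by
    rw [norm_σ, norm_div, norm_mul, norm_pow, x.norm_vec, im_smul_eq_div_normSq,
      Complex.normSq_eq_norm_sq, Complex.norm_real, Real.norm_eq_abs]⟩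
  one_smul x := by
    apply UnitTangent.ext
    · exact one_smul _ x.pt
    · change UpperHalfPlane.σ 1 _ = _
      simp [UpperHalfPlane.σ]
  mul_smul g h x := by
    apply UnitTangent.ext
    · exact mul_smul g h x.pt
    · change UpperHalfPlane.σ (g * h) _ = UpperHalfPlane.σ g ((g.det.val : ℂ) *
        UpperHalfPlane.σ h ((h.det.val : ℂ) * x.vec / denom h x.pt ^ 2) /
          denom g ↑(h • x.pt) ^ 2)
      rw [σ_mul, denom_cocycle_σ]
      congr 1
      simp only [map_div₀, map_mul, map_pow, σ_sq, σ_ofReal, Units.val_mul, Complex.ofReal_mul,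
        mul_pow]
      rw [mul_assoc, ← mul_div_assoc, div_div, mul_comm (denom g _ ^ 2)]

lemma scalar_smul_unitTangent (u : ℝˣ) (x : UnitTangent) :
    GeneralLinearGroup.scalar (Fin 2) u • x = x := by
  have hdet : (GeneralLinearGroup.scalar (Fin 2) u).det.val = (u : ℝ) ^ 2 := by simp
  have hpos : 0 < (GeneralLinearGroup.scalar (Fin 2) u).det.val := by
    rw [hdet]; exact sq_pos_of_ne_zero u.ne_zero
  apply UnitTangent.ext
  · exact glScalar_smul u x.pt
  · change UpperHalfPlane.σ _ (_ * x.vec / _ ^ 2) = _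
    have hu : (u : ℂ) ≠ 0 := by exact_mod_cast u.ne_zero
    rw [UpperHalfPlane.σ, if_pos hpos, hdet, denom_scalar]
    push_cast
    exact mul_div_cancel_left₀ _ (pow_ne_zero 2 hu)

instance : MulAction PGL(2, ℝ) UnitTangent :=
  ProjGenLinGroup.mulActionOfGL scalar_smul_unitTangent

/-- The base point `(i, i)` of `T¹ℍ`: the upward unit vector at `i`. The map `g ↦ g (i, i)`
identifies `PGL₂⁺(ℝ)` with `T¹ℍ`. -/
def UnitTangent.base : UnitTangent := ⟨UpperHalfPlane.I, Complex.I, by simp⟩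

open scoped Classical in
/-- The action of `PGL₂(k)` on `ℙ¹(k) = k ∪ {∞}` by Möbius transformations. -/
instance {k : Type*} [Field k] : MulAction PGL(2, k) (OnePoint k) :=
  ProjGenLinGroup.mulActionOfGL fun u x => by
    cases x with
    | infty => simp [OnePoint.smul_infty_eq_ite]
    | coe c => simp [OnePoint.smul_some_eq_ite, mul_div_cancel_left₀]

/-- `PSO₂(ℝ)`, the image of `SO₂(ℝ)` in `PGL₂(ℝ)`. -/
def PSO2 : Subgroup PGL(2, ℝ) :=
  (ProjGenLinGroup.mk.comp (specialOrthogonalGroup (Fin 2) ℝ).subtype.toHomUnits).range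

/-- `A(ℝ)`, the diagonal subgroup of `PGL₂(ℝ)`. -/
def diagSubgroup : Subgroup PGL(2, ℝ) :=
  (ProjGenLinGroup.mk.comp (Units.map (Matrix.diagonalRingHom (Fin 2) ℝ).toMonoidHom)).range

/-- `A⁺(ℝ)`, the classes of diagonal matrices of positive determinant. -/
def diagPos : Subgroup PGL(2, ℝ) := diagSubgroup ⊓ PGLpos ℝ

/-- The conjugate subgroup `g H g⁻¹`. -/
def conjSubgroup {G : Type*} [Group G] (g : G) (H : Subgroup G) : Subgroup G :=
  H.map (MulAut.conj g).toMonoidHom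

/-! ### Embeddings, tori, orders -/

section Embeddings

variable {F K : Type*} [Field F] [Field K] [Algebra F K]

/-- For an `F`-algebra `σ : F → A` and an embedding `ψ : K → M₂(F)`, the image in `PGL₂(A)` of
`(A ⊗_F K)ˣ` under `ψ`: the `A`-points of the torus `T_ψ`. -/
def torus {A : Type*} [CommRing A] (σ : F →+* A) (ψ : K →ₐ[F] Matrix (Fin 2) (Fin 2) F) :
    Subgroup PGL(2, A) :=
  letI := σ.toAlgebra
  let f : A ⊗[F] K →ₐ[A] Matrix (Fin 2) (Fin 2) A :=
    Algebra.TensorProduct.lift (Algebra.ofId A _) ((Algebra.ofId F A).mapMatrix.comp ψ)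
      fun a _ => Algebra.commutes a _
  (ProjGenLinGroup.mk.comp (Units.map (f : A ⊗[F] K →* Matrix (Fin 2) (Fin 2) A))).range

/-- `ψ(K) ∩ M₂(R) = ψ(O)` for a subring `R` of `F` and a subring `O` of `K`. -/
def IsOptimal (R : Subring F) (O : Subring K) (ψ : K →ₐ[F] Matrix (Fin 2) (Fin 2) F) : Prop :=
  Set.range ψ ∩ {M | ∀ i j, M i j ∈ R} = ψ '' O

/-- `ψ(K^×)` fixes the point `(τ : 1)` of `ℙ¹(K)`. -/
def IsFixedPoint (ψ : K →ₐ[F] Matrix (Fin 2) (Fin 2) F) (τ : K) : Prop :=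
  ∀ x : K, ∃ c : K, ((ψ x).map (algebraMap F K)).mulVec ![τ, 1] = c • ![τ, 1]

/-- `ψ(x)` acts on the column `(τ, 1)ᵗ` as multiplication by `x`, for every `x ∈ K`. -/
def IsEigenPoint (ψ : K →ₐ[F] Matrix (Fin 2) (Fin 2) F) (τ : K) : Prop :=
  ∀ x : K, ((ψ x).map (algebraMap F K)).mulVec ![τ, 1] = x • ![τ, 1]

/-- `O` is an `R`-order of `K` (where `F` is the fraction field of `R`). -/
def IsOrder {R : Type*} [CommRing R] (F : Type*) {K : Type*} [Field F] [Field K] [Algebra F K]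
    [Algebra R K] (O : Subalgebra R K) : Prop :=
  Module.Finite R O ∧ Submodule.span F (O : Set K) = ⊤

end Embeddings

/-- The elements of `Kˣ` which are positive at every real embedding of `K`. -/
def totallyPositive (K : Type*) [Field K] : Subgroup Kˣ where
  carrier := {x | ∀ ρ : K →+* ℝ, 0 < ρ x}
  one_mem' := by simp
  mul_mem' {x y} hx hy ρ := by simpa using mul_pos (hx ρ) (hy ρ)
  inv_mem' {x} hx ρ := by simpa using hx ρ

/-- The narrow class group `Pic⁺(O)` of a ring `O` with field of fractions `K`: the group of
invertible `O`-submodules of `K` (that is, invertible fractional ideals) modulo the ideals `x O` with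
`x` totally positive. -/
abbrev NarrowPic (O K : Type*) [CommRing O] [Field K] [Algebra O K] : Type _ :=
  (Submodule O K)ˣ ⧸
    (totallyPositive K).map (Units.map (Submodule.spanSingleton (A := K) O).toMonoidHom)

/-- The geodesic of `ℍ` with end points `a ≠ b` in `ℝ`. -/
def geodesic (a b : ℝ) : Set ℍ := {z | ‖(z : ℂ) - ((a + b) / 2 : ℝ)‖ = |a - b| / 2}

/-! ### Adelic quotients -/

section Adelic

variable (R F : Type*) [CommRing R] [IsDedekindDomain R] [Field F] [Algebra R F]
  [IsFractionRing R F]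

/-- The `v`-component `𝔸_F → F_v` at a finite place. -/
def finComp (v : HeightOneSpectrum R) : AdeleRing R F →+* v.adicCompletion F :=
  (RestrictedProduct.evalRingHom (fun w : HeightOneSpectrum R => w.adicCompletion F) v).comp
    (RingHom.snd (InfiniteAdeleRing F) (FiniteAdeleRing R F))

/-- The real embedding of a totally real field attached to an infinite place. -/
def realEmb {F : Type*} [Field F] [IsTotallyReal F] (v : InfinitePlace F) : F →+* ℝ :=
  InfinitePlace.embedding_of_isReal (IsTotallyReal.isReal v)

/-- The `v`-component `𝔸_F → F_v = ℝ` at an infinite place of a totally real field. -/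
def infComp [IsTotallyReal F] (v : InfinitePlace F) : AdeleRing R F →+* ℝ :=
  (InfinitePlace.Completion.extensionEmbeddingOfIsReal (IsTotallyReal.isReal v)).comp
    ((Pi.evalRingHom _ v).comp (RingHom.fst (InfiniteAdeleRing F) (FiniteAdeleRing R F)))

/-- `G(F)` inside `G(𝔸_F)`, for `G = PGL₂`. -/
def globalPoints : Subgroup PGL(2, AdeleRing R F) :=
  (ProjGenLinGroup.map (algebraMap F (AdeleRing R F))).range

/-- `[G] = G(F) \ G(𝔸_F)`. -/
abbrev AdelicQuotient : Type _ := Quotient (QuotientGroup.rightRel (globalPoints R F))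

variable {R F}

/-- `[G]_U = G(F) \ G(𝔸_F) / U`. -/
abbrev AdelicDoubleQuotient (U : Subgroup PGL(2, AdeleRing R F)) : Type _ :=
  DoubleCoset.Quotient (globalPoints R F : Set PGL(2, AdeleRing R F)) U

/-- The projection `[·]_U : [G] → [G]_U`. -/
def adelicProj (U : Subgroup PGL(2, AdeleRing R F)) :
    AdelicQuotient R F → AdelicDoubleQuotient U :=
  Quotient.lift (DoubleCoset.mk (globalPoints R F) U) fun a b h => by
    rw [DoubleCoset.eq]
    exact ⟨b * a⁻¹, QuotientGroup.rightRel_apply.1 h, 1, U.one_mem, by group⟩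

variable (R) in
/-- The homogeneous toral set `[T_ψ g]` in `[G]`. -/
def toralSet {K : Type*} [Field K] [Algebra F K] (ψ : K →ₐ[F] Matrix (Fin 2) (Fin 2) F)
    (g : PGL(2, AdeleRing R F)) : Set (AdelicQuotient R F) :=
  {q | ∃ t ∈ torus (algebraMap F (AdeleRing R F)) ψ, q = Quotient.mk _ (t * g)}

/-- `PGL₂(𝒪_v)` inside `PGL₂(F_v)`. -/
def maxCompact (F : Type*) [Field F] [Algebra R F] [IsFractionRing R F]
    (v : HeightOneSpectrum R) : Subgroup PGL(2, v.adicCompletion F) :=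
  (ProjGenLinGroup.map (algebraMap (v.adicCompletionIntegers F) (v.adicCompletion F))).range

end Adelic

/-! ### ATR cycles -/

section ATR

variable {F : Type*} [Field F] [NumberField F] [IsTotallyReal F]

/-- `K/F` is almost totally real, with distinguished place `v₀`: the algebra `K ⊗_F ℝ` is `ℂ` at
`v₀` and `ℝ × ℝ` at the other infinite places. -/
def IsATR (K : Type*) [Field K] [Algebra F K] (v₀ : InfinitePlace F) : Prop :=
  (letI := (realEmb v₀).toAlgebra; Nonempty (ℝ ⊗[F] K ≃ₐ[ℝ] ℂ)) ∧
  ∀ v : InfinitePlace F, v ≠ v₀ →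
    letI := (realEmb v).toAlgebra; Nonempty (ℝ ⊗[F] K ≃ₐ[ℝ] ℝ × ℝ)

/-- `ℍ × ∏_{v ≠ v₀} Z`, where `Z` is `ℍ` or `T¹ℍ`. -/
def HilbertSpace (v₀ : InfinitePlace F) (Z : Type*) : Type _ :=
  ℍ × ({v : InfinitePlace F // v ≠ v₀} → Z)

/-- `PGL₂(F)` acts on each factor through the corresponding real embedding of `F`. -/
instance (v₀ : InfinitePlace F) (Z : Type*) [MulAction PGL(2, ℝ) Z] :
    MulAction PGL(2, F) (HilbertSpace v₀ Z) where
  smul γ x := (ProjGenLinGroup.map (realEmb v₀) γ • x.1,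
    fun v => ProjGenLinGroup.map (realEmb v.1) γ • x.2 v)
  one_smul x := Prod.ext (by change ProjGenLinGroup.map _ 1 • x.1 = _; simp)
    (funext fun v => by change ProjGenLinGroup.map _ 1 • x.2 v = _; simp)
  mul_smul γ δ x := Prod.ext
    (by change ProjGenLinGroup.map _ (γ * δ) • x.1 = _; rw [map_mul, mul_smul]; rfl)
    (funext fun v => by
      change ProjGenLinGroup.map _ (γ * δ) • x.2 v = _; rw [map_mul, mul_smul]; rfl)

variable (F) in
/-- `PSL₂(ℤ_F)` inside `PGL₂(F)`. -/
def hilbertModularGroup : Subgroup PGL(2, F) :=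
  ((ProjGenLinGroup.map (algebraMap (𝓞 F) F)).comp
    (ProjectiveSpecialLinearGroup.toPGL (n := Fin 2) (R := 𝓞 F))).range

/-- `PSL₂(ℤ_F) \ (ℍ × ∏_{v ≠ v₀} Z)`. -/
abbrev HilbertQuotient (v₀ : InfinitePlace F) (Z : Type*) [MulAction PGL(2, ℝ) Z] : Type _ :=
  MulAction.orbitRel.Quotient (hilbertModularGroup F) (HilbertSpace v₀ Z)

/-- The `PSL₂(ℤ_F)`-orbit of a point. -/
def HilbertQuotient.mk (v₀ : InfinitePlace F) {Z : Type*} [MulAction PGL(2, ℝ) Z]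
    (z : ℍ) (w : {v : InfinitePlace F // v ≠ v₀} → Z) : HilbertQuotient v₀ Z :=
  Quotient.mk _ ((z, w) : HilbertSpace v₀ Z)

/-- The projection of `PSL₂(ℤ_F) \ (ℍ × ∏ T¹ℍ)` to `PSL₂(ℤ_F) \ (ℍ × ∏ ℍ)`. -/
def hilbertProj (v₀ : InfinitePlace F) :
    HilbertQuotient v₀ UnitTangent → HilbertQuotient v₀ ℍ :=
  Quotient.map (fun x : HilbertSpace v₀ UnitTangent =>
      ((x.1, fun v => (x.2 v).pt) : HilbertSpace v₀ ℍ)) <| by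
    rintro _ b ⟨γ, rfl⟩
    refine ⟨γ, Prod.ext rfl (funext fun v => ?_)⟩
    change ProjGenLinGroup.map (realEmb v.1) γ.1 • (b.2 v).pt =
      (ProjGenLinGroup.map (realEmb v.1) γ.1 • b.2 v).pt
    generalize ProjGenLinGroup.map (realEmb v.1) γ.1 = g
    induction g using ProjGenLinGroup.induction_on with
    | mk g => rfl

/-- The compact subgroup `K = PGL₂(ℤ̂_F) × PSO₂(ℝ) × 1` of `G(𝔸_F)`. -/
def levelATR (v₀ : InfinitePlace F) : Subgroup PGL(2, AdeleRing (𝓞 F) F) :=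
  (⨅ v : HeightOneSpectrum (𝓞 F),
    (maxCompact F v).comap (ProjGenLinGroup.map (finComp (𝓞 F) F v))) ⊓
  PSO2.comap (ProjGenLinGroup.map (infComp (𝓞 F) F v₀)) ⊓
  ⨅ v : {v : InfinitePlace F // v ≠ v₀},
    (⊥ : Subgroup PGL(2, ℝ)).comap (ProjGenLinGroup.map (infComp (𝓞 F) F v.1))

/-- `Φ` is the canonical identification `[G]_K ≅ PSL₂(ℤ_F) \ (ℍ × ∏ T¹ℍ)`: it sends the class of `x`
to the orbit of `(γ x)_∞ (i, (i, i), …, (i, i))`, for any `γ ∈ G(F)` such that `γ x` lies in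
`PGL₂(ℤ̂_F)` at the finite places and in `PGL₂⁺(ℝ)` at the infinite places. -/
def IsIdentificationATR (v₀ : InfinitePlace F)
    (Φ : AdelicDoubleQuotient (levelATR v₀) → HilbertQuotient v₀ UnitTangent) : Prop :=
  Function.Bijective Φ ∧
  ∀ (x y : PGL(2, AdeleRing (𝓞 F) F)) (γ : PGL(2, F)),
    y = ProjGenLinGroup.map (algebraMap F (AdeleRing (𝓞 F) F)) γ * x →
    (∀ v, ProjGenLinGroup.map (finComp (𝓞 F) F v) y ∈ maxCompact F v) →
    (∀ v, ProjGenLinGroup.map (infComp (𝓞 F) F v) y ∈ PGLpos ℝ) →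
    Φ (DoubleCoset.mk _ _ x) = HilbertQuotient.mk v₀
      (ProjGenLinGroup.map (infComp (𝓞 F) F v₀) y • UpperHalfPlane.I)
      fun v => ProjGenLinGroup.map (infComp (𝓞 F) F v.1) y • UnitTangent.base

variable {K : Type*} [Field K] [Algebra F K] (v₀ : InfinitePlace F)

/-- `τ ∈ K` is the point `τ₀` of `ℍ` fixed by `ψ(K^×)`, where `K` is viewed in `ℂ` by `ρ₀`. -/
def IsATRPoint (ρ₀ : K →+* ℂ) (ψ : K →ₐ[F] Matrix (Fin 2) (Fin 2) F) (τ : K) : Prop :=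
  IsFixedPoint ψ τ ∧ 0 < (ρ₀ τ).im

variable (ρ₀ : K →+* ℂ) (ρ : {v : InfinitePlace F // v ≠ v₀} → K →+* ℝ)
  (ψ : K →ₐ[F] Matrix (Fin 2) (Fin 2) F)

/-- The ATR cycle `Δ_ψ`: the image of `{τ₀} × ∏_{v ≠ v₀} 𝒴_v`, where `𝒴_v` is the geodesic joining
the two fixed points of `ψ(K^×)` in the boundary of the `v`-th upper half-plane. -/
def atrCycle : Set (HilbertQuotient v₀ ℍ) :=
  {q | ∃ τ τ' : K, IsATRPoint ρ₀ ψ τ ∧ IsFixedPoint ψ τ' ∧ τ' ≠ τ ∧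
    ∃ (z : ℍ) (w : {v : InfinitePlace F // v ≠ v₀} → ℍ), (z : ℂ) = ρ₀ τ ∧
      (∀ v, w v ∈ geodesic (ρ v τ) (ρ v τ')) ∧ q = HilbertQuotient.mk v₀ z w}

/-- The normalized elements `g^ψ ∈ G(F_∞)`: `g_{v₀} ∈ PGL₂⁺(ℝ)` conjugates `PSO₂(ℝ)` to
`ψ(K_{v₀}^×)`, and for `v ≠ v₀` the element `g_v` conjugates `A(ℝ)` to `ψ(K_v^×)` and sends `∞` to
the image of `τ₀` under the chosen real embedding of `K`. -/
structure IsNormalizedATR (g : InfinitePlace F → PGL(2, ℝ)) : Prop where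
  pos : g v₀ ∈ PGLpos ℝ
  conj_PSO2 : conjSubgroup (g v₀) PSO2 = torus (realEmb v₀) ψ
  conj_diag : ∀ v, v ≠ v₀ → conjSubgroup (g v) diagSubgroup = torus (realEmb v) ψ
  endpoint : ∃ τ : K, IsATRPoint ρ₀ ψ τ ∧
    ∀ v : {v : InfinitePlace F // v ≠ v₀},
      g v.1 • (OnePoint.infty : OnePoint ℝ) = ((ρ v τ : ℝ) : OnePoint ℝ)

/-- The lift of the ATR cycle of `ψ`: the image in `PSL₂(ℤ_F) \ (ℍ × ∏ T¹ℍ)` of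
`g_{v₀} PSO₂(ℝ) × ∏_{v ≠ v₀} g_v A⁺(ℝ)`, for `g = g^ψ` normalized in `PGL₂⁺(F_∞)`. -/
def atrLift : Set (HilbertQuotient v₀ UnitTangent) :=
  {q | ∃ g : InfinitePlace F → PGL(2, ℝ), IsNormalizedATR v₀ ρ₀ ρ ψ g ∧ (∀ v, g v ∈ PGLpos ℝ) ∧
    ∃ k : InfinitePlace F → PGL(2, ℝ), k v₀ ∈ PSO2 ∧ (∀ v, v ≠ v₀ → k v ∈ diagPos) ∧
      q = HilbertQuotient.mk v₀ ((g v₀ * k v₀) • UpperHalfPlane.I)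
        fun v => (g v.1 * k v.1) • UnitTangent.base}

/-- The optimal embeddings `opt(O)` of a `ℤ_F`-order `O` of `K`. -/
def optATR (O : Subalgebra (𝓞 F) K) : Set (K →ₐ[F] Matrix (Fin 2) (Fin 2) F) :=
  {ψ | IsOptimal (algebraMap (𝓞 F) F).range O.toSubring ψ}

end ATR

/-! ### Stark–Heegner cycles -/

section StarkHeegner

/-- The finite place of `ℚ` attached to a prime number `p`. -/
def primePlace (p : ℕ) [hp : Fact p.Prime] : HeightOneSpectrum ℤ :=
  (Rat.HeightOneSpectrum.primesEquiv (R := ℤ)).symm ⟨p, hp.out⟩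

/-- The field `ℚ_p`, as the completion of `ℚ` at `p`. -/
abbrev Qp (p : ℕ) [Fact p.Prime] : Type := (primePlace p).adicCompletion ℚ

/-- The ring `ℤ_p`. -/
abbrev Zp (p : ℕ) [Fact p.Prime] : Type := (primePlace p).adicCompletionIntegers ℚ

variable (p : ℕ) [Fact p.Prime] (E : Type*) [Field E] [Algebra (Qp p) E]

/-- `x ∈ E` is integral over `ℤ_p`. -/
def IsIntegralElt (x : E) : Prop :=
  ((algebraMap (Qp p) E).comp (algebraMap (Zp p) (Qp p))).IsIntegralElem x

/-- `E` is the unramified quadratic extension `ℚ_{p²}` of `ℚ_p`: it has degree two and `p` generates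
the maximal ideal of its ring of integers. -/
def IsUnramifiedQuadratic : Prop :=
  Module.finrank (Qp p) E = 2 ∧
  ∀ x : E, IsIntegralElt p E x →
    (∃ y, IsIntegralElt p E y ∧ x * y = 1) ∨ (∃ y, IsIntegralElt p E y ∧ x = p * y)

open scoped Classical in
/-- The inclusion `ℙ¹(ℚ_p) → ℙ¹(E)` is `PGL₂(ℚ_p)`-equivariant. -/
lemma map_smul_range (γ : PGL(2, Qp p)) (z : OnePoint (Qp p)) :
    OnePoint.map (algebraMap (Qp p) E) (γ • z) =
      ProjGenLinGroup.map (algebraMap (Qp p) E) γ • OnePoint.map (algebraMap (Qp p) E) z := by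
  induction γ using ProjGenLinGroup.induction_on with
  | mk g => exact OnePoint.map_smul (algebraMap (Qp p) E) g z

/-- The `E`-points `ℙ¹(E) ∖ ℙ¹(ℚ_p)` of Drinfeld's upper half-plane. -/
def Drinfeld : Type _ :=
  {z : OnePoint E // z ∉ Set.range (OnePoint.map (algebraMap (Qp p) E))}

/-- The action of `PGL₂(ℚ_p)` on `ℙ¹(E) ∖ ℙ¹(ℚ_p)` by Möbius transformations. -/
instance : MulAction PGL(2, Qp p) (Drinfeld p E) where
  smul γ z := ⟨ProjGenLinGroup.map (algebraMap (Qp p) E) γ • z.1, by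
    rintro ⟨w, hw⟩
    exact z.2 ⟨γ⁻¹ • w, by rw [map_smul_range, hw, map_inv, inv_smul_smul]⟩⟩
  one_smul z := Subtype.ext (by
    change ProjGenLinGroup.map (algebraMap (Qp p) E) 1 • z.1 = _
    rw [map_one, one_smul])
  mul_smul γ δ z := Subtype.ext (by
    change ProjGenLinGroup.map (algebraMap (Qp p) E) (γ * δ) • z.1 = _
    rw [map_mul, mul_smul]; rfl)

/-- `Z × ℋ_{p²}^{unr}`, where `Z` is `ℍ` or `T¹ℍ`. -/
def MockSpace (Z : Type*) : Type _ := Z × Drinfeld p E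

/-- `PGL₂(ℚ)` acts diagonally. -/
instance (Z : Type*) [MulAction PGL(2, ℝ) Z] : MulAction PGL(2, ℚ) (MockSpace p E Z) where
  smul γ x := (ProjGenLinGroup.map (algebraMap ℚ ℝ) γ • x.1,
    ProjGenLinGroup.map (algebraMap ℚ (Qp p)) γ • x.2)
  one_smul x := Prod.ext (by change ProjGenLinGroup.map _ 1 • x.1 = _; rw [map_one, one_smul])
    (by change ProjGenLinGroup.map _ 1 • x.2 = _; rw [map_one, one_smul])
  mul_smul γ δ x := Prod.ext
    (by change ProjGenLinGroup.map _ (γ * δ) • x.1 = _; rw [map_mul, mul_smul]; rfl)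
    (by change ProjGenLinGroup.map _ (γ * δ) • x.2 = _; rw [map_mul, mul_smul]; rfl)

/-- `ℤ[1/p]` inside `ℚ`. -/
def ZInv : Subalgebra ℤ ℚ := Algebra.adjoin ℤ {(p : ℚ)⁻¹}

/-- `PGL₂⁺(ℤ[1/p])` inside `PGL₂(ℚ)`. -/
def iharaGroup : Subgroup PGL(2, ℚ) :=
  (ProjGenLinGroup.map (algebraMap (ZInv p) ℚ)).range ⊓ PGLpos ℚ

/-- `PGL₂⁺(ℤ[1/p]) \ (Z × ℋ_{p²}^{unr})`. -/
abbrev MockQuotient (Z : Type*) [MulAction PGL(2, ℝ) Z] : Type _ :=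
  MulAction.orbitRel.Quotient (iharaGroup p) (MockSpace p E Z)

variable {E} in
/-- The `PGL₂⁺(ℤ[1/p])`-orbit of a point. -/
def MockQuotient.mk {Z : Type*} [MulAction PGL(2, ℝ) Z] (z : Z) (w : Drinfeld p E) :
    MockQuotient p E Z :=
  Quotient.mk _ ((z, w) : MockSpace p E Z)

/-- The projection of `PGL₂⁺(ℤ[1/p]) \ (T¹ℍ × ℋ_{p²}^{unr})` to
`PGL₂⁺(ℤ[1/p]) \ (ℍ × ℋ_{p²}^{unr})`. -/
def mockProj : MockQuotient p E UnitTangent → MockQuotient p E ℍ :=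
  Quotient.map (fun x : MockSpace p E UnitTangent => ((x.1.pt, x.2) : MockSpace p E ℍ)) <| by
    rintro _ b ⟨γ, rfl⟩
    refine ⟨γ, Prod.ext ?_ rfl⟩
    change ProjGenLinGroup.map (algebraMap ℚ ℝ) γ.1 • b.1.pt =
      (ProjGenLinGroup.map (algebraMap ℚ ℝ) γ.1 • b.1).pt
    generalize ProjGenLinGroup.map (algebraMap ℚ ℝ) γ.1 = g
    induction g using ProjGenLinGroup.induction_on with
    | mk g => rfl

variable {E} (α : Drinfeld p E)

/-- The `p`-component `𝔸_ℚ → ℚ_p`. -/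
abbrev pComp : AdeleRing ℤ ℚ →+* Qp p := finComp ℤ ℚ (primePlace p)

/-- The component `𝔸_ℚ → ℝ`. -/
abbrev realComp : AdeleRing ℤ ℚ →+* ℝ := infComp ℤ ℚ Rat.infinitePlace

/-- `K_p`, the stabilizer of `α` in `PGL₂(ℚ_p)`. -/
abbrev Kp : Subgroup PGL(2, Qp p) := MulAction.stabilizer PGL(2, Qp p) α

/-- The compact subgroup `K = ∏_{q ≠ p} PGL₂(ℤ_q) × K_p` of `G(𝔸_ℚ)`, trivial at infinity. -/
def levelSH : Subgroup PGL(2, AdeleRing ℤ ℚ) :=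
  (⨅ v : {v : HeightOneSpectrum ℤ // v ≠ primePlace p},
    (maxCompact ℚ v.1).comap (ProjGenLinGroup.map (finComp ℤ ℚ v.1))) ⊓
  (Kp p α).comap (ProjGenLinGroup.map (pComp p)) ⊓
  (⊥ : Subgroup PGL(2, ℝ)).comap (ProjGenLinGroup.map realComp)

/-- `Φ` is the canonical identification `[G]_K ≅ PGL₂⁺(ℤ[1/p]) \ (T¹ℍ × ℋ_{p²}^{unr})`: it sends the
class of `x` to the orbit of `((γ x)_∞ (i, i), (γ x)_p α)`, for any `γ ∈ G(ℚ)` such that `γ x` lies in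
`PGL₂(ℤ_q)` for all primes `q ≠ p` and in `PGL₂⁺(ℝ)` at infinity. -/
def IsIdentificationSH
    (Φ : AdelicDoubleQuotient (levelSH p α) → MockQuotient p E UnitTangent) : Prop :=
  Function.Bijective Φ ∧
  ∀ (x y : PGL(2, AdeleRing ℤ ℚ)) (γ : PGL(2, ℚ)),
    y = ProjGenLinGroup.map (algebraMap ℚ (AdeleRing ℤ ℚ)) γ * x →
    (∀ v, v ≠ primePlace p → ProjGenLinGroup.map (finComp ℤ ℚ v) y ∈ maxCompact ℚ v) →
    ProjGenLinGroup.map realComp y ∈ PGLpos ℝ →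
    Φ (DoubleCoset.mk _ _ x) = MockQuotient.mk p
      (ProjGenLinGroup.map realComp y • UnitTangent.base)
      (ProjGenLinGroup.map (pComp p) y • α)

variable {K : Type*} [Field K] [NumberField K]

/-- `O[1/p]` inside `K`. -/
def orderInv (O : Subalgebra ℤ K) : Subalgebra ℤ K := O ⊔ Algebra.adjoin ℤ {(p : K)⁻¹}

/-- The optimal embeddings `opt(O[1/p])`. -/
def optSH (O : Subalgebra ℤ K) : Set (K →ₐ[ℚ] Matrix (Fin 2) (Fin 2) ℚ) :=
  {ψ | IsOptimal (ZInv p).toSubring (orderInv p O).toSubring ψ}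

variable (ρ : K →+* ℝ) (ι : K →+* E) (ψ : K →ₐ[ℚ] Matrix (Fin 2) (Fin 2) ℚ)

/-- The Stark–Heegner cycle `Δ_ψ`: the image of `𝒴_ψ × {τ_ψ}`, where `𝒴_ψ` is the geodesic joining
`τ_ψ` and its conjugate; `K` is viewed in `ℝ` by `ρ` and in `ℚ_{p²}` by `ι`. -/
def shCycle : Set (MockQuotient p E ℍ) :=
  {q | ∃ τ τ' : K, IsEigenPoint ψ τ ∧ IsFixedPoint ψ τ' ∧ τ' ≠ τ ∧
    ∃ (z : ℍ) (w : Drinfeld p E), z ∈ geodesic (ρ τ) (ρ τ') ∧ w.1 = ((ι τ : E) : OnePoint E) ∧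
      q = MockQuotient.mk p z w}

/-- The normalized elements `g^ψ = (g_∞, g_p)` of `PGL₂⁺(ℝ) × PGL₂(ℚ_p)`: they conjugate `A(ℝ)` to
`ψ(K_∞^×)` and `K_p` to `ψ(K_p^×)`, and satisfy `g_∞ ∞ = τ_ψ` and `g_p α = τ_ψ`. -/
structure IsNormalizedSH (gInf : PGL(2, ℝ)) (gp : PGL(2, Qp p)) : Prop where
  pos : gInf ∈ PGLpos ℝ
  conj_diag : conjSubgroup gInf diagSubgroup = torus (algebraMap ℚ ℝ) ψ
  conj_Kp : conjSubgroup gp (Kp p α) = torus (algebraMap ℚ (Qp p)) ψ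
  endpoint : ∃ τ : K, IsEigenPoint ψ τ ∧
    gInf • (OnePoint.infty : OnePoint ℝ) = ((ρ τ : ℝ) : OnePoint ℝ) ∧
    (gp • α).1 = ((ι τ : E) : OnePoint E)

/-- The lift of the Stark–Heegner cycle of `ψ`: the image in
`PGL₂⁺(ℤ[1/p]) \ (T¹ℍ × ℋ_{p²}^{unr})` of `g_∞ A⁺(ℝ) × g_p K_p`, for `g = g^ψ` normalized. -/
def shLift : Set (MockQuotient p E UnitTangent) :=
  {q | ∃ gInf gp, IsNormalizedSH p α ρ ι ψ gInf gp ∧ ∃ a ∈ diagPos, ∃ k ∈ Kp p α,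
    q = MockQuotient.mk p ((gInf * a) • UnitTangent.base) ((gp * k) • α)}

end StarkHeegner

end ToralCycles

end

/-!
Both parts compare three descriptions of the same set: optimal embeddings, points of `K ∖ F`, and
adelic points of the torus.

*Points.* An embedding `ψ` is determined by its eigenpoint `τ ∈ K ∖ F` (`exists_isEigenPoint`,
`exists_embedding`, `IsEigenPoint.ext`), conjugation of `ψ` by `γ` corresponds to the Möbius
transformation `τ ↦ γ τ` (`Moebius`, `IsEigenPoint.conjEmb`), and `ψ` is optimal for `O` over a
principal ideal domain `R` with field of fractions `F` if and only if the lattice `R τ + R` has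
multiplier ring `O` (`IsEigenPoint.isOptimal_iff_isProper`). Here `R` is `ℤ_F` in the first part and
`ℤ[1/p]` in the second one. The `A`-points of the torus are the classes of matrices over `A`
commuting with `ψ(K)` (`mem_torus_iff`); over a local field they form the stabilizer of the
eigenpoint, or of both fixed points if `K` splits. Hence the conditions of normalization only
prescribe the images of `i`, `∞`, `0` and `α` (`isNormalizedATR_iff`, `isNormalizedSH_iff`), and the
lift of a cycle only depends on its fixed point (`atrLift_eq`, `shLift_eq`). Two lifts, or two cycles,
agree if and only if the fixed points are equivalent under `GL₂(R)` with totally positive determinant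
(`atrSet_eq_iff`, `shSet_eq_iff`), since the component in `ℍ` at the complex place, or the one at `p`,
determines the point of `K`.

*Counting.* Points whose lattice has multiplier ring `O` correspond to invertible `O`-submodules of `K`
with a basis of prescribed orientation. Up to equivalence these are counted by the narrow class group
of `O` (`ncard_image_orientedPoints`). The orientation can be corrected at the real places of `F` which
split in `K` (`exists_oriented_multiple`), as at those norms from `K` have both signs; at the
distinguished place of the ATR case it singles out the fixed point in the upper half-plane, and in the
Stark–Heegner case there is no condition left.

*The identifications.* As `R` is principal and has units of all signs, every class in `[G]` has a
representative which is integral at the finite places in question and positive at the real ones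
(`exists_mul_mem_goodATR`, `exists_mul_mem_goodSH`), unique up to the arithmetic group. The bijection
`Φ` follows formally (`exists_doubleCoset_identification`).

*The toral set.* For `t` in the adelic torus of `ψ₀`, let `γ ∈ G(F)` move `t g` to such a
representative. Then the conjugate of `ψ₀` by `γ` is again optimal (`isOptimal_conjEmb`), and the point
obtained lies on its lift. Conversely let `γ` send the fixed point `τ₀` of `ψ₀` to another point `τ`
with the same multiplier ring. The lattices of `τ₀` and `τ` are locally homothetic, because lattices
in a quadratic field are locally principal over their multiplier ring
(`exists_isIntegralGL_moebius`); so at each finite place `γ` differs from an integral matrix by an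
element of the torus. These elements, together with the ones at infinity which lead to a given point of
the lift, form an adelic point of the torus (`exists_mem_torus`).
-/

namespace ToralCycles

/-! ### Möbius transformations of the projective line -/

lemma mk_smul_coe_iff {k : Type*} [Field k] (g : GL (Fin 2) k) (z w : k) :
    ProjGenLinGroup.mk g • (z : OnePoint k) = w ↔
      g 0 0 * z + g 0 1 = w * (g 1 0 * z + g 1 1) := by
  classical
  have hdet := g.det_ne_zero
  rw [det_fin_two] at hdet
  have key : ProjGenLinGroup.mk g • (z : OnePoint k) =
      if g 1 0 * z + g 1 1 = 0 then OnePoint.infty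
        else (((g 0 0 * z + g 0 1) / (g 1 0 * z + g 1 1) : k) : OnePoint k) := by
    convert OnePoint.smul_some_eq_ite (g := g) (k := z)
    rfl
  rw [key]
  split_ifs with h
  · refine iff_of_false (OnePoint.infty_ne_coe _) fun h' => hdet ?_
    rw [h, mul_zero] at h'
    linear_combination g 0 0 * h - g 1 0 * h'
  · rw [OnePoint.coe_eq_coe, div_eq_iff h]

lemma mk_smul_infty_iff {k : Type*} [Field k] (g : GL (Fin 2) k) (w : k) :
    ProjGenLinGroup.mk g • (OnePoint.infty : OnePoint k) = w ↔ g 0 0 = w * g 1 0 := by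
  classical
  have hdet := g.det_ne_zero
  rw [det_fin_two] at hdet
  have key : ProjGenLinGroup.mk g • (OnePoint.infty : OnePoint k) =
      if g 1 0 = 0 then OnePoint.infty else ((g 0 0 / g 1 0 : k) : OnePoint k) := by
    convert OnePoint.smul_infty_eq_ite g
    rfl
  rw [key]
  split_ifs with h
  · refine iff_of_false (OnePoint.infty_ne_coe _) fun h' => hdet ?_
    rw [h', h]; ring
  · rw [OnePoint.coe_eq_coe, div_eq_iff h]

/-! ### Quadratic extensions and embeddings into matrix algebras -/

section Quadratic

variable {F K : Type*} [Field F] [Field K] [Algebra F K]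

lemma eq_zero_of_smul_add_eq_zero {τ : K} (hτ : τ ∉ Set.range (algebraMap F K)) {a b : F}
    (h : algebraMap F K a * τ + algebraMap F K b = 0) : a = 0 ∧ b = 0 := by
  have ha : a = 0 := by
    by_contra ha
    refine hτ ⟨-b / a, ?_⟩
    have : algebraMap F K a ≠ 0 := by simpa using ha
    rw [map_div₀, map_neg, div_eq_iff this]
    linear_combination -h
  subst ha
  simpa using h

lemma coord_ext {τ : K} (hτ : τ ∉ Set.range (algebraMap F K)) {a b c d : F}
    (h : algebraMap F K a * τ + algebraMap F K b = algebraMap F K c * τ + algebraMap F K d) :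
    a = c ∧ b = d := by
  have := eq_zero_of_smul_add_eq_zero (a := a - c) (b := b - d) hτ
    (by rw [map_sub, map_sub]; linear_combination h)
  exact ⟨sub_eq_zero.1 this.1, sub_eq_zero.1 this.2⟩

lemma exists_coord (hK : Module.finrank F K = 2) {τ : K} (hτ : τ ∉ Set.range (algebraMap F K))
    (x : K) : ∃ a b : F, x = algebraMap F K a * τ + algebraMap F K b := by
  have : FiniteDimensional F K := Module.finite_of_finrank_pos (by omega)
  have hli : LinearIndependent F ![τ, 1] := by
    rw [LinearIndependent.pair_iff]
    intro s t h
    exact eq_zero_of_smul_add_eq_zero hτ (by simpa [Algebra.smul_def] using h)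
  have hx : x ∈ Submodule.span F (Set.range ![τ, 1]) := by
    rw [hli.span_eq_top_of_card_eq_finrank' (by simp [hK])]; trivial
  rw [Matrix.range_cons, Matrix.range_cons, Matrix.range_empty, Set.union_empty,
    Set.singleton_union, Submodule.mem_span_pair] at hx
  obtain ⟨a, b, h⟩ := hx
  exact ⟨a, b, by simpa [Algebra.smul_def] using h.symm⟩

lemma exists_notMem_range (hK : Module.finrank F K = 2) :
    ∃ θ : K, θ ∉ Set.range (algebraMap F K) := by
  by_contra! h
  have h1 : (⊥ : Subalgebra F K) = ⊤ := by
    rw [eq_top_iff]; intro x _; exact Algebra.mem_bot.2 (h x)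
  have := Subalgebra.bot_eq_top_iff_finrank_eq_one.1 h1
  omega

lemma isEigenPoint_iff {ψ : K →ₐ[F] Matrix (Fin 2) (Fin 2) F} {τ : K} : IsEigenPoint ψ τ ↔
    ∀ x, x * τ = algebraMap F K (ψ x 0 0) * τ + algebraMap F K (ψ x 0 1) ∧
      x = algebraMap F K (ψ x 1 0) * τ + algebraMap F K (ψ x 1 1) := by
  refine forall_congr' fun x => ?_
  rw [funext_iff, Fin.forall_fin_two]
  simp [Matrix.mulVec, dotProduct, Fin.sum_univ_two, eq_comm]

lemma isFixedPoint_iff {ψ : K →ₐ[F] Matrix (Fin 2) (Fin 2) F} {τ : K} : IsFixedPoint ψ τ ↔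
    ∀ x, (algebraMap F K (ψ x 1 0) * τ + algebraMap F K (ψ x 1 1)) * τ =
      algebraMap F K (ψ x 0 0) * τ + algebraMap F K (ψ x 0 1) := by
  refine forall_congr' fun x => ?_
  constructor
  · rintro ⟨c, hc⟩
    have h0 := congrFun hc 0
    have h1 := congrFun hc 1
    simp [Matrix.mulVec, dotProduct, Fin.sum_univ_two] at h0 h1
    rw [h0, h1]
  · intro h
    refine ⟨algebraMap F K (ψ x 1 0) * τ + algebraMap F K (ψ x 1 1), ?_⟩
    rw [funext_iff, Fin.forall_fin_two]
    simp [Matrix.mulVec, dotProduct, Fin.sum_univ_two, h]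

lemma IsEigenPoint.isFixedPoint {ψ : K →ₐ[F] Matrix (Fin 2) (Fin 2) F} {τ : K}
    (h : IsEigenPoint ψ τ) : IsFixedPoint ψ τ := fun x => ⟨x, h x⟩

lemma IsEigenPoint.notMem (hK : Module.finrank F K = 2)
    {ψ : K →ₐ[F] Matrix (Fin 2) (Fin 2) F} {τ : K} (h : IsEigenPoint ψ τ) :
    τ ∉ Set.range (algebraMap F K) := by
  rintro ⟨t, rfl⟩
  obtain ⟨θ, hθ⟩ := exists_notMem_range hK
  refine hθ ⟨ψ θ 1 0 * t + ψ θ 1 1, ?_⟩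
  rw [map_add, map_mul]
  exact ((isEigenPoint_iff.1 h θ).2).symm

/-- An embedding is determined by its eigenpoint: the rows of `ψ x` are the coordinates of `x τ` and
`x` in the basis `τ, 1`. -/
lemma IsEigenPoint.apply_eq (hK : Module.finrank F K = 2)
    {ψ : K →ₐ[F] Matrix (Fin 2) (Fin 2) F} {τ : K} (h : IsEigenPoint ψ τ) {x : K} {a b c d : F}
    (h0 : x * τ = algebraMap F K a * τ + algebraMap F K b)
    (h1 : x = algebraMap F K c * τ + algebraMap F K d) : ψ x = !![a, b; c, d] := by
  have hx := isEigenPoint_iff.1 h x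
  have e0 := coord_ext (h.notMem hK) (hx.1.symm.trans h0)
  have e1 := coord_ext (h.notMem hK) (hx.2.symm.trans h1)
  ext i j
  fin_cases i <;> fin_cases j <;> simp [e0, e1]

lemma IsEigenPoint.ext (hK : Module.finrank F K = 2)
    {ψ ψ' : K →ₐ[F] Matrix (Fin 2) (Fin 2) F} {τ : K} (h : IsEigenPoint ψ τ)
    (h' : IsEigenPoint ψ' τ) : ψ = ψ' := by
  ext1 x
  have hx := isEigenPoint_iff.1 h' x
  rw [h.apply_eq hK hx.1 hx.2]
  ext i j
  fin_cases i <;> fin_cases j <;> simp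

lemma exists_isEigenPoint (hK : Module.finrank F K = 2)
    (ψ : K →ₐ[F] Matrix (Fin 2) (Fin 2) F) : ∃ τ, IsEigenPoint ψ τ := by
  obtain ⟨θ, hθ⟩ := exists_notMem_range hK
  set M := ψ θ with hM
  -- Cayley–Hamilton for `ψ θ`, pulled back along the injection `ψ`
  have hCH : θ * θ = algebraMap F K (M 0 0 + M 1 1) * θ -
      algebraMap F K (M 0 0 * M 1 1 - M 0 1 * M 1 0) := by
    apply ψ.toRingHom.injective
    simp only [AlgHom.toRingHom_eq_coe, RingHom.coe_coe, map_mul, map_sub, AlgHom.commutes, ← hM]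
    ext i j
    fin_cases i <;> fin_cases j <;>
      simp [Matrix.mul_apply, Fin.sum_univ_two, Matrix.algebraMap_matrix_apply] <;> ring
  have hc : M 1 0 ≠ 0 := by
    intro hc
    have : (θ - algebraMap F K (M 0 0)) * (θ - algebraMap F K (M 1 1)) = 0 := by
      simp only [hc, mul_zero, sub_zero, map_add, map_mul] at hCH
      linear_combination hCH
    rcases mul_eq_zero.1 this with h | h
    · exact hθ ⟨_, (sub_eq_zero.1 h).symm⟩
    · exact hθ ⟨_, (sub_eq_zero.1 h).symm⟩
  have hc' : algebraMap F K (M 1 0) ≠ 0 := by simpa using hc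
  have h1 : algebraMap F K (M 1 0) * ((θ - algebraMap F K (M 1 1)) / algebraMap F K (M 1 0)) =
      θ - algebraMap F K (M 1 1) := mul_div_cancel₀ _ hc'
  set τ : K := (θ - algebraMap F K (M 1 1)) / algebraMap F K (M 1 0) with hτ
  have h2 : θ * τ = algebraMap F K (M 0 0) * τ + algebraMap F K (M 0 1) := by
    apply mul_left_cancel₀ hc'
    simp only [map_add, map_mul, map_sub] at hCH
    linear_combination (θ - algebraMap F K (M 0 0)) * h1 + hCH
  refine ⟨τ, isEigenPoint_iff.2 fun x => ?_⟩
  obtain ⟨p, q, rfl⟩ := exists_coord hK hθ x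
  simp only [map_add, map_mul, AlgHom.commutes, ← hM]
  simp [Matrix.mul_apply, Matrix.algebraMap_matrix_apply]
  constructor
  · linear_combination algebraMap F K p * h2
  · linear_combination -algebraMap F K p * h1

/-- Every `τ ∈ K ∖ F` is the eigenpoint of an embedding: `ψ x` is the transposed matrix of
multiplication by `x` in the basis `(τ, 1)`. -/
lemma exists_embedding (hK : Module.finrank F K = 2) {τ : K}
    (hτ : τ ∉ Set.range (algebraMap F K)) :
    ∃ ψ : K →ₐ[F] Matrix (Fin 2) (Fin 2) F, IsEigenPoint ψ τ := by
  choose p q hpq using exists_coord hK hτ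
  have hmul : ∀ x, x * τ = algebraMap F K (p (x * τ)) * τ + algebraMap F K (q (x * τ)) :=
    fun x => hpq _
  refine ⟨AlgHom.ofLinearMap
    { toFun := fun x => !![p (x * τ), q (x * τ); p x, q x]
      map_add' := fun x y => ?_
      map_smul' := fun r x => ?_ } ?_ fun x y => ?_, ?_⟩
  · have h1 := coord_ext hτ (a := p (x + y)) (b := q (x + y)) (c := p x + p y) (d := q x + q y)
      (by rw [← hpq, map_add, map_add]; linear_combination hpq x + hpq y)
    have h2 := coord_ext hτ (a := p ((x + y) * τ)) (b := q ((x + y) * τ))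
      (c := p (x * τ) + p (y * τ)) (d := q (x * τ) + q (y * τ))
      (by rw [← hpq, map_add, map_add]; linear_combination hmul x + hmul y)
    ext i j
    fin_cases i <;> fin_cases j <;> simp [h1, h2]
  · have h1 := coord_ext hτ (a := p (r • x)) (b := q (r • x)) (c := r * p x) (d := r * q x)
      (by rw [← hpq, map_mul, map_mul, Algebra.smul_def]; linear_combination algebraMap F K r * hpq x)
    have h2 := coord_ext hτ (a := p ((r • x) * τ)) (b := q ((r • x) * τ))
      (c := r * p (x * τ)) (d := r * q (x * τ))
      (by rw [← hpq, map_mul, map_mul, Algebra.smul_def]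
          linear_combination algebraMap F K r * hmul x)
    rw [smul_mul_assoc] at h2
    ext i j
    fin_cases i <;> fin_cases j <;> simp [h1, h2]
  · have h1 := coord_ext hτ (a := p 1) (b := q 1) (c := 0) (d := 1) (by rw [← hpq]; simp)
    have h2 := coord_ext hτ (a := p (1 * τ)) (b := q (1 * τ)) (c := 1) (d := 0)
      (by rw [← hpq]; simp)
    change !![p (1 * τ), q (1 * τ); p 1, q 1] = 1
    rw [h1.1, h1.2, h2.1, h2.2, Matrix.one_fin_two]
  · have h1 := coord_ext hτ (a := p (x * y)) (b := q (x * y)) (c := p x * p (y * τ) + q x * p y)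
      (d := p x * q (y * τ) + q x * q y)
      (by rw [← hpq]; simp only [map_add, map_mul]
          linear_combination y * hpq x + algebraMap F K (p x) * hmul y +
            algebraMap F K (q x) * hpq y)
    have h2 := coord_ext hτ (a := p (x * y * τ)) (b := q (x * y * τ))
      (c := p (x * τ) * p (y * τ) + q (x * τ) * p y)
      (d := p (x * τ) * q (y * τ) + q (x * τ) * q y)
      (by rw [← hpq]; simp only [map_add, map_mul]
          linear_combination y * hpq (x * τ) + algebraMap F K (p (x * τ)) * hmul y +
            algebraMap F K (q (x * τ)) * hpq y)
    change !![p (x * y * τ), q (x * y * τ); p (x * y), q (x * y)] =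
      !![p (x * τ), q (x * τ); p x, q x] * !![p (y * τ), q (y * τ); p y, q y]
    rw [Matrix.mul_fin_two, h1.1, h1.2, h2.1, h2.2]
  · exact isEigenPoint_iff.2 fun x => ⟨hmul x, hpq x⟩

/-- The conjugate `x ↦ γ ψ(x) γ⁻¹` of an embedding. -/
noncomputable def conjEmb (γ : GL (Fin 2) F) (ψ : K →ₐ[F] Matrix (Fin 2) (Fin 2) F) :
    K →ₐ[F] Matrix (Fin 2) (Fin 2) F where
  toFun x := γ * ψ x * (γ⁻¹ : GL (Fin 2) F)
  map_one' := by simp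
  map_mul' x y := by
    rw [map_mul]
    have h : ((γ⁻¹ : GL (Fin 2) F) : Matrix (Fin 2) (Fin 2) F) * γ = 1 := Units.inv_mul γ
    calc (γ : Matrix (Fin 2) (Fin 2) F) * (ψ x * ψ y) * (γ⁻¹ : GL (Fin 2) F)
        = γ * ψ x * 1 * (ψ y * (γ⁻¹ : GL (Fin 2) F)) := by simp only [mul_one, mul_assoc]
      _ = _ := by rw [← h]; simp only [mul_assoc]
  map_zero' := by simp
  map_add' x y := by rw [map_add, mul_add, add_mul]
  commutes' r := by
    rw [AlgHom.commutes, ← Algebra.commutes, mul_assoc, Units.mul_inv, mul_one]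

lemma conjEmb_apply (γ : GL (Fin 2) F) (ψ : K →ₐ[F] Matrix (Fin 2) (Fin 2) F) (x : K) :
    conjEmb γ ψ x = γ * ψ x * (γ⁻¹ : GL (Fin 2) F) := rfl

lemma conjEmb_mul_self (γ : GL (Fin 2) F) (ψ : K →ₐ[F] Matrix (Fin 2) (Fin 2) F) (x : K) :
    conjEmb γ ψ x * γ = γ * ψ x := by
  rw [conjEmb_apply, mul_assoc, Units.inv_mul, mul_one]

/-- The relation `γ τ = τ₁` for the action of `GL₂(F)` on `K ∖ F` by Möbius transformations. -/
def Moebius (γ : GL (Fin 2) F) (τ τ₁ : K) : Prop :=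
  algebraMap F K (γ 0 0) * τ + algebraMap F K (γ 0 1) =
    τ₁ * (algebraMap F K (γ 1 0) * τ + algebraMap F K (γ 1 1))

lemma denom_ne_zero_of_notMem (γ : GL (Fin 2) F) {τ : K}
    (hτ : τ ∉ Set.range (algebraMap F K)) :
    algebraMap F K (γ 1 0) * τ + algebraMap F K (γ 1 1) ≠ 0 := by
  intro h
  have h' := eq_zero_of_smul_add_eq_zero hτ h
  have hdet := γ.det_ne_zero
  rw [det_fin_two, h'.1, h'.2] at hdet
  simp at hdet

lemma Moebius.notMem {γ : GL (Fin 2) F} {τ τ₁ : K} (h : Moebius γ τ τ₁)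
    (hτ : τ ∉ Set.range (algebraMap F K)) : τ₁ ∉ Set.range (algebraMap F K) := by
  rintro ⟨t, rfl⟩
  have := coord_ext hτ (a := γ 0 0) (b := γ 0 1) (c := t * γ 1 0) (d := t * γ 1 1)
    (by rw [h, map_mul, map_mul]; ring)
  have hdet := γ.det_ne_zero
  rw [det_fin_two, this.1, this.2] at hdet
  exact hdet (by ring)

lemma exists_moebius_apply (γ : GL (Fin 2) F) {τ : K} (hτ : τ ∉ Set.range (algebraMap F K)) :
    ∃ τ₁, Moebius γ τ τ₁ :=
  ⟨(algebraMap F K (γ 0 0) * τ + algebraMap F K (γ 0 1)) /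
    (algebraMap F K (γ 1 0) * τ + algebraMap F K (γ 1 1)),
    (div_mul_cancel₀ _ (denom_ne_zero_of_notMem γ hτ)).symm⟩

lemma exists_moebius (hK : Module.finrank F K = 2) {τ τ₁ : K}
    (hτ : τ ∉ Set.range (algebraMap F K)) (hτ₁ : τ₁ ∉ Set.range (algebraMap F K)) :
    ∃ γ : GL (Fin 2) F, Moebius γ τ τ₁ := by
  obtain ⟨a, b, hab⟩ := exists_coord hK hτ τ₁
  have ha : a ≠ 0 := by
    rintro rfl
    exact hτ₁ ⟨b, by simp [hab]⟩
  refine ⟨GeneralLinearGroup.mkOfDetNeZero !![a, b; 0, 1] (by simpa [det_fin_two] using ha), ?_⟩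
  simp [Moebius, GeneralLinearGroup.mkOfDetNeZero, hab]

lemma IsEigenPoint.conjEmb {ψ : K →ₐ[F] Matrix (Fin 2) (Fin 2) F} {τ τ₁ : K}
    (h : IsEigenPoint ψ τ) {γ : GL (Fin 2) F} (hγ : Moebius γ τ τ₁)
    (hτ : τ ∉ Set.range (algebraMap F K)) : IsEigenPoint (conjEmb γ ψ) τ₁ := by
  rw [isEigenPoint_iff] at h ⊢
  intro x
  obtain ⟨h0, h1⟩ := h x
  have hj := denom_ne_zero_of_notMem γ hτ
  have e := conjEmb_mul_self γ ψ x
  have e' : ∀ i j, algebraMap F K ((ToralCycles.conjEmb γ ψ x * γ) i j) =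
    algebraMap F K (((γ : Matrix (Fin 2) (Fin 2) F) * ψ x) i j) := by rw [e]; simp
  simp only [Matrix.mul_apply, Fin.sum_univ_two, map_add, map_mul] at e'
  unfold Moebius at hγ
  constructor <;> apply mul_right_cancel₀ hj
  · linear_combination e' 0 0 * (-τ) - e' 0 1 -
      (x - algebraMap F K (ToralCycles.conjEmb γ ψ x 0 0)) * hγ +
      algebraMap F K (γ 0 0) * h0 + algebraMap F K (γ 0 1) * h1
  · linear_combination e' 1 0 * (-τ) - e' 1 1 + algebraMap F K (ToralCycles.conjEmb γ ψ x 1 0) * hγ +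
      algebraMap F K (γ 1 0) * h0 + algebraMap F K (γ 1 1) * h1

/-! ### Conjugation of a quadratic extension -/

lemma exists_conj [CharZero F] (hK : Module.finrank F K = 2) : ∃ σ : K ≃ₐ[F] K, σ ≠ 1 := by
  have : Algebra.IsQuadraticExtension F K := ⟨hK⟩
  have : FiniteDimensional F K := Module.finite_of_finrank_pos (by omega)
  have hc : Nat.card (K ≃ₐ[F] K) = 2 := by rw [IsGalois.card_aut_eq_finrank, hK]
  have : Finite (K ≃ₐ[F] K) := Nat.finite_of_card_ne_zero (by omega)
  have : Nontrivial (K ≃ₐ[F] K) := (Finite.one_lt_card_iff_nontrivial).1 (by omega)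
  exact exists_ne 1

variable {σ : K ≃ₐ[F] K}

lemma conj_eq_self_iff (hK : Module.finrank F K = 2) (hσ : σ ≠ 1) {x : K} :
    σ x = x ↔ x ∈ Set.range (algebraMap F K) := by
  constructor
  · intro h
    by_contra hx
    refine hσ (AlgEquiv.ext fun y => ?_)
    obtain ⟨a, b, rfl⟩ := exists_coord hK hx y
    simp [h]
  · rintro ⟨a, rfl⟩
    simp

lemma conj_conj [CharZero F] (hK : Module.finrank F K = 2) (x : K) :
    σ (σ x) = x := by
  have : Algebra.IsQuadraticExtension F K := ⟨hK⟩
  have : FiniteDimensional F K := Module.finite_of_finrank_pos (by omega)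
  have hc : Nat.card (K ≃ₐ[F] K) = 2 := by rw [IsGalois.card_aut_eq_finrank, hK]
  have h : σ ^ 2 = 1 := by rw [← hc]; exact pow_card_eq_one'
  rw [sq] at h
  exact congr($h x)

lemma exists_trace [CharZero F] (hK : Module.finrank F K = 2) (hσ : σ ≠ 1) (x : K) :
    ∃ t, algebraMap F K t = x + σ x := by
  refine (conj_eq_self_iff hK hσ).1 ?_
  rw [map_add, conj_conj hK, add_comm]

lemma exists_norm [CharZero F] (hK : Module.finrank F K = 2) (hσ : σ ≠ 1) (x : K) :
    ∃ t, algebraMap F K t = x * σ x := by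
  refine (conj_eq_self_iff hK hσ).1 ?_
  rw [map_mul, conj_conj hK, mul_comm]

/-- Composing an embedding with the conjugation of `K` conjugates its eigenpoint. -/
lemma IsEigenPoint.comp_conj [CharZero F] (hK : Module.finrank F K = 2)
    {ψ : K →ₐ[F] Matrix (Fin 2) (Fin 2) F} {τ : K} (h : IsEigenPoint ψ τ) :
    IsEigenPoint (ψ.comp (σ : K →ₐ[F] K)) (σ τ) := by
  rw [isEigenPoint_iff] at h ⊢
  intro x
  obtain ⟨h0, h1⟩ := h (σ x)
  constructor
  · have := congrArg σ h0
    simpa [conj_conj hK] using this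
  · have := congrArg σ h1
    simpa [conj_conj hK] using this

lemma range_comp_conj (ψ : K →ₐ[F] Matrix (Fin 2) (Fin 2) F) :
    Set.range (ψ.comp (σ : K →ₐ[F] K)) = Set.range ψ := by
  change Set.range (ψ ∘ σ) = _
  rw [Set.range_comp, σ.surjective.range_eq, Set.image_univ]

lemma IsEigenPoint.isFixedPoint_iff_eq [CharZero F] (hK : Module.finrank F K = 2) (hσ : σ ≠ 1)
    {ψ : K →ₐ[F] Matrix (Fin 2) (Fin 2) F} {τ τ' : K} (h : IsEigenPoint ψ τ) :
    IsFixedPoint ψ τ' ↔ τ' = τ ∨ τ' = σ τ := by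
  constructor
  · intro h'
    have e := isEigenPoint_iff.1 h τ
    have e' := isFixedPoint_iff.1 h' τ
    have e1 := coord_ext (h.notMem hK) (a := ψ τ 1 0) (b := ψ τ 1 1) (c := 1) (d := 0)
      (by rw [← e.2]; simp)
    rw [e1.1, e1.2] at e'
    have e0 := e.1
    have es := congrArg σ e0
    simp only [map_mul, map_add, AlgEquiv.commutes] at es
    simp only [map_one, map_zero, one_mul, add_zero] at e'
    have hne : τ - σ τ ≠ 0 := fun h0 =>
      h.notMem hK ((conj_eq_self_iff hK hσ).1 (sub_eq_zero.1 h0).symm)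
    have key : (τ' - τ) * (τ' - σ τ) = 0 := by
      have ht : τ + σ τ = algebraMap F K (ψ τ 0 0) := by
        apply mul_left_cancel₀ hne
        linear_combination e0 - es
      linear_combination e' - e0 + (τ - τ') * ht
    rcases mul_eq_zero.1 key with h0 | h0
    · exact Or.inl (sub_eq_zero.1 h0)
    · exact Or.inr (sub_eq_zero.1 h0)
  · rintro (rfl | rfl)
    · exact h.isFixedPoint
    · have h2 := (h.comp_conj (σ := σ) hK).isFixedPoint
      rw [isFixedPoint_iff] at h2 ⊢
      intro x
      simpa [conj_conj hK] using h2 (σ x)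

end Quadratic

/-! ### Tori as centralizers -/

section Torus

variable {F K A : Type*} [Field F] [Field K] [Algebra F K] [CommRing A]

/-- The `A`-points of the torus `T_ψ` are the classes of the invertible matrices over `A` which
commute with `ψ(K)`. -/
lemma mem_torus_iff (hK : Module.finrank F K = 2) (σ : F →+* A)
    (ψ : K →ₐ[F] Matrix (Fin 2) (Fin 2) F) (t : PGL(2, A)) :
    t ∈ torus σ ψ ↔ ∃ g : GL (Fin 2) A, ProjGenLinGroup.mk g = t ∧
      ∀ x, Commute (g : Matrix (Fin 2) (Fin 2) A) ((ψ x).map σ) := by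
  let := σ.toAlgebra
  let f : A ⊗[F] K →ₐ[A] Matrix (Fin 2) (Fin 2) A :=
    Algebra.TensorProduct.lift (Algebra.ofId A _) ((Algebra.ofId F A).mapMatrix.comp ψ)
      fun a _ => Algebra.commutes a _
  have hf : ∀ a x, f (a ⊗ₜ x) = a • (ψ x).map σ := fun a x => by
    have h : f (a ⊗ₜ x) = algebraMap A (Matrix (Fin 2) (Fin 2) A) a * (ψ x).map σ :=
      Algebra.TensorProduct.lift_tmul ..
    rw [h, ← Algebra.smul_def]
  constructor
  · rintro ⟨u, rfl⟩
    refine ⟨Units.map (f : A ⊗[F] K →* Matrix (Fin 2) (Fin 2) A) u, rfl, fun x => ?_⟩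
    have h1 : (ψ x).map σ = f (1 ⊗ₜ x) := by rw [hf, one_smul]
    rw [h1]
    change Commute (f u) (f (1 ⊗ₜ x))
    exact (Commute.all _ _).map f
  · rintro ⟨g, rfl, hg⟩
    obtain ⟨τ, hτ⟩ := exists_isEigenPoint hK ψ
    have e := isEigenPoint_iff.1 hτ τ
    have e1 := coord_ext (hτ.notMem hK) (a := ψ τ 1 0) (b := ψ τ 1 1) (c := 1) (d := 0)
      (by rw [← e.2]; simp)
    have hc := (hg τ).eq
    have hc1 : ∀ i j, ((g : Matrix (Fin 2) (Fin 2) A) * (ψ τ).map σ) i j =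
      ((ψ τ).map σ * (g : Matrix (Fin 2) (Fin 2) A)) i j := by rw [hc]; simp
    have h10 := hc1 1 0
    have h11 := hc1 1 1
    simp only [Matrix.mul_apply, Fin.sum_univ_two, Matrix.map_apply, e1.1, e1.2, map_one,
      map_zero, mul_one, one_mul, zero_mul, add_zero, mul_zero] at h10 h11
    set a := σ (ψ τ 0 0) with ha
    set b := σ (ψ τ 0 1) with hb
    -- `g = s + r ψ(τ)`, the image of `s ⊗ 1 + r ⊗ τ`
    set r := g.val 1 0 with hr
    set s := g.val 1 1 with hs
    have hdet : g.det.val = s * s + s * r * a - r * r * b := by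
      rw [GeneralLinearGroup.val_det_apply, det_fin_two, ← hr, ← hs, ← h10, ← h11]; ring
    have hττ : (1 : A) ⊗ₜ[F] (τ * τ) = a ⊗ₜ τ + b ⊗ₜ (1 : K) := by
      rw [e.1, ← Algebra.smul_def, Algebra.algebraMap_eq_smul_one, TensorProduct.tmul_add,
        ← TensorProduct.smul_tmul, ← TensorProduct.smul_tmul, Algebra.smul_def, Algebra.smul_def,
        mul_one, mul_one]
      rfl
    have hsm : ∀ (c : A) (x : K), c ⊗ₜ[F] x = c • ((1 : A) ⊗ₜ[F] x) := fun c x => by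
      rw [TensorProduct.smul_tmul', smul_eq_mul, mul_one]
    have hone : (1 : A ⊗[F] K) = (1 : A) ⊗ₜ (1 : K) := rfl
    have hmul : (s ⊗ₜ[F] (1 : K) + r ⊗ₜ τ) * ((s + r * a) ⊗ₜ (1 : K) - r ⊗ₜ τ) =
        (s * s + s * r * a - r * r * b) • (1 : A ⊗[F] K) := by
      simp only [mul_sub, add_mul, Algebra.TensorProduct.tmul_mul_tmul, mul_one, one_mul]
      rw [hsm (r * r) (τ * τ), hττ, hone, hsm (s * (s + r * a)), hsm (r * (s + r * a)),
        hsm (s * r), hsm a, hsm b]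
      module
    let d := g.det
    have hdv : (d : A) = s * s + s * r * a - r * r * b := hdet
    let u : (A ⊗[F] K)ˣ := Units.mkOfMulEqOne (s ⊗ₜ[F] (1 : K) + r ⊗ₜ τ)
      ((d⁻¹ : Aˣ).val • ((s + r * a) ⊗ₜ (1 : K) - r ⊗ₜ τ)) (by
        rw [mul_smul_comm, hmul, smul_smul, ← hdv, Units.inv_mul, one_smul])
    refine ⟨u, ?_⟩
    change ProjGenLinGroup.mk _ = _
    congr 1
    ext1
    change f (s ⊗ₜ[F] (1 : K) + r ⊗ₜ τ) = g.val
    rw [map_add, hf, hf, map_one]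
    ext i j
    fin_cases i <;> fin_cases j <;>
      simp [e1, ← ha, ← hb, ← hr, ← hs]
    · linear_combination h10
    · linear_combination h11

lemma torus_eq_of_range_eq (hK : Module.finrank F K = 2) (σ : F →+* A)
    {ψ ψ' : K →ₐ[F] Matrix (Fin 2) (Fin 2) F} (h : Set.range ψ = Set.range ψ') :
    torus σ ψ = torus σ ψ' := by
  ext t
  rw [mem_torus_iff hK, mem_torus_iff hK]
  refine exists_congr fun g => and_congr_right fun _ => ?_
  have key : ∀ χ : K →ₐ[F] Matrix (Fin 2) (Fin 2) F,
      (∀ x, Commute (g : Matrix (Fin 2) (Fin 2) A) ((χ x).map σ)) ↔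
        ∀ M ∈ Set.range χ, Commute (g : Matrix (Fin 2) (Fin 2) A) (M.map σ) := fun χ => by simp
  rw [key, key, h]

lemma mem_conjSubgroup {G : Type*} [Group G] {g : G} {H : Subgroup G} {x : G} :
    x ∈ conjSubgroup g H ↔ g⁻¹ * x * g ∈ H := by
  constructor
  · rintro ⟨y, hy, rfl⟩
    have : g⁻¹ * (MulAut.conj g y) * g = y := by rw [MulAut.conj_apply]; group
    change g⁻¹ * (MulAut.conj g y) * g ∈ H
    rwa [this]
  · intro h
    refine ⟨_, h, ?_⟩
    change MulAut.conj g _ = x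
    rw [MulAut.conj_apply]; group

/-- Tori are compatible with base change. -/
lemma map_mem_torus {B : Type*} [CommRing B] (hK : Module.finrank F K = 2) {σ : F →+* A}
    (f : A →+* B) {ψ : K →ₐ[F] Matrix (Fin 2) (Fin 2) F} {t : PGL(2, A)} (ht : t ∈ torus σ ψ) :
    ProjGenLinGroup.map f t ∈ torus (f.comp σ) ψ := by
  rw [mem_torus_iff hK] at ht ⊢
  obtain ⟨g, rfl, hg⟩ := ht
  refine ⟨GeneralLinearGroup.map f g, rfl, fun x => ?_⟩
  have h := congrArg f.mapMatrix (hg x).eq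
  rw [map_mul, map_mul] at h
  exact h

end Torus

/-! ### Real points of the torus -/

lemma mk_mem_PGLpos_iff {R : Type*} [CommRing R] [LinearOrder R] [IsStrictOrderedRing R]
    (g : GL (Fin 2) R) : ProjGenLinGroup.mk g ∈ PGLpos R ↔ 0 < g.det.val := by
  constructor
  · rintro ⟨h, hh, e⟩
    obtain ⟨u, rfl⟩ := ProjGenLinGroup.mk_eq_mk_iff.1 e
    have hu : (0 : R) < (u : R) ^ 2 := by
      have : (u : R) ≠ 0 := u.ne_zero
      positivity
    simpa using mul_pos hh hu
  · intro h
    exact ⟨g, h, rfl⟩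

section Stabilizers

variable {F K A : Type*} [Field F] [Field K] [Algebra F K] [CommRing A]

/-- Commuting with `ψ(K)` amounts to two linear equations: `ψ τ` has bottom row `(1, 0)`, so a
matrix which commutes with it is determined by its own bottom row. -/
lemma commute_map_iff (hK : Module.finrank F K = 2) {ψ : K →ₐ[F] Matrix (Fin 2) (Fin 2) F}
    {τ : K} (hτ : IsEigenPoint ψ τ) (σ : F →+* A) (g : Matrix (Fin 2) (Fin 2) A) :
    (∀ x, Commute g ((ψ x).map σ)) ↔
      g 0 0 = σ (ψ τ 0 0) * g 1 0 + g 1 1 ∧ g 0 1 = σ (ψ τ 0 1) * g 1 0 := by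
  have e := isEigenPoint_iff.1 hτ τ
  have e1 := coord_ext (hτ.notMem hK) (a := ψ τ 1 0) (b := ψ τ 1 1) (c := 1) (d := 0)
    (by rw [← e.2]; simp)
  constructor
  · intro hg
    have hc : ∀ i j, (g * (ψ τ).map σ) i j = ((ψ τ).map σ * g) i j := by
      rw [(hg τ).eq]; simp
    have h10 := hc 1 0
    have h11 := hc 1 1
    simp only [Matrix.mul_apply, Fin.sum_univ_two, Matrix.map_apply, e1.1, e1.2, map_one,
      map_zero, mul_one, one_mul, zero_mul, add_zero, mul_zero] at h10 h11
    exact ⟨by linear_combination -h10, by linear_combination -h11⟩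
  · rintro ⟨h0, h1⟩ x
    obtain ⟨p, q, rfl⟩ := exists_coord hK (hτ.notMem hK) x
    rw [Commute, SemiconjBy]
    ext i j
    fin_cases i <;> fin_cases j <;>
      simp [Matrix.mul_apply, Matrix.algebraMap_matrix_apply, e1, h0, h1] <;> ring

lemma IsEigenPoint.mul_self_eq {ψ : K →ₐ[F] Matrix (Fin 2) (Fin 2) F}
    {τ : K} (hτ : IsEigenPoint ψ τ) :
    τ * τ = algebraMap F K (ψ τ 0 0) * τ + algebraMap F K (ψ τ 0 1) :=
  (isEigenPoint_iff.1 hτ τ).1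

/-- At a place where the eigenpoint `τ` of `ψ` is not rational, the torus is its stabilizer. -/
lemma mk_mem_torus_iff_of_notMem {k E : Type*} [Field k] [Field E] [Algebra k E]
    (hK : Module.finrank F K = 2)
    {ψ : K →ₐ[F] Matrix (Fin 2) (Fin 2) F} {τ : K} (hτ : IsEigenPoint ψ τ) (σ : F →+* k)
    (ι : K →+* E) (hι : ∀ x, ι (algebraMap F K x) = algebraMap k E (σ x))
    (hz : ι τ ∉ Set.range (algebraMap k E)) (g : GL (Fin 2) k) :
    ProjGenLinGroup.mk g ∈ torus σ ψ ↔ algebraMap k E (g 0 0) * ι τ + algebraMap k E (g 0 1) =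
      ι τ * (algebraMap k E (g 1 0) * ι τ + algebraMap k E (g 1 1)) := by
  have hsq := congrArg ι hτ.mul_self_eq
  simp only [map_mul, map_add, hι] at hsq
  have key : ∀ h : GL (Fin 2) k, (h 0 0 = σ (ψ τ 0 0) * h 1 0 + h 1 1 ∧
      h 0 1 = σ (ψ τ 0 1) * h 1 0) ↔ algebraMap k E (h 0 0) * ι τ + algebraMap k E (h 0 1) =
      ι τ * (algebraMap k E (h 1 0) * ι τ + algebraMap k E (h 1 1)) := by
    intro h
    constructor
    · rintro ⟨h0, h1⟩
      rw [h0, h1]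
      simp only [map_add, map_mul]
      linear_combination -algebraMap k E (h 1 0) * hsq
    · intro e
      exact coord_ext (F := k) hz (by
        rw [e]; simp only [map_add, map_mul]
        linear_combination algebraMap k E (h 1 0) * hsq)
  rw [mem_torus_iff hK]
  constructor
  · rintro ⟨h, hh, hc⟩
    obtain ⟨u, rfl⟩ := ProjGenLinGroup.mk_eq_mk_iff.1 hh
    have := (key h).1 ((commute_map_iff hK hτ σ h.val).1 hc)
    simp only [Units.val_mul, GeneralLinearGroup.coe_scalar, Matrix.mul_apply,
      Fin.sum_univ_two]
    simp
    linear_combination algebraMap k E u * this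
  · intro h
    exact ⟨g, rfl, (commute_map_iff hK hτ σ g.val).2 ((key g).2 h)⟩

/-- At a real place where `K` splits, the torus consists of the projectivities fixing both
eigenpoints. -/
lemma mk_mem_torus_iff_of_split {k : Type*} [Field k] [CharZero F]
    (hK : Module.finrank F K = 2) {s : K ≃ₐ[F] K} (hs : s ≠ 1)
    {ψ : K →ₐ[F] Matrix (Fin 2) (Fin 2) F} {τ : K} (hτ : IsEigenPoint ψ τ) (σ : F →+* k)
    (ρ : K →+* k) (hρ : ∀ x, ρ (algebraMap F K x) = σ x) (g : GL (Fin 2) k) :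
    ProjGenLinGroup.mk g ∈ torus σ ψ ↔
      g 0 0 * ρ τ + g 0 1 = ρ τ * (g 1 0 * ρ τ + g 1 1) ∧
      g 0 0 * ρ (s τ) + g 0 1 = ρ (s τ) * (g 1 0 * ρ (s τ) + g 1 1) := by
  have hsq := congrArg ρ hτ.mul_self_eq
  have hsq' := congrArg ρ (congrArg s hτ.mul_self_eq)
  simp only [map_mul, map_add, hρ, AlgEquiv.commutes] at hsq hsq'
  have hne : ρ τ - ρ (s τ) ≠ 0 := fun h0 =>
    hτ.notMem hK ((conj_eq_self_iff hK hs).1 (ρ.injective (sub_eq_zero.1 h0)).symm)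
  have key : ∀ h : GL (Fin 2) k, (h 0 0 = σ (ψ τ 0 0) * h 1 0 + h 1 1 ∧
      h 0 1 = σ (ψ τ 0 1) * h 1 0) ↔ h 0 0 * ρ τ + h 0 1 = ρ τ * (h 1 0 * ρ τ + h 1 1) ∧
      h 0 0 * ρ (s τ) + h 0 1 = ρ (s τ) * (h 1 0 * ρ (s τ) + h 1 1) := by
    intro h
    constructor
    · rintro ⟨h0, h1⟩
      rw [h0, h1]
      exact ⟨by linear_combination -h 1 0 * hsq, by linear_combination -h 1 0 * hsq'⟩
    · rintro ⟨e0, e1⟩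
      have h0 : h 0 0 = σ (ψ τ 0 0) * h 1 0 + h 1 1 := by
        apply mul_right_cancel₀ hne
        linear_combination e0 - e1 + h 1 0 * hsq - h 1 0 * hsq'
      refine ⟨h0, ?_⟩
      linear_combination e0 - ρ τ * h0 + h 1 0 * hsq
  rw [mem_torus_iff hK]
  constructor
  · rintro ⟨h, hh, hc⟩
    obtain ⟨u, rfl⟩ := ProjGenLinGroup.mk_eq_mk_iff.1 hh
    have := (key h).1 ((commute_map_iff hK hτ σ h.val).1 hc)
    simp only [Units.val_mul, GeneralLinearGroup.coe_scalar, Matrix.mul_apply,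
      Fin.sum_univ_two]
    simp
    exact ⟨by linear_combination (u : k) * this.1, by linear_combination (u : k) * this.2⟩
  · intro h
    exact ⟨g, rfl, (commute_map_iff hK hτ σ g.val).2 ((key g).2 h)⟩

end Stabilizers

section UpperHalfPlane

lemma mk_smul_eq_iff {g : GL (Fin 2) ℝ} (hg : 0 < g.det.val) (z w : ℍ) :
    ProjGenLinGroup.mk g • z = w ↔
      (g 0 0 : ℂ) * z + g 0 1 = w * (g 1 0 * z + g 1 1) := by
  rw [pglMk_smul, UpperHalfPlane.ext_iff, coe_smul_of_det_pos hg,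
    div_eq_iff (denom_ne_zero g z)]
  rfl

lemma exists_PGLpos_smul_I (z : ℍ) : ∃ g ∈ PGLpos ℝ, g • UpperHalfPlane.I = z := by
  have hdet : (!![z.im, z.re; 0, 1] : Matrix (Fin 2) (Fin 2) ℝ).det = z.im := by
    simp [det_fin_two]
  let g : GL (Fin 2) ℝ := GeneralLinearGroup.mkOfDetNeZero !![z.im, z.re; 0, 1]
    (by rw [hdet]; exact z.im_pos.ne')
  have hg : 0 < g.det.val := by
    change 0 < (!![z.im, z.re; 0, 1] : Matrix (Fin 2) (Fin 2) ℝ).det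
    rw [hdet]; exact z.im_pos
  refine ⟨ProjGenLinGroup.mk g, (mk_mem_PGLpos_iff g).2 hg, ?_⟩
  rw [mk_smul_eq_iff hg]
  simp [g, GeneralLinearGroup.mkOfDetNeZero, Complex.ext_iff]

/-- `PSO₂(ℝ)` is the stabilizer of `i` in `PGL₂⁺(ℝ)`. -/
lemma mem_PSO2_iff (t : PGL(2, ℝ)) :
    t ∈ PSO2 ↔ t ∈ PGLpos ℝ ∧ t • UpperHalfPlane.I = UpperHalfPlane.I := by
  constructor
  · rintro ⟨u, rfl⟩
    obtain ⟨h1, h2⟩ := mem_specialOrthogonalGroup_iff.1 u.2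
    set g : GL (Fin 2) ℝ := (specialOrthogonalGroup (Fin 2) ℝ).subtype.toHomUnits u with hgd
    have hgv : (g : Matrix (Fin 2) (Fin 2) ℝ) = u.1 := rfl
    have hdet : g.det.val = 1 := by rw [GeneralLinearGroup.val_det_apply, hgv, h2]
    have hpos : 0 < g.det.val := by rw [hdet]; exact one_pos
    change ProjGenLinGroup.mk g ∈ PGLpos ℝ ∧ ProjGenLinGroup.mk g • UpperHalfPlane.I = _
    refine ⟨(mk_mem_PGLpos_iff g).2 hpos, (mk_smul_eq_iff hpos _ _).2 ?_⟩
    rw [mem_orthogonalGroup_iff, ← hgv] at h1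
    rw [← hgv, det_fin_two] at h2
    have e := fun i j => congrFun (congrFun h1 i) j
    have e00 := e 0 0
    have e01 := e 0 1
    have e11 := e 1 1
    simp only [Matrix.mul_apply, Fin.sum_univ_two, transpose_apply, Matrix.one_apply_eq,
      ne_eq, zero_ne_one, not_false_eq_true, Matrix.one_apply_ne] at e00 e01 e11
    have ha : g 0 0 = g 1 1 := by
      linear_combination -(g 0 0) * e11 + g 1 1 * h2 + g 1 0 * e01
    have hb : g 0 1 = - g 1 0 := by
      linear_combination -(g 0 1) * e11 + g 1 1 * e01 - g 1 0 * h2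
    rw [ha, hb]
    simp [Complex.ext_iff]
  · induction t using ProjGenLinGroup.induction_on with
    | mk g =>
    rw [mk_mem_PGLpos_iff]
    rintro ⟨hg, h⟩
    rw [mk_smul_eq_iff hg] at h
    have ha : g 0 0 = g 1 1 := by simpa using congrArg Complex.im h
    have hb : g 0 1 = -g 1 0 := by simpa using congrArg Complex.re h
    have hdet : g.det.val = g 1 1 ^ 2 + g 1 0 ^ 2 := by
      rw [GeneralLinearGroup.val_det_apply, det_fin_two, ha, hb]; ring
    set d := g.det.val
    have hd0 : Real.sqrt d ≠ 0 := (Real.sqrt_pos.2 hg).ne'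
    have hdd : Real.sqrt d * Real.sqrt d = d := Real.mul_self_sqrt hg.le
    obtain ⟨c, hcc⟩ : ∃ c : ℝˣ, (c : ℝ) * c * (g 1 1 ^ 2 + g 1 0 ^ 2) = 1 := by
      refine ⟨Units.mk0 (Real.sqrt d)⁻¹ (inv_ne_zero hd0), ?_⟩
      rw [Units.val_mk0, ← hdet]
      calc (Real.sqrt d)⁻¹ * (Real.sqrt d)⁻¹ * d
          = (Real.sqrt d)⁻¹ * (Real.sqrt d)⁻¹ * (Real.sqrt d * Real.sqrt d) := by rw [hdd]
        _ = 1 := by field_simp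
    have hM : ((g * GeneralLinearGroup.scalar (Fin 2) c : GL (Fin 2) ℝ) :
        Matrix (Fin 2) (Fin 2) ℝ) ∈ specialOrthogonalGroup (Fin 2) ℝ := by
      rw [mem_specialOrthogonalGroup_iff, mem_orthogonalGroup_iff]
      have hv : ((g * GeneralLinearGroup.scalar (Fin 2) c : GL (Fin 2) ℝ) :
          Matrix (Fin 2) (Fin 2) ℝ) = !![g 1 1 * (c : ℝ), -g 1 0 * (c : ℝ);
          g 1 0 * (c : ℝ), g 1 1 * (c : ℝ)] := by
        ext i j
        fin_cases i <;> fin_cases j <;>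
          simp [ha, hb]
      rw [hv]
      constructor
      · ext i j
        fin_cases i <;> fin_cases j <;> simp [Matrix.mul_apply, Fin.sum_univ_two] <;>
          first | linear_combination hcc | ring
      · rw [det_fin_two]; simp
        linear_combination hcc
    refine ⟨⟨_, hM⟩, ?_⟩
    change ProjGenLinGroup.mk _ = _
    rw [ProjGenLinGroup.mk_eq_mk_iff]
    refine ⟨c⁻¹, ?_⟩
    have : (specialOrthogonalGroup (Fin 2) ℝ).subtype.toHomUnits ⟨_, hM⟩ =
      g * GeneralLinearGroup.scalar (Fin 2) c := Units.ext rfl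
    rw [this, mul_assoc, ← map_mul, mul_inv_cancel, map_one, mul_one]

lemma smul_I_eq_smul_I_iff {y y' : PGL(2, ℝ)} (hy : y ∈ PGLpos ℝ) (hy' : y' ∈ PGLpos ℝ) :
    y • UpperHalfPlane.I = y' • UpperHalfPlane.I ↔ y⁻¹ * y' ∈ PSO2 := by
  rw [mem_PSO2_iff, mul_smul, inv_smul_eq_iff, eq_comm]
  exact ⟨fun h => ⟨mul_mem (inv_mem hy) hy', h⟩, fun h => h.2⟩

/-- Only `i` is fixed by `PSO₂(ℝ)`: look at `z ↦ -1/z`. -/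
lemma eq_I_of_PSO2_smul {z : ℍ} (h : ∀ t ∈ PSO2, t • z = z) : z = UpperHalfPlane.I := by
  have hdet : (!![0, -1; 1, 0] : Matrix (Fin 2) (Fin 2) ℝ).det = 1 := by simp [det_fin_two]
  let g : GL (Fin 2) ℝ := GeneralLinearGroup.mkOfDetNeZero !![0, -1; 1, 0]
    (by rw [hdet]; exact one_ne_zero)
  have hg : 0 < g.det.val := by
    change 0 < (!![0, -1; 1, 0] : Matrix (Fin 2) (Fin 2) ℝ).det
    rw [hdet]; exact one_pos
  have hgm : ProjGenLinGroup.mk g ∈ PSO2 := by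
    rw [mem_PSO2_iff, mk_mem_PGLpos_iff, mk_smul_eq_iff hg]
    exact ⟨hg, by simp [g, GeneralLinearGroup.mkOfDetNeZero]⟩
  have hz := (mk_smul_eq_iff hg _ _).1 (h _ hgm)
  simp [g, GeneralLinearGroup.mkOfDetNeZero] at hz
  have h2 : ((z : ℂ) - Complex.I) * (z + Complex.I) = 0 := by
    linear_combination -hz - Complex.I_mul_I
  ext1
  rcases mul_eq_zero.1 h2 with h3 | h3
  · exact sub_eq_zero.1 h3
  · have := congrArg Complex.im h3
    simp at this
    have := z.im_pos
    linarith

end UpperHalfPlane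

section ComplexPlace

variable {F K : Type*} [Field F] [Field K] [Algebra F K]

/-- At a real place where `K` is complex, the torus is the stabilizer of the eigenpoint, seen in the
upper half-plane, in `PGL₂⁺(ℝ)`. -/
lemma mem_torus_complex_iff (hK : Module.finrank F K = 2)
    {ψ : K →ₐ[F] Matrix (Fin 2) (Fin 2) F} {τ : K} (hτ : IsEigenPoint ψ τ) (σ : F →+* ℝ)
    (ρ₀ : K →+* ℂ) (hρ₀ : ∀ x, ρ₀ (algebraMap F K x) = (σ x : ℂ)) (z : ℍ) (hz : (z : ℂ) = ρ₀ τ)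
    (t : PGL(2, ℝ)) : t ∈ torus σ ψ ↔ t ∈ PGLpos ℝ ∧ t • z = z := by
  have hz' : ρ₀ τ ∉ Set.range (algebraMap ℝ ℂ) := by
    rw [← hz]
    rintro ⟨x, hx⟩
    have := congrArg Complex.im hx
    simp at this
    exact z.im_ne_zero this.symm
  induction t using ProjGenLinGroup.induction_on with
  | mk g =>
  rw [mk_mem_torus_iff_of_notMem hK hτ σ ρ₀ hρ₀ hz', mk_mem_PGLpos_iff, ← hz]
  constructor
  · intro h
    have hpos : 0 < g.det.val := by
      rw [GeneralLinearGroup.val_det_apply, det_fin_two]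
      have h1 := congrArg Complex.im h
      have h2 := congrArg Complex.re h
      simp at h1 h2
      have hy := z.im_pos
      have e1 : g 0 0 = 2 * z.re * g 1 0 + g 1 1 := by
        apply mul_right_cancel₀ hy.ne'
        linear_combination h1
      have e2 : g 0 1 = -(z.re ^ 2 + z.im ^ 2) * g 1 0 := by
        linear_combination h2 - z.re * e1
      have e3 : g 0 0 * g 1 1 - g 0 1 * g 1 0 =
          (g 1 1 + z.re * g 1 0) ^ 2 + (z.im * g 1 0) ^ 2 := by
        rw [e1, e2]; ring
      have hne := g.det_ne_zero
      rw [det_fin_two] at hne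
      rw [e3] at hne ⊢
      exact lt_of_le_of_ne (by positivity) hne.symm
    exact ⟨hpos, (mk_smul_eq_iff hpos _ _).2 h⟩
  · rintro ⟨hpos, h⟩
    exact (mk_smul_eq_iff hpos _ _).1 h

/-- The first normalization condition says that `g` sends `i` to the fixed point of the torus. -/
lemma conj_PSO2_eq_torus_iff (hK : Module.finrank F K = 2)
    {ψ : K →ₐ[F] Matrix (Fin 2) (Fin 2) F} {τ : K} (hτ : IsEigenPoint ψ τ) (σ : F →+* ℝ)
    (ρ₀ : K →+* ℂ) (hρ₀ : ∀ x, ρ₀ (algebraMap F K x) = (σ x : ℂ)) (z : ℍ) (hz : (z : ℂ) = ρ₀ τ)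
    {g : PGL(2, ℝ)} (hg : g ∈ PGLpos ℝ) :
    conjSubgroup g PSO2 = torus σ ψ ↔ g • UpperHalfPlane.I = z := by
  have key := mem_torus_complex_iff hK hτ σ ρ₀ hρ₀ z hz
  constructor
  · intro h
    have : g⁻¹ • z = UpperHalfPlane.I := eq_I_of_PSO2_smul fun t ht => by
      have h1 : g * t * g⁻¹ ∈ torus σ ψ := by
        rw [← h, mem_conjSubgroup]
        convert ht using 1; group
      have h2 := ((key _).1 h1).2
      rw [mul_smul, mul_smul] at h2
      exact eq_inv_smul_iff.2 h2
    rw [← this, smul_inv_smul]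
  · rintro rfl
    ext t
    rw [mem_conjSubgroup, key, mem_PSO2_iff]
    constructor
    · rintro ⟨h1, h2⟩
      refine ⟨?_, ?_⟩
      · have := mul_mem (mul_mem hg h1) (inv_mem hg)
        convert this using 1; group
      · rw [mul_smul, mul_smul, inv_smul_eq_iff] at h2
        exact h2
    · rintro ⟨h1, h2⟩
      exact ⟨mul_mem (mul_mem (inv_mem hg) h1) hg, by
        rw [mul_smul, mul_smul, inv_smul_eq_iff, h2]⟩

end ComplexPlace

/-! ### Geodesics and the unit tangent bundle -/

lemma mk_smul_infty_eq_infty_iff {k : Type*} [Field k] (g : GL (Fin 2) k) :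
    ProjGenLinGroup.mk g • (OnePoint.infty : OnePoint k) = OnePoint.infty ↔ g 1 0 = 0 := by
  classical
  have key : ProjGenLinGroup.mk g • (OnePoint.infty : OnePoint k) =
      if g 1 0 = 0 then OnePoint.infty else ((g 0 0 / g 1 0 : k) : OnePoint k) := by
    convert OnePoint.smul_infty_eq_ite g
    rfl
  rw [key]
  split_ifs with h <;> simp [h]

lemma mk_mem_diagSubgroup_iff (g : GL (Fin 2) ℝ) :
    ProjGenLinGroup.mk g ∈ diagSubgroup ↔ g 0 1 = 0 ∧ g 1 0 = 0 := by
  constructor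
  · rintro ⟨u, hu⟩
    obtain ⟨c, rfl⟩ := ProjGenLinGroup.mk_eq_mk_iff.1 hu
    simp
  · rintro ⟨h1, h2⟩
    have hdet := g.det_ne_zero
    rw [det_fin_two, h1, zero_mul, sub_zero] at hdet
    let u : (Fin 2 → ℝ)ˣ := Units.mkOfMulEqOne ![g 0 0, g 1 1] ![(g 0 0)⁻¹, (g 1 1)⁻¹] (by
      ext i
      fin_cases i
      · simp [left_ne_zero_of_mul hdet]
      · simp [right_ne_zero_of_mul hdet])
    refine ⟨u, ?_⟩
    change ProjGenLinGroup.mk _ = _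
    congr 1
    ext i j
    change Matrix.diagonal ![g 0 0, g 1 1] i j = g i j
    fin_cases i <;> fin_cases j <;> simp [h1, h2]

lemma mem_diagSubgroup_iff (t : PGL(2, ℝ)) :
    t ∈ diagSubgroup ↔ t • (OnePoint.infty : OnePoint ℝ) = OnePoint.infty ∧
      t • ((0 : ℝ) : OnePoint ℝ) = ((0 : ℝ) : OnePoint ℝ) := by
  induction t using ProjGenLinGroup.induction_on with
  | mk g =>
  rw [mk_mem_diagSubgroup_iff, mk_smul_infty_eq_infty_iff, mk_smul_coe_iff, and_comm]
  simp

/-- Some diagonal matrix has no fixed points on the projective line besides `0` and `∞`. -/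
lemma eq_zero_or_infty_of_diag_smul {z : OnePoint ℝ} (h : ∀ t ∈ diagSubgroup, t • z = z) :
    z = OnePoint.infty ∨ z = ((0 : ℝ) : OnePoint ℝ) := by
  induction z using OnePoint.rec with
  | infty => exact Or.inl rfl
  | coe x =>
    right
    let g : GL (Fin 2) ℝ := GeneralLinearGroup.mkOfDetNeZero !![2, 0; 0, 1]
      (by simp [det_fin_two])
    have hg := h (ProjGenLinGroup.mk g) ((mk_mem_diagSubgroup_iff g).2
      (by simp [g, GeneralLinearGroup.mkOfDetNeZero]))
    rw [mk_smul_coe_iff] at hg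
    simp [g, GeneralLinearGroup.mkOfDetNeZero] at hg
    rw [OnePoint.coe_eq_coe]
    linarith

section RealPlace

variable {F K : Type*} [Field F] [Field K] [Algebra F K] [CharZero F]

/-- For `g` sending `∞` to one of the fixed points of a split torus, the normalization condition says
that `g` sends `0` to the other one. -/
lemma conj_diag_eq_torus_iff (hK : Module.finrank F K = 2) {s : K ≃ₐ[F] K} (hs : s ≠ 1)
    {ψ : K →ₐ[F] Matrix (Fin 2) (Fin 2) F} {τ : K} (hτ : IsEigenPoint ψ τ) (σ : F →+* ℝ)
    (ρ : K →+* ℝ) (hρ : ∀ x, ρ (algebraMap F K x) = σ x) {τ₁ τ₂ : K}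
    (h₁₂ : (τ₁ = τ ∧ τ₂ = s τ) ∨ (τ₁ = s τ ∧ τ₂ = τ)) {g : PGL(2, ℝ)}
    (hg : g • (OnePoint.infty : OnePoint ℝ) = ((ρ τ₁ : ℝ) : OnePoint ℝ)) :
    conjSubgroup g diagSubgroup = torus σ ψ ↔
      g • ((0 : ℝ) : OnePoint ℝ) = ((ρ τ₂ : ℝ) : OnePoint ℝ) := by
  have key : ∀ t : PGL(2, ℝ), t ∈ torus σ ψ ↔
      t • ((ρ τ₁ : ℝ) : OnePoint ℝ) = ((ρ τ₁ : ℝ) : OnePoint ℝ) ∧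
      t • ((ρ τ₂ : ℝ) : OnePoint ℝ) = ((ρ τ₂ : ℝ) : OnePoint ℝ) := by
    intro t
    induction t using ProjGenLinGroup.induction_on with
    | mk t =>
    rw [mk_mem_torus_iff_of_split hK hs hτ σ ρ hρ, mk_smul_coe_iff, mk_smul_coe_iff]
    rcases h₁₂ with ⟨rfl, rfl⟩ | ⟨rfl, rfl⟩
    · rfl
    · rw [and_comm]
  have hne : τ₁ ≠ τ₂ := by
    have : s τ ≠ τ := fun h0 => hτ.notMem hK ((conj_eq_self_iff hK hs).1 h0)
    rcases h₁₂ with ⟨rfl, rfl⟩ | ⟨rfl, rfl⟩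
    · exact this.symm
    · exact this
  constructor
  · intro h
    have h2 : g⁻¹ • ((ρ τ₂ : ℝ) : OnePoint ℝ) = OnePoint.infty ∨
        g⁻¹ • ((ρ τ₂ : ℝ) : OnePoint ℝ) = ((0 : ℝ) : OnePoint ℝ) :=
      eq_zero_or_infty_of_diag_smul fun t ht => by
        have h1 : g * t * g⁻¹ ∈ torus σ ψ := by
          rw [← h, mem_conjSubgroup]
          convert ht using 1; group
        have h2 := ((key _).1 h1).2
        rw [mul_smul, mul_smul] at h2
        exact eq_inv_smul_iff.2 h2
    rcases h2 with h2 | h2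
    · rw [inv_smul_eq_iff, hg, OnePoint.coe_eq_coe] at h2
      exact absurd (ρ.injective h2).symm hne
    · rw [← h2, smul_inv_smul]
  · intro h
    ext t
    rw [mem_conjSubgroup, key, mem_diagSubgroup_iff, ← hg, ← h]
    simp only [mul_smul, inv_smul_eq_iff]

end RealPlace

lemma exists_PGLpos_endpoints {a b : ℝ} (hab : a ≠ b) :
    ∃ g ∈ PGLpos ℝ, g • (OnePoint.infty : OnePoint ℝ) = (a : OnePoint ℝ) ∧
      g • ((0 : ℝ) : OnePoint ℝ) = (b : OnePoint ℝ) := by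
  have hdet : (!![a, b * (a - b); 1, a - b] : Matrix (Fin 2) (Fin 2) ℝ).det = (a - b) ^ 2 := by
    rw [det_fin_two]; simp; ring
  have hpos : 0 < (a - b) ^ 2 := by
    have := sub_ne_zero.2 hab
    positivity
  let g : GL (Fin 2) ℝ := GeneralLinearGroup.mkOfDetNeZero !![a, b * (a - b); 1, a - b]
    (by rw [hdet]; exact hpos.ne')
  refine ⟨ProjGenLinGroup.mk g, (mk_mem_PGLpos_iff g).2 ?_, ?_, ?_⟩
  · change 0 < (!![a, b * (a - b); 1, a - b] : Matrix (Fin 2) (Fin 2) ℝ).det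
    rw [hdet]; exact hpos
  · rw [mk_smul_infty_iff]; simp [g, GeneralLinearGroup.mkOfDetNeZero]
  · rw [mk_smul_coe_iff]; simp [g, GeneralLinearGroup.mkOfDetNeZero]

lemma exists_diagPos_smul_I {w : ℍ} (hw : w.re = 0) :
    ∃ k ∈ diagPos, k • UpperHalfPlane.I = w := by
  have hdet : (!![w.im, 0; 0, 1] : Matrix (Fin 2) (Fin 2) ℝ).det = w.im := by
    simp [det_fin_two]
  let g : GL (Fin 2) ℝ := GeneralLinearGroup.mkOfDetNeZero !![w.im, 0; 0, 1]
    (by rw [hdet]; exact w.im_pos.ne')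
  have hg : 0 < g.det.val := by
    change 0 < (!![w.im, 0; 0, 1] : Matrix (Fin 2) (Fin 2) ℝ).det
    rw [hdet]; exact w.im_pos
  refine ⟨ProjGenLinGroup.mk g, ⟨(mk_mem_diagSubgroup_iff g).2 ?_, (mk_mem_PGLpos_iff g).2 hg⟩, ?_⟩
  · simp [g, GeneralLinearGroup.mkOfDetNeZero]
  · rw [mk_smul_eq_iff hg]
    simp [g, GeneralLinearGroup.mkOfDetNeZero, Complex.ext_iff, hw]

lemma re_diagPos_smul_I {k : PGL(2, ℝ)} (hk : k ∈ diagPos) :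
    (k • UpperHalfPlane.I : ℍ).re = 0 := by
  induction k using ProjGenLinGroup.induction_on with
  | mk g =>
  obtain ⟨h1, h2⟩ := hk
  have hpos := (mk_mem_PGLpos_iff g).1 h2
  obtain ⟨h01, h10⟩ := (mk_mem_diagSubgroup_iff g).1 h1
  have h := (mk_smul_eq_iff hpos UpperHalfPlane.I _).1 rfl
  rw [h01, h10] at h
  have hre := congrArg Complex.re h
  rw [GeneralLinearGroup.val_det_apply, det_fin_two, h01, zero_mul, sub_zero] at hpos
  have h11 := right_ne_zero_of_mul hpos.ne'
  simp at hre
  exact (hre.resolve_right h11)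

/-- The image of the imaginary axis under `g` is the geodesic from `g 0` to `g ∞`. -/
lemma smul_mem_geodesic_iff {g : PGL(2, ℝ)} (hg : g ∈ PGLpos ℝ) {a b : ℝ} (hab : a ≠ b)
    (ha : g • (OnePoint.infty : OnePoint ℝ) = (a : OnePoint ℝ))
    (hb : g • ((0 : ℝ) : OnePoint ℝ) = (b : OnePoint ℝ)) (w : ℍ) :
    g • w ∈ geodesic a b ↔ w.re = 0 := by
  induction g using ProjGenLinGroup.induction_on with
  | mk g =>
  have hpos := (mk_mem_PGLpos_iff g).1 hg
  rw [mk_smul_infty_iff] at ha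
  rw [mk_smul_coe_iff] at hb
  simp only [mul_zero, zero_add] at hb
  have hdet : g.det.val = (a - b) * (g 1 0 * g 1 1) := by
    rw [GeneralLinearGroup.val_det_apply, det_fin_two, ha, hb]; ring
  have hrs : g 1 0 * g 1 1 ≠ 0 := by
    intro h; rw [hdet, h, mul_zero] at hpos; exact lt_irrefl _ hpos
  set z : ℍ := ProjGenLinGroup.mk g • w with hz
  have h := (mk_smul_eq_iff hpos w z).1 rfl
  rw [ha, hb] at h
  have hden : (g 1 0 : ℂ) * w + g 1 1 ≠ 0 := denom_ne_zero g w
  have hsub : ((z : ℂ) - ((a + b) / 2 : ℝ)) * ((g 1 0 : ℂ) * w + g 1 1) =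
      ((a - b) / 2 : ℝ) * ((g 1 0 : ℂ) * w - g 1 1) := by
    push_cast at h ⊢
    linear_combination -h
  have hn := congrArg norm hsub
  rw [norm_mul, norm_mul, Complex.norm_real, Real.norm_eq_abs, abs_div, abs_two] at hn
  have hpos' : 0 < ‖(g 1 0 : ℂ) * w + g 1 1‖ := norm_pos_iff.2 hden
  have hab' : 0 < |a - b| / 2 := by
    have := abs_pos.2 (sub_ne_zero.2 hab)
    positivity
  have hsq : ‖(g 1 0 : ℂ) * w + g 1 1‖ ^ 2 - ‖(g 1 0 : ℂ) * w - g 1 1‖ ^ 2 =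
      4 * (g 1 0 * g 1 1) * w.re := by
    rw [Complex.sq_norm, Complex.sq_norm, Complex.normSq_apply, Complex.normSq_apply]
    simp
    ring
  change ‖(z : ℂ) - ((a + b) / 2 : ℝ)‖ = |a - b| / 2 ↔ _
  constructor
  · intro e
    rw [e] at hn
    have := mul_left_cancel₀ hab'.ne' hn
    rw [this, sub_self] at hsq
    have h4 : (4 * (g 1 0 * g 1 1)) ≠ 0 := by simpa using hrs
    exact (mul_eq_zero.1 hsq.symm).resolve_left h4
  · intro e
    rw [e, mul_zero, sub_eq_zero] at hsq
    have := (sq_eq_sq₀ (norm_nonneg _) (norm_nonneg _)).1 hsq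
    rw [← this] at hn
    exact mul_right_cancel₀ hpos'.ne' hn

lemma geodesic_eq_image {g : PGL(2, ℝ)} (hg : g ∈ PGLpos ℝ) {a b : ℝ} (hab : a ≠ b)
    (ha : g • (OnePoint.infty : OnePoint ℝ) = (a : OnePoint ℝ))
    (hb : g • ((0 : ℝ) : OnePoint ℝ) = (b : OnePoint ℝ)) (z : ℍ) :
    z ∈ geodesic a b ↔ ∃ k ∈ diagPos, (g * k) • UpperHalfPlane.I = z := by
  constructor
  · intro hz
    rw [← smul_inv_smul g z, smul_mem_geodesic_iff hg hab ha hb] at hz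
    obtain ⟨k, hk, e⟩ := exists_diagPos_smul_I hz
    exact ⟨k, hk, by rw [mul_smul, e, smul_inv_smul]⟩
  · rintro ⟨k, hk, rfl⟩
    rw [mul_smul, smul_mem_geodesic_iff hg hab ha hb]
    exact re_diagPos_smul_I hk

lemma smul_pt (g : PGL(2, ℝ)) (x : UnitTangent) : (g • x).pt = g • x.pt := by
  induction g using ProjGenLinGroup.induction_on with
  | mk g => rfl

lemma mk_smul_vec {g : GL (Fin 2) ℝ} (hg : 0 < g.det.val) (x : UnitTangent) :
    (ProjGenLinGroup.mk g • x).vec = (g.det.val : ℂ) * x.vec / denom g x.pt ^ 2 := by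
  change UpperHalfPlane.σ g _ = _
  rw [UpperHalfPlane.σ, if_pos hg]
  rfl

/-- `PGL₂⁺(ℝ)` acts freely on the unit tangent bundle. -/
lemma eq_one_of_smul_base {y : PGL(2, ℝ)} (hy : y ∈ PGLpos ℝ)
    (h : y • UnitTangent.base = UnitTangent.base) : y = 1 := by
  induction y using ProjGenLinGroup.induction_on with
  | mk g =>
  have hpos := (mk_mem_PGLpos_iff g).1 hy
  have h1 := congrArg UnitTangent.pt h
  rw [smul_pt] at h1
  have h1' := (mk_smul_eq_iff hpos _ _).1 h1
  have h2 := congrArg UnitTangent.vec h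
  rw [mk_smul_vec hpos] at h2
  have ha : g 0 0 = g 1 1 := by simpa [UnitTangent.base] using congrArg Complex.im h1'
  have hb : g 0 1 = -g 1 0 := by simpa [UnitTangent.base] using congrArg Complex.re h1'
  have hdet : g.det.val = g 1 1 ^ 2 + g 1 0 ^ 2 := by
    rw [GeneralLinearGroup.val_det_apply, det_fin_two, ha, hb]; ring
  have hden : denom g UnitTangent.base.pt = (g 1 0 : ℂ) * Complex.I + g 1 1 := rfl
  rw [div_eq_iff (pow_ne_zero 2 (denom_ne_zero g _)), hden, hdet] at h2
  have hre := congrArg Complex.re h2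
  have him := congrArg Complex.im h2
  simp [UnitTangent.base, sq] at hre him
  have hc : g 1 0 = 0 := by nlinarith
  rw [ProjGenLinGroup.mk_eq_one, GeneralLinearGroup.center_eq_range_scalar]
  have hd : g 1 1 ≠ 0 := by
    rintro h0
    rw [hdet, h0, hc] at hpos
    simp at hpos
  refine ⟨Units.mk0 _ hd, ?_⟩
  ext i j
  fin_cases i <;> fin_cases j <;> simp [ha, hb, hc]

lemma smul_base_eq_smul_base_iff {y y' : PGL(2, ℝ)} (hy : y ∈ PGLpos ℝ) (hy' : y' ∈ PGLpos ℝ) :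
    y • UnitTangent.base = y' • UnitTangent.base ↔ y = y' := by
  constructor
  · intro h
    have := eq_one_of_smul_base (mul_mem (inv_mem hy') hy)
      (by rw [mul_smul, h, inv_smul_smul])
    exact (inv_mul_eq_one.1 this).symm
  · rintro rfl; rfl

lemma exists_PGLpos_smul_base (x : UnitTangent) :
    ∃ g ∈ PGLpos ℝ, g • UnitTangent.base = x := by
  -- translate and scale to the point, then rotate by a square root of `i y / ζ`
  have hy := x.pt.im_pos
  have hv : x.vec ≠ 0 := by
    intro h
    have := x.norm_vec
    rw [h, norm_zero] at this
    exact hy.ne this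
  obtain ⟨w, hw⟩ := IsAlgClosed.exists_pow_nat_eq (Complex.I * x.pt.im / x.vec) two_pos
  have hw1 : w.re ^ 2 + w.im ^ 2 = 1 := by
    have h1 := congrArg norm hw
    rw [norm_pow, norm_div, norm_mul, x.norm_vec, Complex.norm_I, one_mul, Complex.norm_real,
      Real.norm_eq_abs, abs_of_pos hy, div_self hy.ne', Complex.sq_norm,
      Complex.normSq_apply] at h1
    linear_combination h1
  have hdet : (!![x.pt.im * w.re + x.pt.re * w.im, -x.pt.im * w.im + x.pt.re * w.re;
      w.im, w.re] : Matrix (Fin 2) (Fin 2) ℝ).det = x.pt.im := by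
    rw [det_fin_two]; simp
    linear_combination x.pt.im * hw1
  let g : GL (Fin 2) ℝ := GeneralLinearGroup.mkOfDetNeZero _ (by rw [hdet]; exact hy.ne')
  have hgd : g.det.val = x.pt.im := hdet
  have hg : 0 < g.det.val := by rw [hgd]; exact hy
  refine ⟨ProjGenLinGroup.mk g, (mk_mem_PGLpos_iff g).2 hg, UnitTangent.ext ?_ ?_⟩
  · rw [smul_pt, mk_smul_eq_iff hg]
    simp [g, GeneralLinearGroup.mkOfDetNeZero, UnitTangent.base, Complex.ext_iff]
    constructor <;> ring
  · rw [mk_smul_vec hg, hgd]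
    have hden : denom g UnitTangent.base.pt = w := by
      change ((w.im : ℝ) : ℂ) * Complex.I + (w.re : ℝ) = w
      rw [add_comm]; exact Complex.re_add_im w
    have hw0 : w ≠ 0 := by
      rintro rfl; simp at hw1
    rw [hden, div_eq_iff (pow_ne_zero 2 hw0), hw]
    change (x.pt.im : ℂ) * Complex.I = _
    field_simp

/-! ### Strong approximation for `PGL₂` over a principal ideal domain -/

section Integral

variable {L Γ₀ : Type*} [Field L] [LinearOrderedCommGroupWithZero Γ₀]

/-- `g` lies in `GL₂` of the valuation ring of `w`: its entries are integral and its determinant is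
a unit. -/
def IsIntegralGL (w : Valuation L Γ₀) (g : GL (Fin 2) L) : Prop :=
  (∀ i j, w (g i j) ≤ 1) ∧ w g.det.val = 1

variable {w : Valuation L Γ₀}

lemma isIntegralGL_one : IsIntegralGL w 1 := by
  refine ⟨fun i j => ?_, by simp⟩
  rcases eq_or_ne i j with rfl | h
  · simp
  · simp [Matrix.one_apply_ne h]

lemma IsIntegralGL.mul {g h : GL (Fin 2) L} (hg : IsIntegralGL w g) (hh : IsIntegralGL w h) :
    IsIntegralGL w (g * h) := by
  refine ⟨fun i j => ?_, by rw [map_mul, Units.val_mul, map_mul, hg.2, hh.2, one_mul]⟩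
  rw [Units.val_mul, Matrix.mul_apply, Fin.sum_univ_two]
  refine w.map_add_le ?_ ?_ <;> rw [map_mul]
  · exact mul_le_one' (hg.1 i 0) (hh.1 0 j)
  · exact mul_le_one' (hg.1 i 1) (hh.1 1 j)

lemma IsIntegralGL.inv {g : GL (Fin 2) L} (hg : IsIntegralGL w g) : IsIntegralGL w g⁻¹ := by
  have hdet : w (g.det.val)⁻¹ = 1 := by rw [map_inv₀, hg.2, inv_one]
  have hinv : ((g⁻¹ : GL (Fin 2) L) : Matrix (Fin 2) (Fin 2) L) =
      (g.det.val)⁻¹ • !![g 1 1, -g 0 1; -g 1 0, g 0 0] := by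
    rw [GeneralLinearGroup.val_det_apply, ← Matrix.adjugate_fin_two, ← Ring.inverse_eq_inv',
      ← Matrix.inv_def, Matrix.coe_units_inv]
  refine ⟨fun i j => ?_, by rw [map_inv, Units.val_inv_eq_inv_val, hdet]⟩
  rw [hinv, Matrix.smul_apply, smul_eq_mul, map_mul, hdet, one_mul]
  fin_cases i <;> fin_cases j <;> simp [hg.1]

end Integral

section Local

variable {R F : Type*} [CommRing R] [IsDedekindDomain R] [Field F] [Algebra R F]
  [IsFractionRing R F]

lemma valued_algebraMap (v : HeightOneSpectrum R) (x : F) :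
    Valued.v (algebraMap F (v.adicCompletion F) x) = v.valuation F x :=
  v.valuedAdicCompletion_eq_valuation' x

lemma isIntegralGL_map_iff (v : HeightOneSpectrum R) (γ : GL (Fin 2) F) :
    IsIntegralGL (Valued.v : Valuation (v.adicCompletion F) _)
      (GeneralLinearGroup.map (algebraMap F (v.adicCompletion F)) γ) ↔
      IsIntegralGL (v.valuation F) γ := by
  unfold IsIntegralGL
  refine and_congr (forall_congr' fun i => forall_congr' fun j => ?_) ?_
  · rw [← valued_algebraMap]; rfl
  · rw [← valued_algebraMap]
    have : (GeneralLinearGroup.map (algebraMap F (v.adicCompletion F)) γ).det.val =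
      algebraMap F (v.adicCompletion F) γ.det.val := by
      simp [GeneralLinearGroup.val_det_apply, det_fin_two]
    rw [this]

/-- The classes in `PGL₂(𝒪_v)` are those with a representative in `GL₂(𝒪_v)`, where integrality is
expressed by the valuation of `F_v`. -/
lemma mk_mem_maxCompact_iff (v : HeightOneSpectrum R) (g : GL (Fin 2) (v.adicCompletion F)) :
    ProjGenLinGroup.mk g ∈ maxCompact F v ↔ ∃ c : (v.adicCompletion F)ˣ,
      IsIntegralGL Valued.v (g * GeneralLinearGroup.scalar (Fin 2) c) := by
  constructor
  · rintro ⟨k, hk⟩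
    induction k using ProjGenLinGroup.induction_on with
    | mk k =>
    rw [ProjGenLinGroup.map_mk, ProjGenLinGroup.mk_eq_mk_iff] at hk
    obtain ⟨u, rfl⟩ := hk
    refine ⟨u⁻¹, ?_⟩
    rw [mul_assoc, ← map_mul, mul_inv_cancel, map_one, mul_one]
    refine ⟨fun i j => (k i j).2, ?_⟩
    have hdet : (GeneralLinearGroup.map (algebraMap (v.adicCompletionIntegers F)
        (v.adicCompletion F)) k).det.val = (k.det.val : v.adicCompletion F) := by
      rw [GeneralLinearGroup.val_det_apply, GeneralLinearGroup.val_det_apply, det_fin_two,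
        det_fin_two]
      rfl
    rw [hdet]
    exact HeightOneSpectrum.adicCompletionIntegers.isUnit_iff_valued_eq_one.1 k.det.isUnit
  · rintro ⟨c, h1, h2⟩
    let M : Matrix (Fin 2) (Fin 2) (v.adicCompletionIntegers F) :=
      fun i j => ⟨(g * GeneralLinearGroup.scalar (Fin 2) c) i j, h1 i j⟩
    have hM : (M.det : v.adicCompletion F) =
        (g * GeneralLinearGroup.scalar (Fin 2) c).det.val := by
      rw [GeneralLinearGroup.val_det_apply, det_fin_two, det_fin_two]
      rfl
    have hu : IsUnit M.det := by
      rw [HeightOneSpectrum.adicCompletionIntegers.isUnit_iff_valued_eq_one, hM, h2]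
    refine ⟨ProjGenLinGroup.mk (GeneralLinearGroup.mk'' M hu), ?_⟩
    rw [ProjGenLinGroup.map_mk, ProjGenLinGroup.mk_eq_mk_iff]
    refine ⟨c⁻¹, ?_⟩
    have : GeneralLinearGroup.map (algebraMap (v.adicCompletionIntegers F) (v.adicCompletion F))
        (GeneralLinearGroup.mk'' M hu) = g * GeneralLinearGroup.scalar (Fin 2) c := by
      ext i j; rfl
    rw [this, mul_assoc, ← map_mul, mul_inv_cancel, map_one, mul_one]

lemma mk_mem_maxCompact_of_isIntegralGL {v : HeightOneSpectrum R}
    {g : GL (Fin 2) (v.adicCompletion F)} (hg : IsIntegralGL Valued.v g) :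
    ProjGenLinGroup.mk g ∈ maxCompact F v :=
  (mk_mem_maxCompact_iff v g).2 ⟨1, by simpa using hg⟩

lemma map_mk_mem_maxCompact {v : HeightOneSpectrum R} {γ : GL (Fin 2) F}
    (hγ : IsIntegralGL (v.valuation F) γ) :
    ProjGenLinGroup.map (algebraMap F (v.adicCompletion F)) (ProjGenLinGroup.mk γ) ∈
      maxCompact F v :=
  mk_mem_maxCompact_of_isIntegralGL ((isIntegralGL_map_iff v γ).2 hγ)

/-- `F` is dense in `F_v`. -/
lemma exists_sub_valued_le_one (v : HeightOneSpectrum R) (x : v.adicCompletion F) :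
    ∃ y : F, Valued.v (x - algebraMap F _ y) ≤ 1 := by
  have h : IsOpen (v.adicCompletionIntegers F : Set (v.adicCompletion F)) :=
    Valued.isOpen_valuationSubring _
  obtain ⟨y, hy⟩ := (HeightOneSpectrum.denseRange_algebraMap F v).exists_mem_open
    (h.preimage ((continuous_const (y := x)).sub continuous_id)) ⟨x, by simp⟩
  exact ⟨y, hy⟩

variable [IsPrincipalIdealRing R]

lemma exists_generator (v : HeightOneSpectrum R) :
    ∃ π : R, v.asIdeal = Ideal.span {π} ∧ v.valuation F (algebraMap R F π) = WithZero.exp (-1) ∧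
      ∀ w : HeightOneSpectrum R, w ≠ v → w.valuation F (algebraMap R F π) = 1 := by
  obtain ⟨π, hπ⟩ := (IsPrincipalIdealRing.principal v.asIdeal).principal
  rw [Ideal.submodule_span_eq] at hπ
  have hπ0 : π ≠ 0 := by
    rintro rfl
    exact v.ne_bot (by rw [hπ]; simp)
  refine ⟨π, hπ, ?_, fun w hw => ?_⟩
  · rw [HeightOneSpectrum.valuation_of_algebraMap]
    exact v.intValuation_singleton hπ0 hπ
  · rw [HeightOneSpectrum.valuation_eq_one_iff_notMem]
    intro hmem
    apply hw
    have hle : v.asIdeal ≤ w.asIdeal := by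
      rw [hπ, Ideal.span_singleton_le_iff_mem]; exact hmem
    ext1
    exact ((v.isPrime.isMaximal v.ne_bot).eq_of_le w.isPrime.ne_top hle).symm

/-- Partial fractions: an element of `F_v` is, modulo `𝒪_v`, an element of `F` which is integral
at the other primes. -/
lemma exists_sub_valued_le_one_of_integral_away (v : HeightOneSpectrum R)
    (x : v.adicCompletion F) : ∃ r : F, Valued.v (x - algebraMap F _ r) ≤ 1 ∧
      ∀ w : HeightOneSpectrum R, w ≠ v → w.valuation F r ≤ 1 := by
  obtain ⟨y, hy⟩ := exists_sub_valued_le_one v x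
  obtain ⟨π, hπ, hv, hw⟩ := exists_generator (F := F) v
  obtain ⟨n, m, hm, rfl⟩ := IsFractionRing.div_surjective (A := R) y
  have hm0 : m ≠ 0 := nonZeroDivisors.ne_zero hm
  have hprime : Prime π := by
    rw [← Ideal.span_singleton_prime (by rintro rfl; exact v.ne_bot (by rw [hπ]; simp)), ← hπ]
    exact v.isPrime
  obtain ⟨k, m', hm', rfl⟩ := WfDvdMonoid.max_power_factor hm0 hprime.irreducible
  have hcop : IsCoprime (π ^ k) m' :=
    ((hprime.irreducible.coprime_iff_not_dvd).2 hm').pow_left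
  obtain ⟨s, t, hst⟩ := hcop
  have hπ0 : algebraMap R F π ≠ 0 := by simpa using hprime.ne_zero
  have hm'0 : algebraMap R F m' ≠ 0 := by
    simpa using right_ne_zero_of_mul hm0
  have hst' : algebraMap R F s * algebraMap R F π ^ k + algebraMap R F t * algebraMap R F m' = 1 := by
    rw [← map_pow, ← map_mul, ← map_mul, ← map_add, hst, map_one]
  refine ⟨algebraMap R F (n * t) / algebraMap R F π ^ k, ?_, fun w hwv => ?_⟩
  · have e : x - algebraMap F _ (algebraMap R F (n * t) / algebraMap R F π ^ k) =
      (x - algebraMap F _ (algebraMap R F n / algebraMap R F (π ^ k * m'))) +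
        algebraMap F _ (algebraMap R F (n * s) / algebraMap R F m') := by
      rw [sub_add, ← map_sub]
      congr 2
      simp only [map_mul, map_pow]
      field_simp
      linear_combination algebraMap R F n * hst'
    rw [e]
    refine Valuation.map_add_le _ hy ?_
    rw [valued_algebraMap, map_div₀]
    have h1 : v.valuation F (algebraMap R F m') = 1 := by
      rw [HeightOneSpectrum.valuation_eq_one_iff_notMem, hπ, Ideal.mem_span_singleton]
      exact hm'
    rw [h1, div_one]
    exact v.valuation_le_one _
  · rw [map_div₀, map_pow, hw w hwv, one_pow, div_one]
    exact w.valuation_le_one _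

lemma exists_valued_smul_eq_one (v : HeightOneSpectrum R) {x : v.adicCompletion F} (hx : x ≠ 0) :
    ∃ c : F, c ≠ 0 ∧ Valued.v (algebraMap F _ c * x) = 1 ∧
      ∀ w : HeightOneSpectrum R, w ≠ v → w.valuation F c = 1 := by
  obtain ⟨π, hπ, hv, hw⟩ := exists_generator (F := F) v
  have hx0 : Valued.v x ≠ 0 := by simpa using hx
  have hπ0 : algebraMap R F π ≠ 0 := by
    intro h; rw [h, map_zero] at hv; exact WithZero.exp_ne_zero hv.symm
  refine ⟨algebraMap R F π ^ (WithZero.log (Valued.v x)), zpow_ne_zero _ hπ0, ?_, fun w hwv => ?_⟩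
  · rw [map_mul, valued_algebraMap, map_zpow₀, hv, ← WithZero.exp_zsmul]
    nth_rw 2 [← WithZero.exp_log hx0]
    rw [← WithZero.exp_add]
    simp
  · rw [map_zpow₀, hw w hwv, _root_.one_zpow]

/-- At a single prime `v`, an element of `GL₂(F_v)` can be moved into `PGL₂(𝒪_v)` from the left by
an element of `GL₂(F)` which is integral at the other primes: reduce to an upper triangular matrix
by column operations, then normalize the diagonal and clear the polar part of the last entry. -/
lemma exists_mul_mem_maxCompact (v : HeightOneSpectrum R) (g : PGL(2, v.adicCompletion F)) :
    ∃ γ : GL (Fin 2) F, ProjGenLinGroup.map (algebraMap F _) (ProjGenLinGroup.mk γ) * g ∈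
      maxCompact F v ∧ ∀ w : HeightOneSpectrum R, w ≠ v → IsIntegralGL (w.valuation F) γ := by
  -- upper triangular matrices
  have htri : ∀ g : GL (Fin 2) (v.adicCompletion F), g 1 0 = 0 →
      ∃ γ : GL (Fin 2) F, ProjGenLinGroup.map (algebraMap F _) (ProjGenLinGroup.mk γ) *
        ProjGenLinGroup.mk g ∈ maxCompact F v ∧
        ∀ w : HeightOneSpectrum R, w ≠ v → IsIntegralGL (w.valuation F) γ := by
    intro g h10
    have hdet := g.det_ne_zero
    rw [det_fin_two, h10, mul_zero, sub_zero] at hdet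
    obtain ⟨c, hc0, hc, hcw⟩ := exists_valued_smul_eq_one v (left_ne_zero_of_mul hdet)
    obtain ⟨d, hd0, hd, hdw⟩ := exists_valued_smul_eq_one v (right_ne_zero_of_mul hdet)
    obtain ⟨r, hr, hrw⟩ := exists_sub_valued_le_one_of_integral_away v
      (algebraMap F _ c * g 0 1 / (algebraMap F _ d * g 1 1))
    have hγdet : (!![c, -(r * d); 0, d] : Matrix (Fin 2) (Fin 2) F).det = c * d := by
      simp [det_fin_two]
    let γ : GL (Fin 2) F := GeneralLinearGroup.mkOfDetNeZero !![c, -(r * d); 0, d]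
      (by rw [hγdet]; exact mul_ne_zero hc0 hd0)
    have hγd : γ.det.val = c * d := hγdet
    refine ⟨γ, ?_, fun w hw => ⟨?_, ?_⟩⟩
    · rw [ProjGenLinGroup.map_mk, ← map_mul]
      apply mk_mem_maxCompact_of_isIntegralGL
      have e00 : (GeneralLinearGroup.map (algebraMap F (v.adicCompletion F)) γ * g) 0 0 =
          algebraMap F _ c * g 0 0 := by
        simp [Matrix.mul_apply, Fin.sum_univ_two, γ, GeneralLinearGroup.mkOfDetNeZero, h10]
      have e10 : (GeneralLinearGroup.map (algebraMap F (v.adicCompletion F)) γ * g) 1 0 = 0 := by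
        simp [Matrix.mul_apply, Fin.sum_univ_two, γ, GeneralLinearGroup.mkOfDetNeZero, h10]
      have e11 : (GeneralLinearGroup.map (algebraMap F (v.adicCompletion F)) γ * g) 1 1 =
          algebraMap F _ d * g 1 1 := by
        simp [Matrix.mul_apply, Fin.sum_univ_two, γ, GeneralLinearGroup.mkOfDetNeZero]
      have hd' : algebraMap F (v.adicCompletion F) d * g 1 1 ≠ 0 := by
        intro h; rw [h, map_zero] at hd; exact zero_ne_one hd
      have e01 : (GeneralLinearGroup.map (algebraMap F (v.adicCompletion F)) γ * g) 0 1 =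
          (algebraMap F _ c * g 0 1 / (algebraMap F _ d * g 1 1) - algebraMap F _ r) *
            (algebraMap F _ d * g 1 1) := by
        rw [sub_mul, div_mul_cancel₀ _ hd']
        simp [Matrix.mul_apply, Fin.sum_univ_two, γ, GeneralLinearGroup.mkOfDetNeZero]
        ring
      constructor
      · intro i j
        fin_cases i <;> fin_cases j
        · exact (congrArg Valued.v e00).trans hc |>.le
        · change Valued.v _ ≤ 1
          refine (congrArg Valued.v e01).trans_le ?_
          rw [map_mul, hd, mul_one]; exact hr
        · exact (congrArg Valued.v e10).trans_le (by simp)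
        · exact (congrArg Valued.v e11).trans hd |>.le
      · rw [GeneralLinearGroup.val_det_apply, det_fin_two, e00, e11, e10, mul_zero, sub_zero,
          map_mul, hc, hd, one_mul]
    · have hd1 := (hdw w hw).le
      have hc1 := (hcw w hw).le
      intro i j
      fin_cases i <;> fin_cases j <;>
        simp [γ, GeneralLinearGroup.mkOfDetNeZero, hd1, hc1]
      exact mul_le_one' (hrw w hw) hd1
    · rw [hγd, map_mul, hcw w hw, hdw w hw, one_mul]
  -- matrices whose lower right entry dominates the lower left one
  have hdom : ∀ g : GL (Fin 2) (v.adicCompletion F), Valued.v (g 1 0) ≤ Valued.v (g 1 1) →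
      ∃ γ : GL (Fin 2) F, ProjGenLinGroup.map (algebraMap F _) (ProjGenLinGroup.mk γ) *
        ProjGenLinGroup.mk g ∈ maxCompact F v ∧
        ∀ w : HeightOneSpectrum R, w ≠ v → IsIntegralGL (w.valuation F) γ := by
    intro g hle
    have h11 : g 1 1 ≠ 0 := by
      intro h
      rw [h, map_zero, le_zero_iff, map_eq_zero] at hle
      have hdet := g.det_ne_zero
      rw [det_fin_two, h, hle] at hdet
      simp at hdet
    let k : GL (Fin 2) (v.adicCompletion F) := GeneralLinearGroup.mkOfDetNeZero
      !![1, 0; -(g 1 0 / g 1 1), 1] (by simp [det_fin_two])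
    have hk : IsIntegralGL Valued.v k := by
      constructor
      · have : Valued.v (g 1 0) / Valued.v (g 1 1) ≤ 1 :=
          div_le_one_of_le₀ hle zero_le
        intro i j
        fin_cases i <;> fin_cases j <;> simp [k, GeneralLinearGroup.mkOfDetNeZero, this]
      · have : k.det.val = 1 := by
          change (!![1, 0; -(g 1 0 / g 1 1), 1] : Matrix (Fin 2) (Fin 2) _).det = 1
          simp [det_fin_two]
        rw [this, map_one]
    obtain ⟨γ, h1, h2⟩ := htri (g * k) (by
      simp [Matrix.mul_apply, Fin.sum_univ_two, k, GeneralLinearGroup.mkOfDetNeZero]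
      field_simp
      ring)
    refine ⟨γ, ?_, h2⟩
    rw [map_mul, ← mul_assoc] at h1
    exact (Subgroup.mul_mem_cancel_right _ (mk_mem_maxCompact_of_isIntegralGL hk)).1 h1
  induction g using ProjGenLinGroup.induction_on with
  | mk g =>
  rcases le_total (Valued.v (g 1 0)) (Valued.v (g 1 1)) with h | h
  · exact hdom g h
  · let k : GL (Fin 2) (v.adicCompletion F) := GeneralLinearGroup.mkOfDetNeZero
      !![0, 1; 1, 0] (by simp [det_fin_two])
    have hk : IsIntegralGL Valued.v k := by
      constructor
      · intro i j
        fin_cases i <;> fin_cases j <;> simp [k, GeneralLinearGroup.mkOfDetNeZero]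
      · have : k.det.val = -1 := by
          change (!![0, 1; 1, 0] : Matrix (Fin 2) (Fin 2) (v.adicCompletion F)).det = -1
          simp [det_fin_two]
        rw [this, Valuation.map_neg, map_one]
    obtain ⟨γ, h1, h2⟩ := hdom (g * k) (by
      simpa [Matrix.mul_apply, Fin.sum_univ_two, k, GeneralLinearGroup.mkOfDetNeZero] using h)
    refine ⟨γ, ?_, h2⟩
    rw [map_mul, ← mul_assoc] at h1
    exact (Subgroup.mul_mem_cancel_right _ (mk_mem_maxCompact_of_isIntegralGL hk)).1 h1

/-- The class number of `PGL₂` over a principal ideal domain is one. -/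
lemma exists_forall_mul_mem_maxCompact
    (y : ∀ v : HeightOneSpectrum R, PGL(2, v.adicCompletion F))
    (hy : ∀ᶠ v in Filter.cofinite, y v ∈ maxCompact F v) :
    ∃ γ : GL (Fin 2) F, ∀ v, ProjGenLinGroup.map (algebraMap F _) (ProjGenLinGroup.mk γ) * y v ∈
      maxCompact F v := by
  classical
  suffices H : ∀ (s : Finset (HeightOneSpectrum R))
      (y : ∀ v : HeightOneSpectrum R, PGL(2, v.adicCompletion F)),
      (∀ v ∉ s, y v ∈ maxCompact F v) → ∃ γ : GL (Fin 2) F, ∀ v,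
        ProjGenLinGroup.map (algebraMap F _) (ProjGenLinGroup.mk γ) * y v ∈ maxCompact F v by
    rw [Filter.eventually_cofinite] at hy
    exact H hy.toFinset y fun v hv => by simpa using hv
  intro s
  induction s using Finset.induction_on with
  | empty =>
    intro y hy
    exact ⟨1, fun v => by simpa using hy v (by simp)⟩
  | insert v s _ ih =>
    intro y hy
    obtain ⟨γ, h1, h2⟩ := exists_mul_mem_maxCompact v (y v)
    obtain ⟨δ, hδ⟩ := ih
      (fun w => ProjGenLinGroup.map (algebraMap F _) (ProjGenLinGroup.mk γ) * y w) (by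
        intro w hw
        rcases eq_or_ne w v with rfl | hwv
        · exact h1
        · exact mul_mem (map_mk_mem_maxCompact (h2 w hwv)) (hy w (by simp [hwv, hw])))
    refine ⟨δ * γ, fun w => ?_⟩
    have := hδ w
    rwa [← mul_assoc, ← map_mul, ← map_mul] at this

end Local

section Representatives

variable {R F : Type*} [CommRing R] [IsDedekindDomain R] [Field F] [Algebra R F]
  [IsFractionRing R F] [IsPrincipalIdealRing R]

/-- A class in `PGL₂(F)` is represented by a primitive matrix over `R`, and that matrix is
invertible at every prime where the class is integral. -/
lemma exists_isIntegralGL_rep (γ : PGL(2, F)) : ∃ g : GL (Fin 2) F, ProjGenLinGroup.mk g = γ ∧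
    ∀ v : HeightOneSpectrum R,
      ProjGenLinGroup.map (algebraMap F (v.adicCompletion F)) γ ∈ maxCompact F v →
        IsIntegralGL (v.valuation F) g := by
  induction γ using ProjGenLinGroup.induction_on with
  | mk g₀ =>
  obtain ⟨b, hb⟩ := IsLocalization.exist_integer_multiples_of_finite (nonZeroDivisors R)
    (fun p : Fin 2 × Fin 2 => g₀ p.1 p.2)
  choose n hn using hb
  have hb0 : algebraMap R F b ≠ 0 := by
    simp
  obtain ⟨d, hd⟩ := (IsPrincipalIdealRing.principal (Ideal.span (Set.range n))).principal
  rw [Ideal.submodule_span_eq] at hd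
  have hdvd : ∀ p, ∃ m, n p = d * m := fun p => by
    rw [← dvd_def, ← Ideal.mem_span_singleton, ← hd]
    exact Ideal.subset_span ⟨p, rfl⟩
  choose m hm using hdvd
  have hd0 : d ≠ 0 := by
    rintro rfl
    have h0 : ∀ i j, g₀ i j = 0 := fun i j => by
      have h1 := hn (i, j)
      rw [hm, zero_mul, map_zero, Algebra.smul_def] at h1
      exact (mul_eq_zero.1 h1.symm).resolve_left hb0
    have hdet := g₀.det_ne_zero
    rw [det_fin_two, h0, h0 0 1] at hdet
    simp at hdet
  have hd0' : algebraMap R F d ≠ 0 := by simpa using hd0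
  have hdmem : d ∈ Ideal.span (Set.range n) := by
    rw [hd]; exact Ideal.mem_span_singleton_self d
  obtain ⟨u, hu⟩ := (Ideal.mem_span_range_iff_exists_fun).1 hdmem
  have hum : ∑ p, u p * m p = 1 := by
    apply mul_left_cancel₀ hd0
    rw [mul_one, Finset.mul_sum]
    nth_rw 2 [← hu]
    refine Finset.sum_congr rfl fun p _ => ?_
    rw [hm p]; ring
  let c : Fˣ := Units.mk0 (algebraMap R F b / algebraMap R F d) (div_ne_zero hb0 hd0')
  set g := g₀ * GeneralLinearGroup.scalar (Fin 2) c with hg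
  have hgm : ∀ i j, g i j = algebraMap R F (m (i, j)) := fun i j => by
    have h1 := hn (i, j)
    rw [hm, map_mul, Algebra.smul_def] at h1
    have h2 : g i j = g₀ i j * (algebraMap R F b / algebraMap R F d) := by
      simp [hg, c]
    rw [h2, mul_div_assoc', div_eq_iff hd0', mul_comm]
    have h1' : algebraMap R F d * algebraMap R F (m (i, j)) = algebraMap R F b * g₀ i j := h1
    rw [mul_comm (algebraMap R F (m (i, j))), h1']
  have hmk : ProjGenLinGroup.mk g = ProjGenLinGroup.mk g₀ := by
    rw [hg, map_mul, ProjGenLinGroup.mk_scalar, mul_one]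
  refine ⟨g, hmk, fun v hv => ?_⟩
  rw [← hmk, ProjGenLinGroup.map_mk, mk_mem_maxCompact_iff] at hv
  obtain ⟨e, he1, he2⟩ := hv
  have hint : ∀ i j, v.valuation F (g i j) ≤ 1 := fun i j => by
    rw [hgm]; exact v.valuation_le_one _
  refine ⟨hint, ?_⟩
  have hent : ∀ i j, (GeneralLinearGroup.map (algebraMap F (v.adicCompletion F)) g *
      GeneralLinearGroup.scalar (Fin 2) e) i j = algebraMap F (v.adicCompletion F) (g i j) * e :=
    fun i j => by simp
  -- some entry of the primitive matrix is a unit at `v`, so the scaling factor is integral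
  obtain ⟨p, hp⟩ : ∃ p : Fin 2 × Fin 2, m p ∉ v.asIdeal := by
    by_contra! h
    apply v.isPrime.ne_top
    rw [Ideal.eq_top_iff_one, ← hum]
    exact Ideal.sum_mem _ fun p _ => Ideal.mul_mem_left _ _ (h p)
  have hp1 : v.valuation F (g p.1 p.2) = 1 := by
    rw [hgm, HeightOneSpectrum.valuation_eq_one_iff_notMem]; exact hp
  have hle : Valued.v (e : v.adicCompletion F) ≤ 1 := by
    have := he1 p.1 p.2
    rwa [hent, map_mul, valued_algebraMap, hp1, one_mul] at this
  have hdet : (GeneralLinearGroup.map (algebraMap F (v.adicCompletion F)) g *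
      GeneralLinearGroup.scalar (Fin 2) e).det.val =
        algebraMap F (v.adicCompletion F) g.det.val * (e * e) := by
    rw [GeneralLinearGroup.val_det_apply, GeneralLinearGroup.val_det_apply, det_fin_two,
      det_fin_two, hent, hent, hent, hent, map_sub, map_mul, map_mul]
    ring
  have hdle : v.valuation F g.det.val ≤ 1 := by
    rw [GeneralLinearGroup.val_det_apply, det_fin_two]
    refine (v.valuation F).map_sub_le ?_ ?_ <;> rw [map_mul] <;>
      exact mul_le_one' (hint _ _) (hint _ _)
  rw [hdet, map_mul, valued_algebraMap] at he2
  have hee : Valued.v ((e : v.adicCompletion F) * e) ≤ 1 := by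
    rw [map_mul]; exact mul_le_one' hle hle
  refine le_antisymm hdle ?_
  calc (1 : WithZero (Multiplicative ℤ)) = _ := he2.symm
    _ ≤ v.valuation F g.det.val * 1 := mul_le_mul' le_rfl hee
    _ = _ := mul_one _

end Representatives

/-! ### Adelic matrices and their components -/

section Adeles

variable {R F : Type*} [CommRing R] [IsDedekindDomain R] [Field F] [Algebra R F]
  [IsFractionRing R F]

lemma finComp_comp_algebraMap (v : HeightOneSpectrum R) :
    (finComp R F v).comp (algebraMap F (AdeleRing R F)) = algebraMap F (v.adicCompletion F) :=
  rfl

lemma map_finComp_map (v : HeightOneSpectrum R) (γ : PGL(2, F)) :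
    ProjGenLinGroup.map (finComp R F v)
      (ProjGenLinGroup.map (algebraMap F (AdeleRing R F)) γ) =
      ProjGenLinGroup.map (algebraMap F (v.adicCompletion F)) γ := by
  rw [← finComp_comp_algebraMap, ProjGenLinGroup.map_comp]; rfl

lemma eventually_finComp_le_one (a : AdeleRing R F) :
    ∀ᶠ v in Filter.cofinite, Valued.v (finComp R F v a) ≤ 1 := a.2.2

lemma eventually_map_finComp_mem_maxCompact (a : PGL(2, AdeleRing R F)) :
    ∀ᶠ v in Filter.cofinite, ProjGenLinGroup.map (finComp R F v) a ∈ maxCompact F v := by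
  induction a using ProjGenLinGroup.induction_on with
  | mk a =>
  have h1 : ∀ᶠ v in Filter.cofinite, ∀ i j, Valued.v (finComp R F v (a i j)) ≤ 1 :=
    Filter.eventually_all.2 fun i => Filter.eventually_all.2 fun j => eventually_finComp_le_one _
  filter_upwards [h1, eventually_finComp_le_one (a.det.val),
    eventually_finComp_le_one ((a.det⁻¹ : (AdeleRing R F)ˣ).val)] with v hv hd hd'
  rw [ProjGenLinGroup.map_mk]
  apply mk_mem_maxCompact_of_isIntegralGL
  refine ⟨hv, ?_⟩
  have e : (GeneralLinearGroup.map (finComp R F v) a).det.val = finComp R F v a.det.val := by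
    simp [GeneralLinearGroup.val_det_apply, det_fin_two]
  rw [e]
  refine le_antisymm hd ?_
  have h2 : finComp R F v a.det.val * finComp R F v (a.det⁻¹ : (AdeleRing R F)ˣ).val = 1 := by
    rw [← map_mul, Units.mul_inv, map_one]
  calc (1 : WithZero (Multiplicative ℤ)) = Valued.v (finComp R F v a.det.val) *
        Valued.v (finComp R F v (a.det⁻¹ : (AdeleRing R F)ˣ).val) := by rw [← map_mul, h2, map_one]
    _ ≤ Valued.v (finComp R F v a.det.val) * 1 := by gcongr
    _ = _ := mul_one _

variable [IsTotallyReal F]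

lemma infComp_comp_algebraMap (v : InfinitePlace F) :
    (infComp R F v).comp (algebraMap F (AdeleRing R F)) = realEmb v :=
  RingHom.ext fun _ => InfinitePlace.Completion.extensionEmbeddingOfIsReal_coe _ _

lemma map_infComp_map (v : InfinitePlace F) (γ : PGL(2, F)) :
    ProjGenLinGroup.map (infComp R F v)
      (ProjGenLinGroup.map (algebraMap F (AdeleRing R F)) γ) =
      ProjGenLinGroup.map (realEmb v) γ := by
  rw [← infComp_comp_algebraMap (R := R), ProjGenLinGroup.map_comp]; rfl

lemma adele_ext {a b : AdeleRing R F} (h : ∀ v, finComp R F v a = finComp R F v b)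
    (h' : ∀ v, infComp R F v a = infComp R F v b) : a = b := by
  refine Prod.ext (funext fun v => ?_) (FiniteAdeleRing.ext F h)
  exact (InfinitePlace.Completion.bijective_extensionEmbeddingOfIsReal
    (IsTotallyReal.isReal v)).1 (h' v)

lemma exists_adele (a : ∀ v : HeightOneSpectrum R, v.adicCompletion F)
    (ha : ∀ᶠ v in Filter.cofinite, Valued.v (a v) ≤ 1) (r : InfinitePlace F → ℝ) :
    ∃ x : AdeleRing R F, (∀ v, finComp R F v x = a v) ∧ ∀ v, infComp R F v x = r v := by
  choose c hc using fun v : InfinitePlace F =>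
    (InfinitePlace.Completion.bijective_extensionEmbeddingOfIsReal
      (IsTotallyReal.isReal v)).2 (r v)
  exact ⟨(c, ⟨a, ha⟩), fun v => rfl, hc⟩

/-- Adelic points of `GL₂` are assembled from local ones, almost all integral. -/
lemma exists_adelic_GL (g : ∀ v : HeightOneSpectrum R, GL (Fin 2) (v.adicCompletion F))
    (hg : ∀ᶠ v in Filter.cofinite, IsIntegralGL Valued.v (g v))
    (r : InfinitePlace F → GL (Fin 2) ℝ) :
    ∃ a : GL (Fin 2) (AdeleRing R F), (∀ v, GeneralLinearGroup.map (finComp R F v) a = g v) ∧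
      ∀ v, GeneralLinearGroup.map (infComp R F v) a = r v := by
  choose m hm hm' using fun i j => exists_adele (R := R) (fun v => g v i j)
    (hg.mono fun v h => h.1 i j) fun v => r v i j
  choose n hn hn' using fun i j => exists_adele (R := R) (fun v => (g v)⁻¹ i j)
    (hg.mono fun v h => h.inv.1 i j) fun v => (r v)⁻¹ i j
  have h1 : Matrix.of m * Matrix.of n = 1 := by
    ext i j
    refine adele_ext (fun v => ?_) (fun v => ?_)
    · rw [Matrix.mul_apply, Fin.sum_univ_two, map_add, map_mul, map_mul]
      simp only [Matrix.of_apply, hm, hn]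
      have h2 : ((g v : Matrix (Fin 2) (Fin 2) (v.adicCompletion F)) *
        ((g v)⁻¹ : GL (Fin 2) _)) i j = (1 : Matrix _ _ _) i j := by rw [Units.mul_inv]
      rw [Matrix.mul_apply, Fin.sum_univ_two] at h2
      rw [h2, Matrix.one_apply, Matrix.one_apply]
      split_ifs <;> simp
    · rw [Matrix.mul_apply, Fin.sum_univ_two, map_add, map_mul, map_mul]
      simp only [Matrix.of_apply, hm', hn']
      have h2 : ((r v : Matrix (Fin 2) (Fin 2) ℝ) *
        ((r v)⁻¹ : GL (Fin 2) _)) i j = (1 : Matrix _ _ _) i j := by rw [Units.mul_inv]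
      rw [Matrix.mul_apply, Fin.sum_univ_two] at h2
      rw [h2, Matrix.one_apply, Matrix.one_apply]
      split_ifs <;> simp
  refine ⟨⟨Matrix.of m, Matrix.of n, h1, _root_.mul_eq_one_comm.1 h1⟩, fun v => ?_, fun v => ?_⟩
  · exact Units.ext (Matrix.ext fun i j => hm i j v)
  · exact Units.ext (Matrix.ext fun i j => hm' i j v)

/-- Commutation of adelic matrices can be checked at all places. -/
lemma adelic_commute {g M : Matrix (Fin 2) (Fin 2) (AdeleRing R F)}
    (h : ∀ v, Commute (g.map (finComp R F v)) (M.map (finComp R F v)))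
    (h' : ∀ v, Commute (g.map (infComp R F v)) (M.map (infComp R F v))) : Commute g M := by
  rw [Commute, SemiconjBy]
  ext i j
  refine adele_ext (fun v => ?_) (fun v => ?_)
  · have := (h v).eq
    rw [← Matrix.map_mul, ← Matrix.map_mul] at this
    exact congrFun (congrFun this i) j
  · have := (h' v).eq
    rw [← Matrix.map_mul, ← Matrix.map_mul] at this
    exact congrFun (congrFun this i) j

end Adeles

/-! ### Quadratic lattices and their multiplier rings -/

section MoebiusGroup

variable {F K : Type*} [Field F] [Field K] [Algebra F K]

lemma Moebius.mul {γ δ : GL (Fin 2) F} {τ τ₁ τ₂ : K} (h : Moebius γ τ τ₁)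
    (h' : Moebius δ τ₁ τ₂) : Moebius (δ * γ) τ τ₂ := by
  unfold Moebius at h h' ⊢
  simp only [Units.val_mul, Matrix.mul_apply, Fin.sum_univ_two, map_add, map_mul]
  linear_combination (algebraMap F K (δ 0 0) - τ₂ * algebraMap F K (δ 1 0)) * h +
    (algebraMap F K (γ 1 0) * τ + algebraMap F K (γ 1 1)) * h'

lemma Moebius.inv {γ : GL (Fin 2) F} {τ τ₁ : K} (h : Moebius γ τ τ₁) : Moebius γ⁻¹ τ₁ τ := by
  unfold Moebius at h ⊢
  have hinv : ((γ⁻¹ : GL (Fin 2) F) : Matrix (Fin 2) (Fin 2) F) =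
      (γ.det.val)⁻¹ • !![γ 1 1, -γ 0 1; -γ 1 0, γ 0 0] := by
    rw [GeneralLinearGroup.val_det_apply, ← Matrix.adjugate_fin_two, ← Ring.inverse_eq_inv',
      ← Matrix.inv_def, Matrix.coe_units_inv]
  rw [hinv]
  simp only [Matrix.smul_apply, smul_eq_mul, map_mul, Matrix.of_apply,
    Matrix.cons_val', Matrix.cons_val_zero,
    Matrix.cons_val_one, Matrix.cons_val_fin_one, map_neg]
  linear_combination -algebraMap F K (γ.det.val)⁻¹ * h

lemma isOptimal_iff {R' : Subring F} {O' : Subring K} {ψ : K →ₐ[F] Matrix (Fin 2) (Fin 2) F} :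
    IsOptimal R' O' ψ ↔ ∀ x, x ∈ O' ↔ ∀ i j, ψ x i j ∈ R' := by
  have hinj : Function.Injective ψ := ψ.toRingHom.injective
  rw [IsOptimal, Set.ext_iff]
  constructor
  · intro h x
    have := h (ψ x)
    rw [hinj.mem_set_image] at this
    exact this.symm.trans ⟨fun h => h.2, fun h => ⟨⟨x, rfl⟩, h⟩⟩
  · intro h M
    constructor
    · rintro ⟨⟨x, rfl⟩, hx⟩
      exact ⟨x, (h x).2 hx, rfl⟩
    · rintro ⟨x, hx, rfl⟩
      exact ⟨⟨x, rfl⟩, (h x).1 hx⟩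

end MoebiusGroup

section Lattice

variable {R F K : Type*} [CommRing R] [Field F] [Field K] [Algebra F K] [Algebra R F]
  [Algebra R K] [IsScalarTower R F K]

variable (R) in
/-- The lattice `R τ + R` in `K`. -/
def lat (τ : K) : Submodule R K := Submodule.span R {τ, 1}

lemma mem_lat {τ x : K} : x ∈ lat R τ ↔ ∃ a b : R, x = algebraMap R K a * τ + algebraMap R K b := by
  rw [lat, Submodule.mem_span_pair]
  simp only [Algebra.smul_def, mul_one, eq_comm]

lemma self_mem_lat (τ : K) : τ ∈ lat R τ := Submodule.subset_span (by simp)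

lemma one_mem_lat (τ : K) : (1 : K) ∈ lat R τ := Submodule.subset_span (by simp)

lemma forall_mul_mem_lat_iff {τ x : K} :
    (∀ y ∈ lat R τ, x * y ∈ lat R τ) ↔ x * τ ∈ lat R τ ∧ x ∈ lat R τ := by
  constructor
  · intro h
    exact ⟨h _ (self_mem_lat τ), by simpa using h _ (one_mem_lat τ)⟩
  · rintro ⟨h1, h2⟩ y hy
    obtain ⟨a, b, rfl⟩ := mem_lat.1 hy
    have : x * (algebraMap R K a * τ + algebraMap R K b) = a • (x * τ) + b • x := by
      rw [Algebra.smul_def, Algebra.smul_def]; ring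
    rw [this]
    exact add_mem (Submodule.smul_mem _ _ h1) (Submodule.smul_mem _ _ h2)

/-- The image of `O` in `K` is the ring of multipliers of the lattice `R τ + R`. -/
def IsProper (R O : Type*) {K : Type*} [CommRing R] [CommRing O] [Field K] [Algebra R K]
    [Algebra O K] (τ : K) : Prop :=
  ∀ x : K, x ∈ Set.range (algebraMap O K) ↔ ∀ y ∈ lat R τ, x * y ∈ lat R τ

/-- Optimality of an embedding, read off from its eigenpoint. -/
lemma IsEigenPoint.isOptimal_iff_isProper {O : Type*} [CommRing O] [Algebra O K]
    (hK : Module.finrank F K = 2) {ψ : K →ₐ[F] Matrix (Fin 2) (Fin 2) F} {τ : K}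
    (hτ : IsEigenPoint ψ τ) (R' : Subring F) (hR' : ∀ x, x ∈ R' ↔ x ∈ Set.range (algebraMap R F))
    (O' : Subring K) (hO' : ∀ x, x ∈ O' ↔ x ∈ Set.range (algebraMap O K)) :
    IsOptimal R' O' ψ ↔ IsProper R O τ := by
  rw [isOptimal_iff, IsProper]
  refine forall_congr' fun x => ?_
  rw [hO', forall_mul_mem_lat_iff]
  refine iff_congr Iff.rfl ?_
  have e := isEigenPoint_iff.1 hτ x
  have hmem : ∀ {y : K} {a b : F}, y = algebraMap F K a * τ + algebraMap F K b →
      (y ∈ lat R τ ↔ a ∈ R' ∧ b ∈ R') := by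
    intro y a b hy
    rw [mem_lat, hR', hR']
    constructor
    · rintro ⟨m, n, hmn⟩
      rw [IsScalarTower.algebraMap_apply R F K, IsScalarTower.algebraMap_apply R F K] at hmn
      obtain ⟨rfl, rfl⟩ := coord_ext (hτ.notMem hK) (hy.symm.trans hmn)
      exact ⟨⟨m, rfl⟩, ⟨n, rfl⟩⟩
    · rintro ⟨⟨m, rfl⟩, ⟨n, rfl⟩⟩
      exact ⟨m, n, by
        rw [IsScalarTower.algebraMap_apply R F K, IsScalarTower.algebraMap_apply R F K, hy]⟩
  rw [hmem e.1, hmem e.2]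
  simp only [Fin.forall_fin_two]

variable [IsFractionRing R F]

/-- The primitive quadratic equation of an element of `K ∖ F`. -/
lemma exists_primitive_quadratic [IsDomain R] [IsPrincipalIdealRing R]
    (hK : Module.finrank F K = 2) {τ : K}
    (hτ : τ ∉ Set.range (algebraMap F K)) : ∃ a b c u v w : R,
      algebraMap R K a * τ * τ + algebraMap R K b * τ + algebraMap R K c = 0 ∧
      u * a + v * b + w * c = 1 ∧ a ≠ 0 := by
  obtain ⟨A, B, hAB⟩ := exists_coord hK hτ (τ * τ)
  obtain ⟨m, hm⟩ := IsLocalization.exist_integer_multiples_of_finite (nonZeroDivisors R)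
    (![1, -A, -B] : Fin 3 → F)
  choose n hn using hm
  have hm0 : algebraMap R F m ≠ 0 := by simp
  obtain ⟨d, hd⟩ := (IsPrincipalIdealRing.principal (Ideal.span (Set.range n))).principal
  rw [Ideal.submodule_span_eq] at hd
  have hdvd : ∀ p, ∃ k, n p = d * k := fun p => by
    rw [← dvd_def, ← Ideal.mem_span_singleton, ← hd]
    exact Ideal.subset_span ⟨p, rfl⟩
  choose k hk using hdvd
  have h0 : algebraMap R F d * algebraMap R F (k 0) = algebraMap R F m := by
    have := hn 0; rw [hk, map_mul] at this; simpa [Algebra.smul_def] using this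
  have h1 : algebraMap R F d * algebraMap R F (k 1) = algebraMap R F m * -A := by
    have := hn 1; rw [hk, map_mul] at this; simpa [Algebra.smul_def] using this
  have h2 : algebraMap R F d * algebraMap R F (k 2) = algebraMap R F m * -B := by
    have := hn 2; rw [hk, map_mul] at this; simpa [Algebra.smul_def] using this
  have hd0 : algebraMap R F d ≠ 0 := by
    intro h; rw [h, zero_mul] at h0; exact hm0 h0.symm
  have hd0' : d ≠ 0 := by rintro rfl; simp at hd0
  have hdmem : d ∈ Ideal.span (Set.range n) := by
    rw [hd]; exact Ideal.mem_span_singleton_self d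
  obtain ⟨u, hu⟩ := (Ideal.mem_span_range_iff_exists_fun).1 hdmem
  refine ⟨k 0, k 1, k 2, u 0, u 1, u 2, ?_, ?_, ?_⟩
  · have hd0K : algebraMap R K d ≠ 0 := by
      rw [IsScalarTower.algebraMap_apply R F K]; simpa using hd0
    apply mul_left_cancel₀ hd0K
    have e0 := congrArg (algebraMap F K) h0
    have e1 := congrArg (algebraMap F K) h1
    have e2 := congrArg (algebraMap F K) h2
    simp only [map_mul, map_neg, ← IsScalarTower.algebraMap_apply R F K] at e0 e1 e2
    linear_combination τ * τ * e0 + τ * e1 + e2 + algebraMap R K m * hAB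
  · apply mul_left_cancel₀ hd0'
    rw [Fin.sum_univ_three, hk, hk, hk] at hu
    linear_combination hu
  · intro h
    rw [h, map_zero, mul_zero] at h0
    exact hm0 h0.symm

/-- For a primitive equation `a τ² + b τ + c = 0`, the multiplier ring of `R τ + R` is
`R a τ + R`. -/
lemma forall_mul_mem_lat_iff_of_primitive {τ : K}
    (hτ : τ ∉ Set.range (algebraMap F K)) {a b c u v w : R}
    (h : algebraMap R K a * τ * τ + algebraMap R K b * τ + algebraMap R K c = 0)
    (hp : u * a + v * b + w * c = 1) (x : K) :
    (∀ y ∈ lat R τ, x * y ∈ lat R τ) ↔ x ∈ lat R (algebraMap R K a * τ) := by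
  rw [forall_mul_mem_lat_iff]
  have hinj : Function.Injective (algebraMap R F) := IsFractionRing.injective R F
  constructor
  · rintro ⟨h1, h2⟩
    obtain ⟨p, q, hpq⟩ := mem_lat.1 h1
    obtain ⟨m, n, rfl⟩ := mem_lat.1 h2
    have e : algebraMap F K (algebraMap R F (a * n - m * b)) * τ +
        algebraMap F K (algebraMap R F (-(m * c))) =
        algebraMap F K (algebraMap R F (a * p)) * τ + algebraMap F K (algebraMap R F (a * q)) := by
      simp only [← IsScalarTower.algebraMap_apply R F K, map_sub, map_mul, map_neg]
      linear_combination algebraMap R K a * hpq - algebraMap R K m * h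
    obtain ⟨e1, e2⟩ := coord_ext hτ e
    have e1 := hinj e1
    have e2 := hinj e2
    -- `a` divides `m b` and `m c`, hence `m`
    have hdvd : m = (u * m + v * (n - p) - w * q) * a := by
      linear_combination -m * hp - v * e1 - w * e2
    refine mem_lat.2 ⟨u * m + v * (n - p) - w * q, n, ?_⟩
    rw [← mul_assoc, ← map_mul, ← hdvd]
  · intro hx
    obtain ⟨m, n, rfl⟩ := mem_lat.1 hx
    constructor
    · refine mem_lat.2 ⟨n - m * b, -(m * c), ?_⟩
      simp only [map_sub, map_mul, map_neg]
      linear_combination algebraMap R K m * h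
    · refine mem_lat.2 ⟨m * a, n, ?_⟩
      simp only [map_mul]; ring

/-- A lattice with multiplier ring `R ω + R` is locally principal: at every place one of `1`, `τ`
and `τ - 1` generates `R τ + R`, because one of `a`, `c` and `a + b + c` is a unit. In terms of
matrices, `τ` and `ω = a τ` are equivalent under `GL₂` of the valuation ring. -/
lemma exists_isIntegralGL_moebius_of_primitive {Γ₀ : Type*} [LinearOrderedCommGroupWithZero Γ₀]
    (μ : Valuation F Γ₀) (hμ : ∀ r : R, μ (algebraMap R F r) ≤ 1) {τ : K} {a b c u v w : R}
    (h : algebraMap R K a * τ * τ + algebraMap R K b * τ + algebraMap R K c = 0)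
    (hp : u * a + v * b + w * c = 1) :
    ∃ g : GL (Fin 2) F, IsIntegralGL μ g ∧ Moebius g (algebraMap R K a * τ) τ := by
  have hne : ∀ {r : R}, μ (algebraMap R F r) = 1 → algebraMap R F r ≠ 0 := fun h h0 => by
    rw [h0, map_zero] at h; exact zero_ne_one h
  have hinv : ∀ {r : R}, μ (algebraMap R F r) = 1 → μ (algebraMap R F r)⁻¹ = 1 := fun h => by
    rw [map_inv₀, h, inv_one]
  simp only [IsScalarTower.algebraMap_apply R F K] at h ⊢
  by_cases h1 : μ (algebraMap R F a) = 1
  · have h0 := hne h1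
    have h0' : algebraMap F K (algebraMap R F a) ≠ 0 := by simpa using h0
    have hdet : (!![(algebraMap R F a)⁻¹, 0; 0, 1] : Matrix (Fin 2) (Fin 2) F).det =
      (algebraMap R F a)⁻¹ := by simp [det_fin_two]
    refine ⟨GeneralLinearGroup.mkOfDetNeZero _ (by rw [hdet]; exact inv_ne_zero h0), ⟨?_, ?_⟩, ?_⟩
    · intro i j
      fin_cases i <;> fin_cases j <;> simp [GeneralLinearGroup.mkOfDetNeZero, h1]
    · exact (congrArg μ hdet).trans (hinv h1)
    · simp [Moebius, GeneralLinearGroup.mkOfDetNeZero]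
      field_simp
  by_cases h2 : μ (algebraMap R F c) = 1
  · have h0 := hne h2
    have h0' : algebraMap F K (algebraMap R F c) ≠ 0 := by simpa using h0
    have hdet : (!![0, 1; -(algebraMap R F c)⁻¹, -((algebraMap R F c)⁻¹ * algebraMap R F b)] :
      Matrix (Fin 2) (Fin 2) F).det = (algebraMap R F c)⁻¹ := by simp [det_fin_two]
    refine ⟨GeneralLinearGroup.mkOfDetNeZero _ (by rw [hdet]; exact inv_ne_zero h0), ⟨?_, ?_⟩, ?_⟩
    · intro i j
      fin_cases i <;> fin_cases j <;> simp [GeneralLinearGroup.mkOfDetNeZero, h2, hμ]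
    · exact (congrArg μ hdet).trans (hinv h2)
    · simp [Moebius, GeneralLinearGroup.mkOfDetNeZero]
      field_simp
      linear_combination h
  by_cases h3 : μ (algebraMap R F (a + b + c)) = 1
  · have h0 := hne h3
    have h0' : algebraMap F K (algebraMap R F (a + b + c)) ≠ 0 := (map_ne_zero _).2 h0
    set s := algebraMap R F (a + b + c) with hs
    have hsab : s - algebraMap R F c = algebraMap R F (a + b) := by
      rw [hs, ← map_sub]; congr 1; ring
    have hdet : (!![-s⁻¹, s⁻¹ * algebraMap R F c; -s⁻¹, -(s⁻¹ * algebraMap R F (a + b))] :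
        Matrix (Fin 2) (Fin 2) F).det = s⁻¹ := by
      rw [det_fin_two, ← hsab]; simp; field_simp; ring
    refine ⟨GeneralLinearGroup.mkOfDetNeZero _ (by rw [hdet]; exact inv_ne_zero h0), ⟨?_, ?_⟩, ?_⟩
    · intro i j
      have := hμ c
      have := hμ (a + b)
      fin_cases i <;> fin_cases j <;>
        simp [GeneralLinearGroup.mkOfDetNeZero, h3, hμ, -map_add]
    · exact (congrArg μ hdet).trans (hinv h3)
    · simp [Moebius, GeneralLinearGroup.mkOfDetNeZero]
      field_simp
      linear_combination h
  · exfalso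
    have l1 := lt_of_le_of_ne (hμ a) h1
    have l2 := lt_of_le_of_ne (hμ c) h2
    have l3 := lt_of_le_of_ne (hμ (a + b + c)) h3
    have hb : μ (algebraMap R F b) < 1 := by
      have : algebraMap R F b = algebraMap R F (a + b + c) - algebraMap R F a - algebraMap R F c := by
        rw [map_add, map_add]; ring
      rw [this]
      exact μ.map_sub_lt (μ.map_sub_lt l3 l1) l2
    have hmul : ∀ x y : R, μ (algebraMap R F y) < 1 → μ (algebraMap R F (x * y)) < 1 :=
      fun x y hy => by
        rw [map_mul, map_mul]
        exact (mul_le_mul' (hμ x) le_rfl).trans_lt (by rwa [one_mul])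
    have : μ (algebraMap R F (u * a + v * b + w * c)) < 1 := by
      rw [RingHom.map_add, RingHom.map_add]
      exact μ.map_add_lt (μ.map_add_lt (hmul _ _ l1) (hmul _ _ hb)) (hmul _ _ l2)
    rw [hp, map_one, map_one] at this
    exact lt_irrefl _ this

/-- Two elements of `K ∖ F` whose lattices have the same multiplier ring are equivalent under `GL₂`
of every valuation ring of `F` containing `R`. -/
lemma exists_isIntegralGL_moebius [IsDomain R] [IsPrincipalIdealRing R]
    {O : Type*} [CommRing O] [Algebra O K]
    (hK : Module.finrank F K = 2) {Γ₀ : Type*} [LinearOrderedCommGroupWithZero Γ₀]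
    (μ : Valuation F Γ₀) (hμ : ∀ r : R, μ (algebraMap R F r) ≤ 1) {τ τ₁ : K}
    (hτ : τ ∉ Set.range (algebraMap F K)) (hτ₁ : τ₁ ∉ Set.range (algebraMap F K))
    (hO : IsProper R O τ) (hO₁ : IsProper R O τ₁) :
    ∃ g : GL (Fin 2) F, IsIntegralGL μ g ∧ Moebius g τ τ₁ := by
  obtain ⟨a, b, c, u, v, w, h, hp, ha⟩ := exists_primitive_quadratic (R := R) hK hτ
  obtain ⟨a₁, b₁, c₁, u₁, v₁, w₁, h₁, hp₁, -⟩ := exists_primitive_quadratic (R := R) hK hτ₁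
  have hmem : ∀ x, x ∈ lat R (algebraMap R K a * τ) ↔ x ∈ lat R (algebraMap R K a₁ * τ₁) :=
    fun x => by
      rw [← forall_mul_mem_lat_iff_of_primitive hτ h hp,
        ← forall_mul_mem_lat_iff_of_primitive hτ₁ h₁ hp₁, ← hO, ← hO₁]
  obtain ⟨m, n, hmn⟩ := mem_lat.1 ((hmem _).2 (self_mem_lat (algebraMap R K a₁ * τ₁)))
  obtain ⟨m', n', hmn'⟩ := mem_lat.1 ((hmem _).1 (self_mem_lat (algebraMap R K a * τ)))
  obtain ⟨g, hg, hgm⟩ := exists_isIntegralGL_moebius_of_primitive μ hμ h hp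
  obtain ⟨g₁, hg₁, hgm₁⟩ := exists_isIntegralGL_moebius_of_primitive μ hμ h₁ hp₁
  have hinj : Function.Injective (algebraMap R F) := IsFractionRing.injective R F
  have hunit : m' * m = 1 := by
    apply mul_right_cancel₀ ha
    apply hinj
    refine (coord_ext hτ (b := algebraMap R F (m' * n + n')) (d := algebraMap R F 0) ?_).1
    simp only [← IsScalarTower.algebraMap_apply R F K, map_add, map_mul, map_one, map_zero]
    linear_combination -hmn' - algebraMap R K m' * hmn
  have hm1 : μ (algebraMap R F m) = 1 := by
    refine le_antisymm (hμ m) ?_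
    calc (1 : Γ₀) = μ (algebraMap R F m') * μ (algebraMap R F m) := by
          rw [← map_mul, ← map_mul, hunit, map_one, map_one]
      _ ≤ 1 * μ (algebraMap R F m) := mul_le_mul_left (hμ m') _
      _ = _ := one_mul _
  have hm0 : algebraMap R F m ≠ 0 := by
    intro h0; rw [h0, map_zero] at hm1; exact zero_ne_one hm1
  have hdet : (!![algebraMap R F m, algebraMap R F n; 0, 1] : Matrix (Fin 2) (Fin 2) F).det =
    algebraMap R F m := by simp [det_fin_two]
  let k : GL (Fin 2) F := GeneralLinearGroup.mkOfDetNeZero _ (by rw [hdet]; exact hm0)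
  have hk : IsIntegralGL μ k := by
    refine ⟨?_, (congrArg μ hdet).trans hm1⟩
    intro i j
    fin_cases i <;> fin_cases j <;> simp [k, GeneralLinearGroup.mkOfDetNeZero, hμ]
  have hkm : Moebius k (algebraMap R K a * τ) (algebraMap R K a₁ * τ₁) := by
    simp only [IsScalarTower.algebraMap_apply R F K] at hmn ⊢
    simp [Moebius, k, GeneralLinearGroup.mkOfDetNeZero]
    rw [hmn]
  exact ⟨g₁ * (k * g⁻¹), hg₁.mul (hk.mul hg.inv), (hgm.inv.mul hkm).mul hgm₁⟩

end Lattice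

/-! ### Oriented lattices and the narrow class group -/

/-- `d` is a nonzero element of `F`, positive at every real embedding. -/
def TotPos {F : Type*} [Field F] (d : F) : Prop := d ≠ 0 ∧ ∀ ρ : F →+* ℝ, 0 < ρ d

section TotPos

variable {F : Type*} [Field F]

lemma TotPos.mul {a b : F} (ha : TotPos a) (hb : TotPos b) : TotPos (a * b) :=
  ⟨mul_ne_zero ha.1 hb.1, fun ρ => by rw [map_mul]; exact mul_pos (ha.2 ρ) (hb.2 ρ)⟩

lemma TotPos.of_mul_left {a b : F} (ha : TotPos a) (hab : TotPos (a * b)) : TotPos b :=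
  ⟨right_ne_zero_of_mul hab.1, fun ρ => by
    have := hab.2 ρ
    rw [map_mul] at this
    exact pos_of_mul_pos_right this (ha.2 ρ).le⟩

lemma totPos_one : TotPos (1 : F) := ⟨one_ne_zero, fun ρ => by simp⟩

lemma mem_totallyPositive_iff {x : Fˣ} : x ∈ totallyPositive F ↔ TotPos (x : F) :=
  ⟨fun h => ⟨x.ne_zero, h⟩, fun h => h.2⟩

variable {K : Type*} [Field K] [Algebra F K]

/-- The norm of a totally positive element is totally positive: at a real embedding which does not
extend to `K` the norm is a sum of two squares. -/
lemma TotPos.norm_of_extends {σ : K ≃ₐ[F] K} {x : K} {n : F} (hx : TotPos x)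
    (hn : x * σ x = algebraMap F K n)
    (hext : ∀ ρ₀ : F →+* ℝ, ¬ 0 < ρ₀ n → ∃ ρ : K →+* ℝ, ρ.comp (algebraMap F K) = ρ₀) :
    TotPos n := by
  refine ⟨?_, fun ρ₀ => ?_⟩
  · rintro rfl
    rw [map_zero] at hn
    exact mul_ne_zero hx.1 ((map_ne_zero σ).2 hx.1) hn
  · by_contra h
    obtain ⟨ρ, rfl⟩ := hext ρ₀ h
    refine h ?_
    rw [RingHom.comp_apply, ← hn, map_mul]
    exact mul_pos (hx.2 ρ) (hx.2 (ρ.comp (σ : K →+* K)))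

/-- A real embedding of `F` at which the discriminant of an element of `K ∖ F` is nonnegative extends
to `K`. -/
lemma exists_comp_eq_of_disc_nonneg (hK : Module.finrank F K = 2) {x : K}
    (hx : x ∉ Set.range (algebraMap F K)) {t n : F}
    (hq : x * x = algebraMap F K t * x - algebraMap F K n) (ρ₀ : F →+* ℝ)
    (hd : 0 ≤ ρ₀ (t * t - 4 * n)) : ∃ ρ : K →+* ℝ, ρ.comp (algebraMap F K) = ρ₀ := by
  open Polynomial in
  let _ := ρ₀.toAlgebra
  have : FiniteDimensional F K := Module.finite_of_finrank_pos (by omega)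
  let q : F[X] := X ^ 2 - C t * X + C n
  set s := Real.sqrt (ρ₀ (t * t - 4 * n)) with hs
  have hs2 : s * s = ρ₀ t * ρ₀ t - 4 * ρ₀ n := by
    rw [hs, Real.mul_self_sqrt hd, map_sub, map_mul, map_mul, map_ofNat]
  have hfac : q.map ρ₀ = (X - C ((ρ₀ t + s) / 2)) * (X - C ((ρ₀ t - s) / 2)) := by
    simp only [q, Polynomial.map_add, Polynomial.map_sub, Polynomial.map_pow, Polynomial.map_mul,
      map_X, map_C]
    have e1 : C (ρ₀ t) = C ((ρ₀ t + s) / 2) + C ((ρ₀ t - s) / 2) := by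
      rw [← C_add]; congr 1; ring
    have e2 : C (ρ₀ n) = C ((ρ₀ t + s) / 2) * C ((ρ₀ t - s) / 2) := by
      rw [← C_mul]; congr 1; linear_combination (1 / 4 : ℝ) * hs2
    rw [e1, e2]; ring
  have hsp : (q.map ρ₀).Splits := by
    rw [hfac]; exact (Splits.X_sub_C _).mul (Splits.X_sub_C _)
  have hq0 : q.map ρ₀ ≠ 0 := by
    rw [hfac]; exact mul_ne_zero (X_sub_C_ne_zero _) (X_sub_C_ne_zero _)
  have haev : aeval x q = 0 := by
    simp only [q, map_add, map_sub, map_mul, map_pow, aeval_X, aeval_C]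
    linear_combination hq
  have hadj : IntermediateField.adjoin F {x} = ⊤ := by
    rw [eq_top_iff]
    intro y _
    obtain ⟨a, b, rfl⟩ := exists_coord hK hx y
    exact add_mem (mul_mem (algebraMap_mem _ _) (IntermediateField.mem_adjoin_simple_self F x))
      (algebraMap_mem _ _)
  obtain ⟨f⟩ := IntermediateField.nonempty_algHom_of_adjoin_splits (K := ℝ) (S := {x})
    (fun y hy => by
      obtain rfl := Set.mem_singleton_iff.1 hy
      exact ⟨IsIntegral.of_finite F y,
        hsp.of_dvd hq0 (Polynomial.map_dvd _ (minpoly.dvd F y haev))⟩) hadj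
  exact ⟨f, RingHom.ext fun y => f.commutes y⟩

lemma TotPos.norm [CharZero F] (hK : Module.finrank F K = 2) {σ : K ≃ₐ[F] K} (hσ : σ ≠ 1) {x : K}
    {n : F} (hx : TotPos x) (hn : x * σ x = algebraMap F K n) : TotPos n := by
  refine hx.norm_of_extends hn fun ρ₀ h => ?_
  obtain ⟨t, ht⟩ := exists_trace hK hσ x
  by_cases hxF : x ∈ Set.range (algebraMap F K)
  · -- the norm of an element of `F` is a square
    obtain ⟨y, rfl⟩ := hxF
    rw [AlgEquiv.commutes, ← map_mul] at hn
    have hy : y ≠ 0 := fun hy => hx.1 (by rw [hy, map_zero])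
    rw [← (algebraMap F K).injective hn, map_mul] at h
    exact absurd (mul_self_pos.2 ((map_ne_zero ρ₀).2 hy)) h
  · refine exists_comp_eq_of_disc_nonneg hK hxF (t := t) (n := n) ?_ ρ₀ ?_
    · rw [ht, ← hn]; ring
    · rw [map_sub, map_mul, map_mul, map_ofNat]
      nlinarith [mul_self_nonneg (ρ₀ t)]

/-- If `F` has elements of all signs, in the sense of `hU`, an element with totally positive norm
can be made totally positive: it has the sign of its trace at every real embedding. -/
lemma exists_totPos_smul [CharZero F] {R : Type*} [CommRing R] [Algebra R F]
    (hK : Module.finrank F K = 2) {σ : K ≃ₐ[F] K} (hσ : σ ≠ 1)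
    (hU : ∀ a : F, a ≠ 0 → ∃ ε : Rˣ, TotPos (algebraMap R F ε * a)) {x : K} {n : F} (hn : TotPos n)
    (hx : x * σ x = algebraMap F K n) :
    ∃ ε : Rˣ, TotPos (algebraMap F K (algebraMap R F ε) * x) := by
  have hx0 : x ≠ 0 := by
    rintro rfl
    rw [zero_mul, eq_comm, map_eq_zero] at hx
    exact hn.1 hx
  obtain ⟨t, ht⟩ := exists_trace hK hσ x
  have hpos : ∀ ρ : K →+* ℝ, 0 < ρ x * ρ (σ x) := fun ρ => by
    rw [← map_mul, hx]
    exact hn.2 (ρ.comp (algebraMap F K))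
  by_cases ht0 : t = 0
  · -- the trace can only vanish if `K` has no real embedding
    refine ⟨1, by simpa using hx0, fun ρ => ?_⟩
    have h1 : ρ x + ρ (σ x) = 0 := by rw [← map_add, ← ht, ht0, map_zero, map_zero]
    have h2 := hpos ρ
    rw [eq_neg_of_add_eq_zero_right h1] at h2
    nlinarith [mul_self_nonneg (ρ x)]
  · obtain ⟨ε, hε⟩ := hU t ht0
    refine ⟨ε, mul_ne_zero ?_ hx0, fun ρ => ?_⟩
    · exact (map_ne_zero _).2 (left_ne_zero_of_mul hε.1)
    · have h1 := hε.2 (ρ.comp (algebraMap F K))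
      rw [map_mul, RingHom.comp_apply, RingHom.comp_apply, ht, map_add] at h1
      rw [map_mul]
      set e := ρ (algebraMap F K (algebraMap R F ε))
      have h2 := hpos ρ
      by_contra h3
      rcases lt_trichotomy (ρ x) 0 with h4 | h4 | h4
      · have : ρ (σ x) < 0 := by
          by_contra h; nlinarith
        have : 0 ≤ e := by by_contra h; nlinarith
        nlinarith
      · rw [h4, zero_mul] at h2; exact lt_irrefl _ h2
      · have : 0 < ρ (σ x) := pos_of_mul_pos_right h2 h4.le
        have : e ≤ 0 := by by_contra h; nlinarith
        nlinarith

end TotPos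

section OrientedBasis

variable {R O F K : Type*} [CommRing R] [CommRing O] [Field F] [Field K] [Algebra F K]
  [Algebra R K] [Algebra O K]

/-- `ω₁, ω₂` is an `R`-basis of `I`, and `ω₁ σ(ω₂) - σ(ω₁) ω₂` is a totally positive multiple of
`τ₀ - σ(τ₀)`: the basis is oriented like `τ₀, 1`. -/
structure IsOrientedBasis (R : Type*) {O F K : Type*} [CommRing R] [CommRing O] [Field F] [Field K]
    [Algebra F K] [Algebra R K] [Algebra O K] (σ : K ≃ₐ[F] K) (τ₀ : K) (I : Submodule O K)
    (ω₁ ω₂ : K) : Prop where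
  mem_iff : ∀ x, x ∈ I ↔ ∃ a b : R, x = algebraMap R K a * ω₁ + algebraMap R K b * ω₂
  oriented : ∃ d : F, TotPos d ∧ ω₁ * σ ω₂ - σ ω₁ * ω₂ = algebraMap F K d * (τ₀ - σ τ₀)

lemma eq_zero_of_pair {σ : K ≃ₐ[F] K} {ω₁ ω₂ : K} (h : ω₁ * σ ω₂ - σ ω₁ * ω₂ ≠ 0) {a b : F}
    (hab : algebraMap F K a * ω₁ + algebraMap F K b * ω₂ = 0) : a = 0 ∧ b = 0 := by
  have hc := congrArg σ hab
  simp only [map_add, map_mul, AlgEquiv.commutes, map_zero] at hc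
  have h1 : algebraMap F K a * (ω₁ * σ ω₂ - σ ω₁ * ω₂) = 0 := by
    linear_combination σ ω₂ * hab - ω₂ * hc
  have h2 : algebraMap F K b * (ω₁ * σ ω₂ - σ ω₁ * ω₂) = 0 := by
    linear_combination ω₁ * hc - σ ω₁ * hab
  constructor
  · simpa using (mul_eq_zero.1 h1).resolve_right h
  · simpa using (mul_eq_zero.1 h2).resolve_right h

variable {σ : K ≃ₐ[F] K} {τ₀ : K} {I J : Submodule O K} {ω₁ ω₂ η₁ η₂ : K}

lemma IsOrientedBasis.ne_zero (hτ₀ : τ₀ - σ τ₀ ≠ 0) (h : IsOrientedBasis R σ τ₀ I ω₁ ω₂) :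
    ω₁ * σ ω₂ - σ ω₁ * ω₂ ≠ 0 := by
  obtain ⟨d, hd, e⟩ := h.oriented
  rw [e]
  exact mul_ne_zero ((map_ne_zero _).2 hd.1) hτ₀

lemma IsOrientedBasis.right_ne_zero (hτ₀ : τ₀ - σ τ₀ ≠ 0) (h : IsOrientedBasis R σ τ₀ I ω₁ ω₂) :
    ω₂ ≠ 0 := by
  rintro rfl
  exact h.ne_zero hτ₀ (by simp)

variable [Algebra R F] [IsScalarTower R F K]

lemma pair_ext [IsFractionRing R F] (h : ω₁ * σ ω₂ - σ ω₁ * ω₂ ≠ 0)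
    {a b c d : R} (hab : algebraMap R K a * ω₁ + algebraMap R K b * ω₂ =
      algebraMap R K c * ω₁ + algebraMap R K d * ω₂) : a = c ∧ b = d := by
  have hinj : Function.Injective (algebraMap R F) := IsFractionRing.injective R F
  have := eq_zero_of_pair h (a := algebraMap R F (a - c)) (b := algebraMap R F (b - d)) (by
    rw [← IsScalarTower.algebraMap_apply R F K, ← IsScalarTower.algebraMap_apply R F K, map_sub,
      map_sub]
    linear_combination hab)
  rw [map_eq_zero_iff _ hinj, map_eq_zero_iff _ hinj, sub_eq_zero, sub_eq_zero] at this
  exact this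

/-- `τ₁` is the image of `τ` under a matrix in `GL₂(R)` with totally positive determinant. -/
def PosEquiv (R F : Type*) {K : Type*} [CommRing R] [Field F] [Field K] [Algebra F K] [Algebra R F]
    (τ τ₁ : K) : Prop :=
  ∃ γ : GL (Fin 2) R, TotPos (algebraMap R F γ.det.val) ∧
    Moebius (GeneralLinearGroup.map (algebraMap R F) γ) τ τ₁

/-- The points `τ` of `K` such that `R τ + R` has multiplier ring `O` and some multiple of the basis
`τ, 1` is oriented. -/
def orientedPoints (R O : Type*) {F K : Type*} [CommRing R] [CommRing O] [Field F] [Field K]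
    [Algebra F K] [Algebra R K] [Algebra O K] (σ : K ≃ₐ[F] K) (τ₀ : K) : Set K :=
  {τ | IsProper R O τ ∧ ∃ (ξ : K) (d : F), TotPos d ∧
    ξ * σ ξ * (τ - σ τ) = algebraMap F K d * (τ₀ - σ τ₀)}

lemma IsProper.exists_algebraMap_eq {τ : K} (h : IsProper R O τ) (r : R) :
    ∃ o : O, algebraMap O K o = algebraMap R K r :=
  (h _).2 fun y hy => by
    rw [← Algebra.smul_def]; exact Submodule.smul_mem _ _ hy

lemma IsProper.mul_mem {τ : K} (h : IsProper R O τ) (r : R) {x : K} (hx : x ∈ I) :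
    algebraMap R K r * x ∈ I := by
  obtain ⟨o, ho⟩ := h.exists_algebraMap_eq r
  rw [← ho, ← Algebra.smul_def]
  exact I.smul_mem _ hx

/-- The orientation form is multiplied by the determinant under a change of basis, and by the norm of
`x` under multiplication by `x`. -/
lemma orient_linear {a b c d : R} {ω₁ ω₂ x : K} :
    x * (algebraMap R K a * ω₁ + algebraMap R K b * ω₂) *
        σ (x * (algebraMap R K c * ω₁ + algebraMap R K d * ω₂)) -
      σ (x * (algebraMap R K a * ω₁ + algebraMap R K b * ω₂)) *
        (x * (algebraMap R K c * ω₁ + algebraMap R K d * ω₂)) =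
    algebraMap R K (a * d - b * c) * (x * σ x) * (ω₁ * σ ω₂ - σ ω₁ * ω₂) := by
  have hσ : ∀ r : R, σ (algebraMap R K r) = algebraMap R K r := fun r => by
    rw [IsScalarTower.algebraMap_apply R F K, AlgEquiv.commutes]
  simp only [map_add, map_mul, map_sub, hσ]
  ring

/-- Lattices in the same narrow class give equivalent points. -/
lemma IsOrientedBasis.posEquiv [IsFractionRing R F] (hτ₀ : τ₀ - σ τ₀ ≠ 0)
    (hω : IsOrientedBasis R σ τ₀ I ω₁ ω₂) (hη : IsOrientedBasis R σ τ₀ J η₁ η₂) {x : K} {n : F}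
    (hn : TotPos n) (hx : x * σ x = algebraMap F K n) (hJ : ∀ y, y ∈ J ↔ ∃ z ∈ I, y = x * z) :
    PosEquiv R F (ω₁ / ω₂) (η₁ / η₂) := by
  have hx0 : x ≠ 0 := by
    rintro rfl
    rw [zero_mul, eq_comm, map_eq_zero] at hx
    exact hn.1 hx
  have hmem : ∀ (y : K) (a b : R), y = algebraMap R K a * η₁ + algebraMap R K b * η₂ →
      ∃ c d : R, y = x * (algebraMap R K c * ω₁ + algebraMap R K d * ω₂) := fun y a b h => by
    obtain ⟨z, hz, e⟩ := (hJ y).1 ((hη.mem_iff y).2 ⟨a, b, h⟩)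
    obtain ⟨c, d, rfl⟩ := (hω.mem_iff z).1 hz
    exact ⟨c, d, e⟩
  have hmem' : ∀ (z : K) (a b : R), z = algebraMap R K a * ω₁ + algebraMap R K b * ω₂ →
      ∃ c d : R, x * z = algebraMap R K c * η₁ + algebraMap R K d * η₂ := fun z a b h =>
    (hη.mem_iff _).1 ((hJ _).2 ⟨z, (hω.mem_iff z).2 ⟨a, b, h⟩, rfl⟩)
  obtain ⟨a, b, h1⟩ := hmem η₁ 1 0 (by simp)
  obtain ⟨c, d, h2⟩ := hmem η₂ 0 1 (by simp)
  obtain ⟨a', b', h1'⟩ := hmem' ω₁ 1 0 (by simp)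
  obtain ⟨c', d', h2'⟩ := hmem' ω₂ 0 1 (by simp)
  have hD := hω.ne_zero hτ₀
  have hM : !![a', b'; c', d'] * !![a, b; c, d] = 1 := by
    have e1 := pair_ext (R := R) hD (a := a' * a + b' * c) (b := a' * b + b' * d) (c := 1) (d := 0)
      (mul_left_cancel₀ hx0 (by
        simp only [map_add, map_mul, map_one, map_zero]
        linear_combination -h1' - algebraMap R K a' * h1 - algebraMap R K b' * h2))
    have e2 := pair_ext (R := R) hD (a := c' * a + d' * c) (b := c' * b + d' * d) (c := 0) (d := 1)
      (mul_left_cancel₀ hx0 (by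
        simp only [map_add, map_mul, map_one, map_zero]
        linear_combination -h2' - algebraMap R K c' * h1 - algebraMap R K d' * h2))
    ext i j
    fin_cases i <;> fin_cases j <;> simp [Matrix.mul_apply, e1.1, e1.2, e2.1, e2.2]
  let γ : GL (Fin 2) R := ⟨!![a, b; c, d], !![a', b'; c', d'], _root_.mul_eq_one_comm.1 hM, hM⟩
  have hdet : γ.det.val = a * d - b * c := by
    change Matrix.det !![a, b; c, d] = _
    rw [det_fin_two_of]
  refine ⟨γ, ?_, ?_⟩
  · obtain ⟨d₁, hd₁, e₁⟩ := hω.oriented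
    obtain ⟨d₂, hd₂, e₂⟩ := hη.oriented
    refine TotPos.of_mul_left (hn.mul hd₁) ?_
    have : n * d₁ * algebraMap R F γ.det.val = d₂ := by
      apply (algebraMap F K).injective
      apply mul_right_cancel₀ hτ₀
      rw [← e₂, h1, h2, orient_linear, e₁, hx, hdet, map_mul, map_mul,
        ← IsScalarTower.algebraMap_apply R F K]
      ring
    rwa [this]
  · have hω0 := hω.right_ne_zero hτ₀
    have hη0 := hη.right_ne_zero hτ₀
    have key : (algebraMap R K a * ω₁ + algebraMap R K b * ω₂) * η₂ =
        η₁ * (algebraMap R K c * ω₁ + algebraMap R K d * ω₂) := by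
      rw [h1, h2]; ring
    change algebraMap F K (algebraMap R F a) * _ + algebraMap F K (algebraMap R F b) =
      _ * (algebraMap F K (algebraMap R F c) * _ + algebraMap F K (algebraMap R F d))
    simp only [← IsScalarTower.algebraMap_apply R F K]
    field_simp
    linear_combination key

/-- Equivalent points come from lattices which differ by an element of totally positive norm. -/
lemma IsOrientedBasis.exists_of_posEquiv (hτ₀ : τ₀ - σ τ₀ ≠ 0)
    (hω : IsOrientedBasis R σ τ₀ I ω₁ ω₂) (hη : IsOrientedBasis R σ τ₀ J η₁ η₂)
    (h : PosEquiv R F (ω₁ / ω₂) (η₁ / η₂)) (hN : ∀ x : K, ∃ n : F, algebraMap F K n = x * σ x) :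
    ∃ (x : K) (n : F), TotPos n ∧ x * σ x = algebraMap F K n ∧
      ∀ y, y ∈ J ↔ ∃ z ∈ I, y = x * z := by
  obtain ⟨γ, hdet, hγ⟩ := h
  have hω0 := hω.right_ne_zero hτ₀
  have hη0 := hη.right_ne_zero hτ₀
  have hD := hω.ne_zero hτ₀
  set a := γ 0 0 with ha
  set b := γ 0 1 with hb
  set c := γ 1 0 with hc
  set d := γ 1 1 with hd
  have hdet' : γ.det.val = a * d - b * c := by
    rw [GeneralLinearGroup.val_det_apply, det_fin_two]
  have hγ' : (algebraMap R K a * (ω₁ / ω₂) + algebraMap R K b) =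
      η₁ / η₂ * (algebraMap R K c * (ω₁ / ω₂) + algebraMap R K d) := by
    have := hγ
    simp only [IsScalarTower.algebraMap_apply R F K]
    exact this
  set ζ₁ := algebraMap R K a * ω₁ + algebraMap R K b * ω₂ with hζ₁
  set ζ₂ := algebraMap R K c * ω₁ + algebraMap R K d * ω₂ with hζ₂
  have key : ζ₁ * η₂ = η₁ * ζ₂ := by
    rw [hζ₁, hζ₂]; field_simp at hγ'; linear_combination hγ'
  have horient : ζ₁ * σ ζ₂ - σ ζ₁ * ζ₂ =
      algebraMap R K (a * d - b * c) * (ω₁ * σ ω₂ - σ ω₁ * ω₂) := by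
    have := orient_linear (R := R) (σ := σ) (a := a) (b := b) (c := c) (d := d) (ω₁ := ω₁)
      (ω₂ := ω₂) (x := 1)
    simpa only [one_mul, map_one, mul_one] using this
  have hζ0 : ζ₂ ≠ 0 := by
    intro h0
    rw [h0] at horient
    refine mul_ne_zero ?_ hD (horient.symm.trans (by simp))
    rw [← hdet', IsScalarTower.algebraMap_apply R F K]
    exact (map_ne_zero _).2 hdet.1
  obtain ⟨x, hη₁, hη₂⟩ : ∃ x, η₁ = x * ζ₁ ∧ η₂ = x * ζ₂ :=
    ⟨η₂ / ζ₂, by field_simp; linear_combination -key, by field_simp⟩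
  obtain ⟨n, hn⟩ := hN x
  refine ⟨x, n, ?_, hn.symm, fun y => ?_⟩
  · obtain ⟨d₁, hd₁, e₁⟩ := hω.oriented
    obtain ⟨d₂, hd₂, e₂⟩ := hη.oriented
    refine TotPos.of_mul_left (hdet.mul hd₁) ?_
    have : algebraMap R F γ.det.val * d₁ * n = d₂ := by
      apply (algebraMap F K).injective
      apply mul_right_cancel₀ hτ₀
      rw [← e₂, hη₁, hη₂, map_mul, map_mul, hn, map_mul, map_mul,
        ← IsScalarTower.algebraMap_apply R F K, hdet']
      linear_combination - algebraMap R K (a * d - b * c) * (x * σ x) * e₁ - (x * σ x) * horient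
    rwa [this]
  · -- the rows of `γ⁻¹` express `ω₁, ω₂` in terms of `ζ₁, ζ₂`
    have hinv : algebraMap R K ((γ.det⁻¹ : Rˣ) : R) * algebraMap R K (a * d - b * c) = 1 := by
      rw [← hdet', ← map_mul, Units.inv_mul, map_one]
    rw [hη.mem_iff]
    constructor
    · rintro ⟨r, s, rfl⟩
      refine ⟨algebraMap R K r * ζ₁ + algebraMap R K s * ζ₂, ?_, ?_⟩
      · refine (hω.mem_iff _).2 ⟨r * a + s * c, r * b + s * d, ?_⟩
        simp only [map_add, map_mul, hζ₁, hζ₂]; ring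
      · rw [mul_add]
        linear_combination algebraMap R K r * hη₁ + algebraMap R K s * hη₂
    · rintro ⟨z, hz, rfl⟩
      obtain ⟨r, s, rfl⟩ := (hω.mem_iff z).1 hz
      refine ⟨((γ.det⁻¹ : Rˣ) : R) * (r * d - s * c), ((γ.det⁻¹ : Rˣ) : R) * (s * a - r * b), ?_⟩
      simp only [map_mul, map_sub] at hinv ⊢
      set e := algebraMap R K ((γ.det⁻¹ : Rˣ) : R)
      rw [hη₁, hη₂, hζ₁, hζ₂]
      linear_combination (-x) * (algebraMap R K r * ω₁ + algebraMap R K s * ω₂) * hinv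

end OrientedBasis

section OrientedPoints

variable {R O F K : Type*} [CommRing R] [CommRing O] [Field F] [Field K] [Algebra F K]
  [Algebra R K] [Algebra O K]

variable {σ : K ≃ₐ[F] K} {τ₀ : K}

/-- The multiplier ring of an invertible `O`-submodule is `O`. -/
lemma mem_range_of_mul_mem (I : (Submodule O K)ˣ) {x : K}
    (h : ∀ y ∈ (I : Submodule O K), x * y ∈ (I : Submodule O K)) :
    x ∈ Set.range (algebraMap O K) := by
  have key : ∀ y ∈ (I : Submodule O K) * (I⁻¹ : (Submodule O K)ˣ), x * y ∈
      (I : Submodule O K) * ((I⁻¹ : (Submodule O K)ˣ) : Submodule O K) := fun y hy => by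
    refine Submodule.mul_induction_on hy (fun m hm n hn => ?_) (fun a b ha hb => ?_)
    · rw [← mul_assoc]
      exact Submodule.mul_mem_mul (h m hm) hn
    · rw [mul_add]; exact add_mem ha hb
  rw [Units.mul_inv] at key
  have := key 1 (Submodule.mem_one.2 ⟨1, map_one _⟩)
  rw [mul_one] at this
  exact Submodule.mem_one.1 this

/-- The quotient of an oriented basis of an invertible submodule is an oriented point. -/
lemma IsOrientedBasis.div_mem (hτ₀ : τ₀ - σ τ₀ ≠ 0) {I : (Submodule O K)ˣ} {ω₁ ω₂ : K}
    (h : IsOrientedBasis R σ τ₀ (I : Submodule O K) ω₁ ω₂) :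
    ω₁ / ω₂ ∈ orientedPoints R O σ τ₀ := by
  have h0 := h.right_ne_zero hτ₀
  have hmem : ∀ y, y ∈ lat R (ω₁ / ω₂) ↔ y * ω₂ ∈ (I : Submodule O K) := fun y => by
    rw [mem_lat, h.mem_iff]
    refine exists_congr fun a => exists_congr fun b => ?_
    field_simp
  refine ⟨fun x => ⟨?_, fun hx => mem_range_of_mul_mem I fun y hy => ?_⟩, ω₂, ?_⟩
  · rintro ⟨o, rfl⟩ y hy
    rw [hmem] at hy ⊢
    rw [mul_assoc, ← Algebra.smul_def]
    exact Submodule.smul_mem _ _ hy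
  · have := (hmem _).1 (hx (y / ω₂) ((hmem _).2 (by rwa [div_mul_cancel₀ _ h0])))
    rwa [mul_assoc, div_mul_cancel₀ _ h0] at this
  · obtain ⟨d, hd, e⟩ := h.oriented
    refine ⟨d, hd, ?_⟩
    rw [← e, map_div₀]
    have : σ ω₂ ≠ 0 := (map_ne_zero σ).2 h0
    field_simp

variable [Algebra R F] [IsScalarTower R F K]
variable [IsDomain R] [IsPrincipalIdealRing R] [IsFractionRing R F]

/-- An invertible submodule is a lattice: it is finitely generated over `O`, which is itself finitely
generated over `R`. -/
lemma exists_basis (hK : Module.finrank F K = 2) (hτ₀ : τ₀ ∉ Set.range (algebraMap F K))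
    (hP : IsProper R O τ₀) (I : (Submodule O K)ˣ) : ∃ ω₁ ω₂ : K,
      ω₂ ≠ 0 ∧ ω₁ / ω₂ ∉ Set.range (algebraMap F K) ∧
      ∀ x, x ∈ (I : Submodule O K) ↔
        ∃ a b : R, x = algebraMap R K a * ω₁ + algebraMap R K b * ω₂ := by
  have hinj : Function.Injective (algebraMap R F) := IsFractionRing.injective R F
  have : Module.IsTorsionFree R F := inferInstance
  obtain ⟨a, b, c, u, v, w, h, hp, ha⟩ := exists_primitive_quadratic (R := R) hK hτ₀
  set θ := algebraMap R K a * τ₀ with hθ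
  have hO : ∀ x, x ∈ Set.range (algebraMap O K) ↔ x ∈ lat R θ := fun x => by
    rw [hP, forall_mul_mem_lat_iff_of_primitive hτ₀ h hp]
  let M : Submodule R K :=
    { carrier := (I : Submodule O K)
      add_mem' := fun hx hy => add_mem hx hy
      zero_mem' := zero_mem _
      smul_mem' := fun r x hx => by
        rw [Algebra.smul_def]; exact hP.mul_mem r hx }
  have hM : ∀ x, x ∈ M ↔ x ∈ (I : Submodule O K) := fun x => Iff.rfl
  obtain ⟨s, hs⟩ := Submodule.fg_unit I
  have hfg : M.FG := by
    have hMeq : M = lat R θ * Submodule.span R (s : Set K) := by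
      apply le_antisymm
      · intro x hx
        rw [hM, ← hs] at hx
        induction hx using Submodule.span_induction with
        | mem x hx =>
          rw [← one_mul x]
          exact Submodule.mul_mem_mul (one_mem_lat θ) (Submodule.subset_span hx)
        | zero => exact zero_mem _
        | add x y _ _ hx hy => exact add_mem hx hy
        | smul o x _ hx =>
          have hmul : lat R θ * lat R θ ≤ lat R θ := by
            rw [Submodule.mul_le]
            intro m hm n hn
            obtain ⟨o, rfl⟩ := (hO m).2 hm
            obtain ⟨o', rfl⟩ := (hO n).2 hn
            exact (hO _).1 ⟨o * o', map_mul _ _ _⟩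
          rw [Algebra.smul_def]
          have := Submodule.mul_mem_mul ((hO _).1 ⟨o, rfl⟩) hx
          rw [← mul_assoc] at this
          exact mul_le_mul' hmul le_rfl this
      · rw [Submodule.mul_le]
        intro m hm n hn
        obtain ⟨o, rfl⟩ := (hO m).2 hm
        have hle : Submodule.span R (s : Set K) ≤ M :=
          Submodule.span_le.2 fun x hx => by
            change x ∈ (I : Submodule O K)
            rw [← hs]; exact Submodule.subset_span hx
        have := hle hn
        rw [← Algebra.smul_def]
        exact (I : Submodule O K).smul_mem o this
    rw [hMeq]
    exact (Submodule.fg_span (by simp)).mul ⟨s, rfl⟩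
  have haK : algebraMap R K a ≠ 0 := by
    rw [IsScalarTower.algebraMap_apply R F K]
    exact (map_ne_zero _).2 ((map_ne_zero_iff _ hinj).2 ha)
  have hθF : θ ∉ Set.range (algebraMap F K) := by
    rintro ⟨y, hy⟩
    refine hτ₀ ⟨y / algebraMap R F a, ?_⟩
    rw [map_div₀, hy, ← IsScalarTower.algebraMap_apply R F K, hθ]
    field_simp
  have hspan : Submodule.span F (M : Set K) = ⊤ := by
    have hne : ∃ x ∈ (I : Submodule O K), x ≠ 0 := by
      by_contra! hcon
      have hbot : (I : Submodule O K) = ⊥ := (Submodule.eq_bot_iff _).2 hcon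
      have := I.mul_inv
      rw [hbot, Submodule.bot_mul] at this
      have h1 : (1 : K) ∈ (⊥ : Submodule O K) := by
        rw [this]; exact Submodule.mem_one.2 ⟨1, map_one _⟩
      exact one_ne_zero ((Submodule.mem_bot O).1 h1)
    obtain ⟨x, hx, hx0⟩ := hne
    rw [eq_top_iff]
    intro y _
    obtain ⟨p, q, hpq⟩ := exists_coord hK hθF (y / x)
    have : y = p • (θ * x) + q • x := by
      rw [div_eq_iff hx0] at hpq
      rw [Algebra.smul_def, Algebra.smul_def, hpq]; ring
    rw [this]
    refine add_mem (Submodule.smul_mem _ _ (Submodule.subset_span ?_))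
      (Submodule.smul_mem _ _ (Submodule.subset_span hx))
    obtain ⟨o, ho⟩ := (hO θ).2 (self_mem_lat θ)
    rw [← ho, ← Algebra.smul_def]
    exact (I : Submodule O K).smul_mem o hx
  have hlat : Submodule.IsLattice F M := ⟨hfg, hspan⟩
  have hrank : Module.finrank R M = 2 := by
    exact (congrArg Cardinal.toNat (Submodule.IsLattice.rank' F M)).trans hK
  let B := Module.finBasisOfFinrankEq R M hrank
  have hli := (B.extendOfIsLattice F).linearIndependent
  have hB0 : (B 1 : K) ≠ 0 := fun h0 => B.ne_zero 1 (Subtype.ext h0)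
  refine ⟨B 0, B 1, hB0, ?_, fun x => ⟨fun hx => ?_, ?_⟩⟩
  · rintro ⟨f, hf⟩
    have e : ⇑(B.extendOfIsLattice F) = ![(B 0 : K), B 1] := by
      funext i
      fin_cases i <;> simp
    rw [e, LinearIndependent.pair_iff] at hli
    have := (hli 1 (-f) (by
      rw [one_smul, Algebra.smul_def, map_neg, hf]; field_simp; ring)).1
    exact one_ne_zero this
  · have := congrArg Subtype.val (B.sum_repr ⟨x, hx⟩)
    rw [Fin.sum_univ_two] at this
    refine ⟨B.repr ⟨x, hx⟩ 0, B.repr ⟨x, hx⟩ 1, ?_⟩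
    rw [← Algebra.smul_def, ← Algebra.smul_def]
    exact this.symm
  · rintro ⟨a, b, rfl⟩
    exact add_mem (hP.mul_mem a (B 0).2) (hP.mul_mem b (B 1).2)

/-- Every invertible submodule has an oriented basis: a unit of `R` corrects the signs of an arbitrary
basis at all real embeddings. -/
lemma exists_isOrientedBasis [CharZero F] (hK : Module.finrank F K = 2) (hσ : σ ≠ 1)
    (hU : ∀ a : F, a ≠ 0 → ∃ ε : Rˣ, TotPos (algebraMap R F ε * a))
    (hτ₀ : τ₀ ∉ Set.range (algebraMap F K)) (hP : IsProper R O τ₀) (I : (Submodule O K)ˣ) :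
    ∃ ω₁ ω₂ : K, IsOrientedBasis R σ τ₀ (I : Submodule O K) ω₁ ω₂ := by
  obtain ⟨ω₁, ω₂, h0, hF, hmem⟩ := exists_basis hK hτ₀ hP I
  have hne : τ₀ - σ τ₀ ≠ 0 := fun h =>
    hτ₀ ((conj_eq_self_iff hK hσ).1 (sub_eq_zero.1 h).symm)
  have hσ0 : σ ω₂ ≠ 0 := (map_ne_zero σ).2 h0
  have hD : ω₁ * σ ω₂ - σ ω₁ * ω₂ ≠ 0 := fun h => by
    refine hF ((conj_eq_self_iff hK hσ).1 ?_)
    rw [map_div₀, div_eq_div_iff hσ0 h0]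
    linear_combination -h
  have hne' : σ τ₀ - τ₀ ≠ 0 := fun h => hne (by linear_combination -h)
  obtain ⟨q, hq⟩ : (ω₁ * σ ω₂ - σ ω₁ * ω₂) / (τ₀ - σ τ₀) ∈ Set.range (algebraMap F K) := by
    refine (conj_eq_self_iff hK hσ).1 ?_
    rw [map_div₀, map_sub, map_sub, map_mul, map_mul, conj_conj hK, conj_conj hK, conj_conj hK,
      div_eq_div_iff hne' hne]
    ring
  rw [eq_div_iff hne] at hq
  have hq0 : q ≠ 0 := by
    rintro rfl
    rw [map_zero, zero_mul] at hq
    exact hD hq.symm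
  obtain ⟨ε, hε⟩ := hU q hq0
  refine ⟨algebraMap R K ε * ω₁, ω₂, fun x => ?_, _, hε, ?_⟩
  · rw [hmem]
    constructor
    · rintro ⟨a, b, rfl⟩
      refine ⟨a * (ε⁻¹ : Rˣ), b, ?_⟩
      have : algebraMap R K (ε⁻¹ : Rˣ) * algebraMap R K ε = 1 := by
        rw [← map_mul, Units.inv_mul, map_one]
      rw [map_mul]
      linear_combination -(algebraMap R K a * ω₁) * this
    · rintro ⟨a, b, rfl⟩
      exact ⟨a * ε, b, by rw [map_mul]; ring⟩
  · rw [map_mul, map_mul, IsScalarTower.algebraMap_apply R F K, AlgEquiv.commutes]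
    linear_combination -algebraMap F K (algebraMap R F ε) * hq

/-- Every oriented point comes from an invertible submodule: for a primitive equation
`a τ² + b τ + c = 0` the inverse of `ξ (R τ + R)` is `ξ⁻¹ a (R σ(τ) + R)`. -/
lemma exists_unit_of_mem [CharZero F] (hK : Module.finrank F K = 2) (hσ : σ ≠ 1)
    (hτ₀ : τ₀ ∉ Set.range (algebraMap F K))
    {τ : K} (hτ : τ ∈ orientedPoints R O σ τ₀) :
    ∃ (I : (Submodule O K)ˣ) (ω₁ ω₂ : K),
      IsOrientedBasis R σ τ₀ (I : Submodule O K) ω₁ ω₂ ∧ ω₁ / ω₂ = τ := by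
  obtain ⟨hP, ξ, d, hd, e⟩ := hτ
  have hne : τ₀ - σ τ₀ ≠ 0 := fun h =>
    hτ₀ ((conj_eq_self_iff hK hσ).1 (sub_eq_zero.1 h).symm)
  have hne' : ξ * σ ξ * (τ - σ τ) ≠ 0 := by
    rw [e]; exact mul_ne_zero ((map_ne_zero _).2 hd.1) hne
  have hξ : ξ ≠ 0 := left_ne_zero_of_mul (left_ne_zero_of_mul hne')
  have hτF : τ ∉ Set.range (algebraMap F K) := fun h =>
    right_ne_zero_of_mul hne' (by rw [(conj_eq_self_iff hK hσ).2 h, sub_self])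
  obtain ⟨a, b, c, u, v, w, h, hp, ha⟩ := exists_primitive_quadratic (R := R) hK hτF
  have hinj : Function.Injective (algebraMap R F) := IsFractionRing.injective R F
  have haK : algebraMap R K a ≠ 0 := by
    rw [IsScalarTower.algebraMap_apply R F K]
    exact (map_ne_zero _).2 ((map_ne_zero_iff _ hinj).2 ha)
  have hO : ∀ x, x ∈ Set.range (algebraMap O K) ↔ x ∈ lat R (algebraMap R K a * τ) := fun x => by
    rw [hP, forall_mul_mem_lat_iff_of_primitive hτF h hp]
  have hσR : ∀ r : R, σ (algebraMap R K r) = algebraMap R K r := fun r => by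
    rw [IsScalarTower.algebraMap_apply R F K, AlgEquiv.commutes]
  -- Vieta's formulas
  have hsum : algebraMap R K a * τ + algebraMap R K a * σ τ = -algebraMap R K b := by
    have h' := congrArg σ h
    simp only [map_add, map_mul, hσR, map_zero] at h'
    apply mul_left_cancel₀ (right_ne_zero_of_mul hne')
    linear_combination h - h'
  have hprod : algebraMap R K a * (τ * σ τ) = algebraMap R K c := by
    linear_combination -h + τ * hsum
  let L : Submodule O K := Submodule.span O {ξ * τ, ξ}
  let L' : Submodule O K := Submodule.span O {ξ⁻¹ * (algebraMap R K a * σ τ), ξ⁻¹ * algebraMap R K a}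
  have hLL : L * L' = 1 := by
    have hR : ∀ r : R, algebraMap R K r ∈ (1 : Submodule O K) := fun r =>
      Submodule.mem_one.2 (hP.exists_algebraMap_eq r)
    have haτ : algebraMap R K a * τ ∈ (1 : Submodule O K) :=
      Submodule.mem_one.2 ((hO _).2 (self_mem_lat _))
    have e1 : ξ * τ * (ξ⁻¹ * (algebraMap R K a * σ τ)) = algebraMap R K c := by
      rw [← hprod]; field_simp
    have e2 : ξ * τ * (ξ⁻¹ * algebraMap R K a) = algebraMap R K a * τ := by field_simp
    have e3 : ξ * (ξ⁻¹ * (algebraMap R K a * σ τ)) = -algebraMap R K b - algebraMap R K a * τ := by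
      rw [← hsum]; field_simp; ring
    have e4 : ξ * (ξ⁻¹ * algebraMap R K a) = algebraMap R K a := by field_simp
    apply le_antisymm
    · rw [Submodule.span_mul_span, Submodule.span_le]
      rintro _ ⟨x, hx, y, hy, rfl⟩
      simp only [Set.mem_insert_iff, Set.mem_singleton_iff] at hx hy
      rcases hx with rfl | rfl <;> rcases hy with rfl | rfl
      · simp only [e1]; exact hR c
      · simp only [e2]; exact haτ
      · simp only [e3]; exact sub_mem (neg_mem (hR b)) haτ
      · simp only [e4]; exact hR a
    · have m1 : ξ * τ ∈ L := Submodule.subset_span (by simp)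
      have m2 : ξ ∈ L := Submodule.subset_span (by simp)
      have m3 : ξ⁻¹ * (algebraMap R K a * σ τ) ∈ L' := Submodule.subset_span (by simp)
      have m4 : ξ⁻¹ * algebraMap R K a ∈ L' := Submodule.subset_span (by simp)
      have n1 : algebraMap R K c ∈ L * L' := by
        rw [← e1]; exact Submodule.mul_mem_mul m1 m3
      have n2 : algebraMap R K b ∈ L * L' := by
        have := neg_mem (add_mem (Submodule.mul_mem_mul m1 m4) (Submodule.mul_mem_mul m2 m3))
        rw [e2, e3] at this
        convert this using 1; ring
      have n3 : algebraMap R K a ∈ L * L' := by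
        rw [← e4]; exact Submodule.mul_mem_mul m2 m4
      have : (1 : K) ∈ L * L' := by
        have := add_mem (add_mem (hP.mul_mem u n3) (hP.mul_mem v n2)) (hP.mul_mem w n1)
        rwa [← map_mul, ← map_mul, ← map_mul, ← map_add, ← map_add, hp, map_one] at this
      rw [Submodule.one_eq_span, Submodule.span_le]
      simpa using this
  let I : (Submodule O K)ˣ := ⟨L, L', hLL, by rw [mul_comm, hLL]⟩
  refine ⟨I, ξ * τ, ξ, ⟨fun x => ⟨fun hx => ?_, ?_⟩, d, hd, ?_⟩, by field_simp⟩
  · suffices H : ∃ y ∈ lat R τ, x = ξ * y by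
      obtain ⟨y, hy, rfl⟩ := H
      obtain ⟨r, s, rfl⟩ := mem_lat.1 hy
      exact ⟨r, s, by ring⟩
    change x ∈ Submodule.span O {ξ * τ, ξ} at hx
    induction hx using Submodule.span_induction with
    | mem x hx =>
      simp only [Set.mem_insert_iff, Set.mem_singleton_iff] at hx
      rcases hx with rfl | rfl
      · exact ⟨τ, self_mem_lat τ, rfl⟩
      · exact ⟨1, one_mem_lat τ, (mul_one _).symm⟩
    | zero => exact ⟨0, zero_mem _, by simp⟩
    | add x y _ _ hx hy =>
      obtain ⟨x', hx', rfl⟩ := hx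
      obtain ⟨y', hy', rfl⟩ := hy
      exact ⟨x' + y', add_mem hx' hy', by ring⟩
    | smul o x _ hx =>
      obtain ⟨x', hx', rfl⟩ := hx
      exact ⟨algebraMap O K o * x', (hP _).1 ⟨o, rfl⟩ _ hx', by rw [Algebra.smul_def]; ring⟩
  · rintro ⟨r, s, rfl⟩
    exact add_mem (hP.mul_mem (I := L) r (Submodule.subset_span (by simp)))
      (hP.mul_mem (I := L) s (Submodule.subset_span (by simp)))
  · rw [← e, map_mul]; ring

/-- The equivalence classes of oriented points are in bijection with the narrow class group. -/
theorem ncard_image_orientedPoints [CharZero F] (hK : Module.finrank F K = 2) (hσ : σ ≠ 1)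
    (hU : ∀ a : F, a ≠ 0 → ∃ ε : Rˣ, TotPos (algebraMap R F ε * a))
    (hτ₀ : τ₀ ∉ Set.range (algebraMap F K)) (hP : IsProper R O τ₀) {Y : Type*} (f : K → Y)
    (hf : ∀ τ ∈ orientedPoints R O σ τ₀, ∀ τ₁ ∈ orientedPoints R O σ τ₀,
      f τ = f τ₁ ↔ PosEquiv R F τ τ₁) :
    (f '' orientedPoints R O σ τ₀).ncard = Nat.card (NarrowPic O K) := by
  have hne : τ₀ - σ τ₀ ≠ 0 := fun h =>
    hτ₀ ((conj_eq_self_iff hK hσ).1 (sub_eq_zero.1 h).symm)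
  choose ω₁ ω₂ hω using exists_isOrientedBasis (R := R) hK hσ hU hτ₀ hP
  set H := (totallyPositive K).map (Units.map (Submodule.spanSingleton (A := K) O).toMonoidHom)
    with hH
  let g : (Submodule O K)ˣ → Y := fun I => f (ω₁ I / ω₂ I)
  have hmemH : ∀ I J : (Submodule O K)ˣ, I⁻¹ * J ∈ H ↔
      ∃ x : K, TotPos x ∧ ∀ y, y ∈ (J : Submodule O K) ↔ ∃ z ∈ (I : Submodule O K), y = x * z := by
    intro I J
    have hspan : ∀ (x y : K), y ∈ (I : Submodule O K) * Submodule.span O {x} ↔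
        ∃ z ∈ (I : Submodule O K), y = x * z := fun x y => by
      rw [Submodule.mem_mul_span_singleton]
      simp only [mul_comm x, eq_comm]
    constructor
    · rintro ⟨x, hx, e⟩
      refine ⟨x, ⟨x.ne_zero, hx⟩, fun y => ?_⟩
      have e' : (J : Submodule O K) = (I : Submodule O K) * Submodule.span O {(x : K)} := by
        rw [eq_inv_mul_iff_mul_eq] at e
        exact (congrArg Units.val e).symm
      rw [e', hspan]
    · rintro ⟨x, hx, e⟩
      refine ⟨Units.mk0 x hx.1, hx.2, ?_⟩
      rw [eq_inv_mul_iff_mul_eq]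
      ext y
      rw [e, ← hspan]
      rfl
  have hg : ∀ I J : (Submodule O K)ˣ, g I = g J ↔ I⁻¹ * J ∈ H := by
    intro I J
    rw [hmemH]
    change f _ = f _ ↔ _
    rw [hf _ ((hω I).div_mem hne) _ ((hω J).div_mem hne)]
    constructor
    · intro h
      obtain ⟨x, n, hn, hx, e⟩ := (hω I).exists_of_posEquiv hne (hω J) h (exists_norm hK hσ)
      obtain ⟨ε, hε⟩ := exists_totPos_smul hK hσ hU hn hx
      refine ⟨_, hε, fun y => (e y).trans ⟨?_, ?_⟩⟩
      · rintro ⟨z, hz, rfl⟩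
        refine ⟨_, hP.mul_mem ((ε⁻¹ : Rˣ) : R) hz, ?_⟩
        have : algebraMap R K ε * algebraMap R K (ε⁻¹ : Rˣ) = 1 := by
          rw [← map_mul, Units.mul_inv, map_one]
        rw [← IsScalarTower.algebraMap_apply R F K]
        linear_combination -(x * z) * this
      · rintro ⟨z, hz, rfl⟩
        refine ⟨_, hP.mul_mem (ε : R) hz, ?_⟩
        rw [← IsScalarTower.algebraMap_apply R F K]
        ring
    · rintro ⟨x, hx, e⟩
      obtain ⟨n, hn⟩ := exists_norm hK hσ x
      exact (hω I).posEquiv hne (hω J) (hx.norm hK hσ hn.symm) hn.symm e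
  have hrange : f '' orientedPoints R O σ τ₀ = Set.range g := by
    apply Set.Subset.antisymm
    · rintro _ ⟨τ, hτ, rfl⟩
      obtain ⟨I, η₁, η₂, hη, rfl⟩ := exists_unit_of_mem hK hσ hτ₀ hτ
      refine ⟨I, (hf _ ((hω I).div_mem hne) _ hτ).2 ?_⟩
      exact (hω I).posEquiv hne hη totPos_one (x := 1) (by simp) (by simp)
    · rintro _ ⟨I, rfl⟩
      exact ⟨_, (hω I).div_mem hne, rfl⟩
  rw [hrange, ← Nat.card_coe_set_eq]
  let q : NarrowPic O K → Set.range g := Quotient.lift (fun I => ⟨g I, I, rfl⟩) fun I J h =>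
    Subtype.ext ((hg I J).2 (QuotientGroup.leftRel_apply.1 h))
  refine (Nat.card_congr (Equiv.ofBijective q ⟨?_, ?_⟩)).symm
  · intro x y
    refine Quotient.inductionOn₂ x y fun I J h => Quotient.sound ?_
    exact QuotientGroup.leftRel_apply.2 ((hg I J).1 (congrArg Subtype.val h))
  · rintro ⟨_, I, rfl⟩
    exact ⟨Quotient.mk _ I, rfl⟩

end OrientedPoints

/-! ### Signs -/

section Orientation

variable {F K : Type*} [Field F] [NumberField F] [Field K] [Algebra F K]

/-- The only obstruction to the orientability of a multiple of `τ, 1` is the sign at the real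
embeddings which do not extend to `K`. With `η = τ₀ - σ(τ₀)` the multiple is `y + η`, of norm
`y² - η²`, where `y ∈ F` is chosen as a high power of an element close to `1`, which is larger or
smaller than `1` according to the required sign. -/
lemma exists_oriented_multiple (hK : Module.finrank F K = 2) {σ : K ≃ₐ[F] K} (hσ : σ ≠ 1)
    (hF : Nonempty (F →+* ℝ)) {τ₀ τ : K} (hτ₀ : τ₀ ∉ Set.range (algebraMap F K)) {q : F}
    (hq0 : q ≠ 0) (hq : τ - σ τ = algebraMap F K q * (τ₀ - σ τ₀))
    (hsign : ∀ ρ₀ : F →+* ℝ, (¬ ∃ ρ : K →+* ℝ, ρ.comp (algebraMap F K) = ρ₀) → 0 < ρ₀ q) :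
    ∃ (ξ : K) (d : F), TotPos d ∧ ξ * σ ξ * (τ - σ τ) = algebraMap F K d * (τ₀ - σ τ₀) := by
  set η := τ₀ - σ τ₀ with hη
  have hη0 : η ≠ 0 := fun h =>
    hτ₀ ((conj_eq_self_iff hK hσ).1 (sub_eq_zero.1 h).symm)
  have hση : σ η = -η := by rw [hη, map_sub, conj_conj hK]; ring
  obtain ⟨δ, hδ⟩ := exists_norm hK hσ η
  rw [hση] at hδ
  have hδ0 : δ ≠ 0 := by
    rintro rfl
    rw [map_zero] at hδ
    exact mul_ne_zero hη0 (neg_ne_zero.2 hη0) hδ.symm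
  obtain ⟨M, hM⟩ : ∃ M : ℕ, ∀ ρ₀ : F →+* ℝ, |ρ₀ q| < M := by
    obtain ⟨B, hB⟩ := (Set.finite_range fun ρ₀ : F →+* ℝ => |ρ₀ q|).bddAbove
    obtain ⟨M, hM⟩ := exists_nat_gt B
    exact ⟨M, fun ρ₀ => (hB ⟨ρ₀, rfl⟩).trans_lt hM⟩
  have hM0 : (0 : ℝ) < M := by
    obtain ⟨ρ₀⟩ := hF
    exact (abs_nonneg _).trans_lt (hM ρ₀)
  have key : ∀ ρ₀ : F →+* ℝ, ∀ᶠ n : ℕ in Filter.atTop,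
      0 < ρ₀ ((((1 + q / M) ^ n) ^ 2 + δ) * q) := fun ρ₀ => by
    have hval : ∀ n : ℕ, ρ₀ ((((1 + q / M) ^ n) ^ 2 + δ) * q) =
        (((1 + ρ₀ q / M) ^ 2) ^ n + ρ₀ δ) * ρ₀ q := fun n => by
      rw [← pow_mul, ← pow_mul, mul_comm n 2]
      simp
    simp only [hval]
    have hlow : -1 < ρ₀ q / M := by rw [lt_div_iff₀ hM0]; linarith [(abs_lt.1 (hM ρ₀)).1]
    rcases lt_or_gt_of_ne ((map_ne_zero ρ₀).2 hδ0) with hneg | hpos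
    · rcases lt_or_gt_of_ne ((map_ne_zero ρ₀).2 hq0) with hqn | hqp
      · have h1 : (1 + ρ₀ q / M) ^ 2 < 1 := by
          have : ρ₀ q / M < 0 := div_neg_of_neg_of_pos hqn hM0
          nlinarith
        filter_upwards [(tendsto_pow_atTop_nhds_zero_of_lt_one (sq_nonneg _) h1).eventually
          (gt_mem_nhds (neg_pos.2 hneg))] with n hn
        exact mul_pos_of_neg_of_neg (by linarith) hqn
      · have h1 : 1 < (1 + ρ₀ q / M) ^ 2 := by
          have : 0 < ρ₀ q / M := div_pos hqp hM0
          nlinarith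
        filter_upwards [(tendsto_pow_atTop_atTop_of_one_lt h1).eventually_gt_atTop (-ρ₀ δ)]
          with n hn
        exact mul_pos (by linarith) hqp
    · have : ¬ ∃ ρ : K →+* ℝ, ρ.comp (algebraMap F K) = ρ₀ := by
        rintro ⟨ρ, rfl⟩
        rw [RingHom.comp_apply, hδ, map_mul, map_neg] at hpos
        nlinarith [mul_self_nonneg (ρ η)]
      exact Filter.Eventually.of_forall fun n => mul_pos (by positivity) (hsign ρ₀ this)
  obtain ⟨n, hn⟩ := (Filter.eventually_all.2 key).exists
  refine ⟨algebraMap F K ((1 + q / M) ^ n) + η, (((1 + q / M) ^ n) ^ 2 + δ) * q, ⟨?_, hn⟩, ?_⟩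
  · obtain ⟨ρ₀⟩ := hF
    intro h0
    have := hn ρ₀
    rw [h0, map_zero] at this
    exact lt_irrefl _ this
  · rw [hq, map_add, hση, AlgEquiv.commutes, map_mul, map_add, hδ, map_pow _ _ 2]
    ring

end Orientation

section TotallyReal

variable {F : Type*} [Field F] [IsTotallyReal F]

lemma exists_realEmb_eq (ρ : F →+* ℝ) : ∃ v : InfinitePlace F, realEmb v = ρ := by
  refine ⟨InfinitePlace.mk (Complex.ofRealHom.comp ρ), RingHom.ext fun x => ?_⟩
  apply Complex.ofReal_injective
  rw [realEmb, InfinitePlace.embedding_of_isReal_apply]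
  rcases InfinitePlace.embedding_mk_eq (Complex.ofRealHom.comp ρ) with h | h
  · rw [h]; rfl
  · rw [h]; simp [ComplexEmbedding.conjugate]

variable [NumberField F]

lemma totPos_iff {d : F} : TotPos d ↔ ∀ v, 0 < realEmb v d := by
  refine ⟨fun h v => h.2 _, fun h => ⟨?_, fun ρ => ?_⟩⟩
  · rintro rfl
    have := h (Classical.arbitrary _)
    rw [map_zero] at this
    exact lt_irrefl _ this
  · obtain ⟨v, rfl⟩ := exists_realEmb_eq ρ
    exact h v

/-- Signs at the infinite places can be prescribed, by weak approximation. -/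
lemma exists_sign (r : InfinitePlace F → ℝ) (hr : ∀ v, r v ≠ 0) :
    ∃ a : F, a ≠ 0 ∧ ∀ v, 0 < r v * realEmb v a := by
  let e : ∀ v : InfinitePlace F, v.Completion →+* ℝ := fun v =>
    InfinitePlace.Completion.extensionEmbeddingOfIsReal (IsTotallyReal.isReal v)
  have he : ∀ v, Continuous (e v) := fun v =>
    (InfinitePlace.Completion.isometry_extensionEmbeddingOfIsReal _).continuous
  have hopen : IsOpen {x : InfiniteAdeleRing F | ∀ v, 0 < r v * e v (x v)} := by
    simp only [Set.ofPred_forall]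
    exact isOpen_iInter_of_finite fun v => isOpen_lt continuous_const
      (continuous_const.mul ((he v).comp (continuous_apply v)))
  obtain ⟨a, ha⟩ := (InfiniteAdeleRing.denseRange_algebraMap F).exists_mem_open hopen
    ⟨fun v => if 0 < r v then 1 else -1, fun v => by
      change 0 < r v * e v (if 0 < r v then 1 else -1)
      split_ifs with h
      · simpa using h
      · have := lt_of_le_of_ne (not_lt.1 h) (hr v)
        simpa using this⟩
  have ha' : ∀ v, 0 < r v * realEmb v a := fun v => by
    have := ha v
    rwa [InfiniteAdeleRing.algebraMap_apply,
      show e v (a : v.Completion) = realEmb v a from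
        InfinitePlace.Completion.extensionEmbeddingOfIsReal_coe _ _] at this
  refine ⟨a, ?_, ha'⟩
  rintro rfl
  have := ha' (Classical.arbitrary _)
  rw [map_zero, mul_zero] at this
  exact lt_irrefl _ this

end TotallyReal

/-! ### Fields of narrow class number one -/

section NarrowClassNumberOne

variable {F : Type*} [Field F]

lemma exists_totPos_span (hF : Nat.card (NarrowPic (𝓞 F) F) = 1) (I : (Submodule (𝓞 F) F)ˣ) :
    ∃ x : F, TotPos x ∧ (I : Submodule (𝓞 F) F) = Submodule.span (𝓞 F) {x} := by
  have := (Nat.card_eq_one_iff_unique.1 hF).1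
  have h := QuotientGroup.eq.1 (Subsingleton.elim (QuotientGroup.mk 1 : NarrowPic (𝓞 F) F)
    (QuotientGroup.mk I))
  rw [inv_one, one_mul] at h
  obtain ⟨x, hx, e⟩ := h
  exact ⟨x, mem_totallyPositive_iff.1 hx, (congrArg Units.val e).symm⟩

variable [NumberField F]

/-- Narrow class number one implies class number one. -/
lemma isPrincipalIdealRing_of_narrowPic (hF : Nat.card (NarrowPic (𝓞 F) F) = 1) :
    IsPrincipalIdealRing (𝓞 F) := by
  refine ⟨fun I => ?_⟩
  rcases eq_or_ne I ⊥ with rfl | hI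
  · exact bot_isPrincipal
  have hI' : (I : FractionalIdeal (nonZeroDivisors (𝓞 F)) F) ≠ 0 :=
    FractionalIdeal.coeIdeal_ne_zero.2 hI
  obtain ⟨x, -, hx⟩ := exists_totPos_span hF
    (Units.map (FractionalIdeal.coeSubmoduleHom (nonZeroDivisors (𝓞 F)) F).toMonoidHom
      (Units.mk0 (I : FractionalIdeal (nonZeroDivisors (𝓞 F)) F) hI'))
  have hx : IsLocalization.coeSubmodule F I = Submodule.span (𝓞 F) {x} := hx
  have hxI : x ∈ IsLocalization.coeSubmodule F I := by
    rw [hx]; exact Submodule.mem_span_singleton_self x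
  obtain ⟨y, hy, rfl⟩ := (IsLocalization.mem_coeSubmodule F I).1 hxI
  refine ⟨y, le_antisymm (fun z hz => ?_) ?_⟩
  · have hz' : algebraMap (𝓞 F) F z ∈ Submodule.span (𝓞 F) {algebraMap (𝓞 F) F y} := by
      rw [← hx]; exact (IsLocalization.mem_coeSubmodule F I).2 ⟨z, hz, rfl⟩
    obtain ⟨c, hc⟩ := Submodule.mem_span_singleton.1 hz'
    rw [Algebra.smul_def, ← map_mul] at hc
    rw [← IsFractionRing.injective (𝓞 F) F hc]
    exact Submodule.smul_mem _ c (Submodule.mem_span_singleton_self y)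
  · rw [Submodule.span_le]
    simpa using hy

/-- If the narrow class number of `F` is one, units have all signs. -/
lemma exists_unit_totPos_mul (hF : Nat.card (NarrowPic (𝓞 F) F) = 1) {a : F} (ha : a ≠ 0) :
    ∃ ε : (𝓞 F)ˣ, TotPos (algebraMap (𝓞 F) F ε * a) := by
  obtain ⟨x, hx, e⟩ := exists_totPos_span hF
    (Units.map (Submodule.spanSingleton (A := F) (𝓞 F)).toMonoidHom (Units.mk0 a ha))
  have e : Submodule.span (𝓞 F) {a} = Submodule.span (𝓞 F) {x} := e
  obtain ⟨c, hc⟩ := Submodule.mem_span_singleton.1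
    (e ▸ Submodule.mem_span_singleton_self x : x ∈ Submodule.span (𝓞 F) {a})
  obtain ⟨d, hd⟩ := Submodule.mem_span_singleton.1
    (e ▸ Submodule.mem_span_singleton_self a : a ∈ Submodule.span (𝓞 F) {x})
  have hdc : d * c = 1 := by
    apply IsFractionRing.injective (𝓞 F) F
    apply mul_right_cancel₀ ha
    rw [map_mul, map_one, one_mul, mul_assoc, ← Algebra.smul_def c, hc, ← Algebra.smul_def, hd]
  refine ⟨⟨c, d, by rw [mul_comm, hdc], hdc⟩, ?_⟩
  rw [← Algebra.smul_def, hc]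
  exact hx

variable [IsTotallyReal F]

lemma torsion_eq_one_or_neg_one {ζ : (𝓞 F)ˣ} (hζ : ζ ∈ Units.torsion F) : ζ = 1 ∨ ζ = -1 := by
  let v : InfinitePlace F := Classical.arbitrary _
  have h := (Units.mem_torsion F).1 hζ v
  have h2 : |realEmb v (algebraMap (𝓞 F) F ζ)| = 1 := by
    rw [← h, ← InfinitePlace.norm_embedding_eq, ← Real.norm_eq_abs, ← Complex.norm_real, realEmb,
      InfinitePlace.embedding_of_isReal_apply]
  have hinj : Function.Injective fun x : (𝓞 F)ˣ => realEmb v (algebraMap (𝓞 F) F x) :=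
    (realEmb v).injective.comp ((IsFractionRing.injective (𝓞 F) F).comp Units.val_injective)
  rcases eq_or_eq_neg_of_abs_eq h2 with h3 | h3
  · left; apply hinj; simpa using h3
  · right; apply hinj; simpa using h3

/-- If the narrow class number of `F` is one, totally positive units are squares: units modulo
squares have as many classes as there are signs, and all signs occur. -/
lemma exists_sq_of_totPos_unit (hF : Nat.card (NarrowPic (𝓞 F) F) = 1) {ε : (𝓞 F)ˣ}
    (hε : TotPos (algebraMap (𝓞 F) F ε)) : ∃ w : (𝓞 F)ˣ, w ^ 2 = ε := by
  classical
  let sgn : InfinitePlace F → (𝓞 F)ˣ → Bool := fun v u => decide (0 < realEmb v (algebraMap (𝓞 F) F u))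
  let rep : Bool × (Fin (Units.rank F) → Bool) → (𝓞 F)ˣ := fun c =>
    (if c.1 then -1 else 1) * ∏ i, if c.2 i then Units.fundSystem F i else 1
  have hrep : ∀ u : (𝓞 F)ˣ, ∃ c, ∃ w : (𝓞 F)ˣ, u = rep c * w ^ 2 := fun u => by
    obtain ⟨⟨ζ, e⟩, hu, -⟩ := Units.exist_unique_eq_mul_prod F u
    refine ⟨(decide ((ζ : (𝓞 F)ˣ) = -1), fun i => decide (e i % 2 = 1)),
      ∏ i, Units.fundSystem F i ^ (e i / 2), ?_⟩
    rw [hu]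
    have h1 : (ζ : (𝓞 F)ˣ) = if decide ((ζ : (𝓞 F)ˣ) = -1) then -1 else 1 := by
      rcases torsion_eq_one_or_neg_one ζ.2 with h | h
      · by_cases h' : (ζ : (𝓞 F)ˣ) = -1
        · simp [h']
        · simpa [h'] using h
      · simp [h]
    have h2 : ∀ i, Units.fundSystem F i ^ (e i) =
        (if decide (e i % 2 = 1) then Units.fundSystem F i else 1) *
          (Units.fundSystem F i ^ (e i / 2)) ^ 2 := fun i => by
      rcases Int.emod_two_eq_zero_or_one (e i) with h | h
      · simp only [h, zero_ne_one, decide_false, Bool.false_eq_true, if_false, one_mul]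
        rw [← zpow_natCast, ← _root_.zpow_mul]
        congr 1; push_cast; omega
      · simp only [h, decide_true, if_true]
        rw [← zpow_natCast, ← _root_.zpow_mul, ← _root_.zpow_one_add]
        congr 1; push_cast; omega
    simp only [rep]
    rw [mul_assoc, ← Finset.prod_pow, ← Finset.prod_mul_distrib, ← h1]
    congr 1
    exact Finset.prod_congr rfl fun i _ => h2 i
  have hsgn : ∀ v (u w : (𝓞 F)ˣ), sgn v (u * w ^ 2) = sgn v u := fun v u w => by
    have hw : realEmb v (algebraMap (𝓞 F) F w) ≠ 0 :=
      (map_ne_zero _).2 ((map_ne_zero_iff _ (IsFractionRing.injective (𝓞 F) F)).2 w.ne_zero)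
    have : 0 < realEmb v (algebraMap (𝓞 F) F w) ^ 2 := by positivity
    simp [sgn, mul_pos_iff_of_pos_right this]
  let S : Bool × (Fin (Units.rank F) → Bool) → InfinitePlace F → Bool := fun c v => sgn v (rep c)
  have hsurj : Function.Surjective S := fun s => by
    obtain ⟨a, ha0, ha⟩ := exists_sign (F := F) (fun v => if s v then 1 else -1)
      (fun v => by split_ifs <;> norm_num)
    obtain ⟨u, hu⟩ := exists_unit_totPos_mul hF ha0
    obtain ⟨c, w, hc⟩ := hrep u
    refine ⟨c, funext fun v => ?_⟩
    change sgn v (rep c) = s v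
    rw [← hsgn v _ w, ← hc]
    have h1 := ha v
    have h2 := hu.2 (realEmb v)
    rw [map_mul] at h2
    simp only [sgn]
    by_cases hs : s v = true
    · rw [hs] at h1 ⊢
      rw [if_pos rfl, one_mul] at h1
      exact decide_eq_true (pos_of_mul_pos_left h2 h1.le)
    · rw [Bool.not_eq_true] at hs
      rw [hs] at h1 ⊢
      simp only [Bool.false_eq_true, if_false] at h1
      refine decide_eq_false fun h => ?_
      nlinarith
  have hinj : Function.Injective S := by
    refine ((Fintype.bijective_iff_surjective_and_card S).2 ⟨hsurj, ?_⟩).1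
    have : 0 < Fintype.card (InfinitePlace F) := Fintype.card_pos
    rw [Fintype.card_prod, Fintype.card_fun, Fintype.card_fun, Fintype.card_bool, Fintype.card_fin,
      Units.rank, ← pow_succ']
    congr 1
    omega
  obtain ⟨c, w, hc⟩ := hrep ε
  have hc0 : c = (false, fun _ => false) := by
    apply hinj
    funext v
    have h1 : S c v = true := by
      change sgn v (rep c) = true
      rw [← hsgn v _ w, ← hc]
      exact decide_eq_true (hε.2 _)
    rw [h1]
    simp [S, rep, sgn]
  exact ⟨w, by rw [hc, hc0]; simp [rep]⟩

end NarrowClassNumberOne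

/-! ### The arithmetic groups as stabilizers -/

section Arithmetic

variable {R F : Type*} [CommRing R] [Field F] [Algebra R F] [IsFractionRing R F]

/-- A matrix whose entries are integral, with determinant a unit, comes from `GL₂` of the ring. -/
lemma exists_map_eq_of_forall {ι : Type*} {Γ : ι → Type*}
    [∀ i, LinearOrderedCommGroupWithZero (Γ i)] (μ : ∀ i, Valuation F (Γ i))
    (hR : ∀ x : F, (∀ i, μ i x ≤ 1) → x ∈ Set.range (algebraMap R F)) (g : GL (Fin 2) F)
    (hg : ∀ i, IsIntegralGL (μ i) g) :
    ∃ g' : GL (Fin 2) R, GeneralLinearGroup.map (algebraMap R F) g' = g := by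
  have hinj : Function.Injective (algebraMap R F) := IsFractionRing.injective R F
  choose a ha using fun i j => hR (g i j) fun k => (hg k).1 i j
  choose b hb using fun i j => hR (g⁻¹ i j) fun k => (hg k).inv.1 i j
  have hA : (Matrix.of a).map (algebraMap R F) = g.val := by
    ext i j; exact ha i j
  have hB : (Matrix.of b).map (algebraMap R F) = (g⁻¹).val := by
    ext i j; exact hb i j
  have hinj' : Function.Injective fun M : Matrix (Fin 2) (Fin 2) R => M.map (algebraMap R F) :=
    Matrix.map_injective hinj
  refine ⟨⟨Matrix.of a, Matrix.of b, hinj' ?_, hinj' ?_⟩, Units.ext hA⟩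
  · simp only [Matrix.map_mul, hA, hB, ← Units.val_mul, mul_inv_cancel]
    ext i j; simp [Matrix.one_apply, apply_ite]
  · simp only [Matrix.map_mul, hA, hB, ← Units.val_mul, inv_mul_cancel]
    ext i j; simp [Matrix.one_apply, apply_ite]

end Arithmetic

/-! ### Double cosets as orbit spaces -/

/-- A double coset space `j(Γ) \ G / U` is identified with `Δ \ Y` as soon as every class meets a
set `S`, on which `U` acts from the right with quotient `π : S → Y` and in which `j(Γ)`-equivalence
is `j(Δ)`-equivalence. -/
lemma exists_doubleCoset_identification {G Γ Y : Type*} [Group G] [Group Γ] [MulAction Γ Y]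
    (j : Γ →* G) (U : Subgroup G) (S : Set G) (Δ : Subgroup Γ) (π : G → Y)
    (h₁ : ∀ x, ∃ γ, j γ * x ∈ S) (h₂ : ∀ y ∈ S, ∀ γ, j γ * y ∈ S ↔ γ ∈ Δ)
    (h₃ : ∀ y γ, π (j γ * y) = γ • π y) (h₄ : ∀ y ∈ S, ∀ u ∈ U, y * u ∈ S)
    (h₅ : ∀ y ∈ S, ∀ y' ∈ S, π y = π y' ↔ y⁻¹ * y' ∈ U) (h₆ : ∀ z, ∃ y ∈ S, π y = z) :
    ∃ Φ : DoubleCoset.Quotient (j.range : Set G) (U : Set G) → MulAction.orbitRel.Quotient Δ Y,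
      Function.Bijective Φ ∧ ∀ x γ, j γ * x ∈ S →
        Φ (DoubleCoset.mk j.range U x) = Quotient.mk _ (π (j γ * x)) := by
  have orb : ∀ a b : Y, (Quotient.mk (MulAction.orbitRel Δ Y) a = Quotient.mk _ b) ↔
      ∃ δ ∈ Δ, δ • b = a := fun a b => by
    rw [Quotient.eq, MulAction.orbitRel_apply, MulAction.mem_orbit_iff]
    exact ⟨fun ⟨δ, h⟩ => ⟨δ.1, δ.2, h⟩, fun ⟨δ, h, e⟩ => ⟨⟨δ, h⟩, e⟩⟩
  choose c hc using h₁
  -- the point attached to a class does not depend on the representative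
  have wd : ∀ x x' γ γ', DoubleCoset.mk j.range U x = DoubleCoset.mk j.range U x' →
      j γ * x ∈ S → j γ' * x' ∈ S →
      Quotient.mk (MulAction.orbitRel Δ Y) (π (j γ * x)) = Quotient.mk _ (π (j γ' * x')) := by
    intro x x' γ γ' h hy hy'
    obtain ⟨_, ⟨δ, rfl⟩, u, hu, rfl⟩ := (DoubleCoset.eq j.range U x x').1 h
    have e : j γ' * (j δ * x * u) = j (γ' * δ * γ⁻¹) * (j γ * x * u) := by
      simp only [map_mul, map_inv]; group
    have hyu := h₄ _ hy u hu
    have hδ : γ' * δ * γ⁻¹ ∈ Δ := (h₂ _ hyu _).1 (e ▸ hy')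
    rw [eq_comm, orb]
    refine ⟨_, hδ, ?_⟩
    rw [e, h₃ (j γ * x * u)]
    congr 1
    refine (h₅ _ hy _ hyu).2 ?_
    rwa [_root_.mul_inv_rev, mul_assoc, mul_assoc, inv_mul_cancel_left, inv_mul_cancel_left]
  refine ⟨Quotient.lift (fun x => Quotient.mk _ (π (j (c x) * x))) fun x x' h =>
    wd x x' _ _ (Quotient.sound h) (hc x) (hc x'), ⟨?_, ?_⟩, fun x γ h => wd x x _ _ rfl (hc x) h⟩
  · intro q q'
    refine Quotient.inductionOn₂ q q' fun x x' h => ?_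
    obtain ⟨δ, hδ, e⟩ := (orb _ _).1 h
    rw [← h₃] at e
    have := (h₅ _ ((h₂ _ (hc x') δ).2 hδ) _ (hc x)).1 e
    refine ((DoubleCoset.eq j.range U x' x).2 ⟨j ((c x)⁻¹ * δ * c x'), ⟨_, rfl⟩, _, this, ?_⟩).symm
    simp only [map_mul, map_inv]; group
  · intro q
    refine Quotient.inductionOn q fun z => ?_
    obtain ⟨y, hy, rfl⟩ := h₆ z
    refine ⟨DoubleCoset.mk j.range U y, ?_⟩
    have := wd y y (c y) 1 rfl (hc y) (by simpa using hy)
    rwa [map_one, one_mul] at this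

/-! ### Toral sets and optimal embeddings at the finite places -/

/-- Conjugation by an integral matrix preserves integrality. -/
lemma IsIntegralGL.conj_iff {L Γ₀ : Type*} [Field L] [LinearOrderedCommGroupWithZero Γ₀]
    {w : Valuation L Γ₀} {g : GL (Fin 2) L} (hg : IsIntegralGL w g) (M : Matrix (Fin 2) (Fin 2) L) :
    (∀ i j, w ((g.val * M * g⁻¹.val) i j) ≤ 1) ↔ ∀ i j, w (M i j) ≤ 1 := by
  have key : ∀ (A B : Matrix (Fin 2) (Fin 2) L), (∀ i j, w (A i j) ≤ 1) → (∀ i j, w (B i j) ≤ 1) →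
      ∀ i j, w ((A * B) i j) ≤ 1 := fun A B hA hB i j => by
    rw [Matrix.mul_apply, Fin.sum_univ_two]
    refine w.map_add_le ?_ ?_ <;> rw [map_mul] <;> exact mul_le_one' (hA _ _) (hB _ _)
  refine ⟨fun h => ?_, fun h => key _ _ (key _ _ hg.1 h) hg.inv.1⟩
  have := key _ _ (key _ _ hg.inv.1 h) hg.1
  have e : g⁻¹.val * (g.val * M * g⁻¹.val) * g.val = M := by
    rw [← mul_assoc, ← mul_assoc, ← Units.val_mul, inv_mul_cancel, Units.val_one, one_mul,
      mul_assoc, ← Units.val_mul, inv_mul_cancel, Units.val_one, mul_one]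
  rwa [e] at this

section FinitePlaces

variable {R F K : Type*} [CommRing R] [IsDedekindDomain R] [Field F] [Algebra R F]
  [IsFractionRing R F] [Field K] [Algebra F K]

/-- If `γ t` is integral at `v` for some `t` in the torus of `ψ`, then `ψ` and its conjugate by `γ`
have the same integrality at `v`. -/
lemma conjEmb_integral_iff (hK : Module.finrank F K = 2) {ψ : K →ₐ[F] Matrix (Fin 2) (Fin 2) F}
    {t : PGL(2, AdeleRing R F)} (ht : t ∈ torus (algebraMap F (AdeleRing R F)) ψ) (γ : GL (Fin 2) F)
    (v : HeightOneSpectrum R)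
    (h : ProjGenLinGroup.map (algebraMap F (v.adicCompletion F)) (ProjGenLinGroup.mk γ) *
      ProjGenLinGroup.map (finComp R F v) t ∈ maxCompact F v) (x : K) :
    (∀ i j, v.valuation F (conjEmb γ ψ x i j) ≤ 1) ↔ ∀ i j, v.valuation F (ψ x i j) ≤ 1 := by
  have htv := map_mem_torus hK (finComp R F v) ht
  rw [finComp_comp_algebraMap] at htv
  obtain ⟨s, hs, hcomm⟩ := (mem_torus_iff hK _ _ _).1 htv
  rw [← hs] at h
  obtain ⟨c, hc⟩ := (mk_mem_maxCompact_iff v (GeneralLinearGroup.map (algebraMap F _) γ * s)).1 h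
  set f := algebraMap F (v.adicCompletion F) with hf
  set g := GeneralLinearGroup.map f γ * s * GeneralLinearGroup.scalar (Fin 2) c with hg
  have hconj : g.val * (ψ x).map f * g⁻¹.val = (conjEmb γ ψ x).map f := by
    have hsc : Commute (GeneralLinearGroup.scalar (Fin 2) c).val ((ψ x).map f) :=
      Matrix.scalar_commute _ (fun _ => Commute.all _ _) _
    have e1 : g.val * (ψ x).map f = (conjEmb γ ψ x).map f * g.val := by
      have e2 := congrArg (fun M : Matrix (Fin 2) (Fin 2) F => M.map f) (conjEmb_mul_self γ ψ x)
      simp only [Matrix.map_mul] at e2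
      have e3 : (GeneralLinearGroup.map f γ).val = γ.val.map f := rfl
      rw [hg, Units.val_mul, Units.val_mul, e3]
      simp only [mul_assoc]
      rw [hsc.eq, ← mul_assoc s.val, (hcomm x).eq]
      simp only [← mul_assoc]
      rw [e2]
    rw [e1, mul_assoc, ← Units.val_mul, mul_inv_cancel, Units.val_one, mul_one]
  have := hc.conj_iff ((ψ x).map f)
  rw [hconj] at this
  simpa only [Matrix.map_apply, hf, valued_algebraMap] using this

/-- Optimality is a condition at each place, so it is inherited by the conjugate of `ψ` by `γ` as soon
as `γ` is, at each place, an integral matrix times an element of the torus of `ψ`. -/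
lemma isOptimal_conjEmb (hK : Module.finrank F K = 2) {ψ : K →ₐ[F] Matrix (Fin 2) (Fin 2) F}
    {t : PGL(2, AdeleRing R F)} (ht : t ∈ torus (algebraMap F (AdeleRing R F)) ψ) (γ : GL (Fin 2) F)
    {P : HeightOneSpectrum R → Prop} {R' : Subring F}
    (hR' : ∀ x, x ∈ R' ↔ ∀ v, P v → v.valuation F x ≤ 1)
    (h : ∀ v, P v →
      ProjGenLinGroup.map (algebraMap F (v.adicCompletion F)) (ProjGenLinGroup.mk γ) *
        ProjGenLinGroup.map (finComp R F v) t ∈ maxCompact F v) {O' : Subring K}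
    (hψ : IsOptimal R' O' ψ) : IsOptimal R' O' (conjEmb γ ψ) := by
  rw [isOptimal_iff] at hψ ⊢
  refine fun x => (hψ x).trans ?_
  simp only [hR']
  constructor
  · exact fun H i j v hv => (conjEmb_integral_iff hK ht γ v (h v hv) x).2
      (fun i j => H i j v hv) i j
  · exact fun H i j v hv => (conjEmb_integral_iff hK ht γ v (h v hv) x).1
      (fun i j => H i j v hv) i j

lemma eventually_isIntegralGL (γ : GL (Fin 2) F) :
    ∀ᶠ v : HeightOneSpectrum R in Filter.cofinite, IsIntegralGL (v.valuation F) γ := by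
  have hx : ∀ x : F, ∀ᶠ v : HeightOneSpectrum R in Filter.cofinite, v.valuation F x ≤ 1 :=
    fun x => by
      filter_upwards [eventually_finComp_le_one (algebraMap F (AdeleRing R F) x)] with v hv
      rwa [← RingHom.comp_apply, finComp_comp_algebraMap, valued_algebraMap] at hv
  have h1 : ∀ᶠ v : HeightOneSpectrum R in Filter.cofinite, ∀ i j, v.valuation F (γ i j) ≤ 1 :=
    Filter.eventually_all.2 fun i => Filter.eventually_all.2 fun j => hx _
  filter_upwards [h1, hx γ.det.val, hx (γ.det.val)⁻¹] with v h1 h2 h3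
  refine ⟨h1, le_antisymm h2 ?_⟩
  rw [map_inv₀] at h3
  have h0 : v.valuation F γ.det.val ≠ 0 := (map_ne_zero _).2 γ.det.ne_zero
  exact (inv_le_one₀ (zero_lt_iff.2 h0)).1 h3

lemma Moebius.commute (hK : Module.finrank F K = 2) {ψ : K →ₐ[F] Matrix (Fin 2) (Fin 2) F} {τ : K}
    (hτ : IsEigenPoint ψ τ) {γ : GL (Fin 2) F} (hγ : Moebius γ τ τ) (x : K) :
    Commute γ.val (ψ x) := by
  have h : conjEmb γ ψ = ψ := (hτ.conjEmb hγ (hτ.notMem hK)).ext hK hτ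
  have := conjEmb_mul_self γ ψ x
  rw [h] at this
  exact this.symm

/-- An adelic point of the torus of `ψ`, with given components at infinity, such that `γ t` is
integral at the places in `P`; here `γ` maps the eigenpoint `τ` of `ψ` to a point `τ₁` with the same
multiplier ring. -/
lemma exists_mem_torus [NumberField F] [IsTotallyReal F] {R₁ O : Type*} [CommRing R₁] [IsDomain R₁]
    [IsPrincipalIdealRing R₁] [Algebra R₁ F] [IsFractionRing R₁ F] [Algebra R₁ K]
    [IsScalarTower R₁ F K] [CommRing O] [Algebra O K]
    (hK : Module.finrank F K = 2) {ψ : K →ₐ[F] Matrix (Fin 2) (Fin 2) F} {τ τ₁ : K}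
    (hτ : IsEigenPoint ψ τ) (hτ₁ : τ₁ ∉ Set.range (algebraMap F K)) (hO : IsProper R₁ O τ)
    (hO₁ : IsProper R₁ O τ₁) {P : HeightOneSpectrum R → Prop}
    (hP : ∀ v, P v → ∀ r : R₁, v.valuation F (algebraMap R₁ F r) ≤ 1)
    {γ : GL (Fin 2) F} (hγ : Moebius γ τ τ₁) (r : InfinitePlace F → PGL(2, ℝ))
    (hr : ∀ v, r v ∈ torus (realEmb v) ψ) :
    ∃ t ∈ torus (algebraMap F (AdeleRing R F)) ψ,
      (∀ v, ProjGenLinGroup.map (infComp R F v) t = r v) ∧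
      (∀ v, P v → ProjGenLinGroup.map (algebraMap F (v.adicCompletion F)) (ProjGenLinGroup.mk γ) *
        ProjGenLinGroup.map (finComp R F v) t ∈ maxCompact F v) ∧
      ∀ v, ¬ P v → ProjGenLinGroup.map (finComp R F v) t = 1 := by
  classical
  choose ρ hρ hρc using fun v => (mem_torus_iff hK _ _ _).1 (hr v)
  have hloc : ∀ v : HeightOneSpectrum R, ∃ δ : GL (Fin 2) F, Moebius δ τ τ ∧
      (P v → IsIntegralGL (v.valuation F) (γ * δ)) ∧ (¬ P v → δ = 1) ∧
      (IsIntegralGL (v.valuation F) γ → δ = 1) := fun v => by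
    have h1 : Moebius (1 : GL (Fin 2) F) τ τ := by simp [Moebius]
    by_cases hv : P v
    · by_cases hi : IsIntegralGL (v.valuation F) γ
      · exact ⟨1, h1, fun _ => by simpa using hi, fun _ => rfl, fun _ => rfl⟩
      · obtain ⟨g, hg, hgm⟩ := exists_isIntegralGL_moebius hK (v.valuation F) (hP v hv)
          (hτ.notMem hK) hτ₁ hO hO₁
        exact ⟨γ⁻¹ * g, hgm.mul hγ.inv, fun _ => by simpa using hg, fun h => absurd hv h,
          fun h => absurd h hi⟩
    · exact ⟨1, h1, fun h => absurd h hv, fun _ => rfl, fun _ => rfl⟩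
  choose δ hδ hδP hδ1 hδi using hloc
  obtain ⟨a, ha, ha'⟩ := exists_adelic_GL (R := R) (F := F)
    (fun v => GeneralLinearGroup.map (algebraMap F (v.adicCompletion F)) (δ v)) (by
      filter_upwards [eventually_isIntegralGL (R := R) γ] with v hv
      rw [hδi v hv, map_one]
      exact isIntegralGL_one) ρ
  have hfin : ∀ v, ProjGenLinGroup.map (finComp R F v) (ProjGenLinGroup.mk a) =
      ProjGenLinGroup.map (algebraMap F (v.adicCompletion F)) (ProjGenLinGroup.mk (δ v)) :=
    fun v => congrArg ProjGenLinGroup.mk (ha v)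
  refine ⟨ProjGenLinGroup.mk a, (mem_torus_iff hK _ _ _).2 ⟨a, rfl, fun x => ?_⟩, fun v => ?_,
    fun v hv => ?_, fun v hv => ?_⟩
  · refine adelic_commute (fun v => ?_) fun v => ?_
    · have e : a.val.map (finComp R F v) = (δ v).val.map (algebraMap F (v.adicCompletion F)) :=
        congrArg Units.val (ha v)
      rw [e, Matrix.map_map, ← RingHom.coe_comp, finComp_comp_algebraMap]
      have := congrArg (fun M : Matrix (Fin 2) (Fin 2) F =>
        M.map (algebraMap F (v.adicCompletion F))) ((hδ v).commute hK hτ x).eq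
      simp only [Matrix.map_mul] at this
      exact this
    · have e : a.val.map (infComp R F v) = (ρ v).val := congrArg Units.val (ha' v)
      rw [e, Matrix.map_map, ← RingHom.coe_comp, infComp_comp_algebraMap]
      exact hρc v x
  · rw [← hρ v]
    exact congrArg ProjGenLinGroup.mk (ha' v)
  · rw [hfin, ← map_mul, ← map_mul]
    exact map_mk_mem_maxCompact (hδP v hv)
  · rw [hfin, hδ1 v hv, map_one, map_one]

end FinitePlaces

/-! ### The adelic double quotient of the Hilbert modular group -/

section Adelic

variable {R F : Type*} [CommRing R] [IsDedekindDomain R] [Field F]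
  [IsTotallyReal F] [Algebra R F] [IsFractionRing R F]

lemma exists_adelic_PGL (g : ∀ v : HeightOneSpectrum R, PGL(2, v.adicCompletion F))
    (hg : ∀ᶠ v in Filter.cofinite, g v = 1) (r : InfinitePlace F → PGL(2, ℝ)) :
    ∃ a : PGL(2, AdeleRing R F), (∀ v, ProjGenLinGroup.map (finComp R F v) a = g v) ∧
      ∀ v, ProjGenLinGroup.map (infComp R F v) a = r v := by
  classical
  choose g' hg' using fun v => ProjGenLinGroup.mk_surjective (g v)
  choose r' hr' using fun v => ProjGenLinGroup.mk_surjective (r v)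
  obtain ⟨a, h1, h2⟩ := exists_adelic_GL (R := R) (F := F)
    (fun v => if g v = 1 then 1 else g' v) (hg.mono fun v hv => by
      rw [if_pos hv]; exact isIntegralGL_one) r'
  refine ⟨ProjGenLinGroup.mk a, fun v => ?_, fun v => ?_⟩
  · refine (congrArg ProjGenLinGroup.mk (h1 v)).trans ?_
    split_ifs with h
    · rw [h, map_one]
    · exact hg' v
  · exact (congrArg ProjGenLinGroup.mk (h2 v)).trans (hr' v)

/-- If units of `R₁` have all signs, the signs at the infinite places can be corrected by a matrix
which is integral at the places where `R₁` is. -/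
lemma exists_signs [NumberField F] {R₁ : Type*} [CommRing R₁] [Algebra R₁ F]
    (hU : ∀ a : F, a ≠ 0 → ∃ ε : R₁ˣ, TotPos (algebraMap R₁ F ε * a))
    (y : InfinitePlace F → PGL(2, ℝ)) : ∃ γ : GL (Fin 2) F,
      (∀ v : HeightOneSpectrum R, (∀ r : R₁, v.valuation F (algebraMap R₁ F r) ≤ 1) →
        IsIntegralGL (v.valuation F) γ) ∧
      ∀ v, ProjGenLinGroup.map (realEmb v) (ProjGenLinGroup.mk γ) * y v ∈ PGLpos ℝ := by
  choose g hg using fun v => ProjGenLinGroup.mk_surjective (y v)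
  obtain ⟨a, ha0, ha⟩ := exists_sign (F := F) (fun v => (g v).det.val) fun v => (g v).det.ne_zero
  obtain ⟨ε, hε⟩ := hU a ha0
  have hε0 : algebraMap R₁ F ε ≠ 0 := left_ne_zero_of_mul hε.1
  have hdet : (!![algebraMap R₁ F ε, 0; 0, 1] : Matrix (Fin 2) (Fin 2) F).det =
    algebraMap R₁ F ε := by simp [det_fin_two]
  let γ : GL (Fin 2) F := GeneralLinearGroup.mkOfDetNeZero _ (by rw [hdet]; exact hε0)
  refine ⟨γ, fun v hv => ⟨fun i j => ?_, ?_⟩, fun v => ?_⟩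
  · fin_cases i <;> fin_cases j <;> simp [γ, GeneralLinearGroup.mkOfDetNeZero, hv]
  · have h1 : v.valuation F (algebraMap R₁ F ε) * v.valuation F (algebraMap R₁ F (ε⁻¹ : R₁ˣ)) = 1 := by
      rw [← map_mul, ← map_mul, Units.mul_inv, map_one, map_one]
    refine (congrArg _ hdet).trans (le_antisymm (hv _) ?_)
    rw [← h1]
    exact mul_le_of_le_one_right' (hv _)
  · rw [← hg]
    change ProjGenLinGroup.mk (GeneralLinearGroup.map (realEmb v) γ * g v) ∈ _
    rw [mk_mem_PGLpos_iff, map_mul, Units.val_mul, GeneralLinearGroup.map_det]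
    have h1 : γ.det.val = algebraMap R₁ F ε := hdet
    change 0 < realEmb v γ.det.val * _
    rw [h1]
    have h2 := hε.2 (realEmb v)
    rw [map_mul] at h2
    have h3 := mul_pos h2 (ha v)
    have h4 : 0 < realEmb v a ^ 2 := by
      have : realEmb v a ≠ 0 := (map_ne_zero _).2 ha0
      positivity
    exact pos_of_mul_pos_left (b := realEmb v a ^ 2) (by linarith) h4.le

end Adelic

section ATR

variable {F : Type*} [Field F] [NumberField F] [IsTotallyReal F]

/-- `PSL₂(ℤ_F)` consists of the elements of `PGL₂(F)` which are integral at all finite places and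
positive at all infinite ones, if `F` has narrow class number one. -/
lemma mem_hilbertModularGroup_iff (hF : Nat.card (NarrowPic (𝓞 F) F) = 1) (γ : PGL(2, F)) :
    γ ∈ hilbertModularGroup F ↔
      (∀ v : HeightOneSpectrum (𝓞 F), ProjGenLinGroup.map (algebraMap F (v.adicCompletion F)) γ ∈
        maxCompact F v) ∧ ∀ v, ProjGenLinGroup.map (realEmb v) γ ∈ PGLpos ℝ := by
  constructor
  · rintro ⟨g, rfl⟩
    induction g using QuotientGroup.induction_on with | H g => ?_
    set γ : GL (Fin 2) F := GeneralLinearGroup.map (algebraMap (𝓞 F) F) (SpecialLinearGroup.toGL g)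
      with hγ
    have hdet : γ.det = 1 := by
      rw [hγ, GeneralLinearGroup.map_det]
      simp
    change (∀ v : HeightOneSpectrum (𝓞 F), ProjGenLinGroup.map (algebraMap F (v.adicCompletion F))
      (ProjGenLinGroup.mk γ) ∈ maxCompact F v) ∧
        ∀ v, ProjGenLinGroup.map (realEmb v) (ProjGenLinGroup.mk γ) ∈ PGLpos ℝ
    refine ⟨fun v => map_mk_mem_maxCompact ⟨fun i j => ?_, ?_⟩, fun v => ?_⟩
    · exact v.valuation_le_one _
    · rw [hdet]; simp
    · change ProjGenLinGroup.mk (GeneralLinearGroup.map (realEmb v) γ) ∈ _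
      rw [mk_mem_PGLpos_iff, GeneralLinearGroup.map_det, hdet]
      simp
  · rintro ⟨h1, h2⟩
    have := isPrincipalIdealRing_of_narrowPic hF
    obtain ⟨g, rfl, hg⟩ := exists_isIntegralGL_rep (R := 𝓞 F) γ
    obtain ⟨g', rfl⟩ := exists_map_eq_of_forall (R := 𝓞 F)
      (fun v : HeightOneSpectrum (𝓞 F) => v.valuation F)
      (fun x hx => HeightOneSpectrum.mem_integers_of_valuation_le_one F x hx) g
      (fun v => hg v (h1 v))
    have hpos : TotPos (algebraMap (𝓞 F) F g'.det.val) := totPos_iff.2 fun v => by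
      have := h2 v
      change ProjGenLinGroup.mk (GeneralLinearGroup.map (realEmb v)
        (GeneralLinearGroup.map (algebraMap (𝓞 F) F) g')) ∈ _ at this
      rwa [mk_mem_PGLpos_iff, GeneralLinearGroup.map_det, GeneralLinearGroup.map_det] at this
    obtain ⟨w, hw⟩ := exists_sq_of_totPos_unit hF hpos
    have hdet : ((w⁻¹ : (𝓞 F)ˣ).val • g'.val).det = 1 := by
      rw [Matrix.det_smul, Fintype.card_fin, ← GeneralLinearGroup.val_det_apply, ← hw,
        ← Units.val_pow_eq_pow_val, ← Units.val_mul, ← mul_pow, inv_mul_cancel, one_pow,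
        Units.val_one]
    refine ⟨QuotientGroup.mk (⟨_, hdet⟩ : SpecialLinearGroup (Fin 2) (𝓞 F)), ?_⟩
    refine congrArg (ProjGenLinGroup.map (algebraMap (𝓞 F) F)) (ProjGenLinGroup.mk_eq_mk_iff.2
      ⟨w, Units.ext (Matrix.ext fun i j => ?_)⟩)
    rw [Units.val_mul, GeneralLinearGroup.coe_scalar, Matrix.mul_apply, Fin.sum_univ_two]
    change (w⁻¹ : (𝓞 F)ˣ).val * g' i 0 * _ + (w⁻¹ : (𝓞 F)ˣ).val * g' i 1 * _ = g' i j
    have hw1 : (w⁻¹ : (𝓞 F)ˣ).val * w.val = 1 := Units.inv_mul w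
    fin_cases j
    · simp; linear_combination g' i 0 * hw1
    · simp; linear_combination g' i 1 * hw1

/-- The elements of `PGL₂(𝔸_F)` in `PGL₂(ℤ̂_F) × PGL₂⁺(F_∞)`. -/
def goodATR (F : Type*) [Field F] [NumberField F] [IsTotallyReal F] :
    Set PGL(2, AdeleRing (𝓞 F) F) :=
  {y | (∀ v, ProjGenLinGroup.map (finComp (𝓞 F) F v) y ∈ maxCompact F v) ∧
    ∀ v, ProjGenLinGroup.map (infComp (𝓞 F) F v) y ∈ PGLpos ℝ}

/-- The point `y_∞ (i, (i, i), …, (i, i))`. -/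
noncomputable def pointATR (v₀ : InfinitePlace F) (y : PGL(2, AdeleRing (𝓞 F) F)) :
    HilbertSpace v₀ UnitTangent :=
  (ProjGenLinGroup.map (infComp (𝓞 F) F v₀) y • UpperHalfPlane.I,
    fun v => ProjGenLinGroup.map (infComp (𝓞 F) F v.1) y • UnitTangent.base)

lemma mem_levelATR_iff {v₀ : InfinitePlace F} {u : PGL(2, AdeleRing (𝓞 F) F)} :
    u ∈ levelATR v₀ ↔ (∀ v, ProjGenLinGroup.map (finComp (𝓞 F) F v) u ∈ maxCompact F v) ∧
      ProjGenLinGroup.map (infComp (𝓞 F) F v₀) u ∈ PSO2 ∧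
      ∀ v, v ≠ v₀ → ProjGenLinGroup.map (infComp (𝓞 F) F v) u = 1 := by
  simp only [levelATR, Subgroup.mem_inf, Subgroup.mem_iInf, Subgroup.mem_comap, Subgroup.mem_bot,
    Subtype.forall, and_assoc]

/-- Every class in `[G]` has a representative in `PGL₂(ℤ̂_F) × PGL₂⁺(F_∞)`: as `ℤ_F` is principal
one can clear the finite places, and units of all signs correct the infinite ones. -/
lemma exists_mul_mem_goodATR (hF : Nat.card (NarrowPic (𝓞 F) F) = 1)
    (x : PGL(2, AdeleRing (𝓞 F) F)) : ∃ γ : GL (Fin 2) F,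
      ProjGenLinGroup.map (algebraMap F (AdeleRing (𝓞 F) F)) (ProjGenLinGroup.mk γ) * x ∈
        goodATR F := by
  have := isPrincipalIdealRing_of_narrowPic hF
  obtain ⟨γ, hγ⟩ := exists_forall_mul_mem_maxCompact (R := 𝓞 F) (F := F)
    (fun v => ProjGenLinGroup.map (finComp (𝓞 F) F v) x)
    (eventually_map_finComp_mem_maxCompact x)
  obtain ⟨δ, hδ, hδ'⟩ := exists_signs (R := 𝓞 F) (fun a ha => exists_unit_totPos_mul hF ha)
    fun v => ProjGenLinGroup.map (realEmb v) (ProjGenLinGroup.mk γ) *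
      ProjGenLinGroup.map (infComp (𝓞 F) F v) x
  refine ⟨δ * γ, fun v => ?_, fun v => ?_⟩
  · rw [map_mul, map_finComp_map, map_mul, map_mul, mul_assoc]
    exact mul_mem (map_mk_mem_maxCompact (hδ v fun r => v.valuation_le_one r)) (hγ v)
  · rw [map_mul, map_infComp_map, map_mul, map_mul, mul_assoc]
    exact hδ' v

/-- The canonical identification of the adelic double quotient with the quotient by `PSL₂(ℤ_F)`. -/
lemma exists_isIdentificationATR (hF : Nat.card (NarrowPic (𝓞 F) F) = 1) (v₀ : InfinitePlace F) :
    ∃ Φ : AdelicDoubleQuotient (levelATR v₀) → HilbertQuotient v₀ UnitTangent,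
      Function.Bijective Φ ∧ ∀ x γ,
        ProjGenLinGroup.map (algebraMap F (AdeleRing (𝓞 F) F)) γ * x ∈ goodATR F →
        Φ (DoubleCoset.mk _ _ x) = Quotient.mk _ (pointATR v₀
          (ProjGenLinGroup.map (algebraMap F (AdeleRing (𝓞 F) F)) γ * x)) := by
  refine exists_doubleCoset_identification
    (ProjGenLinGroup.map (algebraMap F (AdeleRing (𝓞 F) F))) (levelATR v₀) (goodATR F)
    (hilbertModularGroup F) (pointATR v₀) ?_ ?_ ?_ ?_ ?_ ?_
  · intro x
    obtain ⟨γ, hγ⟩ := exists_mul_mem_goodATR hF x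
    exact ⟨_, hγ⟩
  · intro y hy γ
    rw [mem_hilbertModularGroup_iff hF]
    refine and_congr (forall_congr' fun v => ?_) (forall_congr' fun v => ?_)
    · rw [map_mul, map_finComp_map]
      exact Subgroup.mul_mem_cancel_right _ (hy.1 v)
    · rw [map_mul, map_infComp_map]
      exact Subgroup.mul_mem_cancel_right _ (hy.2 v)
  · intro y γ
    refine Prod.ext ?_ (funext fun v => ?_)
    · change ProjGenLinGroup.map (infComp (𝓞 F) F v₀) _ • _ = _
      rw [map_mul, map_infComp_map, mul_smul]; rfl
    · change ProjGenLinGroup.map (infComp (𝓞 F) F v.1) _ • _ = _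
      rw [map_mul, map_infComp_map, mul_smul]; rfl
  · intro y hy u hu
    rw [mem_levelATR_iff] at hu
    refine ⟨fun v => ?_, fun v => ?_⟩
    · rw [map_mul]; exact mul_mem (hy.1 v) (hu.1 v)
    · rw [map_mul]
      refine mul_mem (hy.2 v) ?_
      by_cases hv : v = v₀
      · rw [hv]; exact ((mem_PSO2_iff _).1 hu.2.1).1
      · rw [hu.2.2 v hv]; exact one_mem _
  · intro y hy y' hy'
    rw [mem_levelATR_iff]
    constructor
    · intro h
      refine ⟨fun v => ?_, ?_, fun v hv => ?_⟩
      · rw [map_mul, map_inv]; exact mul_mem (inv_mem (hy.1 v)) (hy'.1 v)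
      · rw [map_mul, map_inv]
        exact (smul_I_eq_smul_I_iff (hy.2 v₀) (hy'.2 v₀)).1 (congrArg Prod.fst h)
      · rw [map_mul, map_inv, inv_mul_eq_one]
        exact (smul_base_eq_smul_base_iff (hy.2 v) (hy'.2 v)).1
          (congrFun (congrArg Prod.snd h) ⟨v, hv⟩)
    · rintro ⟨-, h1, h2⟩
      refine Prod.ext ?_ (funext fun v => ?_)
      · rw [map_mul, map_inv] at h1
        exact (smul_I_eq_smul_I_iff (hy.2 v₀) (hy'.2 v₀)).2 h1
      · have := h2 v.1 v.2
        rw [map_mul, map_inv, inv_mul_eq_one] at this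
        exact (smul_base_eq_smul_base_iff (hy.2 v) (hy'.2 v)).2 this
  · rintro ⟨z, w⟩
    classical
    obtain ⟨g₀, hg₀, rfl⟩ := exists_PGLpos_smul_I z
    choose g hg hgw using fun v => exists_PGLpos_smul_base (w v)
    obtain ⟨a, ha, ha'⟩ := exists_adelic_PGL (R := 𝓞 F) (F := F) (fun v => 1)
      (Filter.Eventually.of_forall fun v => rfl)
      (fun v => if h : v ≠ v₀ then g ⟨v, h⟩ else g₀)
    refine ⟨a, ⟨fun v => ?_, fun v => ?_⟩, Prod.ext ?_ (funext fun v => ?_)⟩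
    · rw [ha]; exact one_mem _
    · rw [ha']
      split_ifs with h
      · exact hg _
      · exact hg₀
    · change ProjGenLinGroup.map (infComp (𝓞 F) F v₀) a • _ = _
      rw [ha', dif_neg (not_not.2 rfl)]
    · change ProjGenLinGroup.map (infComp (𝓞 F) F v.1) a • _ = _
      rw [ha', dif_pos v.2, hgw]

end ATR

/-! ### Orbits of the diagonal group along a geodesic -/

section GeodesicOrbit

variable {Z : Type*} [MulAction PGL(2, ℝ) Z]

/-- The image of `x` under the elements of `PGL₂⁺(ℝ)` which send `∞` to `a` and `0` to `b`. For
`x = i` this is the geodesic joining `a` and `b`, for `x = (i, i)` it is the set of its unit tangent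
vectors pointing towards `a`. -/
def geodesicOrbit (x : Z) (a b : ℝ) : Set Z :=
  {w | ∃ y ∈ PGLpos ℝ, y • (OnePoint.infty : OnePoint ℝ) = (a : OnePoint ℝ) ∧
    y • ((0 : ℝ) : OnePoint ℝ) = (b : OnePoint ℝ) ∧ y • x = w}

lemma geodesicOrbit_nonempty (x : Z) {a b : ℝ} (hab : a ≠ b) : (geodesicOrbit x a b).Nonempty := by
  obtain ⟨g, hg, ha, hb⟩ := exists_PGLpos_endpoints hab
  exact ⟨_, g, hg, ha, hb, rfl⟩

lemma smul_mem_geodesicOrbit {x w : Z} {a b a' b' : ℝ} (hw : w ∈ geodesicOrbit x a b)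
    {g : PGL(2, ℝ)} (hg : g ∈ PGLpos ℝ) (ha : g • (a : OnePoint ℝ) = (a' : OnePoint ℝ))
    (hb : g • (b : OnePoint ℝ) = (b' : OnePoint ℝ)) : g • w ∈ geodesicOrbit x a' b' := by
  obtain ⟨y, hy, h1, h2, rfl⟩ := hw
  exact ⟨g * y, mul_mem hg hy, by rw [mul_smul, h1, ha], by rw [mul_smul, h2, hb], mul_smul _ _ _⟩

lemma geodesicOrbit_I {a b : ℝ} (hab : a ≠ b) :
    geodesicOrbit UpperHalfPlane.I a b = geodesic a b := by
  ext z
  constructor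
  · rintro ⟨y, hy, ha, hb, rfl⟩
    exact (smul_mem_geodesic_iff hy hab ha hb _).2 (by simp)
  · intro hz
    obtain ⟨g, hg, ha, hb⟩ := exists_PGLpos_endpoints hab
    obtain ⟨k, hk, rfl⟩ := (geodesic_eq_image hg hab ha hb z).1 hz
    have hk' := (mem_diagSubgroup_iff k).1 hk.1
    exact ⟨g * k, mul_mem hg hk.2, by rw [mul_smul, hk'.1, ha], by rw [mul_smul, hk'.2, hb], rfl⟩

lemma pt_image_geodesicOrbit (a b : ℝ) :
    UnitTangent.pt '' geodesicOrbit UnitTangent.base a b = geodesicOrbit UpperHalfPlane.I a b := by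
  ext z
  constructor
  · rintro ⟨_, ⟨y, hy, ha, hb, rfl⟩, rfl⟩
    exact ⟨y, hy, ha, hb, (smul_pt y UnitTangent.base).symm⟩
  · rintro ⟨y, hy, ha, hb, rfl⟩
    exact ⟨_, ⟨y, hy, ha, hb, rfl⟩, smul_pt y _⟩

/-- Right multiplication by `A⁺(ℝ)` preserves the conditions on the end points. -/
lemma mem_geodesicOrbit_of_diagPos {x : Z} {a b : ℝ} {y k : PGL(2, ℝ)} (hy : y ∈ PGLpos ℝ)
    (ha : y • (OnePoint.infty : OnePoint ℝ) = (a : OnePoint ℝ))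
    (hb : y • ((0 : ℝ) : OnePoint ℝ) = (b : OnePoint ℝ)) (hk : k ∈ diagPos) :
    (y * k) • x ∈ geodesicOrbit x a b := by
  have hk' := (mem_diagSubgroup_iff k).1 hk.1
  exact ⟨y * k, mul_mem hy hk.2, by rw [mul_smul, hk'.1, ha], by rw [mul_smul, hk'.2, hb], rfl⟩

end GeodesicOrbit

/-! ### Fixed points of optimal embeddings -/

section FixedPoints

variable {F K : Type*} [Field F] [Field K] [Algebra F K] {σ : K ≃ₐ[F] K}

lemma ne_conj (hK : Module.finrank F K = 2) (hσ : σ ≠ 1) {τ : K}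
    (hτ : τ ∉ Set.range (algebraMap F K)) : τ - σ τ ≠ 0 := fun h =>
  hτ ((conj_eq_self_iff hK hσ).1 (sub_eq_zero.1 h).symm)

lemma conj_notMem {τ : K} (hτ : τ ∉ Set.range (algebraMap F K)) :
    σ τ ∉ Set.range (algebraMap F K) := by
  rintro ⟨y, hy⟩
  exact hτ ⟨y, σ.injective (by rw [← hy, AlgEquiv.commutes])⟩

lemma Moebius.conj {γ : GL (Fin 2) F} {τ τ₁ : K} (h : Moebius γ τ τ₁) :
    Moebius γ (σ τ) (σ τ₁) := by
  unfold Moebius at h ⊢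
  have := congrArg σ h
  simpa only [map_add, map_mul, AlgEquiv.commutes] using this

/-- Möbius transformations are compatible with embeddings into a field. -/
lemma Moebius.map_smul {k : Type*} [Field k] {γ : GL (Fin 2) F} {τ τ₁ : K} (h : Moebius γ τ τ₁)
    {s : F →+* k} {ρ : K →+* k} (hρ : ∀ x, ρ (algebraMap F K x) = s x) :
    ProjGenLinGroup.map s (ProjGenLinGroup.mk γ) • ((ρ τ : k) : OnePoint k) =
      ((ρ τ₁ : k) : OnePoint k) := by
  refine (mk_smul_coe_iff (GeneralLinearGroup.map s γ) (ρ τ) (ρ τ₁)).2 ?_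
  have := congrArg ρ h
  simp only [map_add, map_mul, hρ] at this
  exact this

/-- The multiplier ring `R a τ + R` is stable under conjugation, as it contains the trace of
`a τ`. -/
lemma IsProper.conj {R O : Type*} [CommRing R] [IsDomain R] [IsPrincipalIdealRing R] [Algebra R F]
    [IsFractionRing R F] [Algebra R K] [IsScalarTower R F K] [CommRing O] [Algebra O K]
    (hK : Module.finrank F K = 2) (hσ : σ ≠ 1) {τ : K} (hτ : τ ∉ Set.range (algebraMap F K))
    (hO : IsProper R O τ) : IsProper R O (σ τ) := by
  obtain ⟨a, b, c, u, v, w, h, hp, -⟩ := exists_primitive_quadratic (R := R) hK hτ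
  have hσR : ∀ r : R, σ (algebraMap R K r) = algebraMap R K r := fun r => by
    rw [IsScalarTower.algebraMap_apply R F K, AlgEquiv.commutes]
  have h' : algebraMap R K a * σ τ * σ τ + algebraMap R K b * σ τ + algebraMap R K c = 0 := by
    have := congrArg σ h
    simpa only [map_add, map_mul, hσR, map_zero] using this
  have hsum : algebraMap R K a * τ + algebraMap R K a * σ τ = -algebraMap R K b := by
    apply mul_left_cancel₀ (ne_conj hK hσ hτ)
    linear_combination h - h'
  intro x
  rw [hO x, forall_mul_mem_lat_iff_of_primitive hτ h hp,
    forall_mul_mem_lat_iff_of_primitive (conj_notMem hτ) h' hp, mem_lat, mem_lat]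
  constructor
  · rintro ⟨m, n, rfl⟩
    refine ⟨-m, n - m * b, ?_⟩
    simp only [map_sub, map_mul, map_neg]
    linear_combination algebraMap R K m * hsum
  · rintro ⟨m, n, rfl⟩
    refine ⟨-m, n - m * b, ?_⟩
    simp only [map_sub, map_mul, map_neg]
    linear_combination algebraMap R K m * hsum

variable [CharZero F]

lemma IsFixedPoint.isFixedPoint_iff_eq (hK : Module.finrank F K = 2) (hσ : σ ≠ 1)
    {ψ : K →ₐ[F] Matrix (Fin 2) (Fin 2) F} {τ τ' : K} (h : IsFixedPoint ψ τ) :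
    IsFixedPoint ψ τ' ↔ τ' = τ ∨ τ' = σ τ := by
  obtain ⟨θ, hθ⟩ := exists_isEigenPoint hK ψ
  rw [hθ.isFixedPoint_iff_eq hK hσ]
  rcases (hθ.isFixedPoint_iff_eq hK hσ).1 h with rfl | rfl
  · rfl
  · rw [conj_conj hK, or_comm]

lemma exists_sub_conj_eq (hK : Module.finrank F K = 2) (hσ : σ ≠ 1) {τ₀ : K}
    (hτ₀ : τ₀ ∉ Set.range (algebraMap F K)) (τ : K) :
    ∃ q : F, τ - σ τ = algebraMap F K q * (τ₀ - σ τ₀) := by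
  have hne := ne_conj hK hσ hτ₀
  have hne' : σ τ₀ - τ₀ ≠ 0 := fun h => hne (by linear_combination -h)
  obtain ⟨q, hq⟩ : (τ - σ τ) / (τ₀ - σ τ₀) ∈ Set.range (algebraMap F K) := by
    refine (conj_eq_self_iff hK hσ).1 ?_
    rw [map_div₀, map_sub, map_sub, conj_conj hK, conj_conj hK, div_eq_div_iff hne' hne]
    ring
  exact ⟨q, ((eq_div_iff hne).1 hq).symm⟩

/-- An embedding can be replaced by its conjugate, so that a given fixed point becomes the
eigenpoint. -/
lemma exists_isEigenPoint_of_isFixedPoint (hK : Module.finrank F K = 2)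
    {ψ : K →ₐ[F] Matrix (Fin 2) (Fin 2) F} {τ : K} (h : IsFixedPoint ψ τ) :
    ∃ ψ' : K →ₐ[F] Matrix (Fin 2) (Fin 2) F, IsEigenPoint ψ' τ ∧ Set.range ψ' = Set.range ψ := by
  obtain ⟨σ, hσ⟩ := exists_conj hK
  obtain ⟨θ, hθ⟩ := exists_isEigenPoint hK ψ
  rcases (hθ.isFixedPoint_iff_eq hK hσ).1 h with rfl | rfl
  · exact ⟨ψ, hθ, rfl⟩
  · exact ⟨_, hθ.comp_conj hK, range_comp_conj ψ⟩

end FixedPoints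

/-! ### ATR cycles and their lifts -/

section ATRPlace

variable {F : Type*} [Field F] [IsTotallyReal F] {K : Type*} [Field K] [Algebra F K]
  {v₀ : InfinitePlace F} {ρ₀ : K →+* ℂ}

/-- The distinguished place of an almost totally real extension does not extend to a real embedding:
`K ⊗ ℝ = ℂ` has no real point. -/
lemma IsATR.not_exists_real (h : IsATR K v₀) :
    ¬ ∃ ρ : K →+* ℝ, ρ.comp (algebraMap F K) = realEmb v₀ := by
  rintro ⟨ρ, hρ⟩
  have h1 := h.1
  let _ := (realEmb v₀).toAlgebra
  obtain ⟨e⟩ := h1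
  let f : K →ₐ[F] ℝ := { ρ with commutes' := fun x => congr($hρ x) }
  let g : TensorProduct F ℝ K →ₐ[ℝ] ℝ :=
    Algebra.TensorProduct.lift (AlgHom.id ℝ ℝ) f fun _ _ => Commute.all _ _
  have h2 := congrArg (g.comp (e.symm : ℂ →ₐ[ℝ] TensorProduct F ℝ K)) Complex.I_mul_I
  rw [map_mul, map_neg, map_one] at h2
  nlinarith [mul_self_nonneg ((g.comp (e.symm : ℂ →ₐ[ℝ] TensorProduct F ℝ K)) Complex.I)]

variable (hK : Module.finrank F K = 2) (hATR : IsATR K v₀)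
  (hρ₀ : ∀ x, ρ₀ (algebraMap F K x) = (realEmb v₀ x : ℂ))

include hK hATR hρ₀ in
lemma im_ne_zero {τ : K} (hτ : τ ∉ Set.range (algebraMap F K)) : (ρ₀ τ).im ≠ 0 := by
  intro h
  have him : ∀ y, (ρ₀ y).im = 0 := fun y => by
    obtain ⟨a, b, rfl⟩ := exists_coord hK hτ y
    simp [hρ₀, h]
  refine hATR.not_exists_real ⟨⟨⟨⟨fun y => (ρ₀ y).re, by simp⟩, fun x y => ?_⟩, by simp, ?_⟩, ?_⟩
  · simp [him]
  · intro x y; simp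
  · ext x; simp [hρ₀]

end ATRPlace

section ATRPoints

variable {F : Type*} [Field F] [IsTotallyReal F] {K : Type*} [Field K] [Algebra F K]
  {v₀ : InfinitePlace F} {ρ₀ : K →+* ℂ} {σ : K ≃ₐ[F] K}
  (hK : Module.finrank F K = 2) (hσ : σ ≠ 1) (hATR : IsATR K v₀)
  (hρ₀ : ∀ x, ρ₀ (algebraMap F K x) = (realEmb v₀ x : ℂ))

include hρ₀ in
lemma notMem_of_im_pos {τ : K} (hτ : 0 < (ρ₀ τ).im) : τ ∉ Set.range (algebraMap F K) := by
  rintro ⟨x, rfl⟩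
  rw [hρ₀, Complex.ofReal_im] at hτ
  exact lt_irrefl _ hτ

section

variable [CharZero F]

include hK hσ hρ₀ in
lemma im_conj (τ : K) : (ρ₀ (σ τ)).im = -(ρ₀ τ).im := by
  obtain ⟨t, ht⟩ := exists_trace hK hσ τ
  have := congrArg (fun x => (ρ₀ x).im) ht
  simp only [hρ₀, map_add, Complex.add_im, Complex.ofReal_im] at this
  linarith

include hK hσ hATR hρ₀ in
/-- The norm of a nonzero element is positive at the distinguished place. -/
lemma norm_pos_of_isATR {x : K} (hx : x ≠ 0) {n : F} (hn : x * σ x = algebraMap F K n) :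
    0 < realEmb v₀ n := by
  have hconj : ρ₀ (σ x) = (starRingEnd ℂ) (ρ₀ x) := by
    refine Complex.ext ?_ (im_conj hK hσ hρ₀ x)
    rw [Complex.conj_re]
    by_cases hxF : x ∈ Set.range (algebraMap F K)
    · rw [(conj_eq_self_iff hK hσ).2 hxF]
    · apply mul_left_cancel₀ (im_ne_zero hK hATR hρ₀ hxF)
      have h := congrArg (fun y => (ρ₀ y).im) hn
      simp only [hρ₀, map_mul, Complex.mul_im, Complex.ofReal_im, im_conj hK hσ hρ₀ x] at h
      linarith
  have h := congrArg ρ₀ hn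
  rw [map_mul, hconj, Complex.mul_conj, hρ₀] at h
  rw [← Complex.ofReal_inj.1 h]
  exact Complex.normSq_pos.2 ((map_ne_zero ρ₀).2 hx)

include hK hσ hρ₀ in
lemma IsATRPoint.unique {ψ : K →ₐ[F] Matrix (Fin 2) (Fin 2) F} {τ τ₁ : K}
    (h : IsATRPoint ρ₀ ψ τ) (h₁ : IsATRPoint ρ₀ ψ τ₁) : τ₁ = τ := by
  rcases (h.1.isFixedPoint_iff_eq hK hσ).1 h₁.1 with h' | h'
  · exact h'
  · have := h₁.2
    rw [h', im_conj hK hσ hρ₀] at this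
    linarith [h.2]

include hK hσ hATR hρ₀ in
lemma exists_isATRPoint (ψ : K →ₐ[F] Matrix (Fin 2) (Fin 2) F) : ∃ τ, IsATRPoint ρ₀ ψ τ := by
  obtain ⟨θ, hθ⟩ := exists_isEigenPoint hK ψ
  rcases lt_or_gt_of_ne (im_ne_zero hK hATR hρ₀ (hθ.notMem hK)) with h | h
  · exact ⟨σ θ, (hθ.isFixedPoint_iff_eq hK hσ).2 (Or.inr rfl), by
      rw [im_conj hK hσ hρ₀]; linarith⟩
  · exact ⟨θ, hθ.isFixedPoint, h⟩

end

include hρ₀ in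
lemma Moebius.smul_eq {γ : GL (Fin 2) F} {τ τ₁ : K} (h : Moebius γ τ τ₁)
    (hγ : ProjGenLinGroup.map (realEmb v₀) (ProjGenLinGroup.mk γ) ∈ PGLpos ℝ) {z z₁ : ℍ}
    (hz : (z : ℂ) = ρ₀ τ) (hz₁ : (z₁ : ℂ) = ρ₀ τ₁) :
    ProjGenLinGroup.map (realEmb v₀) (ProjGenLinGroup.mk γ) • z = z₁ := by
  refine (mk_smul_eq_iff (g := GeneralLinearGroup.map (realEmb v₀) γ)
    ((mk_mem_PGLpos_iff _).1 hγ) z z₁).2 ?_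
  have := congrArg ρ₀ h
  simp only [map_add, map_mul, hρ₀, ← hz, ← hz₁] at this
  exact this

include hρ₀ in
lemma moebius_of_smul_eq {γ : GL (Fin 2) F} {τ τ₁ : K}
    (hγ : ProjGenLinGroup.map (realEmb v₀) (ProjGenLinGroup.mk γ) ∈ PGLpos ℝ) {z z₁ : ℍ}
    (hz : (z : ℂ) = ρ₀ τ) (hz₁ : (z₁ : ℂ) = ρ₀ τ₁)
    (h : ProjGenLinGroup.map (realEmb v₀) (ProjGenLinGroup.mk γ) • z = z₁) : Moebius γ τ τ₁ := by
  have := (mk_smul_eq_iff (g := GeneralLinearGroup.map (realEmb v₀) γ)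
    ((mk_mem_PGLpos_iff _).1 hγ) z z₁).1 h
  apply ρ₀.injective
  simp only [map_add, map_mul, hρ₀, ← hz, ← hz₁]
  exact this

include hρ₀ in
/-- A Möbius transformation between two points of the upper half-plane has positive
determinant. -/
lemma Moebius.mem_PGLpos {γ : GL (Fin 2) F} {τ τ₁ : K} (h : Moebius γ τ τ₁) (hτ : 0 < (ρ₀ τ).im)
    (hτ₁ : 0 < (ρ₀ τ₁).im) :
    ProjGenLinGroup.map (realEmb v₀) (ProjGenLinGroup.mk γ) ∈ PGLpos ℝ := by
  refine (mk_mem_PGLpos_iff (GeneralLinearGroup.map (realEmb v₀) γ)).2 ?_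
  have hne := (GeneralLinearGroup.map (realEmb v₀) γ).det_ne_zero
  rw [GeneralLinearGroup.val_det_apply]
  rw [det_fin_two] at hne ⊢
  have e := congrArg ρ₀ h
  simp only [map_add, map_mul, hρ₀] at e
  change realEmb v₀ (γ 0 0) * realEmb v₀ (γ 1 1) - realEmb v₀ (γ 0 1) * realEmb v₀ (γ 1 0) ≠ 0 at hne
  change 0 < realEmb v₀ (γ 0 0) * realEmb v₀ (γ 1 1) - realEmb v₀ (γ 0 1) * realEmb v₀ (γ 1 0)
  generalize realEmb v₀ (γ 0 0) = a at *
  generalize realEmb v₀ (γ 0 1) = b at *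
  generalize realEmb v₀ (γ 1 0) = c at *
  generalize realEmb v₀ (γ 1 1) = d at *
  have er := congrArg Complex.re e
  have ei := congrArg Complex.im e
  simp only [Complex.add_re, Complex.add_im, Complex.mul_re, Complex.mul_im, Complex.ofReal_re,
    Complex.ofReal_im, zero_mul, sub_zero, add_zero] at er ei
  set x := (ρ₀ τ).re
  set y := (ρ₀ τ).im
  have key : (a * d - b * c) * y = (ρ₀ τ₁).im * ((c * x + d) ^ 2 + (c * y) ^ 2) := by
    linear_combination (c * x + d) * ei - c * y * er
  have h1 : 0 ≤ (a * d - b * c) * y := by rw [key]; positivity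
  exact lt_of_le_of_ne (nonneg_of_mul_nonneg_left h1 hτ) hne.symm

variable [NumberField F]

include hK hσ hATR hρ₀ in
/-- If `τ₀` lies in the upper half-plane, the oriented points are those in the upper half-plane. -/
lemma mem_orientedPoints_iff {ρ : {v : InfinitePlace F // v ≠ v₀} → K →+* ℝ}
    (hρ : ∀ v x, ρ v (algebraMap F K x) = realEmb v.1 x) {O : Type*} [CommRing O] [Algebra O K]
    {τ₀ : K} (hτ₀ : 0 < (ρ₀ τ₀).im) (τ : K) :
    τ ∈ orientedPoints (𝓞 F) O σ τ₀ ↔ IsProper (𝓞 F) O τ ∧ 0 < (ρ₀ τ).im := by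
  have hτ₀F := notMem_of_im_pos hρ₀ hτ₀
  have hne := ne_conj hK hσ hτ₀F
  have him : ∀ x : K, (ρ₀ (x - σ x)).im = 2 * (ρ₀ x).im := fun x => by
    rw [map_sub, Complex.sub_im, im_conj hK hσ hρ₀]; ring
  refine and_congr_right fun _ => ⟨?_, fun hτ => ?_⟩
  · rintro ⟨ξ, d, hd, e⟩
    have hξ : ξ ≠ 0 := by
      rintro rfl
      rw [zero_mul, zero_mul, eq_comm] at e
      exact mul_ne_zero ((map_ne_zero _).2 hd.1) hne e
    obtain ⟨n, hn⟩ := exists_norm hK hσ ξ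
    have hn0 := norm_pos_of_isATR hK hσ hATR hρ₀ hξ hn.symm
    rw [← hn] at e
    have := congrArg (fun x => (ρ₀ x).im) e
    simp only [map_mul, hρ₀, Complex.im_ofReal_mul, him] at this
    have h1 := mul_pos (hd.2 (realEmb v₀)) (mul_pos two_pos hτ₀)
    rw [← this] at h1
    linarith [pos_of_mul_pos_right h1 hn0.le]
  · have hτF := notMem_of_im_pos hρ₀ hτ
    obtain ⟨q, hq⟩ := exists_sub_conj_eq hK hσ hτ₀F τ
    refine exists_oriented_multiple hK hσ ⟨realEmb v₀⟩ hτ₀F (q := q) ?_ hq ?_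
    · rintro rfl
      rw [map_zero, zero_mul] at hq
      exact ne_conj hK hσ hτF hq
    · intro s hs
      obtain ⟨v, rfl⟩ := exists_realEmb_eq s
      obtain rfl : v = v₀ := by
        by_contra hv
        exact hs ⟨ρ ⟨v, hv⟩, RingHom.ext fun x => hρ ⟨v, hv⟩ x⟩
      have := congrArg (fun x => (ρ₀ x).im) hq
      simp only [map_mul, hρ₀, Complex.im_ofReal_mul, him] at this
      have h1 : 0 < realEmb v q * (2 * (ρ₀ τ₀).im) := by rw [← this]; positivity
      exact pos_of_mul_pos_left h1 (by positivity)

end ATRPoints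

section ATRSets

variable {F : Type*} [Field F] [IsTotallyReal F] {K : Type*} [Field K] [Algebra F K]
  {v₀ : InfinitePlace F} {ρ₀ : K →+* ℂ} {ρ : {v : InfinitePlace F // v ≠ v₀} → K →+* ℝ}
  {σ : K ≃ₐ[F] K} {Z : Type*} [MulAction PGL(2, ℝ) Z]

variable (v₀ ρ₀ ρ σ) in
/-- The image of `{τ} × ∏ (orbits along the geodesics joining τ and its conjugate)`. For `x = i` and
`x = (i, i)` this is the ATR cycle of `τ` and its lift. -/
def atrSet (x : Z) (τ : K) : Set (HilbertQuotient v₀ Z) :=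
  {q | ∃ (z : ℍ) (w : {v : InfinitePlace F // v ≠ v₀} → Z), (z : ℂ) = ρ₀ τ ∧
    (∀ v, w v ∈ geodesicOrbit x (ρ v τ) (ρ v (σ τ))) ∧ q = HilbertQuotient.mk v₀ z w}

lemma hilbertQuotient_mk_eq_iff {z z' : ℍ} {w w' : {v : InfinitePlace F // v ≠ v₀} → Z} :
    HilbertQuotient.mk v₀ z w = HilbertQuotient.mk v₀ z' w' ↔ ∃ γ ∈ hilbertModularGroup F,
      ProjGenLinGroup.map (realEmb v₀) γ • z' = z ∧
        ∀ v, ProjGenLinGroup.map (realEmb v.1) γ • w' v = w v := by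
  refine (Quotient.eq (r := MulAction.orbitRel (hilbertModularGroup F) (HilbertSpace v₀ Z))).trans ?_
  constructor
  · rintro ⟨γ, h⟩
    exact ⟨γ.1, γ.2, congrArg Prod.fst h, fun v => congrFun (congrArg Prod.snd h) v⟩
  · rintro ⟨γ, hγ, h1, h2⟩
    exact ⟨⟨γ, hγ⟩, Prod.ext h1 (funext h2)⟩

lemma hilbertProj_image_atrSet (τ : K) :
    hilbertProj v₀ '' atrSet v₀ ρ₀ ρ σ UnitTangent.base τ =
      atrSet v₀ ρ₀ ρ σ UpperHalfPlane.I τ := by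
  ext q
  constructor
  · rintro ⟨_, ⟨z, w, hz, hw, rfl⟩, rfl⟩
    refine ⟨z, fun v => (w v).pt, hz, fun v => ?_, rfl⟩
    rw [← pt_image_geodesicOrbit]
    exact ⟨_, hw v, rfl⟩
  · rintro ⟨z, w, hz, hw, rfl⟩
    simp only [← pt_image_geodesicOrbit] at hw
    choose w' hw' e using hw
    refine ⟨HilbertQuotient.mk v₀ z w', ⟨z, w', hz, hw', rfl⟩, ?_⟩
    rw [← funext e]
    rfl

variable [NumberField F] (hF : Nat.card (NarrowPic (𝓞 F) F) = 1)
  (hK : Module.finrank F K = 2) (hσ : σ ≠ 1)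
  (hρ₀ : ∀ x, ρ₀ (algebraMap F K x) = (realEmb v₀ x : ℂ))
  (hρ : ∀ v x, ρ v (algebraMap F K x) = realEmb v.1 x)

include hF hρ₀ in
lemma posEquiv_iff_exists_hilbertModularGroup {τ τ₁ : K} {z z₁ : ℍ}
    (hz : (z : ℂ) = ρ₀ τ) (hz₁ : (z₁ : ℂ) = ρ₀ τ₁) :
    PosEquiv (𝓞 F) F τ τ₁ ↔
      ∃ γ ∈ hilbertModularGroup F, ProjGenLinGroup.map (realEmb v₀) γ • z = z₁ := by
  constructor
  · rintro ⟨g, hdet, hg⟩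
    have hpos : ∀ v, ProjGenLinGroup.map (realEmb v)
        (ProjGenLinGroup.mk (GeneralLinearGroup.map (algebraMap (𝓞 F) F) g)) ∈ PGLpos ℝ := fun v => by
      refine (mk_mem_PGLpos_iff (GeneralLinearGroup.map (realEmb v)
        (GeneralLinearGroup.map (algebraMap (𝓞 F) F) g))).2 ?_
      rw [GeneralLinearGroup.map_det, GeneralLinearGroup.map_det]
      exact hdet.2 (realEmb v)
    refine ⟨_, (mem_hilbertModularGroup_iff hF _).2 ⟨fun v => map_mk_mem_maxCompact ⟨fun i j => ?_, ?_⟩,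
      hpos⟩, hg.smul_eq hρ₀ (hpos v₀) hz hz₁⟩
    · exact v.valuation_le_one _
    · rw [GeneralLinearGroup.map_det]
      have h1 : v.valuation F (algebraMap (𝓞 F) F g.det) *
          v.valuation F (algebraMap (𝓞 F) F (g.det⁻¹ : (𝓞 F)ˣ)) = 1 := by
        rw [← map_mul, ← map_mul, Units.mul_inv, map_one, map_one]
      refine le_antisymm (v.valuation_le_one _) ?_
      rw [← h1]
      exact mul_le_of_le_one_right' (v.valuation_le_one _)
  · rintro ⟨γ, ⟨g, rfl⟩, h⟩
    induction g using QuotientGroup.induction_on with | H g => ?_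
    have hpos : ProjGenLinGroup.map (realEmb v₀) (ProjGenLinGroup.mk
        (GeneralLinearGroup.map (algebraMap (𝓞 F) F) (SpecialLinearGroup.toGL g))) ∈ PGLpos ℝ := by
      refine (mk_mem_PGLpos_iff (GeneralLinearGroup.map (realEmb v₀) (GeneralLinearGroup.map
        (algebraMap (𝓞 F) F) (SpecialLinearGroup.toGL g)))).2 ?_
      rw [GeneralLinearGroup.map_det, GeneralLinearGroup.map_det]
      simp
    refine ⟨SpecialLinearGroup.toGL g, ?_, moebius_of_smul_eq hρ₀ hpos hz hz₁ h⟩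
    have : (SpecialLinearGroup.toGL g).det = 1 := by simp
    rw [this]
    simpa using totPos_one

include hF hK hσ hρ₀ hρ in
/-- The ATR sets of two points agree exactly if the points are equivalent; the component in the
upper half-plane at the distinguished place already determines the class of the point. -/
lemma atrSet_eq_iff (x : Z) {τ τ₁ : K} (hτ : 0 < (ρ₀ τ).im) (hτ₁ : 0 < (ρ₀ τ₁).im) :
    atrSet v₀ ρ₀ ρ σ x τ = atrSet v₀ ρ₀ ρ σ x τ₁ ↔ PosEquiv (𝓞 F) F τ τ₁ := by
  let z : ℍ := ⟨ρ₀ τ, hτ⟩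
  let z₁ : ℍ := ⟨ρ₀ τ₁, hτ₁⟩
  have hz : (z : ℂ) = ρ₀ τ := rfl
  have hz₁ : (z₁ : ℂ) = ρ₀ τ₁ := rfl
  have sub : ∀ {τ τ₁ : K} {z z₁ : ℍ} (hz : (z : ℂ) = ρ₀ τ) (hz₁ : (z₁ : ℂ) = ρ₀ τ₁),
      (∃ γ ∈ hilbertModularGroup F, ProjGenLinGroup.map (realEmb v₀) γ • z = z₁) →
      atrSet v₀ ρ₀ ρ σ x τ ⊆ atrSet v₀ ρ₀ ρ σ x τ₁ := by
    rintro τ τ₁ z z₁ hz hz₁ ⟨γ, hγ, h⟩ _ ⟨z', w, hz', hw, rfl⟩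
    obtain rfl : z' = z := UpperHalfPlane.ext (hz'.trans hz.symm)
    have hpos := ((mem_hilbertModularGroup_iff hF γ).1 hγ).2
    have hmk : HilbertQuotient.mk v₀ z' w = HilbertQuotient.mk v₀ z₁
        fun v => ProjGenLinGroup.map (realEmb v.1) γ • w v := by
      rw [eq_comm, hilbertQuotient_mk_eq_iff]
      exact ⟨γ, hγ, h, fun v => rfl⟩
    refine ⟨z₁, fun v => ProjGenLinGroup.map (realEmb v.1) γ • w v, hz₁, fun v => ?_, hmk⟩
    induction γ using ProjGenLinGroup.induction_on with
    | mk g =>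
      have hm := moebius_of_smul_eq hρ₀ (hpos v₀) hz hz₁ h
      exact smul_mem_geodesicOrbit (hw v) (hpos v.1) (hm.map_smul (hρ v)) (hm.conj.map_smul (hρ v))
  rw [posEquiv_iff_exists_hilbertModularGroup hF hρ₀ hz hz₁]
  constructor
  · intro h
    have hne : ∀ v, ρ v τ₁ ≠ ρ v (σ τ₁) := fun v h' =>
      ne_conj hK hσ (notMem_of_im_pos hρ₀ hτ₁) (sub_eq_zero.2 ((ρ v).injective h'))
    choose w hw using fun v => geodesicOrbit_nonempty x (hne v)
    obtain ⟨z', w', hz', -, e⟩ : HilbertQuotient.mk v₀ z₁ w ∈ atrSet v₀ ρ₀ ρ σ x τ := by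
      rw [h]; exact ⟨z₁, w, hz₁, hw, rfl⟩
    obtain rfl : z' = z := UpperHalfPlane.ext (hz'.trans hz.symm)
    obtain ⟨γ, hγ, e, -⟩ := hilbertQuotient_mk_eq_iff.1 e
    exact ⟨γ, hγ, e⟩
  · intro h
    refine (sub hz hz₁ h).antisymm (sub hz₁ hz ?_)
    obtain ⟨γ, hγ, e⟩ := h
    exact ⟨γ⁻¹, inv_mem hγ, by rw [map_inv, ← e, inv_smul_smul]⟩

include hK hσ hρ₀ in
/-- The ATR cycle of an embedding depends only on its point in the upper half-plane. -/
lemma atrCycle_eq {ψ : K →ₐ[F] Matrix (Fin 2) (Fin 2) F} {τ : K} (h : IsATRPoint ρ₀ ψ τ) :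
    atrCycle v₀ ρ₀ ρ ψ = atrSet v₀ ρ₀ ρ σ UpperHalfPlane.I τ := by
  have hne := ne_conj hK hσ (notMem_of_im_pos hρ₀ h.2)
  have hne' : ∀ v, ρ v τ ≠ ρ v (σ τ) := fun v h' => hne (sub_eq_zero.2 ((ρ v).injective h'))
  ext q
  constructor
  · rintro ⟨τ₁, τ', h₁, h₂, h₃, z, w, hz, hw, rfl⟩
    obtain rfl := h.unique hK hσ hρ₀ h₁
    obtain rfl := ((h₁.1.isFixedPoint_iff_eq hK hσ).1 h₂).resolve_left h₃
    exact ⟨z, w, hz, fun v => by rw [geodesicOrbit_I (hne' v)]; exact hw v, rfl⟩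
  · rintro ⟨z, w, hz, hw, rfl⟩
    refine ⟨τ, σ τ, h, (h.1.isFixedPoint_iff_eq hK hσ).2 (Or.inr rfl), ?_, z, w, hz, fun v => ?_, rfl⟩
    · exact fun h' => hne (sub_eq_zero.2 h'.symm)
    · rw [← geodesicOrbit_I (hne' v)]; exact hw v

include hK hσ hρ₀ hρ in
/-- In terms of points, `g` is normalized if `g` sends `i` to `τ` at the distinguished place, and `∞`
and `0` to `τ` and its conjugate at the other ones. -/
lemma isNormalizedATR_iff {ψ : K →ₐ[F] Matrix (Fin 2) (Fin 2) F} {τ : K} (h : IsATRPoint ρ₀ ψ τ)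
    {z : ℍ} (hz : (z : ℂ) = ρ₀ τ) {g : InfinitePlace F → PGL(2, ℝ)} :
    IsNormalizedATR v₀ ρ₀ ρ ψ g ↔ g v₀ ∈ PGLpos ℝ ∧ g v₀ • UpperHalfPlane.I = z ∧
      ∀ v : {v : InfinitePlace F // v ≠ v₀},
        g v.1 • (OnePoint.infty : OnePoint ℝ) = ((ρ v τ : ℝ) : OnePoint ℝ) ∧
        g v.1 • ((0 : ℝ) : OnePoint ℝ) = ((ρ v (σ τ) : ℝ) : OnePoint ℝ) := by
  obtain ⟨ψ', hψ', hr⟩ := exists_isEigenPoint_of_isFixedPoint hK h.1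
  have ht : ∀ v, torus (realEmb v) ψ = torus (realEmb v) ψ' := fun v =>
    (torus_eq_of_range_eq hK _ hr).symm
  constructor
  · rintro ⟨h1, h2, h3, τ₁, h4, h5⟩
    obtain rfl := h.unique hK hσ hρ₀ h4
    refine ⟨h1, ?_, fun v => ⟨h5 v, ?_⟩⟩
    · rw [ht] at h2
      exact (conj_PSO2_eq_torus_iff hK hψ' _ ρ₀ hρ₀ z hz h1).1 h2
    · have := h3 v.1 v.2
      rw [ht] at this
      exact (conj_diag_eq_torus_iff hK hσ hψ' _ (ρ v) (hρ v) (Or.inl ⟨rfl, rfl⟩) (h5 v)).1 this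
  · rintro ⟨h1, h2, h3⟩
    refine ⟨h1, ?_, fun v hv => ?_, τ, h, fun v => (h3 v).1⟩
    · rw [ht]
      exact (conj_PSO2_eq_torus_iff hK hψ' _ ρ₀ hρ₀ z hz h1).2 h2
    · rw [ht]
      exact (conj_diag_eq_torus_iff hK hσ hψ' _ (ρ ⟨v, hv⟩) (hρ ⟨v, hv⟩) (Or.inl ⟨rfl, rfl⟩)
        (h3 ⟨v, hv⟩).1).2 (h3 ⟨v, hv⟩).2

include hK hσ hρ₀ hρ in
/-- The elements normalized for `ψ`, multiplied by `PSO₂(ℝ)` and `A⁺(ℝ)`, are all the elements with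
the prescribed images of `i`, `∞` and `0`. -/
lemma atrLift_eq {ψ : K →ₐ[F] Matrix (Fin 2) (Fin 2) F} {τ : K} (h : IsATRPoint ρ₀ ψ τ) :
    atrLift v₀ ρ₀ ρ ψ = atrSet v₀ ρ₀ ρ σ UnitTangent.base τ := by
  classical
  let z : ℍ := ⟨ρ₀ τ, h.2⟩
  have hz : (z : ℂ) = ρ₀ τ := rfl
  ext q
  constructor
  · rintro ⟨g, hg, hpos, k, hk₀, hk, rfl⟩
    obtain ⟨h1, h2, h3⟩ := (isNormalizedATR_iff hK hσ hρ₀ hρ h hz).1 hg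
    refine ⟨_, _, ?_, fun v => ?_, rfl⟩
    · rw [mul_smul, ((mem_PSO2_iff _).1 hk₀).2, h2]
    · exact mem_geodesicOrbit_of_diagPos (hpos v.1) (h3 v).1 (h3 v).2 (hk v.1 v.2)
  · rintro ⟨z', w, hz', hw, rfl⟩
    obtain rfl : z' = z := UpperHalfPlane.ext (hz'.trans hz.symm)
    obtain ⟨g₀, hg₀, e₀⟩ := exists_PGLpos_smul_I z
    choose g hg h1 h2 h3 using hw
    obtain ⟨G, hG₀, hG⟩ : ∃ G : InfinitePlace F → PGL(2, ℝ), G v₀ = g₀ ∧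
        ∀ v : {v : InfinitePlace F // v ≠ v₀}, G v.1 = g v :=
      ⟨fun v => if hv : v ≠ v₀ then g ⟨v, hv⟩ else g₀, dif_neg (not_not.2 rfl),
        fun v => dif_pos v.2⟩
    refine ⟨G, (isNormalizedATR_iff hK hσ hρ₀ hρ h hz).2 ⟨?_, ?_, fun v => ?_⟩, fun v => ?_, 1,
      one_mem _, fun v hv => one_mem _, ?_⟩
    · rwa [hG₀]
    · rwa [hG₀]
    · rw [hG]; exact ⟨h1 v, h2 v⟩
    · by_cases hv : v = v₀
      · rw [hv, hG₀]; exact hg₀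
      · rw [hG ⟨v, hv⟩]; exact hg _
    · simp only [Pi.one_apply, mul_one, hG₀, hG, e₀, h3]

end ATRSets

/-! ### ATR cycles as images of toral sets -/

section SplitTorus

variable {F K : Type*} [Field F] [CharZero F] [Field K] [Algebra F K]

/-- At a split place, the torus is the group fixing both fixed points. -/
lemma mem_torus_iff_smul_of_split {k : Type*} [Field k] (hK : Module.finrank F K = 2)
    {s : K ≃ₐ[F] K} (hs : s ≠ 1) {ψ : K →ₐ[F] Matrix (Fin 2) (Fin 2) F} {τ : K}
    (hτ : IsEigenPoint ψ τ) (σ : F →+* k) (ρ : K →+* k) (hρ : ∀ x, ρ (algebraMap F K x) = σ x)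
    (t : PGL(2, k)) : t ∈ torus σ ψ ↔
      t • ((ρ τ : k) : OnePoint k) = ((ρ τ : k) : OnePoint k) ∧
        t • ((ρ (s τ) : k) : OnePoint k) = ((ρ (s τ) : k) : OnePoint k) := by
  induction t using ProjGenLinGroup.induction_on with
  | mk g => rw [mk_mem_torus_iff_of_split hK hs hτ σ ρ hρ, mk_smul_coe_iff, mk_smul_coe_iff]

end SplitTorus

lemma IsEigenPoint.mem_optATR_iff {F K : Type*} [Field F] [Field K] [Algebra F K]
    {O : Subalgebra (𝓞 F) K} (hK : Module.finrank F K = 2)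
    {ψ : K →ₐ[F] Matrix (Fin 2) (Fin 2) F} {τ : K} (h : IsEigenPoint ψ τ) :
    ψ ∈ optATR O ↔ IsProper (𝓞 F) O τ :=
  h.isOptimal_iff_isProper hK _ (fun _ => Iff.rfl) _ fun x =>
    ⟨fun hx => ⟨⟨x, hx⟩, rfl⟩, by rintro ⟨y, rfl⟩; exact y.2⟩

lemma mem_integers_range_iff {F : Type*} [Field F] [NumberField F] (x : F) :
    x ∈ (algebraMap (𝓞 F) F).range ↔ ∀ v : HeightOneSpectrum (𝓞 F), True → v.valuation F x ≤ 1 := by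
  refine ⟨?_, fun h => HeightOneSpectrum.mem_integers_of_valuation_le_one F x fun v => h v trivial⟩
  rintro ⟨y, rfl⟩ v -
  exact v.valuation_le_one y

lemma isProper_of_mem_optATR {F K : Type*} [Field F] [NumberField F] [Field K] [Algebra F K]
    {O : Subalgebra (𝓞 F) K} (hF : Nat.card (NarrowPic (𝓞 F) F) = 1) (hK : Module.finrank F K = 2)
    {ψ : K →ₐ[F] Matrix (Fin 2) (Fin 2) F} (hψ : ψ ∈ optATR O) {τ : K}
    (h : IsFixedPoint ψ τ) : IsProper (𝓞 F) O τ := by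
  have := isPrincipalIdealRing_of_narrowPic hF
  obtain ⟨σ, hσ⟩ := exists_conj hK
  obtain ⟨θ, hθ⟩ := exists_isEigenPoint hK ψ
  have hP := (hθ.mem_optATR_iff hK).1 hψ
  rcases (hθ.isFixedPoint_iff_eq hK hσ).1 h with rfl | rfl
  · exact hP
  · exact hP.conj hK hσ (hθ.notMem hK)

/-- The action on the upper half-plane at the distinguished place is given by Möbius
transformations in `K`. -/
lemma Moebius.coe_smul {F K : Type*} [Field F] [IsTotallyReal F] [Field K] [Algebra F K]
    {v₀ : InfinitePlace F} {ρ₀ : K →+* ℂ} (hρ₀ : ∀ x, ρ₀ (algebraMap F K x) = (realEmb v₀ x : ℂ))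
    {γ : GL (Fin 2) F} {τ τ₁ : K} (h : Moebius γ τ τ₁) (hτ : τ ∉ Set.range (algebraMap F K))
    (hγ : ProjGenLinGroup.map (realEmb v₀) (ProjGenLinGroup.mk γ) ∈ PGLpos ℝ) {z : ℍ}
    (hz : (z : ℂ) = ρ₀ τ) :
    ((ProjGenLinGroup.map (realEmb v₀) (ProjGenLinGroup.mk γ) • z : ℍ) : ℂ) = ρ₀ τ₁ := by
  have h1 := (mk_smul_eq_iff (g := GeneralLinearGroup.map (realEmb v₀) γ)
    ((mk_mem_PGLpos_iff _).1 hγ) z _).1 rfl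
  have h2 := congrArg ρ₀ h
  have h3 := (map_ne_zero ρ₀).2 (denom_ne_zero_of_notMem γ hτ)
  simp only [map_add, map_mul, hρ₀, ← hz] at h2 h3
  exact mul_right_cancel₀ h3 (h1.symm.trans h2)

section ATRPoints

variable {F : Type*} [Field F] [NumberField F] [IsTotallyReal F] {K : Type*} [Field K] [Algebra F K]
  {v₀ : InfinitePlace F} {ρ₀ : K →+* ℂ} {ρ : {v : InfinitePlace F // v ≠ v₀} → K →+* ℝ}
  {σ : K ≃ₐ[F] K} {O : Subalgebra (𝓞 F) K}
  (hF : Nat.card (NarrowPic (𝓞 F) F) = 1) (hK : Module.finrank F K = 2) (hσ : σ ≠ 1)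
  (hATR : IsATR K v₀)
  (hρ₀ : ∀ x, ρ₀ (algebraMap F K x) = (realEmb v₀ x : ℂ))
  (hρ : ∀ v x, ρ v (algebraMap F K x) = realEmb v.1 x)

include hF hK hσ hATR hρ₀ hρ in
/-- The optimal embeddings and their points in the upper half-plane: a function of the embedding
which depends only on the point takes the same values on both. -/
lemma image_optATR {Y : Type*} {f : (K →ₐ[F] Matrix (Fin 2) (Fin 2) F) → Y} {f' : K → Y}
    (hf : ∀ ψ τ, IsATRPoint ρ₀ ψ τ → f ψ = f' τ) {τ₀ : K} (hτ₀ : 0 < (ρ₀ τ₀).im) :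
    f '' optATR O = f' '' orientedPoints (𝓞 F) O σ τ₀ := by
  have hmem := mem_orientedPoints_iff hK hσ hATR hρ₀ hρ (O := O) hτ₀
  ext y
  constructor
  · rintro ⟨ψ, hψ, rfl⟩
    obtain ⟨τ, hτ⟩ := exists_isATRPoint hK hσ hATR hρ₀ ψ
    exact ⟨τ, (hmem τ).2 ⟨isProper_of_mem_optATR hF hK hψ hτ.1, hτ.2⟩, (hf ψ τ hτ).symm⟩
  · rintro ⟨τ, hτ, rfl⟩
    obtain ⟨hP, him⟩ := (hmem τ).1 hτ
    obtain ⟨ψ, hψ⟩ := exists_embedding hK (notMem_of_im_pos hρ₀ him)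
    exact ⟨ψ, (hψ.mem_optATR_iff hK).2 hP, hf ψ τ ⟨hψ.isFixedPoint, him⟩⟩

include hF hK hσ hATR hρ₀ hρ in
lemma ncard_image_optATR {Z : Type*} [MulAction PGL(2, ℝ) Z] (x : Z)
    {f : (K →ₐ[F] Matrix (Fin 2) (Fin 2) F) → Set (HilbertQuotient v₀ Z)}
    (hf : ∀ ψ τ, IsATRPoint ρ₀ ψ τ → f ψ = atrSet v₀ ρ₀ ρ σ x τ) (hne : (optATR O).Nonempty) :
    (f '' optATR O).ncard = Nat.card (NarrowPic O K) := by
  have := isPrincipalIdealRing_of_narrowPic hF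
  obtain ⟨ψ, hψ⟩ := hne
  obtain ⟨τ₀, hτ₀⟩ := exists_isATRPoint hK hσ hATR hρ₀ ψ
  rw [image_optATR hF hK hσ hATR hρ₀ hρ hf hτ₀.2]
  refine ncard_image_orientedPoints hK hσ (fun a ha => exists_unit_totPos_mul hF ha)
    (notMem_of_im_pos hρ₀ hτ₀.2) (isProper_of_mem_optATR hF hK hψ hτ₀.1) _ fun τ hτ τ₁ hτ₁ => ?_
  rw [mem_orientedPoints_iff hK hσ hATR hρ₀ hρ hτ₀.2] at hτ hτ₁
  exact atrSet_eq_iff hF hK hσ hρ₀ hρ x hτ.2 hτ₁.2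

variable {g : PGL(2, AdeleRing (𝓞 F) F)}
  (hgfin : ∀ v, ProjGenLinGroup.map (finComp (𝓞 F) F v) g = 1)
  {ψ : K →ₐ[F] Matrix (Fin 2) (Fin 2) F} (hψ : ψ ∈ optATR O) {τ₀ : K} (hτ₀ : IsEigenPoint ψ τ₀)
  (him : 0 < (ρ₀ τ₀).im)
  (hg : IsNormalizedATR v₀ ρ₀ ρ ψ fun v => ProjGenLinGroup.map (infComp (𝓞 F) F v) g)
  {Φ : AdelicDoubleQuotient (levelATR v₀) → HilbertQuotient v₀ UnitTangent}
  (hΦ : ∀ x γ, ProjGenLinGroup.map (algebraMap F (AdeleRing (𝓞 F) F)) γ * x ∈ goodATR F →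
    Φ (DoubleCoset.mk _ _ x) = Quotient.mk _ (pointATR v₀
      (ProjGenLinGroup.map (algebraMap F (AdeleRing (𝓞 F) F)) γ * x)))

include hF hK hσ hρ₀ hρ hgfin hψ hτ₀ him hg hΦ in
/-- Moving `t g` to a point over `PGL₂(ℤ̂_F)` by `γ ∈ G(F)` replaces `ψ` by its conjugate by `γ`,
which is again optimal. -/
lemma exists_atrSet_of_mem_torus {t : PGL(2, AdeleRing (𝓞 F) F)}
    (ht : t ∈ torus (algebraMap F (AdeleRing (𝓞 F) F)) ψ) :
    ∃ ψ₁ ∈ optATR O, ∃ τ, IsATRPoint ρ₀ ψ₁ τ ∧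
      Φ (DoubleCoset.mk _ _ (t * g)) ∈ atrSet v₀ ρ₀ ρ σ UnitTangent.base τ := by
  have hτ₀F := hτ₀.notMem hK
  obtain ⟨h1, h2, h3⟩ := (isNormalizedATR_iff hK hσ hρ₀ hρ ⟨hτ₀.isFixedPoint, him⟩
    (z := ⟨ρ₀ τ₀, him⟩) rfl).1 hg
  obtain ⟨γ, hγ⟩ := exists_mul_mem_goodATR hF (t * g)
  obtain ⟨τ, hτ⟩ := exists_moebius_apply γ hτ₀F
  have hinf : ∀ v, ProjGenLinGroup.map (infComp (𝓞 F) F v)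
      (ProjGenLinGroup.map (algebraMap F (AdeleRing (𝓞 F) F)) (ProjGenLinGroup.mk γ) * (t * g)) =
      ProjGenLinGroup.map (realEmb v) (ProjGenLinGroup.mk γ) *
        (ProjGenLinGroup.map (infComp (𝓞 F) F v) t *
          ProjGenLinGroup.map (infComp (𝓞 F) F v) g) := fun v => by
    rw [map_mul, map_infComp_map, map_mul]
  have htv : ∀ v, ProjGenLinGroup.map (infComp (𝓞 F) F v) t ∈ torus (realEmb v) ψ := fun v => by
    have := map_mem_torus hK (infComp (𝓞 F) F v) ht
    rwa [infComp_comp_algebraMap] at this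
  obtain ⟨ht0, ht0'⟩ := (mem_torus_complex_iff hK hτ₀ _ ρ₀ hρ₀ ⟨ρ₀ τ₀, him⟩ rfl _).1 (htv v₀)
  have hγ0 : ProjGenLinGroup.map (realEmb v₀) (ProjGenLinGroup.mk γ) ∈ PGLpos ℝ := by
    have := hγ.2 v₀
    rw [hinf] at this
    exact (Subgroup.mul_mem_cancel_right _ (mul_mem ht0 h1)).1 this
  have hz := hτ.coe_smul hρ₀ hτ₀F hγ0 (z := ⟨ρ₀ τ₀, him⟩) rfl
  refine ⟨conjEmb γ ψ, isOptimal_conjEmb hK ht γ mem_integers_range_iff (fun v _ => ?_) hψ, τ,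
    ⟨(hτ₀.conjEmb hτ hτ₀F).isFixedPoint, ?_⟩, ?_⟩
  · have := hγ.1 v
    rwa [map_mul, map_finComp_map, map_mul, hgfin, mul_one] at this
  · rw [← hz]; exact UpperHalfPlane.im_pos _
  · rw [hΦ _ _ hγ]
    refine ⟨_, _, ?_, fun v => ?_, rfl⟩
    · rw [hinf, mul_smul, mul_smul, h2, ht0', hz]
    · have hs := (mem_torus_iff_smul_of_split hK hσ hτ₀ _ (ρ v) (hρ v) _).1 (htv v.1)
      refine ⟨_, hγ.2 v.1, ?_, ?_, rfl⟩
      · rw [hinf, mul_smul, mul_smul, (h3 v).1, hs.1, hτ.map_smul (hρ v)]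
      · rw [hinf, mul_smul, mul_smul, (h3 v).2, hs.2, hτ.conj.map_smul (hρ v)]

include hF hK hσ hρ₀ hρ hgfin hψ hτ₀ him hg hΦ in
/-- Every point of the lift of an ATR cycle of conductor `O` comes from the toral set: the lattices
of `τ` and `τ₀` are locally homothetic, which gives the finite components of the torus element, and
its infinite components are determined by the given point. -/
lemma exists_mem_torus_of_mem_atrSet {τ : K} (hP : IsProper (𝓞 F) O τ) (hτ : 0 < (ρ₀ τ).im)
    {q : HilbertQuotient v₀ UnitTangent} (hq : q ∈ atrSet v₀ ρ₀ ρ σ UnitTangent.base τ) :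
    ∃ t ∈ torus (algebraMap F (AdeleRing (𝓞 F) F)) ψ, Φ (DoubleCoset.mk _ _ (t * g)) = q := by
  classical
  have := isPrincipalIdealRing_of_narrowPic hF
  have hτ₀F := hτ₀.notMem hK
  have hτF := notMem_of_im_pos hρ₀ hτ
  obtain ⟨h1, h2, h3⟩ := (isNormalizedATR_iff hK hσ hρ₀ hρ ⟨hτ₀.isFixedPoint, him⟩
    (z := ⟨ρ₀ τ₀, him⟩) rfl).1 hg
  obtain ⟨z, w, hz, hw, rfl⟩ := hq
  obtain ⟨y₀, hy₀, hy₀z⟩ := exists_PGLpos_smul_I z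
  choose y hy hya hyb hyw using hw
  obtain ⟨Y, hY₀, hY⟩ : ∃ Y : InfinitePlace F → PGL(2, ℝ), Y v₀ = y₀ ∧
      ∀ v : {v : InfinitePlace F // v ≠ v₀}, Y v.1 = y v :=
    ⟨fun v => if hv : v ≠ v₀ then y ⟨v, hv⟩ else y₀, dif_neg (not_not.2 rfl), fun v => dif_pos v.2⟩
  have hYpos : ∀ v, Y v ∈ PGLpos ℝ := fun v => by
    by_cases hv : v = v₀
    · rw [hv, hY₀]; exact hy₀
    · rw [hY ⟨v, hv⟩]; exact hy _
  obtain ⟨γ, hγ⟩ := exists_moebius hK hτ₀F hτF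
  have hγ0 := hγ.mem_PGLpos hρ₀ him hτ
  have hr : ∀ v, (ProjGenLinGroup.map (realEmb v) (ProjGenLinGroup.mk γ))⁻¹ * Y v *
      (ProjGenLinGroup.map (infComp (𝓞 F) F v) g)⁻¹ ∈ torus (realEmb v) ψ := fun v => by
    by_cases hv : v = v₀
    · subst hv
      refine (mem_torus_complex_iff hK hτ₀ _ ρ₀ hρ₀ ⟨ρ₀ τ₀, him⟩ rfl _).2
        ⟨mul_mem (mul_mem (inv_mem hγ0) (hYpos v)) (inv_mem h1), ?_⟩
      rw [mul_smul, mul_smul, ← h2, inv_smul_smul, hY₀, hy₀z, inv_smul_eq_iff, h2,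
        hγ.smul_eq hρ₀ hγ0 rfl hz]
    · have h3' := h3 ⟨v, hv⟩
      refine (mem_torus_iff_smul_of_split hK hσ hτ₀ _ (ρ ⟨v, hv⟩) (hρ ⟨v, hv⟩) _).2 ⟨?_, ?_⟩
      · rw [mul_smul, mul_smul, ← h3'.1, inv_smul_smul, hY ⟨v, hv⟩, hya, inv_smul_eq_iff, h3'.1,
          hγ.map_smul (hρ ⟨v, hv⟩)]
      · rw [mul_smul, mul_smul, ← h3'.2, inv_smul_smul, hY ⟨v, hv⟩, hyb, inv_smul_eq_iff, h3'.2,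
          hγ.conj.map_smul (hρ ⟨v, hv⟩)]
  obtain ⟨t, ht, htinf, htfin, -⟩ := exists_mem_torus (R := 𝓞 F) (P := fun _ => True) hK hτ₀ hτF
    ((hτ₀.mem_optATR_iff hK).1 hψ) hP (fun v _ r => v.valuation_le_one r) hγ _ hr
  have hinf : ∀ v, ProjGenLinGroup.map (infComp (𝓞 F) F v)
      (ProjGenLinGroup.map (algebraMap F (AdeleRing (𝓞 F) F)) (ProjGenLinGroup.mk γ) * (t * g)) =
      Y v := fun v => by
    rw [map_mul, map_infComp_map, map_mul, htinf]
    group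
  refine ⟨t, ht, ?_⟩
  rw [hΦ (t * g) (ProjGenLinGroup.mk γ) ⟨fun v => ?_, fun v => ?_⟩]
  · rw [pointATR]
    simp only [hinf, hY₀, hY, hy₀z, hyw]
    rfl
  · rw [map_mul, map_finComp_map, map_mul, hgfin, mul_one]
    exact htfin v trivial
  · rw [hinf]; exact hYpos v

end ATRPoints

section ATR

variable {F : Type*} [Field F] [NumberField F] [IsTotallyReal F] {K : Type*} [Field K] [Algebra F K]
  {v₀ : InfinitePlace F} {ρ₀ : K →+* ℂ} {ρ : {v : InfinitePlace F // v ≠ v₀} → K →+* ℝ}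
  {O : Subalgebra (𝓞 F) K}

/-- The toral set of one optimal embedding covers the lifts of all ATR cycles of its conductor. -/
lemma image_toralSet_ATR (hF : Nat.card (NarrowPic (𝓞 F) F) = 1) (hK : Module.finrank F K = 2)
    (hATR : IsATR K v₀)
    (hρ₀ : ∀ x, ρ₀ (algebraMap F K x) = (realEmb v₀ x : ℂ))
    (hρ : ∀ v x, ρ v (algebraMap F K x) = realEmb v.1 x)
    {Φ : AdelicDoubleQuotient (levelATR v₀) → HilbertQuotient v₀ UnitTangent}
    (hΦ : ∀ x γ, ProjGenLinGroup.map (algebraMap F (AdeleRing (𝓞 F) F)) γ * x ∈ goodATR F →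
      Φ (DoubleCoset.mk _ _ x) = Quotient.mk _ (pointATR v₀
        (ProjGenLinGroup.map (algebraMap F (AdeleRing (𝓞 F) F)) γ * x)))
    {ψ₀ : K →ₐ[F] Matrix (Fin 2) (Fin 2) F} (hψ₀ : ψ₀ ∈ optATR O)
    {g : PGL(2, AdeleRing (𝓞 F) F)}
    (hgfin : ∀ v, ProjGenLinGroup.map (finComp (𝓞 F) F v) g = 1)
    (hginf : IsNormalizedATR v₀ ρ₀ ρ ψ₀ fun v => ProjGenLinGroup.map (infComp (𝓞 F) F v) g) :
    Φ '' (adelicProj (levelATR v₀) '' toralSet (𝓞 F) ψ₀ g) =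
      ⋃ ψ ∈ optATR O, atrLift v₀ ρ₀ ρ ψ := by
  obtain ⟨σ, hσ⟩ := exists_conj hK
  obtain ⟨τ₀, hτ₀⟩ := exists_isATRPoint hK hσ hATR hρ₀ ψ₀
  -- replace `ψ₀` by its conjugate if necessary, which changes neither the torus nor the hypotheses
  obtain ⟨ψ, hψ, hr⟩ := exists_isEigenPoint_of_isFixedPoint hK hτ₀.1
  have hψO : ψ ∈ optATR O := (hψ.mem_optATR_iff hK).2 (isProper_of_mem_optATR hF hK hψ₀ hτ₀.1)
  have hg : IsNormalizedATR v₀ ρ₀ ρ ψ fun v => ProjGenLinGroup.map (infComp (𝓞 F) F v) g :=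
    (isNormalizedATR_iff hK hσ hρ₀ hρ ⟨hψ.isFixedPoint, hτ₀.2⟩ (z := ⟨ρ₀ τ₀, hτ₀.2⟩) rfl).2
      ((isNormalizedATR_iff hK hσ hρ₀ hρ hτ₀ rfl).1 hginf)
  have ht := torus_eq_of_range_eq hK (algebraMap F (AdeleRing (𝓞 F) F)) hr
  ext q
  simp only [Set.mem_iUnion, exists_prop]
  constructor
  · rintro ⟨_, ⟨_, ⟨t, htm, rfl⟩, rfl⟩, rfl⟩
    obtain ⟨ψ₁, hψ₁, τ, hτ, h⟩ := exists_atrSet_of_mem_torus hF hK hσ hρ₀ hρ hgfin hψO hψ hτ₀.2 hg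
      hΦ (ht ▸ htm)
    refine ⟨ψ₁, hψ₁, ?_⟩
    rw [atrLift_eq hK hσ hρ₀ hρ hτ]
    exact h
  · rintro ⟨ψ₁, hψ₁, hq⟩
    obtain ⟨τ, hτ⟩ := exists_isATRPoint hK hσ hATR hρ₀ ψ₁
    rw [atrLift_eq hK hσ hρ₀ hρ hτ] at hq
    obtain ⟨t, htm, h⟩ := exists_mem_torus_of_mem_atrSet hF hK hσ hρ₀ hρ hgfin hψO hψ hτ₀.2 hg hΦ
      (isProper_of_mem_optATR hF hK hψ₁ hτ.1) hτ.2 hq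
    exact ⟨_, ⟨_, ⟨t, ht ▸ htm, rfl⟩, rfl⟩, h⟩

end ATR

/-! ### The ring `ℤ[1/p]` and the inert prime `p` -/

section ZInv

variable (p : ℕ) [Fact p.Prime]

lemma asIdeal_primePlace : (primePlace p).asIdeal = Ideal.span {(p : ℤ)} := by
  have h : ∀ e : ℤ ≃+* ℤ, (Ideal.span {(p : ℤ)}).map e = Ideal.span {(p : ℤ)} := fun e => by
    rw [Ideal.map_span, Set.image_singleton, map_natCast]
  exact h _

lemma eq_primePlace_of_mem {v : HeightOneSpectrum ℤ} (h : (p : ℤ) ∈ v.asIdeal) :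
    v = primePlace p := by
  apply HeightOneSpectrum.ext
  refine ((primePlace p).isMaximal.eq_of_le v.isPrime.ne_top ?_).symm
  rw [asIdeal_primePlace, Ideal.span_singleton_le_iff_mem]
  exact h

lemma valuation_prime_eq_one {v : HeightOneSpectrum ℤ} (hv : v ≠ primePlace p) :
    v.valuation ℚ (p : ℚ) = 1 := by
  refine le_antisymm ?_ (not_lt.1 fun h => hv (eq_primePlace_of_mem p ?_))
  · exact v.valuation_le_one (p : ℤ)
  · exact (v.valuation_lt_one_iff_mem (K := ℚ) (p : ℤ)).1 h

variable {p} in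
lemma mem_ZInv_iff_exists {x : ℚ} : x ∈ ZInv p ↔ ∃ (n : ℕ) (a : ℤ), x * (p : ℚ) ^ n = a := by
  have hp : (p : ℚ) ≠ 0 := Nat.cast_ne_zero.2 (Fact.out : p.Prime).ne_zero
  constructor
  · intro hx
    induction hx using Algebra.adjoin_induction with
    | mem x hx =>
      obtain rfl := Set.mem_singleton_iff.1 hx
      exact ⟨1, 1, by simp [hp]⟩
    | algebraMap r => exact ⟨0, r, by simp⟩
    | add x y _ _ hx hy =>
      obtain ⟨m, a, ha⟩ := hx
      obtain ⟨n, b, hb⟩ := hy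
      refine ⟨m + n, a * p ^ n + b * p ^ m, ?_⟩
      push_cast
      rw [← ha, ← hb]; ring
    | mul x y _ _ hx hy =>
      obtain ⟨m, a, ha⟩ := hx
      obtain ⟨n, b, hb⟩ := hy
      refine ⟨m + n, a * b, ?_⟩
      push_cast
      rw [← ha, ← hb]; ring
  · rintro ⟨n, a, h⟩
    have : x = algebraMap ℤ ℚ a * (p : ℚ)⁻¹ ^ n := by
      rw [inv_pow]; field_simp; simpa using h
    rw [this]
    exact mul_mem (Subalgebra.algebraMap_mem _ _)
      (pow_mem (Algebra.subset_adjoin (Set.mem_singleton _)) _)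

variable {p} in
lemma mem_ZInv_iff {x : ℚ} : x ∈ (ZInv p).toSubring ↔
    ∀ v : HeightOneSpectrum ℤ, v ≠ primePlace p → v.valuation ℚ x ≤ 1 := by
  rw [Subalgebra.mem_toSubring, mem_ZInv_iff_exists]
  constructor
  · rintro ⟨n, a, h⟩ v hv
    have := congrArg (v.valuation ℚ) h
    rw [map_mul, map_pow, valuation_prime_eq_one p hv, one_pow, mul_one] at this
    rw [this]
    exact v.valuation_le_one a
  · intro h
    obtain ⟨n, m, hm, hd⟩ := Nat.exists_eq_pow_mul_and_not_dvd x.den_nz p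
      (Fact.out : p.Prime).ne_one
    -- `p ^ n * x` is integral at all primes, as its denominator is prime to `p`
    have hint : ∀ v : HeightOneSpectrum ℤ, v.valuation ℚ (x * (p : ℚ) ^ n) ≤ 1 := fun v => by
      by_cases hv : v = primePlace p
      · have hm1 : v.valuation ℚ (m : ℚ) = 1 := by
          refine le_antisymm (v.valuation_le_one (m : ℤ)) (not_lt.1 fun h' => hm ?_)
          have := (v.valuation_lt_one_iff_mem (K := ℚ) (m : ℤ)).1 h'
          rw [hv, asIdeal_primePlace, Ideal.mem_span_singleton] at this
          exact_mod_cast this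
        have e : x * (p : ℚ) ^ n * m = (x.num : ℚ) := by
          rw [mul_assoc]
          exact_mod_cast (hd ▸ Rat.mul_den_eq_num x)
        rw [← mul_one (v.valuation ℚ _)]
        nth_rw 1 [← hm1]
        rw [← map_mul, e]
        exact v.valuation_le_one x.num
      · rw [map_mul, map_pow, valuation_prime_eq_one p hv, one_pow, mul_one]
        exact h v hv
    obtain ⟨a, ha⟩ := HeightOneSpectrum.mem_integers_of_valuation_le_one ℚ _ hint
    exact ⟨n, a, by rw [← ha]; rfl⟩

instance isFractionRing_ZInv : IsFractionRing (ZInv p) ℚ := by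
  refine IsFractionRing.of_field _ _ fun x =>
    ⟨algebraMap ℤ (ZInv p) x.num, algebraMap ℤ (ZInv p) x.den, ?_⟩
  rw [← IsScalarTower.algebraMap_apply, ← IsScalarTower.algebraMap_apply]
  simp [Rat.num_div_den]

instance isPrincipalIdealRing_ZInv : IsPrincipalIdealRing (ZInv p) := by
  refine ⟨fun I => ?_⟩
  obtain ⟨n, hn⟩ := (IsPrincipalIdealRing.principal (I.comap (algebraMap ℤ (ZInv p)))).principal
  have hp : (p : ℚ) ≠ 0 := Nat.cast_ne_zero.2 (Fact.out : p.Prime).ne_zero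
  refine ⟨algebraMap ℤ (ZInv p) n, le_antisymm (fun x hx => ?_) ?_⟩
  · obtain ⟨k, a, ha⟩ := mem_ZInv_iff_exists.1 x.2
    have hxa : x * (p : ZInv p) ^ k = algebraMap ℤ (ZInv p) a := Subtype.ext (by simpa using ha)
    have haI : a ∈ I.comap (algebraMap ℤ (ZInv p)) := by
      rw [Ideal.mem_comap, ← hxa]
      exact I.mul_mem_right _ hx
    rw [hn] at haI
    obtain ⟨b, rfl⟩ := Submodule.mem_span_singleton.1 haI
    let i : ZInv p := ⟨(p : ℚ)⁻¹, Algebra.subset_adjoin (Set.mem_singleton _)⟩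
    have hi : (p : ZInv p) * i = 1 := Subtype.ext (by simp [i, hp])
    refine Submodule.mem_span_singleton.2 ⟨algebraMap ℤ (ZInv p) b * i ^ k, ?_⟩
    calc (algebraMap ℤ (ZInv p) b * i ^ k) • algebraMap ℤ (ZInv p) n
        = algebraMap ℤ (ZInv p) (b • n) * i ^ k := by simp only [smul_eq_mul, map_mul]; ring
      _ = x * ((p : ZInv p) * i) ^ k := by rw [← hxa]; ring
      _ = x := by rw [hi, one_pow, mul_one]
  · rw [Submodule.span_singleton_le_iff_mem]
    have : n ∈ I.comap (algebraMap ℤ (ZInv p)) := by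
      rw [hn]; exact Submodule.mem_span_singleton_self n
    exact this

lemma totPos_rat_iff {x : ℚ} : TotPos x ↔ 0 < x := by
  constructor
  · intro h
    simpa using h.2 (algebraMap ℚ ℝ)
  · intro h
    exact ⟨h.ne', fun ρ => by simpa using h⟩

lemma exists_unit_totPos_mul_rat {R : Type*} [CommRing R] [Algebra R ℚ] {a : ℚ} (ha : a ≠ 0) :
    ∃ ε : Rˣ, TotPos (algebraMap R ℚ ε * a) := by
  rcases lt_or_gt_of_ne ha with h | h
  · exact ⟨-1, totPos_rat_iff.2 (by simpa using h)⟩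
  · exact ⟨1, totPos_rat_iff.2 (by simpa using h)⟩

end ZInv

section Inert

variable {p : ℕ} [Fact p.Prime] {K : Type*} [Field K] [NumberField K]

variable (p) in
lemma nonempty_ringHom_padic : Nonempty (Qp p →+* ℚ_[p]) := by
  obtain ⟨e⟩ : Nonempty ((primePlace p).adicCompletion ℚ →+* ℚ_[p]) := by
    rw [primePlace]
    exact ⟨(Padic.adicCompletionEquiv ℤ ⟨p, Fact.out⟩).symm.toAlgEquiv.toRingEquiv.toRingHom⟩
  exact ⟨e⟩

/-- A homomorphism from a number field to `ℚ_p` can be reduced modulo `p`. -/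
lemma nonempty_ringHom_zmod {K : Type*} [Field K] (j : K →+* ℚ_[p]) : Nonempty (𝓞 K →+* ZMod p) := by
  have hint : ∀ x : 𝓞 K, ∃ y : ℤ_[p], (y : ℚ_[p]) = j x := fun x => by
    have h : IsIntegral ℤ_[p] (j x) := (x.isIntegral_coe.map j.toIntAlgHom).tower_top
    exact IsIntegrallyClosed.isIntegral_iff.1 h
  choose g hg using hint
  have hinj : Function.Injective (PadicInt.Coe.ringHom (p := p)) := Subtype.val_injective
  have hg' : ∀ x, PadicInt.Coe.ringHom (g x) = j.comp (algebraMap (𝓞 K) K) x := hg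
  let f : 𝓞 K →+* ℤ_[p] :=
    { toFun := g
      map_one' := hinj (by rw [hg', map_one, map_one])
      map_zero' := hinj (by rw [hg', map_zero, map_zero])
      map_add' := fun x y => hinj (by rw [hg', map_add, map_add, hg', hg'])
      map_mul' := fun x y => hinj (by rw [hg', map_mul, map_mul, hg', hg']) }
  exact ⟨PadicInt.toZMod.comp f⟩

/-- A quadratic field in which `p` is inert has no embedding into `ℚ_p`, since the residue field
`𝔽_{p²}` has no embedding into `𝔽_p`. -/
lemma isEmpty_ringHom_Qp (hK : Module.finrank ℚ K = 2)
    (hinert : (Ideal.span {(p : 𝓞 K)}).IsPrime) : IsEmpty (K →+* Qp p) := by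
  refine ⟨fun j₀ => ?_⟩
  obtain ⟨e⟩ := nonempty_ringHom_padic p
  obtain ⟨f⟩ := nonempty_ringHom_zmod (e.comp j₀)
  have hp0 : (p : 𝓞 K) ≠ 0 := Nat.cast_ne_zero.2 (Fact.out : p.Prime).ne_zero
  have hker : Ideal.span {(p : 𝓞 K)} = RingHom.ker f := by
    have := hinert.isMaximal (by simpa using hp0)
    refine this.eq_of_le (RingHom.ker_ne_top f) ?_
    rw [Ideal.span_singleton_le_iff_mem, RingHom.mem_ker, map_natCast, ZMod.natCast_self]
  have hcard : Ideal.absNorm (Ideal.span {(p : 𝓞 K)}) = p ^ 2 := by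
    have : (p : 𝓞 K) = algebraMap ℤ (𝓞 K) p := by simp
    rw [Ideal.absNorm_span_singleton, this, Algebra.norm_algebraMap, RingOfIntegers.rank, hK]
    simp
  have hle : Nat.card (𝓞 K ⧸ RingHom.ker f) ≤ Nat.card (ZMod p) :=
    Nat.card_le_card_of_injective _ (RingHom.kerLift_injective f)
  rw [← hker, Nat.card_zmod, ← Submodule.cardQuot_apply, ← Ideal.absNorm_apply, hcard] at hle
  have := (Fact.out : p.Prime).two_le
  nlinarith

/-- The points of `K ∖ ℚ` give points of `ℙ¹(E) ∖ ℙ¹(ℚ_p)`. -/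
lemma notMem_range_Qp {E : Type*} [Field E] [Algebra (Qp p) E] (hK : Module.finrank ℚ K = 2)
    (hinert : (Ideal.span {(p : 𝓞 K)}).IsPrime) (ι : K →+* E) {τ : K}
    (hτ : τ ∉ Set.range (algebraMap ℚ K)) : ι τ ∉ Set.range (algebraMap (Qp p) E) := by
  rintro ⟨s, hs⟩
  have hmem : ∀ x, ι x ∈ (algebraMap (Qp p) E).range := fun x => by
    obtain ⟨a, b, rfl⟩ := exists_coord hK hτ x
    refine ⟨algebraMap ℚ (Qp p) a * s + algebraMap ℚ (Qp p) b, ?_⟩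
    rw [map_add, map_mul, map_add, map_mul, hs]
    congr 1
    · congr 1
      exact RingHom.congr_fun (Subsingleton.elim
        ((algebraMap (Qp p) E).comp (algebraMap ℚ (Qp p))) (ι.comp (algebraMap ℚ K))) a
    · exact RingHom.congr_fun (Subsingleton.elim
        ((algebraMap (Qp p) E).comp (algebraMap ℚ (Qp p))) (ι.comp (algebraMap ℚ K))) b
  let e := RingEquiv.ofBijective (algebraMap (Qp p) E).rangeRestrict
    ⟨fun x y h => (algebraMap (Qp p) E).injective (congrArg Subtype.val h),
      (algebraMap (Qp p) E).rangeRestrict_surjective⟩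
  exact (isEmpty_ringHom_Qp hK hinert).false
    ((e.symm : (algebraMap (Qp p) E).range →+* Qp p).comp (ι.codRestrict _ hmem))

end Inert

/-! ### The adelic double quotient of the group `PGL₂⁺(ℤ[1/p])` -/

lemma map_realComp_map (γ : PGL(2, ℚ)) :
    ProjGenLinGroup.map realComp (ProjGenLinGroup.map (algebraMap ℚ (AdeleRing ℤ ℚ)) γ) =
      ProjGenLinGroup.map (algebraMap ℚ ℝ) γ := by
  rw [map_infComp_map, Subsingleton.elim (realEmb Rat.infinitePlace) (algebraMap ℚ ℝ)]

lemma map_mem_PGLpos_iff (γ : PGL(2, ℚ)) :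
    ProjGenLinGroup.map (algebraMap ℚ ℝ) γ ∈ PGLpos ℝ ↔ γ ∈ PGLpos ℚ := by
  induction γ using ProjGenLinGroup.induction_on with
  | mk g =>
    change ProjGenLinGroup.mk (GeneralLinearGroup.map (algebraMap ℚ ℝ) g) ∈ _ ↔ _
    rw [mk_mem_PGLpos_iff, mk_mem_PGLpos_iff, GeneralLinearGroup.map_det]
    exact Rat.cast_pos (K := ℝ)

section

variable {p : ℕ} [Fact p.Prime]

/-- `PGL₂⁺(ℤ[1/p])` consists of the elements of `PGL₂(ℚ)` which are integral at all primes other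
than `p` and positive at infinity. -/
lemma mem_iharaGroup_iff (γ : PGL(2, ℚ)) : γ ∈ iharaGroup p ↔
    (∀ v, v ≠ primePlace p →
      ProjGenLinGroup.map (algebraMap ℚ (v.adicCompletion ℚ)) γ ∈ maxCompact ℚ v) ∧
    ProjGenLinGroup.map (algebraMap ℚ ℝ) γ ∈ PGLpos ℝ := by
  rw [iharaGroup, Subgroup.mem_inf, map_mem_PGLpos_iff]
  refine and_congr_left fun _ => ⟨?_, fun h => ?_⟩
  · rintro ⟨g, rfl⟩ v hv
    induction g using ProjGenLinGroup.induction_on with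
    | mk g =>
      have hle : ∀ x : ZInv p, v.valuation ℚ (algebraMap (ZInv p) ℚ x) ≤ 1 := fun x =>
        mem_ZInv_iff.1 x.2 v hv
      refine map_mk_mem_maxCompact (γ := GeneralLinearGroup.map (algebraMap (ZInv p) ℚ) g)
        ⟨fun i j => hle _, ?_⟩
      rw [GeneralLinearGroup.map_det]
      have h1 : v.valuation ℚ (algebraMap (ZInv p) ℚ g.det) *
          v.valuation ℚ (algebraMap (ZInv p) ℚ (g.det⁻¹ : (ZInv p)ˣ)) = 1 := by
        rw [← map_mul, ← map_mul, Units.mul_inv, map_one, map_one]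
      refine le_antisymm (hle _) ?_
      rw [← h1]
      exact mul_le_of_le_one_right' (hle _)
  · obtain ⟨g, rfl, hg⟩ := exists_isIntegralGL_rep (R := ℤ) γ
    obtain ⟨g', rfl⟩ := exists_map_eq_of_forall (R := ZInv p)
      (fun v : {v : HeightOneSpectrum ℤ // v ≠ primePlace p} => v.1.valuation ℚ)
      (fun x hx => ⟨⟨x, mem_ZInv_iff.2 fun v hv => hx ⟨v, hv⟩⟩, rfl⟩) g
      (fun v => hg v.1 (h v.1 v.2))
    exact ⟨ProjGenLinGroup.mk g', rfl⟩

variable (p) in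
/-- The elements of `PGL₂(𝔸_ℚ)` which are integral at the primes other than `p` and positive at
infinity. -/
def goodSH : Set PGL(2, AdeleRing ℤ ℚ) :=
  {y | (∀ v, v ≠ primePlace p → ProjGenLinGroup.map (finComp ℤ ℚ v) y ∈ maxCompact ℚ v) ∧
    ProjGenLinGroup.map realComp y ∈ PGLpos ℝ}

variable {E : Type*} [Field E] [Algebra (Qp p) E]

/-- The point `(y_∞ (i, i), y_p α)`. -/
noncomputable def pointSH (α : Drinfeld p E) (y : PGL(2, AdeleRing ℤ ℚ)) :
    MockSpace p E UnitTangent :=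
  (ProjGenLinGroup.map realComp y • UnitTangent.base, ProjGenLinGroup.map (pComp p) y • α)

lemma mem_levelSH_iff {α : Drinfeld p E} {u : PGL(2, AdeleRing ℤ ℚ)} :
    u ∈ levelSH p α ↔
      (∀ v, v ≠ primePlace p → ProjGenLinGroup.map (finComp ℤ ℚ v) u ∈ maxCompact ℚ v) ∧
      ProjGenLinGroup.map (pComp p) u • α = α ∧ ProjGenLinGroup.map realComp u = 1 := by
  simp only [levelSH, Subgroup.mem_inf, Subgroup.mem_iInf, Subgroup.mem_comap, Subgroup.mem_bot,
    Subtype.forall, and_assoc, MulAction.mem_stabilizer_iff]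

/-- Points of `ℙ¹(E) ∖ ℙ¹(ℚ_p)` are affine. -/
lemma Drinfeld.exists_coe (w : Drinfeld p E) :
    ∃ x : E, x ∉ Set.range (algebraMap (Qp p) E) ∧ w.1 = (x : OnePoint E) := by
  obtain ⟨w, hw⟩ := w
  induction w using OnePoint.rec with
  | infty => exact absurd ⟨OnePoint.infty, rfl⟩ hw
  | coe x =>
    refine ⟨x, ?_, rfl⟩
    rintro ⟨s, rfl⟩
    exact hw ⟨(s : OnePoint (Qp p)), rfl⟩

lemma exists_drinfeld {x : E} (hx : x ∉ Set.range (algebraMap (Qp p) E)) :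
    ∃ w : Drinfeld p E, w.1 = (x : OnePoint E) := by
  refine ⟨⟨x, ?_⟩, rfl⟩
  rintro ⟨s, hs⟩
  induction s using OnePoint.rec with
  | infty => exact OnePoint.infty_ne_coe x hs
  | coe s => exact hx ⟨s, OnePoint.coe_injective hs⟩

/-- `PGL₂(ℚ_p)` acts transitively on the points over the quadratic extension `E`. -/
lemma exists_smul_eq_drinfeld (hE : Module.finrank (Qp p) E = 2) (w w' : Drinfeld p E) :
    ∃ g : PGL(2, Qp p), g • w = w' := by
  obtain ⟨x, hx, hw⟩ := w.exists_coe
  obtain ⟨x', hx', hw'⟩ := w'.exists_coe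
  obtain ⟨γ, hγ⟩ := exists_moebius hE hx hx'
  refine ⟨ProjGenLinGroup.mk γ, Subtype.ext ?_⟩
  change ProjGenLinGroup.map (algebraMap (Qp p) E) (ProjGenLinGroup.mk γ) • w.1 = w'.1
  rw [hw, hw']
  exact hγ.map_smul (ρ := RingHom.id E) fun _ => rfl

lemma exists_mul_mem_goodSH (x : PGL(2, AdeleRing ℤ ℚ)) : ∃ γ : GL (Fin 2) ℚ,
    ProjGenLinGroup.map (algebraMap ℚ (AdeleRing ℤ ℚ)) (ProjGenLinGroup.mk γ) * x ∈ goodSH p := by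
  obtain ⟨γ, hγ⟩ := exists_forall_mul_mem_maxCompact (R := ℤ) (F := ℚ)
    (fun v => ProjGenLinGroup.map (finComp ℤ ℚ v) x) (eventually_map_finComp_mem_maxCompact x)
  obtain ⟨δ, hδ, hδ'⟩ := exists_signs (R := ℤ) (R₁ := ℤ)
    (fun a ha => exists_unit_totPos_mul_rat ha) fun v =>
      ProjGenLinGroup.map (realEmb v) (ProjGenLinGroup.mk γ) *
        ProjGenLinGroup.map (infComp ℤ ℚ v) x
  refine ⟨δ * γ, fun v _ => ?_, ?_⟩
  · rw [map_mul, map_finComp_map, map_mul, map_mul, mul_assoc]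
    exact mul_mem (map_mk_mem_maxCompact (hδ v fun r => v.valuation_le_one r)) (hγ v)
  · rw [map_mul, map_infComp_map, map_mul, map_mul, mul_assoc]
    exact hδ' _

/-- The canonical identification of the adelic double quotient with the quotient by `PGL₂⁺(ℤ[1/p])`. -/
lemma exists_isIdentificationSH (hE : Module.finrank (Qp p) E = 2) (α : Drinfeld p E) :
    ∃ Φ : AdelicDoubleQuotient (levelSH p α) → MockQuotient p E UnitTangent,
      Function.Bijective Φ ∧ ∀ x γ,
        ProjGenLinGroup.map (algebraMap ℚ (AdeleRing ℤ ℚ)) γ * x ∈ goodSH p →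
        Φ (DoubleCoset.mk _ _ x) = Quotient.mk _ (pointSH α
          (ProjGenLinGroup.map (algebraMap ℚ (AdeleRing ℤ ℚ)) γ * x)) := by
  refine exists_doubleCoset_identification
    (ProjGenLinGroup.map (algebraMap ℚ (AdeleRing ℤ ℚ))) (levelSH p α) (goodSH p)
    (iharaGroup p) (pointSH α) ?_ ?_ ?_ ?_ ?_ ?_
  · intro x
    obtain ⟨γ, hγ⟩ := exists_mul_mem_goodSH (p := p) x
    exact ⟨_, hγ⟩
  · intro y hy γ
    rw [mem_iharaGroup_iff]
    refine and_congr (forall₂_congr fun v hv => ?_) ?_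
    · rw [map_mul, map_finComp_map]
      exact Subgroup.mul_mem_cancel_right _ (hy.1 v hv)
    · rw [map_mul, map_realComp_map]
      exact Subgroup.mul_mem_cancel_right _ hy.2
  · intro y γ
    refine Prod.ext ?_ ?_
    · change ProjGenLinGroup.map realComp _ • _ = _
      rw [map_mul, map_realComp_map, mul_smul]; rfl
    · change ProjGenLinGroup.map (pComp p) _ • _ = _
      rw [map_mul, map_finComp_map, mul_smul]; rfl
  · intro y hy u hu
    rw [mem_levelSH_iff] at hu
    refine ⟨fun v hv => ?_, ?_⟩
    · rw [map_mul]; exact mul_mem (hy.1 v hv) (hu.1 v hv)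
    · rw [map_mul, hu.2.2, mul_one]; exact hy.2
  · intro y hy y' hy'
    rw [mem_levelSH_iff]
    constructor
    · intro h
      refine ⟨fun v hv => ?_, ?_, ?_⟩
      · rw [map_mul, map_inv]; exact mul_mem (inv_mem (hy.1 v hv)) (hy'.1 v hv)
      · rw [map_mul, map_inv, mul_smul, inv_smul_eq_iff]
        exact (congrArg Prod.snd h).symm
      · rw [map_mul, map_inv, inv_mul_eq_one]
        exact (smul_base_eq_smul_base_iff hy.2 hy'.2).1 (congrArg Prod.fst h)
    · rintro ⟨-, h1, h2⟩
      refine Prod.ext ?_ ?_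
      · rw [map_mul, map_inv, inv_mul_eq_one] at h2
        exact (smul_base_eq_smul_base_iff hy.2 hy'.2).2 h2
      · rw [map_mul, map_inv, mul_smul, inv_smul_eq_iff] at h1
        exact h1.symm
  · rintro ⟨z, w⟩
    classical
    obtain ⟨g, hg, rfl⟩ := exists_PGLpos_smul_base z
    obtain ⟨gp, rfl⟩ := exists_smul_eq_drinfeld hE α w
    obtain ⟨a, ha, ha'⟩ := exists_adelic_PGL (R := ℤ) (F := ℚ)
      (Function.update (fun v => 1) (primePlace p) gp) (by
        filter_upwards [(Set.finite_singleton (primePlace p)).compl_mem_cofinite] with v hv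
        exact Function.update_of_ne hv _ _) (fun _ => g)
    refine ⟨a, ⟨fun v hv => ?_, ?_⟩, Prod.ext ?_ ?_⟩
    · rw [ha, Function.update_of_ne hv]; exact one_mem _
    · rw [ha']; exact hg
    · change ProjGenLinGroup.map realComp a • _ = _
      rw [ha']
    · change ProjGenLinGroup.map (pComp p) a • _ = _
      rw [ha, Function.update_self]

end

/-! ### Stark–Heegner cycles and their lifts -/

lemma IsEigenPoint.unique {F K : Type*} [Field F] [Field K] [Algebra F K]
    (hK : Module.finrank F K = 2) {ψ : K →ₐ[F] Matrix (Fin 2) (Fin 2) F} {τ τ₁ : K}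
    (h : IsEigenPoint ψ τ) (h₁ : IsEigenPoint ψ τ₁) : τ₁ = τ := by
  have e := (isEigenPoint_iff.1 h τ).2
  have e₁ := (isEigenPoint_iff.1 h₁ τ).2
  have hne : algebraMap F K (ψ τ 1 0) ≠ 0 := fun h0 => h.notMem hK ⟨ψ τ 1 1, by
    rw [h0, zero_mul, zero_add] at e; exact e.symm⟩
  apply mul_left_cancel₀ hne
  linear_combination e - e₁

lemma IsEigenPoint.mem_optSH_iff {p : ℕ} {K : Type*} [Field K] [NumberField K] {O : Subalgebra ℤ K}
    (hK : Module.finrank ℚ K = 2) {ψ : K →ₐ[ℚ] Matrix (Fin 2) (Fin 2) ℚ} {τ : K}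
    (h : IsEigenPoint ψ τ) : ψ ∈ optSH p O ↔ IsProper (ZInv p) (orderInv p O) τ :=
  h.isOptimal_iff_isProper hK _
    (fun x => ⟨fun hx => ⟨⟨x, hx⟩, rfl⟩, by rintro ⟨y, rfl⟩; exact y.2⟩) _ fun x =>
    ⟨fun hx => ⟨⟨x, hx⟩, rfl⟩, by rintro ⟨y, rfl⟩; exact y.2⟩

section

variable {p : ℕ} [Fact p.Prime] {E : Type*} [Field E] [Algebra (Qp p) E]
  {K : Type*} [Field K] [NumberField K]
  {ρ : K →+* ℝ} {ι : K →+* E} {σ : K ≃ₐ[ℚ] K}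
  {Z : Type*} [MulAction PGL(2, ℝ) Z]

/-- Möbius transformations of `K ∖ ℚ`, seen in `ℙ¹(E) ∖ ℙ¹(ℚ_p)`. -/
lemma moebius_iff_smul_drinfeld {γ : GL (Fin 2) ℚ} {τ τ₁ : K} {w w₁ : Drinfeld p E}
    (hw : w.1 = ((ι τ : E) : OnePoint E)) (hw₁ : w₁.1 = ((ι τ₁ : E) : OnePoint E)) :
    Moebius γ τ τ₁ ↔ ProjGenLinGroup.map (algebraMap ℚ (Qp p)) (ProjGenLinGroup.mk γ) • w = w₁ := by
  let s : ℚ →+* E := (algebraMap (Qp p) E).comp (algebraMap ℚ (Qp p))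
  have hs : ∀ x, ι (algebraMap ℚ K x) = s x := fun x =>
    RingHom.congr_fun (Subsingleton.elim (ι.comp (algebraMap ℚ K)) s) x
  have e : ProjGenLinGroup.map (algebraMap ℚ (Qp p)) (ProjGenLinGroup.mk γ) • w = w₁ ↔
      ProjGenLinGroup.mk (GeneralLinearGroup.map s γ) • ((ι τ : E) : OnePoint E) =
        ((ι τ₁ : E) : OnePoint E) := by
    rw [← hw, ← hw₁]
    exact Subtype.ext_iff
  rw [e, mk_smul_coe_iff]
  constructor
  · intro h
    have := congrArg ι h
    simp only [map_add, map_mul, hs] at this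
    exact this
  · intro h
    apply ι.injective
    simp only [map_add, map_mul, hs]
    exact h

/-- As `p` is inert, the torus at `p` is the stabilizer of the eigenpoint. -/
lemma mem_torus_iff_smul_drinfeld (hK : Module.finrank ℚ K = 2)
    (hinert : (Ideal.span {(p : 𝓞 K)}).IsPrime)
    {ψ : K →ₐ[ℚ] Matrix (Fin 2) (Fin 2) ℚ} {τ : K} (hτ : IsEigenPoint ψ τ) {w : Drinfeld p E}
    (hw : w.1 = ((ι τ : E) : OnePoint E)) (t : PGL(2, Qp p)) :
    t ∈ torus (algebraMap ℚ (Qp p)) ψ ↔ t • w = w := by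
  induction t using ProjGenLinGroup.induction_on with
  | mk g =>
    rw [mk_mem_torus_iff_of_notMem hK hτ _ ι (fun x => RingHom.congr_fun (Subsingleton.elim
      (ι.comp (algebraMap ℚ K)) ((algebraMap (Qp p) E).comp (algebraMap ℚ (Qp p)))) x)
      (notMem_range_Qp hK hinert ι (hτ.notMem hK))]
    refine Iff.trans ?_ Subtype.ext_iff.symm
    change _ ↔ ProjGenLinGroup.mk (GeneralLinearGroup.map (algebraMap (Qp p) E) g) • w.1 = w.1
    rw [hw, mk_smul_coe_iff]
    rfl

variable (p ρ ι σ) in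
/-- The image of the product of the orbit along the geodesic joining `τ` and its conjugate with
`{τ}`. For `x = i` and `x = (i, i)` this is the Stark–Heegner cycle of `τ` and its lift. -/
def shSet (x : Z) (τ : K) : Set (MockQuotient p E Z) :=
  {q | ∃ (z : Z) (w : Drinfeld p E), z ∈ geodesicOrbit x (ρ τ) (ρ (σ τ)) ∧
    w.1 = ((ι τ : E) : OnePoint E) ∧ q = MockQuotient.mk p z w}

lemma mockQuotient_mk_eq_iff {z z' : Z} {w w' : Drinfeld p E} :
    MockQuotient.mk p z w = MockQuotient.mk p z' w' ↔ ∃ γ ∈ iharaGroup p,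
      ProjGenLinGroup.map (algebraMap ℚ ℝ) γ • z' = z ∧
        ProjGenLinGroup.map (algebraMap ℚ (Qp p)) γ • w' = w := by
  refine (Quotient.eq (r := MulAction.orbitRel (iharaGroup p) (MockSpace p E Z))).trans ?_
  constructor
  · rintro ⟨γ, h⟩
    exact ⟨γ.1, γ.2, congrArg Prod.fst h, congrArg Prod.snd h⟩
  · rintro ⟨γ, hγ, h1, h2⟩
    exact ⟨⟨γ, hγ⟩, Prod.ext h1 h2⟩

lemma mockProj_image_shSet (τ : K) :
    mockProj p E '' shSet p ρ ι σ UnitTangent.base τ = shSet p ρ ι σ UpperHalfPlane.I τ := by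
  ext q
  constructor
  · rintro ⟨_, ⟨z, w, hz, hw, rfl⟩, rfl⟩
    refine ⟨z.pt, w, ?_, hw, rfl⟩
    rw [← pt_image_geodesicOrbit]
    exact ⟨_, hz, rfl⟩
  · rintro ⟨z, w, hz, hw, rfl⟩
    rw [← pt_image_geodesicOrbit] at hz
    obtain ⟨z', hz', rfl⟩ := hz
    exact ⟨MockQuotient.mk p z' w, ⟨z', w, hz', hw, rfl⟩, rfl⟩

lemma posEquiv_iff_exists_iharaGroup {τ τ₁ : K} {w w₁ : Drinfeld p E}
    (hw : w.1 = ((ι τ : E) : OnePoint E)) (hw₁ : w₁.1 = ((ι τ₁ : E) : OnePoint E)) :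
    PosEquiv (ZInv p) ℚ τ τ₁ ↔
      ∃ γ ∈ iharaGroup p, ProjGenLinGroup.map (algebraMap ℚ (Qp p)) γ • w = w₁ := by
  constructor
  · rintro ⟨g, hdet, hg⟩
    refine ⟨_, ⟨⟨ProjGenLinGroup.mk g, rfl⟩, ?_⟩, (moebius_iff_smul_drinfeld hw hw₁).1 hg⟩
    refine (mk_mem_PGLpos_iff (GeneralLinearGroup.map (algebraMap (ZInv p) ℚ) g)).2 ?_
    rw [GeneralLinearGroup.map_det]
    exact totPos_rat_iff.1 hdet
  · rintro ⟨γ, ⟨⟨g, rfl⟩, hpos⟩, h⟩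
    induction g using ProjGenLinGroup.induction_on with
    | mk g =>
      have hpos := (mk_mem_PGLpos_iff (GeneralLinearGroup.map (algebraMap (ZInv p) ℚ) g)).1 hpos
      rw [GeneralLinearGroup.map_det] at hpos
      exact ⟨g, totPos_rat_iff.2 hpos, (moebius_iff_smul_drinfeld hw hw₁).2 h⟩

variable (hK : Module.finrank ℚ K = 2) (hσ : σ ≠ 1)
  (hinert : (Ideal.span {(p : 𝓞 K)}).IsPrime)

include hK hσ hinert in
/-- The cycles of two points agree exactly if the points are equivalent; the `p`-adic component
already determines the class of the point. -/
lemma shSet_eq_iff (x : Z) {τ τ₁ : K} (hτ : τ ∉ Set.range (algebraMap ℚ K))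
    (hτ₁ : τ₁ ∉ Set.range (algebraMap ℚ K)) :
    shSet p ρ ι σ x τ = shSet p ρ ι σ x τ₁ ↔ PosEquiv (ZInv p) ℚ τ τ₁ := by
  obtain ⟨w, hw⟩ := exists_drinfeld (notMem_range_Qp hK hinert ι hτ)
  obtain ⟨w₁, hw₁⟩ := exists_drinfeld (notMem_range_Qp hK hinert ι hτ₁)
  have sub : ∀ {τ τ₁ : K} {w w₁ : Drinfeld p E} (hw : w.1 = ((ι τ : E) : OnePoint E))
      (hw₁ : w₁.1 = ((ι τ₁ : E) : OnePoint E)),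
      (∃ γ ∈ iharaGroup p, ProjGenLinGroup.map (algebraMap ℚ (Qp p)) γ • w = w₁) →
      shSet p ρ ι σ x τ ⊆ shSet p ρ ι σ x τ₁ := by
    rintro τ τ₁ w w₁ hw hw₁ ⟨γ, hγ, h⟩ _ ⟨z, w', hz, hw', rfl⟩
    obtain rfl : w' = w := Subtype.ext (hw'.trans hw.symm)
    have hmk : MockQuotient.mk p z w' =
        MockQuotient.mk p (ProjGenLinGroup.map (algebraMap ℚ ℝ) γ • z) w₁ := by
      rw [eq_comm, mockQuotient_mk_eq_iff]
      exact ⟨γ, hγ, rfl, h⟩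
    refine ⟨_, w₁, ?_, hw₁, hmk⟩
    have hpos := ((mem_iharaGroup_iff γ).1 hγ).2
    induction γ using ProjGenLinGroup.induction_on with
    | mk g =>
      have hm := (moebius_iff_smul_drinfeld hw hw₁).2 h
      exact smul_mem_geodesicOrbit hz hpos (hm.map_smul fun x => by simp)
        (hm.conj.map_smul fun x => by simp)
  rw [posEquiv_iff_exists_iharaGroup hw hw₁]
  constructor
  · intro h
    have hne : ρ τ₁ ≠ ρ (σ τ₁) := fun h' =>
      ne_conj hK hσ hτ₁ (sub_eq_zero.2 (ρ.injective h'))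
    obtain ⟨z, hz⟩ := geodesicOrbit_nonempty x hne
    obtain ⟨z', w', -, hw', e⟩ : MockQuotient.mk p z w₁ ∈ shSet p ρ ι σ x τ := by
      rw [h]; exact ⟨z, w₁, hz, hw₁, rfl⟩
    obtain rfl : w' = w := Subtype.ext (hw'.trans hw.symm)
    obtain ⟨γ, hγ, -, e⟩ := mockQuotient_mk_eq_iff.1 e
    exact ⟨γ, hγ, e⟩
  · intro h
    refine (sub hw hw₁ h).antisymm (sub hw₁ hw ?_)
    obtain ⟨γ, hγ, e⟩ := h
    exact ⟨γ⁻¹, inv_mem hγ, by rw [map_inv, ← e, inv_smul_smul]⟩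

include hK hσ in
lemma shCycle_eq {ψ : K →ₐ[ℚ] Matrix (Fin 2) (Fin 2) ℚ} {τ : K} (h : IsEigenPoint ψ τ) :
    shCycle p ρ ι ψ = shSet p ρ ι σ UpperHalfPlane.I τ := by
  have hne := ne_conj hK hσ (h.notMem hK)
  have hne' : ρ τ ≠ ρ (σ τ) := fun h' => hne (sub_eq_zero.2 (ρ.injective h'))
  ext q
  constructor
  · rintro ⟨τ₁, τ', h₁, h₂, h₃, z, w, hz, hw, rfl⟩
    obtain rfl := h.unique hK h₁
    obtain rfl := ((h₁.isFixedPoint_iff_eq hK hσ).1 h₂).resolve_left h₃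
    exact ⟨z, w, by rw [geodesicOrbit_I hne']; exact hz, hw, rfl⟩
  · rintro ⟨z, w, hz, hw, rfl⟩
    refine ⟨τ, σ τ, h, (h.isFixedPoint_iff_eq hK hσ).2 (Or.inr rfl), ?_, z, w, ?_, hw, rfl⟩
    · exact fun h' => hne (sub_eq_zero.2 h'.symm)
    · rw [← geodesicOrbit_I hne']; exact hz

include hK hσ hinert in
/-- In terms of points, `g` is normalized if it sends `∞`, `0` and `α` to `τ`, its conjugate and `τ`. -/
lemma isNormalizedSH_iff {α : Drinfeld p E} {ψ : K →ₐ[ℚ] Matrix (Fin 2) (Fin 2) ℚ} {τ : K}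
    (h : IsEigenPoint ψ τ) {w : Drinfeld p E} (hw : w.1 = ((ι τ : E) : OnePoint E))
    {gInf : PGL(2, ℝ)} {gp : PGL(2, Qp p)} :
    IsNormalizedSH p α ρ ι ψ gInf gp ↔ gInf ∈ PGLpos ℝ ∧
      gInf • (OnePoint.infty : OnePoint ℝ) = ((ρ τ : ℝ) : OnePoint ℝ) ∧
      gInf • ((0 : ℝ) : OnePoint ℝ) = ((ρ (σ τ) : ℝ) : OnePoint ℝ) ∧ gp • α = w := by
  have hdiag := fun hg => conj_diag_eq_torus_iff hK hσ h (algebraMap ℚ ℝ) ρ (fun x => by simp)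
    (Or.inl ⟨rfl, rfl⟩) (g := gInf) hg
  constructor
  · rintro ⟨h1, h2, -, τ₁, h4, h5, h6⟩
    obtain rfl := h.unique hK h4
    exact ⟨h1, h5, (hdiag h5).1 h2, Subtype.ext (h6.trans hw.symm)⟩
  · rintro ⟨h1, h2, h3, h4⟩
    refine ⟨h1, (hdiag h2).2 h3, ?_, τ, h, h2, by rw [h4, hw]⟩
    ext t
    rw [mem_torus_iff_smul_drinfeld hK hinert h hw, ← h4, ← MulAction.mem_stabilizer_iff,
      MulAction.stabilizer_smul_eq_stabilizer_map_conj]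
    rfl

include hK hσ hinert in
lemma shLift_eq (hE : Module.finrank (Qp p) E = 2) {α : Drinfeld p E}
    {ψ : K →ₐ[ℚ] Matrix (Fin 2) (Fin 2) ℚ} {τ : K} (h : IsEigenPoint ψ τ) :
    shLift p α ρ ι ψ = shSet p ρ ι σ UnitTangent.base τ := by
  obtain ⟨w, hw⟩ := exists_drinfeld (notMem_range_Qp hK hinert ι (h.notMem hK))
  ext q
  constructor
  · rintro ⟨gInf, gp, hg, a, ha, k, hk, rfl⟩
    obtain ⟨h1, h2, h3, h4⟩ := (isNormalizedSH_iff hK hσ hinert h hw).1 hg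
    refine ⟨_, _, mem_geodesicOrbit_of_diagPos h1 h2 h3 ha, ?_, rfl⟩
    rw [mul_smul, MulAction.mem_stabilizer_iff.1 hk, h4, hw]
  · rintro ⟨z, w', ⟨g, hg, h1, h2, rfl⟩, hw', rfl⟩
    obtain rfl : w' = w := Subtype.ext (hw'.trans hw.symm)
    obtain ⟨gp, h3⟩ := exists_smul_eq_drinfeld hE α w'
    refine ⟨g, gp, (isNormalizedSH_iff hK hσ hinert h hw).2 ⟨hg, h1, h2, h3⟩, 1, one_mem _, 1,
      one_mem _, ?_⟩
    rw [mul_one, mul_one, h3]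

/-! ### Stark–Heegner cycles as images of toral sets -/

variable {O : Subalgebra ℤ K}

include hK hσ in
/-- As `K` is real, there is no condition of orientation. -/
lemma mem_orientedPoints_iff_of_real (ρ : K →+* ℝ) {R O' : Type*} [CommRing R] [CommRing O']
    [Algebra R K] [Algebra O' K] {τ₀ : K} (hτ₀ : τ₀ ∉ Set.range (algebraMap ℚ K)) (τ : K) :
    τ ∈ orientedPoints R O' σ τ₀ ↔ IsProper R O' τ ∧ τ ∉ Set.range (algebraMap ℚ K) := by
  have hne := ne_conj hK hσ hτ₀
  refine and_congr_right fun _ => ⟨?_, fun hτ => ?_⟩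
  · rintro ⟨ξ, d, hd, e⟩ hτ
    rw [(conj_eq_self_iff hK hσ).2 hτ, sub_self, mul_zero, eq_comm] at e
    exact mul_ne_zero ((map_ne_zero _).2 hd.1) hne e
  · obtain ⟨q, hq⟩ := exists_sub_conj_eq hK hσ hτ₀ τ
    refine exists_oriented_multiple hK hσ ⟨algebraMap ℚ ℝ⟩ hτ₀ (q := q) ?_ hq ?_
    · rintro rfl
      rw [map_zero, zero_mul] at hq
      exact ne_conj hK hσ hτ hq
    · exact fun s hs => absurd ⟨ρ, Subsingleton.elim _ _⟩ hs

include hK hσ hinert in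
lemma ncard_image_optSH (x : Z) {f : (K →ₐ[ℚ] Matrix (Fin 2) (Fin 2) ℚ) → Set (MockQuotient p E Z)}
    (hf : ∀ ψ τ, IsEigenPoint ψ τ → f ψ = shSet p ρ ι σ x τ) (hne : (optSH p O).Nonempty) :
    (f '' optSH p O).ncard = Nat.card (NarrowPic (orderInv p O) K) := by
  obtain ⟨ψ₀, hψ₀⟩ := hne
  obtain ⟨τ₀, hτ₀⟩ := exists_isEigenPoint hK ψ₀
  have hmem := mem_orientedPoints_iff_of_real hK hσ ρ (R := ZInv p) (O' := orderInv p O)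
    (hτ₀.notMem hK)
  have himage : f '' optSH p O =
      shSet p ρ ι σ x '' orientedPoints (ZInv p) (orderInv p O) σ τ₀ := by
    ext y
    constructor
    · rintro ⟨ψ, hψ, rfl⟩
      obtain ⟨τ, hτ⟩ := exists_isEigenPoint hK ψ
      exact ⟨τ, (hmem τ).2 ⟨(hτ.mem_optSH_iff hK).1 hψ, hτ.notMem hK⟩, (hf ψ τ hτ).symm⟩
    · rintro ⟨τ, hτ, rfl⟩
      obtain ⟨hP, hτF⟩ := (hmem τ).1 hτ
      obtain ⟨ψ, hψ⟩ := exists_embedding hK hτF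
      exact ⟨ψ, (hψ.mem_optSH_iff hK).2 hP, hf ψ τ hψ⟩
  rw [himage]
  refine ncard_image_orientedPoints hK hσ (fun a ha => exists_unit_totPos_mul_rat ha)
    (hτ₀.notMem hK) ((hτ₀.mem_optSH_iff hK).1 hψ₀) _ fun τ hτ τ₁ hτ₁ => ?_
  exact shSet_eq_iff hK hσ hinert x ((hmem τ).1 hτ).2 ((hmem τ₁).1 hτ₁).2

variable {g : PGL(2, AdeleRing ℤ ℚ)}
  (hgfin : ∀ v, v ≠ primePlace p → ProjGenLinGroup.map (finComp ℤ ℚ v) g = 1)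
  {ψ : K →ₐ[ℚ] Matrix (Fin 2) (Fin 2) ℚ} (hψ : ψ ∈ optSH p O) {τ₀ : K} (hτ₀ : IsEigenPoint ψ τ₀)
  {α : Drinfeld p E}
  (hg : IsNormalizedSH p α ρ ι ψ
    (ProjGenLinGroup.map realComp g) (ProjGenLinGroup.map (pComp p) g))
  {Φ : AdelicDoubleQuotient (levelSH p α) → MockQuotient p E UnitTangent}
  (hΦ : ∀ x γ, ProjGenLinGroup.map (algebraMap ℚ (AdeleRing ℤ ℚ)) γ * x ∈ goodSH p →
    Φ (DoubleCoset.mk _ _ x) = Quotient.mk _ (pointSH α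
      (ProjGenLinGroup.map (algebraMap ℚ (AdeleRing ℤ ℚ)) γ * x)))

include hK hσ hinert hgfin hψ hτ₀ hg hΦ in
/-- Moving `t g` to a point integral outside `p` by `γ ∈ G(ℚ)` replaces `ψ` by its conjugate by
`γ`, which is again optimal. -/
lemma exists_shSet_of_mem_torus {t : PGL(2, AdeleRing ℤ ℚ)}
    (ht : t ∈ torus (algebraMap ℚ (AdeleRing ℤ ℚ)) ψ) :
    ∃ ψ₁ ∈ optSH p O, ∃ τ, IsEigenPoint ψ₁ τ ∧
      Φ (DoubleCoset.mk _ _ (t * g)) ∈ shSet p ρ ι σ UnitTangent.base τ := by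
  have hτ₀F := hτ₀.notMem hK
  obtain ⟨w₀, hw₀⟩ := exists_drinfeld (notMem_range_Qp hK hinert ι hτ₀F)
  obtain ⟨-, h2, h3, h4⟩ := (isNormalizedSH_iff hK hσ hinert hτ₀ hw₀).1 hg
  obtain ⟨γ, hγ⟩ := exists_mul_mem_goodSH (p := p) (t * g)
  obtain ⟨τ, hτ⟩ := exists_moebius_apply γ hτ₀F
  obtain ⟨w, hw⟩ := exists_drinfeld (notMem_range_Qp hK hinert ι (hτ.notMem hτ₀F))
  have htinf := map_mem_torus hK realComp ht
  rw [infComp_comp_algebraMap,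
    Subsingleton.elim (realEmb Rat.infinitePlace) (algebraMap ℚ ℝ)] at htinf
  have htp := map_mem_torus hK (pComp p) ht
  rw [finComp_comp_algebraMap, mem_torus_iff_smul_drinfeld hK hinert hτ₀ hw₀] at htp
  have hs := (mem_torus_iff_smul_of_split hK hσ hτ₀ _ ρ (fun x => by simp) _).1 htinf
  refine ⟨conjEmb γ ψ, isOptimal_conjEmb hK ht γ (fun x => mem_ZInv_iff) (fun v hv => ?_) hψ, τ,
    hτ₀.conjEmb hτ hτ₀F, ?_⟩
  · have := hγ.1 v hv
    rwa [map_mul, map_finComp_map, map_mul, hgfin v hv, mul_one] at this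
  · rw [hΦ _ _ hγ]
    refine ⟨_, w, ⟨_, hγ.2, ?_, ?_, rfl⟩, hw, ?_⟩
    · rw [map_mul, map_realComp_map, map_mul, mul_smul, mul_smul, h2, hs.1,
        hτ.map_smul fun x => by simp]
    · rw [map_mul, map_realComp_map, map_mul, mul_smul, mul_smul, h3, hs.2,
        hτ.conj.map_smul fun x => by simp]
    · rw [pointSH, map_mul (ProjGenLinGroup.map (pComp p)), map_finComp_map,
        map_mul (ProjGenLinGroup.map (pComp p)), mul_smul, mul_smul, h4, htp,
        (moebius_iff_smul_drinfeld hw₀ hw).1 hτ]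
      rfl

include hK hσ hinert hgfin hψ hτ₀ hg hΦ in
/-- Every point of the lift of a Stark–Heegner cycle comes from the toral set; the component at `p`
of the torus element can be taken trivial, as the `p`-adic torus fixes `τ₀`. -/
lemma exists_mem_torus_of_mem_shSet {τ : K} (hP : IsProper (ZInv p) (orderInv p O) τ)
    (hτ : τ ∉ Set.range (algebraMap ℚ K)) {q : MockQuotient p E UnitTangent}
    (hq : q ∈ shSet p ρ ι σ UnitTangent.base τ) :
    ∃ t ∈ torus (algebraMap ℚ (AdeleRing ℤ ℚ)) ψ, Φ (DoubleCoset.mk _ _ (t * g)) = q := by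
  have hτ₀F := hτ₀.notMem hK
  obtain ⟨w₀, hw₀⟩ := exists_drinfeld (notMem_range_Qp hK hinert ι hτ₀F)
  obtain ⟨-, h2, h3, h4⟩ := (isNormalizedSH_iff hK hσ hinert hτ₀ hw₀).1 hg
  obtain ⟨_, w, ⟨y, hy, hya, hyb, rfl⟩, hw, rfl⟩ := hq
  obtain ⟨γ, hγ⟩ := exists_moebius hK hτ₀F hτ
  have hr : (ProjGenLinGroup.map (algebraMap ℚ ℝ) (ProjGenLinGroup.mk γ))⁻¹ * y *
      (ProjGenLinGroup.map realComp g)⁻¹ ∈ torus (algebraMap ℚ ℝ) ψ := by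
    refine (mem_torus_iff_smul_of_split hK hσ hτ₀ _ ρ (fun x => by simp) _).2 ⟨?_, ?_⟩
    · rw [mul_smul, mul_smul, ← h2, inv_smul_smul, hya, inv_smul_eq_iff, h2,
        hγ.map_smul fun x => by simp]
    · rw [mul_smul, mul_smul, ← h3, inv_smul_smul, hyb, inv_smul_eq_iff, h3,
        hγ.conj.map_smul fun x => by simp]
  obtain ⟨t, ht, htinf, htfin, htp⟩ := exists_mem_torus (R := ℤ) (P := fun v => v ≠ primePlace p)
    hK hτ₀ hτ ((hτ₀.mem_optSH_iff hK).1 hψ) hP (fun v hv r => mem_ZInv_iff.1 r.2 v hv) hγ (fun _ => _)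
    (fun v => by rw [Subsingleton.elim (realEmb v) (algebraMap ℚ ℝ)]; exact hr)
  have hinf : ProjGenLinGroup.map realComp
      (ProjGenLinGroup.map (algebraMap ℚ (AdeleRing ℤ ℚ)) (ProjGenLinGroup.mk γ) * (t * g)) =
      y := by
    rw [map_mul, map_realComp_map, map_mul, htinf]
    group
  have hp : ProjGenLinGroup.map (pComp p)
      (ProjGenLinGroup.map (algebraMap ℚ (AdeleRing ℤ ℚ)) (ProjGenLinGroup.mk γ) * (t * g)) • α =
      w := by
    rw [map_mul, map_finComp_map, map_mul, htp _ (not_not.2 rfl), one_mul, mul_smul, h4]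
    exact (moebius_iff_smul_drinfeld hw₀ hw).1 hγ
  refine ⟨t, ht, ?_⟩
  rw [hΦ (t * g) (ProjGenLinGroup.mk γ) ⟨fun v hv => ?_, ?_⟩]
  · rw [pointSH, hinf, hp]
    rfl
  · rw [hinf]; exact hy
  · rw [map_mul, map_finComp_map, map_mul, hgfin v hv, mul_one]
    exact htfin v hv

include hK hinert hgfin hψ hg hΦ in
/-- The toral set of one optimal embedding covers the lifts of all Stark–Heegner cycles of its
conductor. -/
lemma image_toralSet_SH (hE : Module.finrank (Qp p) E = 2) :
    Φ '' (adelicProj (levelSH p α) '' toralSet ℤ ψ g) = ⋃ ψ ∈ optSH p O, shLift p α ρ ι ψ := by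
  obtain ⟨σ, hσ⟩ := exists_conj hK
  obtain ⟨τ₀, hτ₀⟩ := exists_isEigenPoint hK ψ
  ext q
  simp only [Set.mem_iUnion, exists_prop]
  constructor
  · rintro ⟨_, ⟨_, ⟨t, htm, rfl⟩, rfl⟩, rfl⟩
    obtain ⟨ψ₁, hψ₁, τ, hτ, h⟩ := exists_shSet_of_mem_torus hK hσ hinert hgfin hψ hτ₀ hg hΦ htm
    refine ⟨ψ₁, hψ₁, ?_⟩
    rw [shLift_eq hK hσ hinert hE hτ]
    exact h
  · rintro ⟨ψ₁, hψ₁, hq⟩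
    obtain ⟨τ, hτ⟩ := exists_isEigenPoint hK ψ₁
    rw [shLift_eq hK hσ hinert hE hτ] at hq
    obtain ⟨t, htm, h⟩ := exists_mem_torus_of_mem_shSet hK hσ hinert hgfin hψ hτ₀ hg hΦ
      ((hτ.mem_optSH_iff hK).1 hψ₁) (hτ.notMem hK) hq
    exact ⟨_, ⟨_, ⟨t, htm, rfl⟩, rfl⟩, h⟩

end

end ToralCycles

open ToralCycles in
theorem mainTheorem6 :
    -- ATR cycles
    (∀ (F : Type*) [Field F] [NumberField F] [IsTotallyReal F]
      (_hF : Nat.card (NarrowPic (𝓞 F) F) = 1) (v₀ : InfinitePlace F),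
      ∃ Φ : AdelicDoubleQuotient (levelATR v₀) → HilbertQuotient v₀ UnitTangent,
        IsIdentificationATR v₀ Φ ∧
        ∀ (K : Type*) [Field K] [Algebra F K] (_hK : Module.finrank F K = 2) (_hATR : IsATR K v₀)
          (ρ₀ : K →+* ℂ) (_hρ₀ : ∀ x, ρ₀ (algebraMap F K x) = (realEmb v₀ x : ℂ))
          (ρ : {v : InfinitePlace F // v ≠ v₀} → K →+* ℝ)
          (_hρ : ∀ v x, ρ v (algebraMap F K x) = realEmb v.1 x)
          (O : Subalgebra (𝓞 F) K) (_hO : IsOrder F O)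
          (ψ₀ : K →ₐ[F] Matrix (Fin 2) (Fin 2) F) (_hψ₀ : ψ₀ ∈ optATR O)
          (g : PGL(2, AdeleRing (𝓞 F) F))
          (_hgfin : ∀ v, ProjGenLinGroup.map (finComp (𝓞 F) F v) g = 1)
          (_hginf : IsNormalizedATR v₀ ρ₀ ρ ψ₀ fun v => ProjGenLinGroup.map (infComp (𝓞 F) F v) g),
          Φ '' (adelicProj (levelATR v₀) '' toralSet (𝓞 F) ψ₀ g) =
              ⋃ ψ ∈ optATR O, atrLift v₀ ρ₀ ρ ψ ∧
            (atrLift v₀ ρ₀ ρ '' optATR O).ncard = Nat.card (NarrowPic O K) ∧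
            (atrCycle v₀ ρ₀ ρ '' optATR O).ncard = Nat.card (NarrowPic O K) ∧
            ∀ ψ ∈ optATR O, hilbertProj v₀ '' atrLift v₀ ρ₀ ρ ψ = atrCycle v₀ ρ₀ ρ ψ) ∧
    -- Stark–Heegner cycles
    (∀ (p : ℕ) [Fact p.Prime] (E : Type*) [Field E] [Algebra (Qp p) E]
      (_hE : IsUnramifiedQuadratic p E) (u : (Zp p)ˣ) (_hu : ¬ IsSquare (u : Zp p))
      (a : E) (_ha : a ^ 2 = algebraMap (Qp p) E (u : Zp p))
      (α : Drinfeld p E) (_hα : α.1 = (a : OnePoint E)),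
      ∃ Φ : AdelicDoubleQuotient (levelSH p α) → MockQuotient p E UnitTangent,
        IsIdentificationSH p α Φ ∧
        ∀ (K : Type*) [Field K] [NumberField K] (_hK : Module.finrank ℚ K = 2)
          (_hinert : (Ideal.span {(p : 𝓞 K)}).IsPrime) (ρ : K →+* ℝ) (ι : K →+* E)
          (O : Subalgebra ℤ K) (_hO : IsOrder ℚ O)
          (ψ₀ : K →ₐ[ℚ] Matrix (Fin 2) (Fin 2) ℚ) (_hψ₀ : ψ₀ ∈ optSH p O)
          (g : PGL(2, AdeleRing ℤ ℚ))
          (_hgfin : ∀ v, v ≠ primePlace p → ProjGenLinGroup.map (finComp ℤ ℚ v) g = 1)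
          (_hgS : IsNormalizedSH p α ρ ι ψ₀
            (ProjGenLinGroup.map realComp g) (ProjGenLinGroup.map (pComp p) g)),
          Φ '' (adelicProj (levelSH p α) '' toralSet ℤ ψ₀ g) =
              ⋃ ψ ∈ optSH p O, shLift p α ρ ι ψ ∧
            (shLift p α ρ ι '' optSH p O).ncard = Nat.card (NarrowPic (orderInv p O) K) ∧
            ((shCycle p ρ ι : _ → Set (MockQuotient p E ℍ)) '' optSH p O).ncard =
              Nat.card (NarrowPic (orderInv p O) K) ∧
            ∀ ψ ∈ optSH p O, mockProj p E '' shLift p α ρ ι ψ = shCycle p ρ ι ψ) := by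
  constructor
  · intro F _ _ _ hF v₀
    obtain ⟨Φ, hbij, hΦ⟩ := exists_isIdentificationATR hF v₀
    refine ⟨Φ, ⟨hbij, ?_⟩, ?_⟩
    · rintro x _ γ rfl h1 h2
      exact hΦ x γ ⟨h1, h2⟩
    · intro K _ _ hK hATR ρ₀ hρ₀ ρ hρ O _ ψ₀ hψ₀ g hgfin hginf
      obtain ⟨σ, hσ⟩ := exists_conj hK
      refine ⟨image_toralSet_ATR hF hK hATR hρ₀ hρ hΦ hψ₀ hgfin hginf,
        ncard_image_optATR hF hK hσ hATR hρ₀ hρ _ (fun ψ τ h => atrLift_eq hK hσ hρ₀ hρ h) ⟨ψ₀, hψ₀⟩,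
        ncard_image_optATR hF hK hσ hATR hρ₀ hρ _ (fun ψ τ h => atrCycle_eq hK hσ hρ₀ h) ⟨ψ₀, hψ₀⟩,
        fun ψ _ => ?_⟩
      obtain ⟨τ, hτ⟩ := exists_isATRPoint hK hσ hATR hρ₀ ψ
      rw [atrLift_eq hK hσ hρ₀ hρ hτ, atrCycle_eq hK hσ hρ₀ hτ, hilbertProj_image_atrSet]
  · intro p _ E _ _ hE u _ a _ α _
    obtain ⟨Φ, hbij, hΦ⟩ := exists_isIdentificationSH hE.1 α
    refine ⟨Φ, ⟨hbij, ?_⟩, ?_⟩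
    · rintro x _ γ rfl h1 h2
      exact hΦ x γ ⟨h1, h2⟩
    · intro K _ _ hK hinert ρ ι O _ ψ₀ hψ₀ g hgfin hg
      obtain ⟨σ, hσ⟩ := exists_conj hK
      refine ⟨image_toralSet_SH hK hinert hgfin hψ₀ hg hΦ hE.1,
        ncard_image_optSH hK hσ hinert _ (fun ψ τ h => shLift_eq hK hσ hinert hE.1 h) ⟨ψ₀, hψ₀⟩,
        ncard_image_optSH hK hσ hinert _ (fun ψ τ h => shCycle_eq hK hσ h) ⟨ψ₀, hψ₀⟩,
        fun ψ _ => ?_⟩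
      obtain ⟨τ, hτ⟩ := exists_isEigenPoint hK ψ
      rw [shLift_eq hK hσ hinert hE.1 hτ, shCycle_eq hK hσ hτ, mockProj_image_shSet]
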